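/- **Setting.** There are $K\ge 1$ base learners; learner $i$ has $k_i\ge 1$ arms. In every round $t=1,2,\dots$ a vector of losses in $[0,1]$ for all arms of all learners is drawn independently from a fixed distribution. Let $\lambda_i$ be the least mean loss of an arm of learner $i$; assume that there is $i^*$ with $\Delta_i=\lambda_i-\lambda_{i^*}>0$ for all $i\ne i^*$. A base learner is a randomized algorithm that, knowing an environment parameter $\rho_0\ge1$ given to it when it is (re)started, proposes an arm in each of its rounds on the basis of the arms it proposed and the feedback it received since then. The expected regret of the corralling algorithm is $\mathbb E[R(T)]=\mathbb E\big[\sum_{t=1}^T \ell_t\big]-T\lambda_{i^*}$, where $\ell_t$ is the loss incurred in round $t$. **Stability.** Let $R_i:\mathbb N\to[0,\infty)$ be non-decreasing. Learner $i$ is $(\tfrac12,R_i)$-stable if, whenever it is started with a parameter $\rho_0$, and in each of its rounds $s$ an adaptively chosen probability $w_s\in(0,1]$ (bounded away from $0$) is fixed, the learner proposes an arm $a_s$, and, independently given the past, is sampled with probability $w_s$, its feedback being $\hat\ell_s(a_s)=\ell_s(a_s)/w_s$ if it is sampled and $0$ otherwise, then for every arm $a$ of the learner and every bounded stopping time $\tau$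 $$\mathbb E\Big[\sum_{s\le\tau}\big(\hat\ell_s(a_s)-\ell_s(a)\big)\Big]\le\mathbb E\big[\sqrt{\rho_\tau}\,R_i(\tau)\big],\qquad \rho_\tau=\max\big(\rho_0,\max_{s\le\tau}1/w_s\big).$$ (With $w\equiv1$, $\rho_0=1$, this says that $R_i(t)$ bounds the expected regret of the learner after $t$ rounds in the original environment.) **Algorithm (Corralling with Tsallis-INF).** Given are the horizon $T\ge2$, a multiplier $\beta$ and initial step sizes $\eta_{1,i}>0$. For $\eta\in(0,\infty)^K$ put $\Psi_\eta(w)=-4\sum_i(\sqrt{w_i}-\tfrac12w_i)/\eta_i$, with Bregman divergence $D_{\Psi_\eta}$; let $\mathrm{FTRL}_\eta(L)$ and $\mathrm{OMD}_\eta(\ell,v)$ be the minimizers over the probability simplex of $\langle L,w\rangle+\Psi_\eta(w)$ and of $\langle\ell,w\rangle+D_{\Psi_\eta}(w,v)$. The thresholds are $\rho_s=36\cdot2^{s-1}$ for $1\le s\le n$, where $n$ is the largest integer with $\rho_n\le K^2T$ ($n=1$ if there is none). All learners are started with parameter $1$. *Initial phase:* each learner, in turn, plays $m=\lfloor\log T\rfloor+1$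 rounds and observes its losses; $\hat L$ is the vector of the learners' total losses, all threshold indices are $\theta_i=1$, the step sizes become $\eta_i$ with $1/\eta_i^2=2/\eta_{1,i}^2$, and $w=\mathrm{FTRL}_\eta(\hat L)$. *Main phase:* the epochs have lengths $2Km,4Km,8Km,\dots$. In every round all learners propose arms, learner $i$ is chosen to play with probability $\bar w_i=(1-\frac1{TK})w_i+\frac1{TK}\cdot\frac1K$, and the estimated loss $\hat\ell_i$, which is the incurred loss divided by $\bar w_i$ if $i$ was chosen and $0$ otherwise, is given to learner $i$ as feedback. Unless a negative-regret step (NRS) is in progress, the following is then done. 1. In the first such round of an epoch: every learner $i$ with $w_i>1/\rho_1$ and $\theta_i\ge2$ is restarted with parameter $\rho_1$; then $\theta_i:=\min\{s\in[n]:w_i>1/\rho_s\}$ for all $i$ ($n+1$ if there is no such $s$); an NRS is begun for $\mathcal R=\{i:w_i\le1/\rho_1\}$ if this is not empty. 2. In any other round, unless an NRS ended in the round before: $\mathcal R=\{i:\theta_i\le n,\ w_i\le1/\rho_{\theta_i}\}$; $\theta_i$ is increased by $1$ for $i\in\mathcal R$; an NRS is begun for $\mathcal R$ if this is not empty. 3.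 If no NRS is begun: $1/\eta_i^2$ is increased by $1/\eta_{1,i}^2$ for all $i$, $\hat L:=\hat L+\hat\ell$, $w:=\mathrm{FTRL}_\eta(\hat L)$. An NRS begun in a round with distribution $w_t$ and estimate $\hat\ell_t$ sets $w_{t+1}=\mathrm{OMD}_\eta(\hat\ell_t,w_t)$; after the next round it multiplies $\eta_i$ by $\beta$ and restarts learner $i$ with parameter $2/w_{t,i}$ for all $i\in\mathcal R$, and sets $\hat L=-\nabla\Psi_\eta(w_{t+1})+\hat\ell_{t+1}$ and $w_{t+2}=\mathrm{OMD}_\eta(\hat\ell_{t+1},w_{t+1})=\mathrm{FTRL}_\eta(\hat L)$; after the round after that it sets $\hat L:=\hat L+\hat\ell_{t+2}$, $w_{t+3}=\mathrm{FTRL}_\eta(\hat L)$, and ends. **Theorem.** There is a universal constant $C>0$ such that the following holds. In the setting above, let $T\ge2$, let every learner $i$ be $(\tfrac12,R_i)$-stable, and let $\bar R_i(t)\ge R_i(t)$ for $1\le t\le T$. If $\beta=e^{1/(\log T)^2}$ and, for all $i$, $0<\eta_{1,i}\le\frac14$ and $$\eta_{1,i}\le\min_{1\le t\le T}\frac{\big(1-e^{-1/(\log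 T)^2}\big)\sqrt t}{50\,\bar R_i(t)}$$ (a quotient with $\bar R_i(t)=0$ counting as $+\infty$), then the expected regret of Corralling with Tsallis-INF satisfies $$\mathbb E[R(T)]\le C\Big(\sum_{i\ne i^*}\frac{\log T}{\eta_{1,i}^2\,\Delta_i}+R_{i^*}(T)\Big).$$ -/

import Mathlib

open MeasureTheory

universe u

namespace Corral

noncomputable section

/-! ## Base learners and stability under importance weighting -/

/-- A randomized bandit algorithm with arms `Fin k`. `policy ρ n h` is the distribution of the arm
proposed after `n` rounds with history `h` (arms proposed and feedback received since the learner was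
last started), when the learner was started with environment parameter `ρ`, i.e. was told that the
losses it will see are rescaled by factors of the order of `ρ` (`ρ = 1`: not rescaled). -/
structure Learner (k : ℕ) where
  policy : ℝ → (n : ℕ) → (Fin n → Fin k × ℝ) → Fin k → ℝ
  policy_mem : ∀ ρ n h, policy ρ n h ∈ stdSimplex ℝ (Fin k)
  measurable_policy : ∀ n j,
    Measurable fun p : ℝ × (Fin n → Fin k × ℝ) => policy p.1 n p.2 j

/-- Importance-weighted loss: `ℓ / w` if the learner was sampled, and `0` otherwise. -/
def iwLoss (sampled : Bool) (ℓ w : ℝ) : ℝ := if sampled then ℓ / w else 0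

/-- The learner `A` plays, from a fresh start and up to the stopping time `τ`, against the
importance-weighted version of the stochastic environment with loss law `ν`. In round `n` an arbitrary
adaptive probability `w n` is fixed, the learner proposes `arm n` according to its policy, is sampled
with probability `w n`, and receives the feedback `iwLoss`. The arm, the sampling and the loss
vector are conditionally independent given the past `ℱ n`. -/
structure WeightedPlay {k : ℕ} (A : Learner k) (ν : Measure (Fin k → ℝ))
    {Ω : Type u} [m0 : MeasurableSpace Ω] (P : Measure Ω) where
  ℱ : Filtration ℕ m0
  /-- number of rounds played; whether round `n` is played is decided by the past -/
  τ : Ω → ℕ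
  /-- environment parameter with which the learner is started -/
  ρ₀ : Ω → ℝ
  w : ℕ → Ω → ℝ
  arm : ℕ → Ω → Fin k
  sampled : ℕ → Ω → Bool
  loss : ℕ → Ω → Fin k → ℝ
  measurable_τ : ∀ n, MeasurableSet[ℱ n] {ω | τ ω ≤ n}
  τ_bdd : ∃ N, ∀ ω, τ ω ≤ N
  measurable_ρ₀ : Measurable[ℱ 0] ρ₀
  one_le_ρ₀ : ∀ ω, 1 ≤ ρ₀ ω
  ρ₀_bdd : ∃ M, ∀ ω, ρ₀ ω ≤ M
  measurable_w : ∀ n, Measurable[ℱ n] (w n)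
  w_pos : ∃ ε > 0, ∀ n ω, ε ≤ w n ω
  w_le_one : ∀ n ω, w n ω ≤ 1
  measurable_arm : ∀ n j, MeasurableSet[ℱ (n + 1)] {ω | arm n ω = j}
  measurable_sampled : ∀ n b, MeasurableSet[ℱ (n + 1)] {ω | sampled n ω = b}
  measurable_loss : ∀ n, Measurable[ℱ (n + 1)] (loss n)
  law : ∀ (n : ℕ) (S : Set Ω), MeasurableSet[ℱ n] S → S ⊆ {ω | n < τ ω} →
    ∀ (j : Fin k) (b : Bool) (B : Set (Fin k → ℝ)), MeasurableSet B →
      P.real (S ∩ {ω | arm n ω = j ∧ sampled n ω = b ∧ loss n ω ∈ B}) =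
        ∫ ω in S, A.policy (ρ₀ ω) n
            (fun s : Fin n =>
              (arm s ω, iwLoss (sampled s ω) (loss s ω (arm s ω)) (w s ω))) j
          * (if b then w n ω else 1 - w n ω) * ν.real B ∂P

/-- The largest rescaling factor met before time `τ`. -/
def WeightedPlay.rho {k : ℕ} {A : Learner k} {ν : Measure (Fin k → ℝ)}
    {Ω : Type u} [MeasurableSpace Ω] {P : Measure Ω} (X : WeightedPlay A ν P) (ω : Ω) : ℝ :=
  max (X.ρ₀ ω) (⨆ n : Fin (X.τ ω), 1 / X.w n ω)

/-- `(γ, R)`-stability of the learner `A` in the stochastic environment with loss law `ν`: under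
importance weighting with adaptive sampling probabilities `w`, its regret against every arm is at most
`𝔼[ρ ^ γ * R τ]`, where `ρ` is the largest rescaling factor. The case `w = 1`, `ρ₀ = 1`, constant `τ`
says that in the original environment its regret after `t` rounds is at most `R t`. -/
def IsStable {k : ℕ} (γ : ℝ) (R : ℕ → ℝ) (A : Learner k) (ν : Measure (Fin k → ℝ)) : Prop :=
  Monotone R ∧ (∀ t, 0 ≤ R t) ∧
    ∀ (Ω : Type u) [MeasurableSpace Ω] (P : Measure Ω) [IsProbabilityMeasure P]
      (X : WeightedPlay A ν P) (a : Fin k),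
      ∫ ω, ∑ n ∈ Finset.range (X.τ ω),
          (iwLoss (X.sampled n ω) (X.loss n ω (X.arm n ω)) (X.w n ω) - X.loss n ω a) ∂P
        ≤ ∫ ω, (X.rho ω) ^ γ * R (X.τ ω) ∂P

/-! ## Potential, FTRL and OMD updates -/

/-- `Ψ(w) = -4 ∑ᵢ (√wᵢ - wᵢ / 2) / ηᵢ`. -/
def psi {K : ℕ} (η w : Fin K → ℝ) : ℝ := -4 * ∑ i, (√(w i) - w i / 2) / η i

/-- `∇Ψ`. -/
def gradPsi {K : ℕ} (η w : Fin K → ℝ) : Fin K → ℝ := fun i => -2 * (1 / √(w i) - 1) / η i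

/-- Bregman divergence `D_Ψ(x, y)`. -/
def bregman {K : ℕ} (η x y : Fin K → ℝ) : ℝ :=
  psi η x - psi η y - ∑ i, gradPsi η y i * (x i - y i)

/-- A minimizer of `f` over the probability simplex. -/
def argminSimplex {K : ℕ} (f : (Fin K → ℝ) → ℝ) : Fin K → ℝ :=
  Classical.epsilon fun w => w ∈ stdSimplex ℝ (Fin K) ∧ IsMinOn f (stdSimplex ℝ (Fin K)) w

/-- FTRL iterate `∇Φ(-L) = argmin ⟨L, w⟩ + Ψ(w)`. -/
def ftrl {K : ℕ} (η L : Fin K → ℝ) : Fin K → ℝ :=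
  argminSimplex fun w => ∑ i, L i * w i + psi η w

/-- OMD iterate `argmin ⟨ℓ, v⟩ + D_Ψ(v, w)`. -/
def omd {K : ℕ} (η ℓ w : Fin K → ℝ) : Fin K → ℝ :=
  argminSimplex fun v => ∑ i, ℓ i * v i + bregman η v w

/-! ## The corralling algorithm -/

/-- Thresholds `ρ₁ = 36`, `ρ_{s+1} = 2 ρ_s`. -/
def threshold (s : ℕ) : ℝ := 18 * 2 ^ s

/-- Number of thresholds: the largest `n` with `ρ_n ≤ K² T`, i.e. `1 / ρ_n` is at least the smallest
probability with which a learner can be sampled (and `1` if there is no such `n`). -/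
def numThresholds (K T : ℕ) : ℕ := Nat.log 2 (K ^ 2 * T / 36) + 1

/-- The least `s ∈ [n]` with `x > 1 / ρ_s`, and `n + 1` if there is none. -/
def thresholdIndex (K T : ℕ) (x : ℝ) : ℕ :=
  sInf {s | 1 ≤ s ∧ (1 / threshold s < x ∨ s = numThresholds K T + 1)}

/-- Number of rounds played by each learner in the initial phase. -/
def initRounds (T : ℕ) : ℕ := ⌊Real.log T⌋₊ + 1

/-- What the algorithm does after the current round.
* `regular`: an FTRL step, or the beginning of a negative-regret step;
* `omd R v`: the second OMD update of a negative-regret step, which increases the step sizes of the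
  learners in `R`; `v` is the distribution of the round in which it was begun;
* `last`: the FTRL update that ends a negative-regret step;
* `rest`: an FTRL step, as a negative-regret step has just been taken (unless an epoch begins). -/
inductive Phase (K : ℕ) where
  | regular
  | omd (R : Finset (Fin K)) (v : Fin K → ℝ)
  | last
  | rest

structure State (K : ℕ) where
  /-- distribution over the learners for the current round -/
  w : Fin K → ℝ
  /-- step sizes -/
  η : Fin K → ℝ
  /-- cumulative estimated losses -/
  L : Fin K → ℝ
  /-- current threshold indices -/
  θ : Fin K → ℕ
  phase : Phase K
  /-- the round at which the next epoch begins -/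
  epoch : ℕ
  /-- how many rounds each learner had played when it was last started -/
  start : Fin K → ℕ
  /-- environment parameter with which each learner was last started -/
  env : Fin K → ℝ

/-- The sampling distribution `(1 - 1/(TK)) w + 1/(TK) Unif`. -/
def State.wbar {K : ℕ} (T : ℕ) (s : State K) (i : Fin K) : ℝ :=
  (1 - 1 / ((T : ℝ) * K)) * s.w i + 1 / ((T : ℝ) * K) * (1 / K)

/-- Step size schedule of the FTRL steps: `1 / η'² = 1 / η² + 1 / η₁²`. -/
def decrease {K : ℕ} (η₁ η : Fin K → ℝ) : Fin K → ℝ :=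
  fun i => 1 / √(1 / η i ^ 2 + 1 / η₁ i ^ 2)

/-- State at the beginning of the main phase; `L` is the vector of losses of the initial phase. -/
def State.initial {K : ℕ} (T : ℕ) (η₁ L : Fin K → ℝ) : State K where
  w := ftrl (decrease η₁ η₁) L
  η := decrease η₁ η₁
  L := L
  θ := fun _ => 1
  phase := .regular
  epoch := K * initRounds T
  start := fun _ => 0
  env := fun _ => 1

/-- FTRL step with decreasing step size. -/
def State.ftrlStep {K : ℕ} (η₁ ℓ : Fin K → ℝ) (s : State K) : State K :=
  { s with
    η := decrease η₁ s.η
    L := s.L + ℓ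
    w := ftrl (decrease η₁ s.η) (s.L + ℓ)
    phase := .regular }

/-- If `R` is not empty then a negative-regret step for the learners in `R` is begun by an OMD update
with unchanged step sizes; otherwise an FTRL step is taken. -/
def State.begin {K : ℕ} (η₁ ℓ : Fin K → ℝ) (R : Finset (Fin K)) (s : State K) : State K :=
  open Classical in
  if R.Nonempty then
    { s with
      L := s.L + ℓ
      w := Corral.omd s.η ℓ s.w
      phase := .omd R s.w }
  else s.ftrlStep η₁ ℓ

/-- First round of an epoch, in which a negative-regret step is begun for all learners whose probability
is at most `1 / ρ₁`. `clock` is the number of rounds played by the learners including the present one. A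
learner whose probability fell below a threshold in the preceding epoch, but is above `1 / ρ₁` now,
is restarted. -/
def State.epochStep {K : ℕ} (T : ℕ) (η₁ : Fin K → ℝ) (clock : ℕ) (ℓ : Fin K → ℝ)
    (s : State K) : State K :=
  open Classical in
  State.begin η₁ ℓ (Finset.univ.filter fun i => s.w i ≤ 1 / threshold 1)
    { s with
      θ := fun i => thresholdIndex K T (s.w i)
      epoch := 2 * s.epoch + K * initRounds T
      start := fun i =>
        if 1 / threshold 1 < s.w i ∧ 2 ≤ s.θ i then clock else s.start i
      env := fun i =>
        if 1 / threshold 1 < s.w i ∧ 2 ≤ s.θ i then threshold 1 else s.env i }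

/-- Another round, in which a negative-regret step is begun for all learners whose probability is at
most their current threshold. -/
def State.regularStep {K : ℕ} (T : ℕ) (η₁ ℓ : Fin K → ℝ) (s : State K) : State K :=
  open Classical in
  State.begin η₁ ℓ
    (Finset.univ.filter fun i => s.θ i ≤ numThresholds K T ∧ s.w i ≤ 1 / threshold (s.θ i))
    { s with
      θ := fun i =>
        if s.θ i ≤ numThresholds K T ∧ s.w i ≤ 1 / threshold (s.θ i) then s.θ i + 1 else s.θ i }

/-- Second OMD update of a negative-regret step: the step sizes of the learners in `R` are multiplied by
`β`, these learners are restarted, and `L` is replaced by the loss vector `-∇Ψ(w) + ℓ` for which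
the FTRL iterate is this OMD iterate. -/
def State.omdStep {K : ℕ} (β : ℝ) (clock : ℕ) (R : Finset (Fin K)) (v ℓ : Fin K → ℝ)
    (s : State K) : State K :=
  let η' : Fin K → ℝ := fun i => if i ∈ R then β * s.η i else s.η i
  { s with
    η := η'
    L := fun i => -gradPsi η' s.w i + ℓ i
    w := Corral.omd η' ℓ s.w
    phase := .last
    start := fun i => if i ∈ R then clock else s.start i
    env := fun i => if i ∈ R then 2 / v i else s.env i }

/-- FTRL update that ends a negative-regret step. -/
def State.lastStep {K : ℕ} (ℓ : Fin K → ℝ) (s : State K) : State K :=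
  { s with
    L := s.L + ℓ
    w := ftrl s.η (s.L + ℓ)
    phase := .rest }

/-- Update after round `r` of the game (rounds are counted from `0`), with estimated losses `ℓ`. -/
def State.next {K : ℕ} (T : ℕ) (β : ℝ) (η₁ : Fin K → ℝ) (r clock : ℕ) (ℓ : Fin K → ℝ)
    (s : State K) : State K :=
  match s.phase with
  | .regular => if s.epoch ≤ r then s.epochStep T η₁ clock ℓ else s.regularStep T η₁ ℓ
  | .omd R v => s.omdStep β clock R v ℓ
  | .last => s.lastStep ℓ
  | .rest => if s.epoch ≤ r then s.epochStep T η₁ clock ℓ else s.ftrlStep η₁ ℓ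

/-! ## Runs of the algorithm -/

/-- One trajectory of the game. `arm i q` is the arm proposed by learner `i` in its `q`-th own round,
`chosen r` the learner that plays in round `r` of the game, and `loss r` the losses of all arms in
round `r`. All counts begin with `0`. Each learner plays alone in its first `initRounds T` own rounds;
afterwards all learners propose an arm in every round, so that round `K * initRounds T + n` of
the game is the own round `initRounds T + n` of every learner. -/
structure Trajectory (K : ℕ) (k : Fin K → ℕ) where
  arm : (i : Fin K) → ℕ → Fin (k i)
  chosen : ℕ → Fin K
  loss : ℕ → (i : Fin K) → Fin (k i) → ℝ

namespace Trajectory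

variable {K : ℕ} {k : Fin K → ℕ}

/-- Own round of the learner that plays in round `r` of the game. -/
def ownRound (K T r : ℕ) : ℕ :=
  if r < K * initRounds T then r / K else initRounds T + (r - K * initRounds T)

/-- Loss incurred in round `r`. -/
def playedLoss (T : ℕ) (x : Trajectory K k) (r : ℕ) : ℝ :=
  x.loss r (x.chosen r) (x.arm (x.chosen r) (ownRound K T r))

/-- Total loss of each learner in the initial phase. -/
def initLoss (T : ℕ) (x : Trajectory K k) (i : Fin K) : ℝ :=
  ∑ q ∈ Finset.range (initRounds T), x.loss (q * K + i) i (x.arm i q)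

/-- Estimated loss vector in round `r` of the main phase, given the sampling distribution. -/
def lossEstimate (T : ℕ) (x : Trajectory K k) (r : ℕ) (wbar : Fin K → ℝ) (i : Fin K) : ℝ :=
  iwLoss (decide (x.chosen r = i)) (x.playedLoss T r) (wbar i)

/-- State of the algorithm before round `n` of the main phase. -/
def state (T : ℕ) (β : ℝ) (η₁ : Fin K → ℝ) (x : Trajectory K k) : ℕ → State K
  | 0 => State.initial T η₁ (x.initLoss T)
  | n + 1 =>
    let s := state T β η₁ x n
    s.next T β η₁ (K * initRounds T + n) (initRounds T + n + 1)
      (x.lossEstimate T (K * initRounds T + n) (s.wbar T))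

/-- Feedback that learner `i` receives in its own round `q`. -/
def feedback (T : ℕ) (β : ℝ) (η₁ : Fin K → ℝ) (x : Trajectory K k) (i : Fin K) (q : ℕ) : ℝ :=
  if q < initRounds T then x.loss (q * K + i) i (x.arm i q)
  else x.lossEstimate T (K * initRounds T + (q - initRounds T))
    ((x.state T β η₁ (q - initRounds T)).wbar T) i

/-- History of learner `i` in the `n` own rounds that begin with round `q`. -/
def history (T : ℕ) (β : ℝ) (η₁ : Fin K → ℝ) (x : Trajectory K k) (i : Fin K) (q n : ℕ) :
    Fin n → Fin (k i) × ℝ :=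
  fun s => (x.arm i (q + s), x.feedback T β η₁ i (q + s))

end Trajectory

/-- The random trajectory `X` is a run of the corralling algorithm with horizon `T`, multiplier `β` and
initial step sizes `η₁` on the base learners `A`, in the stochastic environment whose loss vectors
are drawn independently from `D` in each round. `ℱ r` is the information before round `r`. -/
structure IsRun {K : ℕ} {k : Fin K → ℕ} (A : (i : Fin K) → Learner (k i))
    (D : Measure ((i : Fin K) → Fin (k i) → ℝ)) (T : ℕ) (β : ℝ) (η₁ : Fin K → ℝ)
    {Ω : Type u} [m0 : MeasurableSpace Ω] (P : Measure Ω) (ℱ : Filtration ℕ m0)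
    (X : Ω → Trajectory K k) : Prop where
  measurable_chosen : ∀ r i, MeasurableSet[ℱ (r + 1)] {ω | (X ω).chosen r = i}
  measurable_loss : ∀ r, Measurable[ℱ (r + 1)] fun ω => (X ω).loss r
  measurable_arm_init : ∀ q < initRounds T, ∀ (i : Fin K) (j : Fin (k i)),
    MeasurableSet[ℱ (q * K + i + 1)] {ω | (X ω).arm i q = j}
  measurable_arm_main : ∀ n i j,
    MeasurableSet[ℱ (K * initRounds T + n + 1)] {ω | (X ω).arm i (initRounds T + n) = j}
  measurable_weights : ∀ n i,
    Measurable[ℱ (K * initRounds T + n)] fun ω => ((X ω).state T β η₁ n).w i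
  /-- in the initial phase the learners play in turn -/
  chosen_init : ∀ r < K * initRounds T, ∀ ω, ((X ω).chosen r : ℕ) = r % K
  law_init : ∀ q < initRounds T, ∀ (i : Fin K) (S : Set Ω), MeasurableSet[ℱ (q * K + i)] S →
    ∀ (j : Fin (k i)) (B : Set ((i : Fin K) → Fin (k i) → ℝ)), MeasurableSet B →
      P.real (S ∩ {ω | (X ω).arm i q = j ∧ (X ω).loss (q * K + i) ∈ B}) =
        ∫ ω in S, (A i).policy 1 q ((X ω).history T β η₁ i 0 q) j * D.real B ∂P
  /-- in the main phase the arms proposed by the learners, the learner that plays, and the losses are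
  conditionally independent given the past -/
  law_main : ∀ (n : ℕ) (S : Set Ω), MeasurableSet[ℱ (K * initRounds T + n)] S →
    ∀ (j : (i : Fin K) → Fin (k i)) (c : Fin K) (B : Set ((i : Fin K) → Fin (k i) → ℝ)),
      MeasurableSet B →
      P.real (S ∩ {ω | (∀ i, (X ω).arm i (initRounds T + n) = j i) ∧
          (X ω).chosen (K * initRounds T + n) = c ∧ (X ω).loss (K * initRounds T + n) ∈ B}) =
        ∫ ω in S, (∏ i, (A i).policy (((X ω).state T β η₁ n).env i)
              (initRounds T + n - ((X ω).state T β η₁ n).start i)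
              ((X ω).history T β η₁ i (((X ω).state T β η₁ n).start i)
                (initRounds T + n - ((X ω).state T β η₁ n).start i)) (j i))
            * ((X ω).state T β η₁ n).wbar T c * D.real B ∂P

/-- Mean loss of arm `j` of learner `i`. -/
def meanLoss {K : ℕ} {k : Fin K → ℕ} (D : Measure ((i : Fin K) → Fin (k i) → ℝ))
    (i : Fin K) (j : Fin (k i)) : ℝ := ∫ x, x i j ∂D

/-- Mean loss of the best arm of learner `i`. -/
def bestLoss {K : ℕ} {k : Fin K → ℕ} (D : Measure ((i : Fin K) → Fin (k i) → ℝ))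
    (i : Fin K) : ℝ := ⨅ j, meanLoss D i j

/-- Gap `Δᵢ` between the best arm of learner `istar` and the best arm of learner `i`. -/
def gap {K : ℕ} {k : Fin K → ℕ} (D : Measure ((i : Fin K) → Fin (k i) → ℝ))
    (istar i : Fin K) : ℝ := bestLoss D i - bestLoss D istar

/-- Expected (pseudo-)regret of the corralling algorithm after `T` rounds. -/
def expectedRegret {K : ℕ} {k : Fin K → ℕ} (D : Measure ((i : Fin K) → Fin (k i) → ℝ))
    (istar : Fin K) (T : ℕ) {Ω : Type u} [MeasurableSpace Ω] (P : Measure Ω)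
    (X : Ω → Trajectory K k) : ℝ :=
  ∫ ω, ∑ r ∈ Finset.range T, (X ω).playedLoss T r ∂P - T * bestLoss D istar

end

end Corral

namespace Corral

noncomputable section

/-! ## Optimality conditions -/

/-! Write `j` for the best learner, M for `K * initRounds T`, and call a round in which a
negative-regret step is begun for `j` a trigger. In the main phase the played loss is the inner
product of the estimated losses with the sampling distribution. Up to 1/T per round the regret is
therefore the regret of the weights against the vertex of `j`, plus the importance-weighted regret
of learner `j` against its best arm (`integral_playedLoss_sub_le`).

Weights. Every update is characterized by explicit optimality conditions, under which the Bregman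
divergence equals the gap in objective value. One step costs a telescoping difference of
divergences, a stability term and a penalty (`regret_step`). Shifting the losses by the played loss
leaves, in expectation, only sums over i ≠ j, of order √w_i/√n and √w_i/(η_{1,i}√n)
(`integral_stability_le`). Multiplying the step size of `j` by β shrinks its divergence and earns a
`bonus` of order (1 - 1/β)/(η_j √w_j). There are logarithmically many epochs and thresholds, so a
learner undergoes at most 47/20 (log T)² such multiplications, and β = e^{1/(log T)²} lets them
amount to a factor of at most 21/2. Almost a quarter of the rounds are FTRL steps, so η_i stays of
order η_{1,i}/√n (`η_le_sqrt`).

Learner. The rounds of `j` are cut into segments by its restarts. Conditionally on its beginning, a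
segment is a play in the importance-weighted environment, and stability bounds its regret by the
expectation of √ρ R(τ) (`segment_regret`). A segment begun by a negative-regret step ends soon after
its epoch, and its cost is charged to 1/√w_j at the triggers that begin and end it. The condition on
η₁ makes the bonus of one trigger large enough for both charges (`le_bonus`,
`sum_segmentCost_le_bonus`). A segment with the first threshold may be long; it is used only until
w_j falls to 1/36. Until then √ρ ≤ 6.2 in late rounds, and the cost is charged to the trigger that
cuts it, or to R(T) if nothing cuts it. Two errors remain: weights move during negative-regret
steps, when thresholds are not checked, and the normalizing multiplier shifts. Both have conditional
mean at most 1 per round, affect O(K (log T)²) rounds, and carry the factor 1 - 1/β ≤ 1/(log T)², so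
they add up to O(K). Early rounds, where the bonus may not suffice, cost O(M + R(T))
(`sum_regret_le`).

In the sum the bonuses cancel. Since the regret is at least the sum of Δ_i times the expected
sampling probabilities, Young's inequality absorbs half of it and leaves log T/(η_{1,i}² Δ_i)
(`sum_regret_main_le`). A single learner is handled by stability alone, and horizons outside
`Regime` by the trivial bound T. -/

/-- First-order optimality of `w` for `⟨L, w⟩ + Ψ(w)` on the simplex, with multiplier `c`. -/
structure IsKKT {K : ℕ} (η L w : Fin K → ℝ) (c : ℝ) : Prop where
  pos : ∀ i, 0 < w i
  sum : ∑ i, w i = 1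
  eq : ∀ i, 2 * (1 / √(w i) - 1) / η i = L i + c

/-- The Bregman divergence of `Ψ` in closed form. -/
def divg {K : ℕ} (η u w : Fin K → ℝ) : ℝ := ∑ i, 2 / η i * ((√(u i) - √(w i)) ^ 2 / √(w i))

lemma divg_nonneg {K : ℕ} {η u w : Fin K → ℝ} (hη : ∀ i, 0 < η i) : 0 ≤ divg η u w :=
  Finset.sum_nonneg fun i _ => by have := hη i; positivity

lemma IsKKT.le_one {K : ℕ} {η L w : Fin K → ℝ} {c : ℝ} (h : IsKKT η L w c) (i : Fin K) :
    w i ≤ 1 := by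
  rw [← h.sum]; exact Finset.single_le_sum (fun j _ => (h.pos j).le) (Finset.mem_univ i)

lemma IsKKT.mem {K : ℕ} {η L w : Fin K → ℝ} {c : ℝ} (h : IsKKT η L w c) :
    w ∈ stdSimplex ℝ (Fin K) := ⟨fun i => (h.pos i).le, h.sum⟩

/-- The gradient of the objective at `w` is constant along the simplex, so the linear part of the
Bregman divergence drops out and the divergence is exactly the gap in objective value. Minimality,
uniqueness and the one-step regret identity are all read off from this. -/
lemma IsKKT.divg_eq {K : ℕ} {η L w : Fin K → ℝ} {c : ℝ} (h : IsKKT η L w c) (hη : ∀ i, 0 < η i)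
    {u : Fin K → ℝ} (hu : u ∈ stdSimplex ℝ (Fin K)) :
    divg η u w = (∑ i, L i * u i + psi η u) - (∑ i, L i * w i + psi η w) := by
  have key : ∀ i, 2 / η i * ((√(u i) - √(w i)) ^ 2 / √(w i)) =
      (L i + c) * (u i - w i) + (-4 * ((√(u i) - u i / 2) / η i)
        - -4 * ((√(w i) - w i / 2) / η i)) := by
    intro i
    have hw := h.pos i
    have hs : 0 < √(w i) := Real.sqrt_pos.2 hw
    have hη' := hη i
    rw [← h.eq i]
    obtain ⟨a, ha⟩ : ∃ a, a = √(u i) := ⟨_, rfl⟩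
    obtain ⟨b, hb⟩ : ∃ b, b = √(w i) := ⟨_, rfl⟩
    have hu2 : u i = a ^ 2 := by rw [ha, Real.sq_sqrt (hu.1 i)]
    have hw2 : w i = b ^ 2 := by rw [hb, Real.sq_sqrt hw.le]
    rw [← ha, ← hb, hu2, hw2]
    rw [← hb] at hs
    field_simp
    ring
  have hsum : ∑ i, (u i - w i) = 0 := by rw [Finset.sum_sub_distrib, hu.2, h.sum, sub_self]
  have h1 : ∑ i, (L i + c) * (u i - w i) = ∑ i, L i * u i - ∑ i, L i * w i := by
    calc ∑ i, (L i + c) * (u i - w i)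
        = ∑ i, (L i * u i - L i * w i + c * (u i - w i)) :=
          Finset.sum_congr rfl fun i _ => by ring
      _ = _ := by
          rw [Finset.sum_add_distrib, Finset.sum_sub_distrib, ← Finset.mul_sum, hsum]; ring
  unfold divg psi
  rw [Finset.sum_congr rfl fun i _ => key i, Finset.sum_add_distrib, h1, Finset.sum_sub_distrib,
    ← Finset.mul_sum, ← Finset.mul_sum]
  ring

/-- For a fixed multiplier the condition is solved coordinatewise by (1 + η(L + c)/2)⁻². The total
mass is at least 1 at c = -min L, and at most 1 once every coordinate is at most 1/K; the
intermediate value theorem gives mass 1. -/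
lemma exists_isKKT {K : ℕ} [NeZero K] {η : Fin K → ℝ} (hη : ∀ i, 0 < η i) (L : Fin K → ℝ) :
    ∃ w c, IsKKT η L w c := by
  obtain ⟨i0, hi0⟩ := Finite.exists_min L
  obtain ⟨i1, hi1⟩ := Finite.exists_min η
  set W : Fin K → ℝ → ℝ := fun i c => (1 + η i * (L i + c) / 2)⁻¹ ^ 2 with hW
  set c0 := -L i0 with hc0
  have hden : ∀ i c, c0 ≤ c → 1 ≤ 1 + η i * (L i + c) / 2 := by
    intro i c hc
    have : 0 ≤ L i + c := by have := hi0 i; linarith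
    have := mul_nonneg (hη i).le this
    linarith
  have hKpos : (0 : ℝ) < K := by exact_mod_cast Nat.pos_of_ne_zero (NeZero.ne K)
  set c1 := c0 + 2 * K / η i1 with hc1
  have hc01 : c0 ≤ c1 := by
    have := div_pos (mul_pos two_pos hKpos) (hη i1); linarith
  have hcont : ContinuousOn (fun c => ∑ i, W i c) (Set.Icc c0 c1) := by
    refine continuousOn_finsetSum _ fun i _ => ?_
    refine ContinuousOn.pow (ContinuousOn.inv₀ (by fun_prop) ?_) 2
    intro c hc
    have := hden i c hc.1
    positivity
  have hlow : 1 ≤ ∑ i, W i c0 := by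
    have h1 : W i0 c0 = 1 := by simp [hW, hc0]
    rw [← h1]
    exact Finset.single_le_sum (f := fun i => W i c0) (fun j _ => sq_nonneg _) (Finset.mem_univ i0)
  have hup : ∑ i, W i c1 ≤ 1 := by
    have hb : ∀ i, W i c1 ≤ 1 / K := by
      intro i
      have hd : (K : ℝ) ≤ 1 + η i * (L i + c1) / 2 := by
        have h1 : 2 * K / η i1 ≤ L i + c1 := by have := hi0 i; linarith
        have h2 : η i1 * (2 * K / η i1) ≤ η i * (L i + c1) :=
          mul_le_mul (hi1 i) h1 (by have := hη i1; positivity) (hη i).le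
        rw [mul_div_cancel₀ _ (hη i1).ne'] at h2
        linarith
      have hK1 : (1 : ℝ) ≤ K := by exact_mod_cast Nat.pos_of_ne_zero (NeZero.ne K)
      have h3 : (1 + η i * (L i + c1) / 2)⁻¹ ≤ 1 / K := by
        rw [one_div]; exact inv_anti₀ hKpos hd
      have h4 : (0 : ℝ) ≤ (1 + η i * (L i + c1) / 2)⁻¹ := by
        have := hden i c1 hc01; positivity
      calc W i c1 ≤ (1 / K : ℝ) ^ 2 := pow_le_pow_left₀ h4 h3 2
        _ ≤ 1 / K := by
          rw [sq]
          exact mul_le_of_le_one_left (by positivity) (by rw [div_le_one hKpos]; exact hK1)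
    calc ∑ i, W i c1 ≤ ∑ _i : Fin K, (1 / K : ℝ) := Finset.sum_le_sum fun i _ => hb i
      _ = 1 := by simp [hKpos.ne']
  obtain ⟨c, hc, hcs⟩ := intermediate_value_Icc' hc01 hcont ⟨hup, hlow⟩
  refine ⟨fun i => W i c, c, ⟨fun i => ?_, hcs, fun i => ?_⟩⟩
  · have := hden i c hc.1; positivity
  · have h1 := hden i c hc.1
    have : √(W i c) = (1 + η i * (L i + c) / 2)⁻¹ := by
      rw [hW]; exact Real.sqrt_sq (by positivity)
    rw [this, one_div, inv_inv]
    have := (hη i).ne'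
    field_simp
    ring

lemma IsKKT.isMinOn {K : ℕ} {η L w : Fin K → ℝ} {c : ℝ} (h : IsKKT η L w c)
    (hη : ∀ i, 0 < η i) :
    IsMinOn (fun w => ∑ i, L i * w i + psi η w) (stdSimplex ℝ (Fin K)) w := by
  intro u hu
  have h1 := h.divg_eq hη hu
  have h2 : 0 ≤ divg η u w := divg_nonneg hη
  simp only [Set.mem_ofPred_eq]
  linarith

lemma IsKKT.eq_of_isMinOn {K : ℕ} {η L w : Fin K → ℝ} {c : ℝ} (h : IsKKT η L w c)
    (hη : ∀ i, 0 < η i) {u : Fin K → ℝ} (hu : u ∈ stdSimplex ℝ (Fin K))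
    (hmin : IsMinOn (fun w => ∑ i, L i * w i + psi η w) (stdSimplex ℝ (Fin K)) u) : u = w := by
  have h1 := h.divg_eq hη hu
  have h2 := hmin h.mem
  simp only [Set.mem_ofPred_eq] at h2
  have h3 : divg η u w = 0 := le_antisymm (by linarith) (divg_nonneg hη)
  unfold divg at h3
  rw [Finset.sum_eq_zero_iff_of_nonneg (fun i _ => by have := hη i; positivity)] at h3
  funext i
  have h4 := h3 i (Finset.mem_univ i)
  have hw : 0 < √(w i) := Real.sqrt_pos.2 (h.pos i)
  have h5 : (√(u i) - √(w i)) ^ 2 = 0 := by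
    rcases mul_eq_zero.1 h4 with h | h
    · have := hη i; exact absurd h (by positivity)
    · rcases div_eq_zero_iff.1 h with h | h
      · exact h
      · exact absurd h hw.ne'
  have h6 : √(u i) = √(w i) := by
    have := pow_eq_zero_iff (two_ne_zero) |>.1 h5; linarith
  exact (Real.sqrt_inj (hu.1 i) (h.pos i).le).1 h6

/-- Minimizers are unique, so whatever `Classical.epsilon` picks is the solution of the optimality
conditions. -/
lemma exists_isKKT_ftrl {K : ℕ} [NeZero K] {η : Fin K → ℝ} (hη : ∀ i, 0 < η i) (L : Fin K → ℝ) :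
    ∃ c, IsKKT η L (ftrl η L) c := by
  obtain ⟨w, c, h⟩ := exists_isKKT hη L
  have hex : ∃ w, w ∈ stdSimplex ℝ (Fin K) ∧
      IsMinOn (fun w => ∑ i, L i * w i + psi η w) (stdSimplex ℝ (Fin K)) w :=
    ⟨w, h.mem, h.isMinOn hη⟩
  have hs := Classical.epsilon_spec hex
  have : ftrl η L = w := h.eq_of_isMinOn hη hs.1 hs.2
  rw [this]
  exact ⟨c, h⟩

/-- The Bregman divergence differs from Ψ by a linear term and a constant, and the linear term can
be counted among the losses. What is known about FTRL thus applies to OMD. -/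
lemma omd_eq_ftrl {K : ℕ} (η ℓ w : Fin K → ℝ) :
    omd η ℓ w = ftrl η (fun i => -gradPsi η w i + ℓ i) := by
  unfold omd ftrl argminSimplex
  congr 1
  funext v
  have hf : (fun v : Fin K → ℝ => ∑ i, ℓ i * v i + bregman η v w) = fun v =>
      (∑ i, (-gradPsi η w i + ℓ i) * v i + psi η v) + (∑ i, gradPsi η w i * w i - psi η w) := by
    funext v
    unfold bregman
    have : ∑ i, (-gradPsi η w i + ℓ i) * v i =
        ∑ i, ℓ i * v i - ∑ i, gradPsi η w i * (v i - w i) - ∑ i, gradPsi η w i * w i := by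
      rw [← Finset.sum_sub_distrib, ← Finset.sum_sub_distrib]
      exact Finset.sum_congr rfl fun i _ => by ring
    rw [this]; ring
  rw [hf]
  simp only [IsMinOn, IsMinFilter, add_le_add_iff_right]

lemma exists_isKKT_omd {K : ℕ} [NeZero K] {η : Fin K → ℝ} (hη : ∀ i, 0 < η i) (ℓ w : Fin K → ℝ) :
    ∃ c, IsKKT η (fun i => -gradPsi η w i + ℓ i) (omd η ℓ w) c := by
  rw [omd_eq_ftrl]; exact exists_isKKT_ftrl hη _

lemma IsKKT.gradPsi_eq {K : ℕ} {η L w : Fin K → ℝ} {c : ℝ} (h : IsKKT η L w c) (i : Fin K) :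
    -gradPsi η w i = L i + c := by
  rw [← h.eq i]; unfold gradPsi; ring

/-- An OMD update with unchanged step sizes is an FTRL update. -/
lemma IsKKT.omd {K : ℕ} [NeZero K] {η L w : Fin K → ℝ} {c : ℝ} (h : IsKKT η L w c)
    (hη : ∀ i, 0 < η i) (ℓ : Fin K → ℝ) : ∃ c, IsKKT η (L + ℓ) (Corral.omd η ℓ w) c := by
  obtain ⟨c', h'⟩ := exists_isKKT_omd hη ℓ w
  refine ⟨c + c', h'.pos, h'.sum, fun i => ?_⟩
  rw [h'.eq i, h.gradPsi_eq i, Pi.add_apply]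
  ring

/-- Any point of the simplex satisfies the optimality condition for the loss vector `-∇Ψ`. -/
lemma isKKT_neg_gradPsi {K : ℕ} {η w : Fin K → ℝ} (hw : ∀ i, 0 < w i) (hs : ∑ i, w i = 1) :
    IsKKT η (fun i => -gradPsi η w i) w 0 :=
  ⟨hw, hs, fun i => by unfold gradPsi; ring⟩

/-! ### One-step regret: stability, penalty, and the motion of the weights -/

/-- Regret of one step, with a change of the step sizes. -/
lemma IsKKT.regret_eq {K : ℕ} {η η' L ℓ w w' : Fin K → ℝ} {c c' : ℝ} (h : IsKKT η L w c)
    (h' : IsKKT η' (fun i => L i + ℓ i) w' c') (hη : ∀ i, 0 < η i) (hη' : ∀ i, 0 < η' i)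
    {u : Fin K → ℝ} (hu : u ∈ stdSimplex ℝ (Fin K)) :
    ∑ i, ℓ i * (w i - u i) = divg η u w - divg η' u w' +
      (∑ i, ℓ i * (w i - w' i) - divg η w' w) +
      ((psi η' u - psi η u) - (psi η' w' - psi η w')) := by
  rw [h.divg_eq hη hu, h'.divg_eq hη' hu, h.divg_eq hη h'.mem]
  simp only [add_mul, mul_sub, Finset.sum_add_distrib, Finset.sum_sub_distrib]
  ring

/-- Stability of one coordinate. -/
lemma stability_coord {η y w z : ℝ} (hη : 0 < η) (hw : 0 < w) (hz : 0 ≤ z)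
    (hy : 1 / 36 ≤ 1 + η * y * √w / 2) :
    y * (w - z) - 2 / η * ((√z - √w) ^ 2 / √w) ≤ 18 * (η * y ^ 2 * (w * √w)) := by
  obtain ⟨b, hb⟩ : ∃ b, b = √w := ⟨_, rfl⟩
  obtain ⟨s, hs⟩ : ∃ s, s = √z := ⟨_, rfl⟩
  have hb0 : 0 < b := hb ▸ Real.sqrt_pos.2 hw
  have hw2 : w = b ^ 2 := by rw [hb, Real.sq_sqrt hw.le]
  have hz2 : z = s ^ 2 := by rw [hs, Real.sq_sqrt hz]
  rw [← hb] at hy ⊢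
  rw [← hs, hw2, hz2]
  -- with `d = b - s`: `y (2 b d - d²) - 2 d² / (η b)`
  have e : y * (b ^ 2 - s ^ 2) - 2 / η * ((s - b) ^ 2 / b) =
      2 / (η * b) * (2 * (η * y * b / 2) * (b * (b - s)) - (1 + η * y * b / 2) * (b - s) ^ 2) := by
    field_simp
    ring
  have e2 : 18 * (η * y ^ 2 * (b ^ 2 * b)) =
      2 / (η * b) * (36 * (η * y * b / 2) ^ 2 * b ^ 2) := by
    field_simp
    ring
  rw [e, e2]
  refine mul_le_mul_of_nonneg_left ?_ (by positivity)
  -- With d = b - s the claim reads 2abd - (1 + a)d² ≤ 36a²b². The hypothesis gives 1 + a ≥ 1/36,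
  -- and 2abd ≤ 36a²b² + d²/36.
  set a := η * y * b / 2
  nlinarith [sq_nonneg (36 * a * b - (b - s)), sq_nonneg (b - s)]

/-- Stability with a shift of the losses. -/
lemma stability_le {K : ℕ} {η ℓ w z : Fin K → ℝ} (hη : ∀ i, 0 < η i) (hw : ∀ i, 0 < w i)
    (hws : ∑ i, w i = 1) (hz : z ∈ stdSimplex ℝ (Fin K)) (x : ℝ)
    (h : ∀ i, 1 / 36 ≤ 1 + η i * (ℓ i - x) * √(w i) / 2) :
    ∑ i, ℓ i * (w i - z i) - divg η z w ≤
      ∑ i, 18 * (η i * (ℓ i - x) ^ 2 * (w i * √(w i))) := by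
  -- A common shift is invisible because both distributions have mass 1.
  have h1 : ∑ i, ℓ i * (w i - z i) = ∑ i, (ℓ i - x) * (w i - z i) := by
    have : ∑ i, x * (w i - z i) = 0 := by
      rw [← Finset.mul_sum, Finset.sum_sub_distrib, hws, hz.2, sub_self, mul_zero]
    simp only [sub_mul (ℓ _) x, Finset.sum_sub_distrib, this, sub_zero]
  rw [h1, divg, ← Finset.sum_sub_distrib]
  exact Finset.sum_le_sum fun i _ => stability_coord (hη i) (hw i) (hz.1 i) (h i)

lemma psi_sub {K : ℕ} (η η' w : Fin K → ℝ) :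
    psi η' w - psi η w = -4 * ∑ i, (√(w i) - w i / 2) * (1 / η' i - 1 / η i) := by
  unfold psi
  rw [← mul_sub, ← Finset.sum_sub_distrib]
  congr 1
  exact Finset.sum_congr rfl fun i _ => by ring

/-- Cost of decreasing the step sizes, against a vertex of the simplex. -/
lemma penalty_le {K : ℕ} {η η' w : Fin K → ℝ} (hη' : ∀ i, 1 / η i ≤ 1 / η' i)
    (hw : w ∈ stdSimplex ℝ (Fin K)) (j : Fin K) :
    (psi η' (Pi.single j 1) - psi η (Pi.single j 1)) - (psi η' w - psi η w) ≤
      ∑ i ∈ Finset.univ.erase j, 4 * ((1 / η' i - 1 / η i) * √(w i)) := by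
  have hw1 : ∀ i, w i ≤ 1 := fun i => by
    rw [← hw.2]; exact Finset.single_le_sum (fun j _ => hw.1 j) (Finset.mem_univ i)
  rw [psi_sub, psi_sub, ← Finset.add_sum_erase _ _ (Finset.mem_univ j),
    ← Finset.add_sum_erase (a := j) _ (fun i => (√(w i) - w i / 2) * (1 / η' i - 1 / η i))
      (Finset.mem_univ j)]
  have h0 : ∑ x ∈ Finset.univ.erase j, (√((Pi.single j 1 : Fin K → ℝ) x)
      - (Pi.single j 1 : Fin K → ℝ) x / 2) * (1 / η' x - 1 / η x) = 0 :=
    Finset.sum_eq_zero fun x hx => by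
      rw [Pi.single_eq_of_ne (Finset.ne_of_mem_erase hx)]; simp
  rw [h0, Pi.single_eq_same, Real.sqrt_one]
  have h1 : ∑ x ∈ Finset.univ.erase j, (√(w x) - w x / 2) * (1 / η' x - 1 / η x) ≤
      ∑ i ∈ Finset.univ.erase j, (1 / η' i - 1 / η i) * √(w i) :=
    Finset.sum_le_sum fun i _ => by
      have a := hη' i; have b := hw.1 i
      nlinarith [Real.sqrt_nonneg (w i)]
  -- The linear part of Ψ makes √x - x/2 largest at x = 1, with the value 1/2 attained at the
  -- vertex. Hence coordinate `j` contributes nothing positive.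
  have h2 : (√(w j) - w j / 2) * (1 / η' j - 1 / η j) ≤ 1 / 2 * (1 / η' j - 1 / η j) := by
    refine mul_le_mul_of_nonneg_right ?_ (by have := hη' j; linarith)
    have := Real.sq_sqrt (hw.1 j)
    nlinarith [sq_nonneg (√(w j) - 1)]
  rw [← Finset.mul_sum]
  linarith

/-- `1 / √w` after an update with unchanged step sizes. -/
lemma IsKKT.transition {K : ℕ} [NeZero K] {η L ℓ w w' : Fin K → ℝ} {c c' : ℝ}
    (h : IsKKT η L w c) (h' : IsKKT η (fun i => L i + ℓ i) w' c') (hη : ∀ i, 0 < η i)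
    (hℓ : ∀ i, 0 ≤ ℓ i) :
    ∃ x, 0 ≤ x ∧
      x ≤ (∑ i, η i * (w i * √(w i)) * ℓ i) / ∑ i, η i * (w i * √(w i)) ∧
      ∀ i, 1 / √(w' i) = 1 / √(w i) + η i / 2 * (ℓ i - x) := by
  have hY : ∀ i, 1 / √(w' i) = 1 / √(w i) + η i / 2 * (ℓ i - (c - c')) := by
    intro i
    have e1 := h.eq i
    have e2 := h'.eq i
    have hi := hη i
    rw [div_eq_iff hi.ne'] at e1 e2
    linarith
  refine ⟨c - c', ?_, ?_, hY⟩
  -- A negative shift would raise every 1/√w and so lower every coordinate, against the total mass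
  -- 1.
  · by_contra! hneg
    have : ∑ i, w' i < ∑ i, w i := by
      have hlt : ∀ i, w' i < w i := by
        intro i
        have h1 : 1 / √(w i) < 1 / √(w' i) := by
          rw [hY i]
          have := mul_pos (half_pos (hη i)) (by have := hℓ i; linarith : 0 < ℓ i - (c - c'))
          linarith
        have h2 := (one_div_lt_one_div (Real.sqrt_pos.2 (h.pos i)) (Real.sqrt_pos.2 (h'.pos i))).1 h1
        exact (Real.sqrt_lt_sqrt_iff (h'.pos i).le).1 h2
      exact Finset.sum_lt_sum_of_nonempty Finset.univ_nonempty fun i _ => hlt i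
    rw [h.sum, h'.sum] at this
    exact lt_irrefl _ this
  · have hpos : 0 < ∑ i, η i * (w i * √(w i)) :=
      Finset.sum_pos (fun i _ => mul_pos (hη i) (mul_pos (h.pos i) (Real.sqrt_pos.2 (h.pos i))))
        Finset.univ_nonempty
    rw [le_div_iff₀ hpos]
    -- Tangent to the convex function y ↦ y⁻² at 1/√(w i); with a = √(w' i) and b = √(w i) it
    -- amounts to (a + 2b)(a - b)² ≥ 0. After summation the masses cancel and the bound for the
    -- shift is left.
    have key : ∀ i, w i - η i * (w i * √(w i)) * (ℓ i - (c - c')) ≤ w' i := by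
      intro i
      have hYi := hY i
      obtain ⟨b, hb⟩ : ∃ b, b = √(w i) := ⟨_, rfl⟩
      obtain ⟨a, ha⟩ : ∃ a, a = √(w' i) := ⟨_, rfl⟩
      have hb0 : 0 < b := hb ▸ Real.sqrt_pos.2 (h.pos i)
      have ha0 : 0 < a := ha ▸ Real.sqrt_pos.2 (h'.pos i)
      have hw2 : w i = b ^ 2 := by rw [hb, Real.sq_sqrt (h.pos i).le]
      have hw2' : w' i = a ^ 2 := by rw [ha, Real.sq_sqrt (h'.pos i).le]
      rw [← ha, ← hb] at hYi
      have : η i * (ℓ i - (c - c')) = 2 * (1 / a - 1 / b) := by linarith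
      rw [← hb, hw2', hw2]
      calc b ^ 2 - η i * (b ^ 2 * b) * (ℓ i - (c - c'))
          = b ^ 2 - b ^ 3 * (η i * (ℓ i - (c - c'))) := by ring
        _ = (3 * b ^ 2 * a - 2 * b ^ 3) / a := by rw [this]; field_simp; ring
        _ ≤ a ^ 2 := by
            rw [div_le_iff₀ ha0]
            nlinarith [mul_nonneg (by linarith : 0 ≤ a + 2 * b) (sq_nonneg (a - b))]
    have hs := Finset.sum_le_sum fun i (_ : i ∈ Finset.univ) => key i
    rw [h'.sum, Finset.sum_sub_distrib, h.sum] at hs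
    simp only [mul_sub, Finset.sum_sub_distrib, ← Finset.sum_mul] at hs
    linarith

/-- Change of the divergence when the step sizes of the learners in `R` are multiplied by `β`. -/
lemma divg_mul_le {K : ℕ} {η u w : Fin K → ℝ} (hη : ∀ i, 0 < η i) {β : ℝ} (hβ : 1 ≤ β)
    (R : Finset (Fin K)) :
    divg (fun i => if i ∈ R then β * η i else η i) u w ≤ divg η u w ∧
    ∀ j ∈ R, divg (fun i => if i ∈ R then β * η i else η i) u w ≤
      divg η u w - (1 - 1 / β) * (2 / η j * ((√(u j) - √(w j)) ^ 2 / √(w j))) := by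
  have hβ0 : 0 < β := by linarith
  have hterm : ∀ i, 2 / (if i ∈ R then β * η i else η i) * ((√(u i) - √(w i)) ^ 2 / √(w i)) ≤
      2 / η i * ((√(u i) - √(w i)) ^ 2 / √(w i)) := by
    intro i
    refine mul_le_mul_of_nonneg_right ?_ (by positivity)
    refine div_le_div_of_nonneg_left zero_le_two (hη i) ?_
    split_ifs
    · exact le_mul_of_one_le_left (hη i).le hβ
    · exact le_rfl
  refine ⟨Finset.sum_le_sum fun i _ => hterm i, fun j hj => ?_⟩
  unfold divg
  rw [← Finset.add_sum_erase _ _ (Finset.mem_univ j),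
    ← Finset.add_sum_erase _ (fun i => 2 / η i * ((√(u i) - √(w i)) ^ 2 / √(w i)))
      (Finset.mem_univ j)]
  have h1 := Finset.sum_le_sum fun i (_ : i ∈ Finset.univ.erase j) => hterm i
  simp only [if_pos hj]
  have h2 : 2 / (β * η j) = 2 / η j - (1 - 1 / β) * (2 / η j) := by
    have := (hη j).ne'; field_simp; ring
  rw [h2]
  linarith

/-! ## The update, field by field -/

namespace State

variable {K : ℕ}

/-- Number of the phase. -/
def tag (s : State K) : ℕ :=
  match s.phase with
  | .regular => 0
  | .omd _ _ => 1
  | .last => 2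
  | .rest => 3

/-- The learners whose step sizes are about to be increased. -/
def nrs (s : State K) : Finset (Fin K) :=
  match s.phase with
  | .omd R _ => R
  | _ => ∅

/-- The distribution of the round in which the current negative-regret step was begun. -/
def begunAt (s : State K) : Fin K → ℝ :=
  match s.phase with
  | .omd _ v => v
  | _ => 0

/-- Whether round `r` is treated as the first round of an epoch. -/
def AtEpoch (r : ℕ) (s : State K) : Prop := (s.tag = 0 ∨ s.tag = 3) ∧ s.epoch ≤ r

open Classical in
/-- The learners for which a negative-regret step is begun in round `r`. -/
def trig (T r : ℕ) (s : State K) : Finset (Fin K) :=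
  Finset.univ.filter fun i => (s.AtEpoch r ∧ s.w i ≤ 1 / threshold 1) ∨
    (¬ s.AtEpoch r ∧ s.tag = 0 ∧ s.θ i ≤ numThresholds K T ∧ s.w i ≤ 1 / threshold (s.θ i))

/-- Whether learner `i` is restarted in round `r` as an epoch begins. -/
def EpochRestart (r : ℕ) (s : State K) (i : Fin K) : Prop :=
  s.AtEpoch r ∧ 1 / threshold 1 < s.w i ∧ 2 ≤ s.θ i

/-- Whether an FTRL step with decreasing step sizes is taken in round `r`. -/
def IsFtrl (T r : ℕ) (s : State K) : Prop := (s.tag = 0 ∨ s.tag = 3) ∧ s.trig T r = ∅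

lemma mem_trig {T r : ℕ} {s : State K} {i : Fin K} : i ∈ s.trig T r ↔
    (s.AtEpoch r ∧ s.w i ≤ 1 / threshold 1) ∨
    (¬ s.AtEpoch r ∧ s.tag = 0 ∧ s.θ i ≤ numThresholds K T ∧ s.w i ≤ 1 / threshold (s.θ i)) := by
  simp [trig]

lemma tag_le_three (s : State K) : s.tag ≤ 3 := by
  unfold tag; split <;> omega

lemma tag_of_trig {T r : ℕ} {s : State K} (h : (s.trig T r).Nonempty) : s.tag = 0 ∨ s.tag = 3 := by
  obtain ⟨i, hi⟩ := h
  rcases mem_trig.1 hi with h | h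
  · exact h.1.1
  · exact .inl h.2.1

lemma nrs_eq_empty {s : State K} (h : s.tag ≠ 1) : s.nrs = ∅ := by
  unfold tag at h; unfold nrs; split at h <;> simp_all

section next

variable (T : ℕ) (β : ℝ) (η₁ : Fin K → ℝ) (r clock : ℕ) (ℓ : Fin K → ℝ) (s : State K)

/-- In all cases the update is one of four. -/
lemma next_cases :
    ((s.trig T r).Nonempty ∧ (s.tag = 0 ∨ s.tag = 3) ∧
      (s.next T β η₁ r clock ℓ).L = s.L + ℓ ∧ (s.next T β η₁ r clock ℓ).η = s.η ∧
      (s.next T β η₁ r clock ℓ).w = Corral.omd s.η ℓ s.w ∧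
      (s.next T β η₁ r clock ℓ).phase = .omd (s.trig T r) s.w) ∨
    (s.IsFtrl T r ∧
      (s.next T β η₁ r clock ℓ).L = s.L + ℓ ∧ (s.next T β η₁ r clock ℓ).η = decrease η₁ s.η ∧
      (s.next T β η₁ r clock ℓ).w = ftrl (decrease η₁ s.η) (s.L + ℓ) ∧
      (s.next T β η₁ r clock ℓ).phase = .regular) ∨
    (s.tag = 1 ∧
      (s.next T β η₁ r clock ℓ).L = (fun i => -gradPsi (s.next T β η₁ r clock ℓ).η s.w i + ℓ i) ∧
      (s.next T β η₁ r clock ℓ).η = (fun i => if i ∈ s.nrs then β * s.η i else s.η i) ∧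
      (s.next T β η₁ r clock ℓ).w = Corral.omd (s.next T β η₁ r clock ℓ).η ℓ s.w ∧
      (s.next T β η₁ r clock ℓ).phase = .last) ∨
    (s.tag = 2 ∧
      (s.next T β η₁ r clock ℓ).L = s.L + ℓ ∧ (s.next T β η₁ r clock ℓ).η = s.η ∧
      (s.next T β η₁ r clock ℓ).w = ftrl s.η (s.L + ℓ) ∧
      (s.next T β η₁ r clock ℓ).phase = .rest) := by
  classical
  rcases hs : s.phase with _ | ⟨R, v⟩ | _ | _
  · have ht : s.tag = 0 := by simp [tag, hs]
    by_cases he : s.epoch ≤ r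
    · have ha : s.AtEpoch r := ⟨.inl ht, he⟩
      have htr : s.trig T r = Finset.univ.filter fun i => s.w i ≤ 1 / threshold 1 := by
        ext i; simp [mem_trig, ha]
      by_cases hn : (s.trig T r).Nonempty
      · left; have hn' := hn; rw [htr] at hn' ⊢
        simp [next, hs, he, epochStep, begin, hn', ht, -one_div]
      · right; left; have hn' := hn; rw [htr] at hn'
        rw [IsFtrl, ← Finset.not_nonempty_iff_eq_empty]
        simp [next, hs, he, epochStep, begin, hn', ht, -one_div, hn, ftrlStep]
    · have ha : ¬ s.AtEpoch r := fun h => he h.2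
      have htr : s.trig T r = Finset.univ.filter fun i =>
          s.θ i ≤ numThresholds K T ∧ s.w i ≤ 1 / threshold (s.θ i) := by
        ext i; simp [mem_trig, ha, ht]
      by_cases hn : (s.trig T r).Nonempty
      · left; have hn' := hn; rw [htr] at hn' ⊢
        simp [next, hs, he, regularStep, begin, hn', ht, -one_div]
      · right; left; have hn' := hn; rw [htr] at hn'
        rw [IsFtrl, ← Finset.not_nonempty_iff_eq_empty]
        simp [next, hs, he, regularStep, begin, hn', ht, -one_div, hn, ftrlStep]
  · right; right; left
    simp [next, hs, tag, omdStep, nrs]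
  · right; right; right
    simp [next, hs, tag, lastStep]
  · have ht : s.tag = 3 := by simp [tag, hs]
    by_cases he : s.epoch ≤ r
    · have ha : s.AtEpoch r := ⟨.inr ht, he⟩
      have htr : s.trig T r = Finset.univ.filter fun i => s.w i ≤ 1 / threshold 1 := by
        ext i; simp [mem_trig, ha]
      by_cases hn : (s.trig T r).Nonempty
      · left; have hn' := hn; rw [htr] at hn' ⊢
        simp [next, hs, he, epochStep, begin, hn', ht, -one_div]
      · right; left; have hn' := hn; rw [htr] at hn'
        rw [IsFtrl, ← Finset.not_nonempty_iff_eq_empty]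
        simp [next, hs, he, epochStep, begin, hn', ht, -one_div, hn, ftrlStep]
    · have ha : ¬ s.AtEpoch r := fun h => he h.2
      have htr : s.trig T r = ∅ := by
        ext i; simp [mem_trig, ha, ht]
      right; left
      simp [IsFtrl, htr, next, hs, he, ht, ftrlStep]

lemma next_θ : (s.next T β η₁ r clock ℓ).θ = open Classical in fun i =>
    if s.AtEpoch r then thresholdIndex K T (s.w i)
    else if i ∈ s.trig T r then s.θ i + 1 else s.θ i := by
  classical
  rcases hs : s.phase with _ | ⟨R, v⟩ | _ | _
  all_goals
    by_cases he : s.epoch ≤ r <;> funext i <;>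
    simp [next, hs, he, epochStep, regularStep, begin, mem_trig, AtEpoch, tag, ftrlStep, omdStep,
      lastStep] <;> split_ifs <;> simp_all

lemma next_epoch : (s.next T β η₁ r clock ℓ).epoch = open Classical in
    if s.AtEpoch r then 2 * s.epoch + K * initRounds T else s.epoch := by
  classical
  rcases hs : s.phase with _ | ⟨R, v⟩ | _ | _
  all_goals
    by_cases he : s.epoch ≤ r <;>
    simp [next, hs, he, epochStep, regularStep, begin, AtEpoch, tag, ftrlStep, omdStep,
      lastStep] <;> split_ifs <;> simp_all

lemma next_start : (s.next T β η₁ r clock ℓ).start = open Classical in fun i =>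
    if s.EpochRestart r i ∨ i ∈ s.nrs then clock else s.start i := by
  classical
  rcases hs : s.phase with _ | ⟨R, v⟩ | _ | _
  all_goals
    by_cases he : s.epoch ≤ r <;> funext i <;>
    simp [next, hs, he, epochStep, regularStep, begin, AtEpoch, tag, ftrlStep, omdStep,
      lastStep, EpochRestart, nrs] <;> split_ifs <;> simp_all

lemma next_env : (s.next T β η₁ r clock ℓ).env = open Classical in fun i =>
    if s.EpochRestart r i then threshold 1
    else if i ∈ s.nrs then 2 / s.begunAt i else s.env i := by
  classical
  rcases hs : s.phase with _ | ⟨R, v⟩ | _ | _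
  all_goals
    by_cases he : s.epoch ≤ r <;> funext i <;>
    simp [next, hs, he, epochStep, regularStep, begin, AtEpoch, tag, ftrlStep, omdStep,
      lastStep, EpochRestart, nrs, begunAt] <;> split_ifs <;> simp_all

lemma next_tag : (s.next T β η₁ r clock ℓ).tag = open Classical in
    if (s.trig T r).Nonempty then 1 else if s.tag = 0 ∨ s.tag = 3 then 0 else s.tag + 1 := by
  rcases s.next_cases T β η₁ r clock ℓ with h | h | h | h
  · rw [if_pos h.1]; simp [tag, h.2.2.2.2.2]
  · rw [if_neg (by rw [h.1.2]; simp), if_pos h.1.1]; simp [tag, h.2.2.2.2]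
  · rw [if_neg (fun hn => by rcases tag_of_trig hn with h' | h' <;> omega), if_neg (by omega), h.1]
    simp [tag, h.2.2.2.2]
  · rw [if_neg (fun hn => by rcases tag_of_trig hn with h' | h' <;> omega), if_neg (by omega), h.1]
    simp [tag, h.2.2.2.2]

lemma next_nrs : (s.next T β η₁ r clock ℓ).nrs = s.trig T r := by
  rcases s.next_cases T β η₁ r clock ℓ with h | h | h | h
  · simp [nrs, h.2.2.2.2.2]
  · rw [h.1.2]; simp [nrs, h.2.2.2.2]
  · have : s.trig T r = ∅ := Finset.not_nonempty_iff_eq_empty.1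
      fun hn => by rcases tag_of_trig hn with h' | h' <;> omega
    rw [this]; simp [nrs, h.2.2.2.2]
  · have : s.trig T r = ∅ := Finset.not_nonempty_iff_eq_empty.1
      fun hn => by rcases tag_of_trig hn with h' | h' <;> omega
    rw [this]; simp [nrs, h.2.2.2.2]

lemma next_begunAt : (s.next T β η₁ r clock ℓ).begunAt = open Classical in
    if (s.trig T r).Nonempty then s.w else 0 := by
  rcases s.next_cases T β η₁ r clock ℓ with h | h | h | h
  · rw [if_pos h.1]; simp [begunAt, h.2.2.2.2.2]
  · rw [if_neg (by rw [h.1.2]; simp)]; simp [begunAt, h.2.2.2.2]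
  · rw [if_neg (fun hn => by rcases tag_of_trig hn with h' | h' <;> omega)]
    simp [begunAt, h.2.2.2.2]
  · rw [if_neg (fun hn => by rcases tag_of_trig hn with h' | h' <;> omega)]
    simp [begunAt, h.2.2.2.2]

lemma next_η : (s.next T β η₁ r clock ℓ).η = open Classical in fun i =>
    if s.IsFtrl T r then decrease η₁ s.η i else if i ∈ s.nrs then β * s.η i else s.η i := by
  rcases s.next_cases T β η₁ r clock ℓ with h | h | h | h
  · have : ¬ s.IsFtrl T r := fun h' => by rw [h'.2] at h; simp at h
    rw [h.2.2.2.1, nrs_eq_empty (by omega)]; simp [this]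
  · rw [h.2.2.1]; simp [h.1]
  · have : ¬ s.IsFtrl T r := fun h' => by rcases h'.1 with h' | h' <;> omega
    rw [h.2.2.1]; simp [this]
  · have : ¬ s.IsFtrl T r := fun h' => by rcases h'.1 with h' | h' <;> omega
    rw [h.2.2.1, nrs_eq_empty (by omega)]; simp [this]

end next

end State

/-! ## Thresholds -/

lemma threshold_pos (s : ℕ) : 0 < threshold s := by unfold threshold; positivity

lemma threshold_succ (s : ℕ) : threshold (s + 1) = 2 * threshold s := by
  unfold threshold; rw [pow_succ]; ring

lemma threshold_one : threshold 1 = 36 := by norm_num [threshold]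

lemma le_threshold {s : ℕ} (h : 1 ≤ s) : 36 ≤ threshold s := by
  have : (2 : ℝ) ^ 1 ≤ 2 ^ s := pow_le_pow_right₀ (by norm_num) h
  unfold threshold; linarith

lemma one_le_numThresholds (K T : ℕ) : 1 ≤ numThresholds K T := by unfold numThresholds; omega

lemma thresholdIndex_spec (K T : ℕ) (x : ℝ) : 1 ≤ thresholdIndex K T x ∧
    (1 / threshold (thresholdIndex K T x) < x ∨ thresholdIndex K T x = numThresholds K T + 1) :=
  Nat.sInf_mem (s := {s | 1 ≤ s ∧ (1 / threshold s < x ∨ s = numThresholds K T + 1)})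
    ⟨numThresholds K T + 1, by omega, .inr rfl⟩

lemma thresholdIndex_le (K T : ℕ) (x : ℝ) : thresholdIndex K T x ≤ numThresholds K T + 1 :=
  Nat.sInf_le ⟨by omega, .inr rfl⟩

lemma thresholdIndex_eq_one {K T : ℕ} {x : ℝ} (h : 1 / threshold 1 < x) :
    thresholdIndex K T x = 1 :=
  le_antisymm (Nat.sInf_le ⟨le_rfl, .inl h⟩) (thresholdIndex_spec K T x).1

lemma two_le_thresholdIndex {K T : ℕ} {x : ℝ} (h : x ≤ 1 / threshold 1) :
    2 ≤ thresholdIndex K T x := by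
  obtain ⟨h1, h2⟩ := thresholdIndex_spec K T x
  have := one_le_numThresholds K T
  by_contra! hlt
  have he : thresholdIndex K T x = 1 := by omega
  rw [he] at h2
  rcases h2 with h2 | h2
  · exact absurd h (not_le.2 h2)
  · omega

/-- By minimality of the index, `x` is at most the reciprocal of the preceding threshold, which is
half of this one. This keeps the parameter 2 / w given at a restart above the current threshold. -/
lemma threshold_thresholdIndex_le {K T : ℕ} {x : ℝ} (hx : 0 < x) (h : x ≤ 1 / threshold 1) :
    threshold (thresholdIndex K T x) ≤ 2 / x := by
  have h2 := two_le_thresholdIndex (K := K) (T := T) h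
  obtain ⟨k, hk⟩ : ∃ k, thresholdIndex K T x = k + 1 := ⟨thresholdIndex K T x - 1, by omega⟩
  have hnot : ¬ (1 ≤ k ∧ (1 / threshold k < x ∨ k = numThresholds K T + 1)) := by
    intro hk'
    have : thresholdIndex K T x ≤ k := Nat.sInf_le hk'
    omega
  have hxk : x ≤ 1 / threshold k := by
    by_contra! hlt
    exact hnot ⟨by omega, .inl hlt⟩
  rw [hk, threshold_succ, le_div_iff₀ hx]
  rw [le_div_iff₀ (threshold_pos k)] at hxk
  linarith

/-- The last threshold is within a factor of `2` of the bound on the sampling probabilities. -/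
lemma le_threshold_numThresholds (K T : ℕ) :
    ((K : ℝ) ^ 2 * T) ≤ threshold (numThresholds K T + 1) := by
  have h1 : K ^ 2 * T < 36 * (K ^ 2 * T / 36 + 1) := by omega
  have h2 : K ^ 2 * T / 36 + 1 ≤ 2 ^ (Nat.log 2 (K ^ 2 * T / 36) + 1) :=
    Nat.lt_pow_succ_log_self (by norm_num) _
  have h3 : K ^ 2 * T ≤ 36 * 2 ^ (Nat.log 2 (K ^ 2 * T / 36) + 1) := by
    calc K ^ 2 * T ≤ 36 * (K ^ 2 * T / 36 + 1) := h1.le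
      _ ≤ _ := Nat.mul_le_mul_left _ h2
  have h4 : ((K ^ 2 * T : ℕ) : ℝ) ≤ ((36 * 2 ^ (Nat.log 2 (K ^ 2 * T / 36) + 1) : ℕ) : ℝ) := by
    exact_mod_cast h3
  push_cast at h4
  unfold threshold numThresholds
  calc (K : ℝ) ^ 2 * T ≤ _ := h4
    _ = _ := by rw [pow_succ (2 : ℝ) (Nat.log 2 (K ^ 2 * T / 36) + 1)]; ring

/-! ## Paths of the algorithm -/

/-- A sequence of states driven by the estimated losses `ℓ`. -/
structure IsPath {K : ℕ} (T : ℕ) (β : ℝ) (η₁ L₀ : Fin K → ℝ) (s : ℕ → State K)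
    (ℓ : ℕ → Fin K → ℝ) : Prop where
  zero : s 0 = State.initial T η₁ L₀
  succ : ∀ n, s (n + 1) =
    (s n).next T β η₁ (K * initRounds T + n) (initRounds T + n + 1) (ℓ n)

lemma Trajectory.isPath {K : ℕ} {k : Fin K → ℕ} (T : ℕ) (β : ℝ) (η₁ : Fin K → ℝ)
    (x : Trajectory K k) : IsPath T β η₁ (x.initLoss T) (x.state T β η₁)
      fun n => x.lossEstimate T (K * initRounds T + n) ((x.state T β η₁ n).wbar T) :=
  ⟨rfl, fun _ => rfl⟩

/-! ### Counting FTRL steps, epochs, negative-regret steps and restarts -/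

section counts

variable {K : ℕ} (T : ℕ) (s : ℕ → State K)

open Classical in
/-- Number of FTRL steps with decreasing step sizes before round `n`. -/
def nFtrl (n : ℕ) : ℕ := Nat.count (fun k => (s k).IsFtrl T (K * initRounds T + k)) n

open Classical in
/-- Number of epochs begun before round `n`. -/
def nEpoch (n : ℕ) : ℕ := Nat.count (fun k => (s k).AtEpoch (K * initRounds T + k)) n

open Classical in
/-- Number of negative-regret steps for learner `i` begun before round `n`. -/
def nTrig (i : Fin K) (n : ℕ) : ℕ :=
  Nat.count (fun k => i ∈ (s k).trig T (K * initRounds T + k)) n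

open Classical in
/-- Number of negative-regret steps for learner `i` begun before round `n` with threshold index
`1`. -/
def nFirst (i : Fin K) (n : ℕ) : ℕ :=
  Nat.count (fun k => i ∈ (s k).trig T (K * initRounds T + k) ∧ (s k).θ i = 1) n

/-- The update after round `n` is an OMD update or the last update of a negative-regret step. -/
def IsOmd (n : ℕ) : Prop :=
  ((s n).trig T (K * initRounds T + n)).Nonempty ∨ (s n).tag = 1 ∨ (s n).tag = 2

open Classical in
/-- Number of updates before round `n` which belong to negative-regret steps. -/
def nOmd (n : ℕ) : ℕ := Nat.count (IsOmd T s) n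

open Classical in
/-- Number of restarts of learner `i` before round `n` which are due to new epochs. -/
def nRestart (i : Fin K) (n : ℕ) : ℕ :=
  Nat.count (fun k => (s k).EpochRestart (K * initRounds T + k) i) n

end counts

namespace IsPath

variable {K : ℕ} {T : ℕ} {β : ℝ} {η₁ L₀ : Fin K → ℝ} {s : ℕ → State K} {ℓ : ℕ → Fin K → ℝ}

lemma tag_succ (h : IsPath T β η₁ L₀ s ℓ) (n : ℕ) : (s (n + 1)).tag = open Classical in
    if ((s n).trig T (K * initRounds T + n)).Nonempty then 1
    else if (s n).tag = 0 ∨ (s n).tag = 3 then 0 else (s n).tag + 1 := by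
  rw [h.succ n, State.next_tag]

lemma nrs_succ (h : IsPath T β η₁ L₀ s ℓ) (n : ℕ) :
    (s (n + 1)).nrs = (s n).trig T (K * initRounds T + n) := by
  rw [h.succ n, State.next_nrs]

lemma begunAt_succ (h : IsPath T β η₁ L₀ s ℓ) (n : ℕ) : (s (n + 1)).begunAt = open Classical in
    if ((s n).trig T (K * initRounds T + n)).Nonempty then (s n).w else 0 := by
  rw [h.succ n, State.next_begunAt]

lemma θ_succ (h : IsPath T β η₁ L₀ s ℓ) (n : ℕ) (i : Fin K) :
    (s (n + 1)).θ i = open Classical in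
    if (s n).AtEpoch (K * initRounds T + n) then thresholdIndex K T ((s n).w i)
    else if i ∈ (s n).trig T (K * initRounds T + n) then (s n).θ i + 1 else (s n).θ i := by
  rw [h.succ n, State.next_θ]

lemma epoch_succ (h : IsPath T β η₁ L₀ s ℓ) (n : ℕ) : (s (n + 1)).epoch = open Classical in
    if (s n).AtEpoch (K * initRounds T + n) then 2 * (s n).epoch + K * initRounds T
    else (s n).epoch := by
  rw [h.succ n, State.next_epoch]

lemma start_succ (h : IsPath T β η₁ L₀ s ℓ) (n : ℕ) (i : Fin K) :
    (s (n + 1)).start i = open Classical in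
    if (s n).EpochRestart (K * initRounds T + n) i ∨ i ∈ (s n).nrs then initRounds T + n + 1
    else (s n).start i := by
  rw [h.succ n, State.next_start]

lemma env_succ (h : IsPath T β η₁ L₀ s ℓ) (n : ℕ) (i : Fin K) :
    (s (n + 1)).env i = open Classical in
    if (s n).EpochRestart (K * initRounds T + n) i then threshold 1
    else if i ∈ (s n).nrs then 2 / (s n).begunAt i else (s n).env i := by
  rw [h.succ n, State.next_env]

lemma η_succ (h : IsPath T β η₁ L₀ s ℓ) (n : ℕ) (i : Fin K) :
    (s (n + 1)).η i = open Classical in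
    if (s n).IsFtrl T (K * initRounds T + n) then decrease η₁ (s n).η i
    else if i ∈ (s n).nrs then β * (s n).η i else (s n).η i := by
  rw [h.succ n, State.next_η]

lemma η_pos (h : IsPath T β η₁ L₀ s ℓ) (hη₁ : ∀ i, 0 < η₁ i) (hβ : 1 ≤ β) (n : ℕ) (i : Fin K) :
    0 < (s n).η i := by
  induction n with
  | zero => rw [h.zero]; have := hη₁ i; simp only [State.initial, decrease]; positivity
  | succ n ih =>
    rw [h.η_succ]
    split_ifs
    · have := hη₁ i; unfold decrease; positivity
    · positivity
    · exact ih

/-- The stored loss vector always certifies the current weights: OMD with unchanged step sizes is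
FTRL on `L + ℓ`, and when step sizes change `L` is reset to the vector for which the OMD iterate is
an FTRL iterate. -/
lemma kkt [NeZero K] (h : IsPath T β η₁ L₀ s ℓ) (hη₁ : ∀ i, 0 < η₁ i) (hβ : 1 ≤ β) (n : ℕ) :
    ∃ c, IsKKT (s n).η (s n).L (s n).w c := by
  induction n with
  | zero =>
    have := h.η_pos hη₁ hβ 0
    rw [h.zero] at this ⊢
    exact exists_isKKT_ftrl this L₀
  | succ n ih =>
    have hp := h.η_pos hη₁ hβ n
    have hp' := h.η_pos hη₁ hβ (n + 1)
    obtain ⟨c, hc⟩ := ih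
    rw [h.succ n] at hp' ⊢
    rcases (s n).next_cases T β η₁ (K * initRounds T + n) (initRounds T + n + 1) (ℓ n) with
      ⟨-, -, h1, h2, h3, -⟩ | ⟨-, h1, h2, h3, -⟩ | ⟨-, h1, -, h3, -⟩ | ⟨-, h1, h2, h3, -⟩
    · rw [h1, h2, h3]; exact hc.omd hp _
    · rw [h2] at hp'; rw [h1, h2, h3]; exact exists_isKKT_ftrl hp' _
    · rw [h1, h3]; exact exists_isKKT_omd hp' _ _
    · rw [h1, h2, h3]; exact exists_isKKT_ftrl hp _

lemma w_pos [NeZero K] (h : IsPath T β η₁ L₀ s ℓ) (hη₁ : ∀ i, 0 < η₁ i) (hβ : 1 ≤ β) (n : ℕ)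
    (i : Fin K) : 0 < (s n).w i := by
  obtain ⟨c, hc⟩ := h.kkt hη₁ hβ n; exact hc.pos i

lemma w_sum [NeZero K] (h : IsPath T β η₁ L₀ s ℓ) (hη₁ : ∀ i, 0 < η₁ i) (hβ : 1 ≤ β) (n : ℕ) :
    ∑ i, (s n).w i = 1 := by
  obtain ⟨c, hc⟩ := h.kkt hη₁ hβ n; exact hc.sum

lemma w_le_one [NeZero K] (h : IsPath T β η₁ L₀ s ℓ) (hη₁ : ∀ i, 0 < η₁ i) (hβ : 1 ≤ β) (n : ℕ)
    (i : Fin K) : (s n).w i ≤ 1 := by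
  obtain ⟨c, hc⟩ := h.kkt hη₁ hβ n; exact hc.le_one i

lemma tag_zero (h : IsPath T β η₁ L₀ s ℓ) : (s 0).tag = 0 := by rw [h.zero]; rfl

lemma θ_bounds (h : IsPath T β η₁ L₀ s ℓ) (n : ℕ) (i : Fin K) :
    1 ≤ (s n).θ i ∧ (s n).θ i ≤ numThresholds K T + 1 := by
  induction n with
  | zero => rw [h.zero]; exact ⟨le_rfl, by simp [State.initial]⟩
  | succ n ih =>
    rw [h.θ_succ]
    split_ifs with h1 h2
    · exact ⟨(thresholdIndex_spec _ _ _).1, thresholdIndex_le _ _ _⟩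
    · rcases State.mem_trig.1 h2 with h2 | h2
      · exact absurd h2.1 h1
      · have := h2.2.2.1; omega
    · exact ih

/-- A start E of an epoch is followed by 2E + M, so E + M doubles. -/
lemma epoch_add (h : IsPath T β η₁ L₀ s ℓ) (n : ℕ) :
    (s n).epoch + K * initRounds T = 2 ^ (nEpoch T s n + 1) * (K * initRounds T) := by
  induction n with
  | zero => rw [h.zero]; simp [State.initial, nEpoch]; ring
  | succ n ih =>
    rw [h.epoch_succ, nEpoch, Nat.count_succ, ← nEpoch]
    split_ifs with h1
    · rw [pow_succ, mul_right_comm, ← ih]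
      ring
    · exact ih

lemma le_epoch (h : IsPath T β η₁ L₀ s ℓ) (n : ℕ) : K * initRounds T ≤ (s n).epoch := by
  induction n with
  | zero => rw [h.zero]; simp [State.initial]
  | succ n ih => rw [h.epoch_succ]; split_ifs <;> omega

lemma epoch_le (h : IsPath T β η₁ L₀ s ℓ) (n : ℕ) :
    (s n).epoch ≤ 2 * (K * initRounds T + n) + K * initRounds T := by
  induction n with
  | zero => rw [h.zero]; simp [State.initial]
  | succ n ih =>
    rw [h.epoch_succ]
    split_ifs with h1
    · have := h1.2; omega
    · omega

/-- An epoch that is due during a negative-regret step waits for its end. The truncated difference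
`tag - 1` is the delay, at most two rounds, and M ≥ 2 keeps the next start beyond it. -/
lemma round_le_epoch (h : IsPath T β η₁ L₀ s ℓ) (hM : 2 ≤ K * initRounds T) (n : ℕ) :
    K * initRounds T + n ≤ (s n).epoch + ((s n).tag - 1) := by
  induction n with
  | zero => rw [h.zero]; simp [State.initial]
  | succ n ih =>
    rw [h.epoch_succ, h.tag_succ]
    have h2 := h.le_epoch n
    have h3 := (s n).tag_le_three
    by_cases ha : (s n).AtEpoch (K * initRounds T + n)
    · rw [if_pos ha]
      rcases ha.1 with h4 | h4 <;> split_ifs <;> omega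
    · rw [if_neg ha]
      have h5 : (s n).tag = 0 ∨ (s n).tag = 3 → K * initRounds T + n < (s n).epoch := by
        intro h6; by_contra! h7; exact ha ⟨h6, h7⟩
      split_ifs with h6 h7
      · have := h5 (State.tag_of_trig h6); omega
      · have := h5 h7; omega
      · have : (s n).tag = 1 ∨ (s n).tag = 2 := by omega
        rcases this with h8 | h8 <;> omega

/-- An epoch begins only when its start time is reached, so the next start time is at most twice the
current round plus M, while start times double. -/
lemma nEpoch_mul_le (h : IsPath T β η₁ L₀ s ℓ) (n : ℕ) :
    2 ^ nEpoch T s n * (K * initRounds T) ≤ n + 2 * (K * initRounds T) := by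
  have h1 := h.epoch_add n
  have h2 := h.epoch_le n
  rw [pow_succ] at h1
  have h3 : 2 ^ nEpoch T s n * 2 * (K * initRounds T) =
    2 * (2 ^ nEpoch T s n * (K * initRounds T)) := by ring
  omega

/-- The index θ is a potential: a step begun inside an epoch raises it by one, and one begun with an
epoch leaves it at least 2. A new epoch lowers it by at most `numThresholds K T`. -/
lemma nTrig_le (h : IsPath T β η₁ L₀ s ℓ) (n : ℕ) (i : Fin K) :
    nTrig T s i n + 1 ≤ numThresholds K T * nEpoch T s n + (s n).θ i := by
  induction n with
  | zero => rw [h.zero]; simp [State.initial, nTrig, nEpoch]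
  | succ n ih =>
    have hb := h.θ_bounds n i
    rw [h.θ_succ, nTrig, nEpoch, Nat.count_succ, Nat.count_succ, ← nTrig, ← nEpoch]
    by_cases ha : (s n).AtEpoch (K * initRounds T + n)
    · rw [if_pos ha, if_pos ha, mul_add, mul_one]
      split_ifs with h1
      · rcases State.mem_trig.1 h1 with h2 | h2
        · have := two_le_thresholdIndex (K := K) (T := T) h2.2; omega
        · exact absurd ha h2.1
      · have := (thresholdIndex_spec K T ((s n).w i)).1; omega
    · rw [if_neg ha, if_neg ha, add_zero]
      split_ifs <;> omega

lemma nTrig_le' (h : IsPath T β η₁ L₀ s ℓ) (n : ℕ) (i : Fin K) :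
    nTrig T s i n ≤ numThresholds K T * (nEpoch T s n + 1) := by
  have := h.nTrig_le n i
  have := (h.θ_bounds n i).2
  rw [mul_add, mul_one]; omega

/-- A negative-regret step takes three updates, and an FTRL step follows unless an epoch begins just
then; hence the 4, and 3 more per epoch. The tag accounts for a step in progress. -/
lemma le_nFtrl (h : IsPath T β η₁ L₀ s ℓ) (n : ℕ) :
    n ≤ 4 * nFtrl T s n + 3 * nEpoch T s n + (s n).tag := by
  induction n with
  | zero => simp
  | succ n ih =>
    rw [h.tag_succ, nFtrl, nEpoch, Nat.count_succ, Nat.count_succ, ← nFtrl, ← nEpoch]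
    have h3 := (s n).tag_le_three
    by_cases ht : ((s n).trig T (K * initRounds T + n)).Nonempty
    · have h4 := State.tag_of_trig ht
      have h5 : ¬ (s n).IsFtrl T (K * initRounds T + n) := fun h => by
        rw [h.2] at ht; simp at ht
      rw [if_pos ht, if_neg h5]
      by_cases ha : (s n).AtEpoch (K * initRounds T + n)
      · rw [if_pos ha]; omega
      · rw [if_neg ha]
        obtain ⟨i, hi⟩ := ht
        rcases State.mem_trig.1 hi with h6 | h6
        · exact absurd h6.1 ha
        · have := h6.2.1; omega
    · rw [if_neg ht]
      by_cases h4 : (s n).tag = 0 ∨ (s n).tag = 3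
      · have h5 : (s n).IsFtrl T (K * initRounds T + n) :=
          ⟨h4, Finset.not_nonempty_iff_eq_empty.1 ht⟩
        rw [if_pos h4, if_pos h5]; omega
      · rw [if_neg h4]; omega

/-- A step begun at index 1 uses this value up, and only the beginning of an epoch can restore it.
-/
lemma nFirst_le (h : IsPath T β η₁ L₀ s ℓ) (n : ℕ) (i : Fin K) :
    nFirst T s i n + (if (s n).θ i = 1 then 1 else 0) ≤ nEpoch T s n + 1 := by
  induction n with
  | zero => rw [h.zero]; simp [State.initial, nFirst, nEpoch]
  | succ n ih =>
    have hb := h.θ_bounds n i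
    rw [h.θ_succ, nFirst, nEpoch, Nat.count_succ, Nat.count_succ, ← nFirst, ← nEpoch]
    by_cases ha : (s n).AtEpoch (K * initRounds T + n)
    · rw [if_pos ha, if_pos ha]
      by_cases h1 : i ∈ (s n).trig T (K * initRounds T + n)
      · rcases State.mem_trig.1 h1 with h2 | h2
        · have := two_le_thresholdIndex (K := K) (T := T) h2.2
          rw [if_neg (by omega : ¬ thresholdIndex K T ((s n).w i) = 1)]
          split_ifs at ih ⊢ <;> omega
        · exact absurd ha h2.1
      · rw [if_neg (fun h => h1 h.1)]
        split_ifs at ih ⊢ <;> omega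
    · rw [if_neg ha, if_neg ha]
      by_cases h1 : i ∈ (s n).trig T (K * initRounds T + n)
      · rw [if_pos h1]; simp only [h1, true_and]; split_ifs at ih ⊢ <;> omega
      · rw [if_neg h1, if_neg (fun h => h1 h.1)]; omega

lemma nRestart_le (n : ℕ) (i : Fin K) : nRestart T s i n ≤ nEpoch T s n := by
  classical
  exact Nat.count_mono_left fun k _ hk => hk.1

/-- Three updates per step, and several learners may share a step. The induction carries along the
updates still owed by the step in progress, 2 at tag 1 and 1 at tag 2. -/
lemma nOmd_le (h : IsPath T β η₁ L₀ s ℓ) (n : ℕ) : nOmd T s n ≤ 3 * ∑ i, nTrig T s i n := by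
  suffices nOmd T s n + (if (s n).tag = 1 then 2 else if (s n).tag = 2 then 1 else 0) ≤
      3 * ∑ i, nTrig T s i n by omega
  induction n with
  | zero => rw [h.tag_zero]; simp [nOmd]
  | succ n ih =>
    have hsum : ∑ i, nTrig T s i (n + 1) = ∑ i, nTrig T s i n +
        ((s n).trig T (K * initRounds T + n)).card := by
      classical
      unfold nTrig
      simp only [Nat.count_succ, Finset.sum_add_distrib]
      simp
    rw [hsum, h.tag_succ, nOmd, Nat.count_succ, ← nOmd]
    by_cases ht : ((s n).trig T (K * initRounds T + n)).Nonempty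
    · have h1 : 1 ≤ ((s n).trig T (K * initRounds T + n)).card := ht.card_pos
      rw [if_pos ht, if_pos (show IsOmd T s n from .inl ht)]
      have h4 := State.tag_of_trig ht
      split_ifs at ih ⊢ <;> omega
    · rw [if_neg ht]
      have h3 := (s n).tag_le_three
      by_cases h5 : (s n).tag = 0 ∨ (s n).tag = 3
      · have : ¬ IsOmd T s n := by
          rintro (h6 | h6)
          · exact ht h6
          · omega
        rw [if_pos h5, if_neg this]
        simp only [show ¬ (0 : ℕ) = 1 by omega, show ¬ (0 : ℕ) = 2 by omega, if_false]
        omega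
      · have : IsOmd T s n := .inr (by omega)
        rw [if_neg h5, if_pos this]
        split_ifs at ih ⊢ <;> omega

lemma start_bounds (h : IsPath T β η₁ L₀ s ℓ) (n : ℕ) (i : Fin K) :
    (s n).start i ≤ initRounds T + n ∧ ((s n).start i = 0 ∨ initRounds T < (s n).start i) := by
  induction n with
  | zero => rw [h.zero]; simp [State.initial]
  | succ n ih => rw [h.start_succ]; split_ifs <;> omega

/-- Step sizes of learner `i`. -/
lemma η_sq_le (h : IsPath T β η₁ L₀ s ℓ) (hη₁ : ∀ i, 0 < η₁ i) (hβ : 1 ≤ β) (n : ℕ) (i : Fin K) :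
    ((nFtrl T s n + 2 : ℕ) : ℝ) * (s n).η i ^ 2 ≤ β ^ (2 * nTrig T s i n) * η₁ i ^ 2 ∧
    (i ∈ (s n).nrs →
      ((nFtrl T s n + 2 : ℕ) : ℝ) * (β * (s n).η i) ^ 2 ≤ β ^ (2 * nTrig T s i n) * η₁ i ^ 2) := by
  have hη := hη₁ i
  -- An FTRL step: 1/x² ≥ φ/(Bη₁²), and the added 1/η₁² is at least 1/(Bη₁²) because B ≥ 1.
  have hdec : ∀ {φ x B : ℝ}, 0 < x → 0 < φ → 1 ≤ B → φ * x ^ 2 ≤ B * η₁ i ^ 2 →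
      (φ + 1) * (1 / √(1 / x ^ 2 + 1 / η₁ i ^ 2)) ^ 2 ≤ B * η₁ i ^ 2 := by
    intro φ x B hx hφ hB hle
    rw [div_pow, Real.sq_sqrt (by positivity), one_pow, mul_one_div,
      div_le_iff₀ (by positivity)]
    have h1 : B * η₁ i ^ 2 * (1 / x ^ 2 + 1 / η₁ i ^ 2) = B * η₁ i ^ 2 / x ^ 2 + B := by
      field_simp
    rw [h1]
    have : φ ≤ B * η₁ i ^ 2 / x ^ 2 := by rw [le_div_iff₀ (by positivity)]; exact hle
    linarith
  induction n with
  | zero =>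
    rw [h.zero]
    constructor
    · simp only [State.initial, decrease, nFtrl, nTrig, Nat.count_zero]
      have := hdec (φ := 1) (x := η₁ i) (B := 1) hη one_pos le_rfl (by simp)
      norm_num at this ⊢
      exact this
    · simp [State.initial, State.nrs]
  | succ n ih =>
    have hp := h.η_pos hη₁ hβ n i
    rw [h.η_succ, h.nrs_succ, nFtrl, nTrig, Nat.count_succ, Nat.count_succ, ← nFtrl, ← nTrig]
    have hB : 1 ≤ β ^ (2 * nTrig T s i n) := one_le_pow₀ hβ
    by_cases hf : (s n).IsFtrl T (K * initRounds T + n)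
    · have h1 : i ∉ (s n).trig T (K * initRounds T + n) := by rw [hf.2]; simp
      rw [if_pos hf, if_pos hf, if_neg h1]
      refine ⟨?_, fun h => absurd h h1⟩
      have := hdec hp (by positivity) hB ih.1
      push_cast at this ⊢
      rw [decrease, add_zero]
      convert this using 2
      ring
    · rw [if_neg hf, if_neg hf]
      by_cases h1 : i ∈ (s n).trig T (K * initRounds T + n)
      · have h2 : i ∉ (s n).nrs := by
          rw [State.nrs_eq_empty]
          · simp
          · rcases State.tag_of_trig ⟨i, h1⟩ with h | h <;> omega
        -- The step is counted when it is begun, but `β` is applied only after the next round; the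
        -- second conjunct reserves that factor in between.
        rw [if_pos h1, if_neg h2]
        have h3 : β ^ (2 * (nTrig T s i n + 1)) = β ^ 2 * β ^ (2 * nTrig T s i n) := by
          rw [mul_add, pow_add]; ring
        have h4 : ((nFtrl T s n + 0 + 2 : ℕ) : ℝ) * (β * (s n).η i) ^ 2 ≤
            β ^ (2 * (nTrig T s i n + 1)) * η₁ i ^ 2 := by
          rw [h3]
          have := mul_le_mul_of_nonneg_left ih.1 (sq_nonneg β)
          calc _ = β ^ 2 * (((nFtrl T s n + 2 : ℕ) : ℝ) * (s n).η i ^ 2) := by push_cast; ring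
            _ ≤ _ := this
            _ = _ := by ring
        refine ⟨le_trans ?_ h4, fun _ => h4⟩
        gcongr
        exact le_mul_of_one_le_left hp.le hβ
      · rw [if_neg h1]
        refine ⟨?_, fun h => absurd h h1⟩
        split_ifs with h2
        · exact ih.2 h2
        · exact ih.1

/-- Thresholds and environment parameters. -/
lemma env_inv [NeZero K] (h : IsPath T β η₁ L₀ s ℓ) (hη₁ : ∀ i, 0 < η₁ i) (hβ : 1 ≤ β) (n : ℕ)
    (i : Fin K) :
    1 ≤ (s n).env i ∧
    (i ∈ (s n).nrs → 2 ≤ (s n).θ i ∧ threshold ((s n).θ i) ≤ 2 / (s n).begunAt i ∧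
      0 < (s n).begunAt i ∧ (s n).begunAt i ≤ 1 / 36) ∧
    (i ∉ (s n).nrs → ((s n).θ i = 1 → (s n).env i ≤ 36) ∧
      (2 ≤ (s n).θ i → threshold ((s n).θ i) ≤ (s n).env i) ∧
      ((s n).tag = 1 → (s n).θ i ≤ numThresholds K T →
        1 / threshold ((s n).θ i) < (s n).begunAt i)) := by
  induction n with
  | zero =>
    rw [h.zero]
    refine ⟨le_rfl, fun h => by simp [State.initial, State.nrs] at h, fun _ => ⟨fun _ => ?_, ?_, ?_⟩⟩
    · norm_num [State.initial]
    · simp [State.initial]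
    · simp [State.initial, State.tag]
  | succ n ih =>
    have hw := h.w_pos hη₁ hβ n i
    have hb := h.θ_bounds n i
    obtain ⟨ih0, ih1, ih2⟩ := ih
    have henv : 1 ≤ (s (n + 1)).env i := by
      rw [h.env_succ]
      split_ifs with h1 h2
      · rw [threshold_one]; norm_num
      · obtain ⟨-, -, h3, h4⟩ := ih1 h2
        rw [le_div_iff₀ h3]; linarith
      · exact ih0
    refine ⟨henv, ?_, ?_⟩
    · rw [h.nrs_succ]
      intro hi
      have hne : ((s n).trig T (K * initRounds T + n)).Nonempty := ⟨i, hi⟩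
      rw [h.begunAt_succ, if_pos hne, h.θ_succ]
      rcases State.mem_trig.1 hi with h1 | h1
      · rw [if_pos h1.1]
        refine ⟨two_le_thresholdIndex h1.2, threshold_thresholdIndex_le hw h1.2, hw, ?_⟩
        rw [← threshold_one]; exact h1.2
      · rw [if_neg h1.1, if_pos hi, threshold_succ, le_div_iff₀ hw]
        obtain ⟨-, -, -, h2⟩ := h1
        have h3 := le_threshold hb.1
        refine ⟨by omega, ?_, hw, h2.trans ?_⟩
        · rw [le_div_iff₀ (threshold_pos _)] at h2; linarith
        · exact one_div_le_one_div_of_le (by norm_num) h3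
    · rw [h.nrs_succ, h.θ_succ, h.env_succ, h.begunAt_succ, h.tag_succ]
      intro hi
      by_cases ha : (s n).AtEpoch (K * initRounds T + n)
      · have h1 : 1 / threshold 1 < (s n).w i := by
          by_contra! h1; exact hi (State.mem_trig.2 (.inl ⟨ha, h1⟩))
        have h2 : i ∉ (s n).nrs := by
          rw [State.nrs_eq_empty]
          · simp
          · rcases ha.1 with h | h <;> omega
        rw [if_pos ha, thresholdIndex_eq_one h1]
        refine ⟨fun _ => ?_, fun h => absurd h (by norm_num), ?_⟩
        · split_ifs with h3
          · rw [threshold_one]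
          -- Above the first threshold and yet not restarted by the epoch: the index was 1 already.
          · refine (ih2 h2).1 ?_
            by_contra h4
            exact h3 ⟨ha, h1, by omega⟩
        · intro h3 _
          split_ifs at h3 ⊢ with h4 h5
          · exact h1
          · exact absurd ha.1 h5
      · have h1 : ¬ (s n).EpochRestart (K * initRounds T + n) i := fun h => ha h.1
        rw [if_neg ha, if_neg hi, if_neg h1]
        have h8 : (s n).nrs.Nonempty → (s n).tag = 1 := fun h => by
          by_contra h9; rw [State.nrs_eq_empty h9] at h; simp at h
        have h9 : ((s n).trig T (K * initRounds T + n)).Nonempty → (s n).tag = 0 := by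
          rintro ⟨j, hj⟩
          rcases State.mem_trig.1 hj with h | h
          · exact absurd h.1 ha
          · exact h.2.1
        by_cases h2 : i ∈ (s n).nrs
        · obtain ⟨h4, h5, -⟩ := ih1 h2
          have h10 := h8 ⟨i, h2⟩
          rw [if_pos h2, if_neg (fun h => by have := h9 h; omega),
            if_neg (fun h => by omega)]
          exact ⟨fun h => by omega, fun _ => h5, fun h => by omega⟩
        · obtain ⟨h4, h5, -⟩ := ih2 h2
          rw [if_neg h2]
          refine ⟨h4, h5, fun h6 h7 => ?_⟩
          by_cases h3 : ((s n).trig T (K * initRounds T + n)).Nonempty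
          · rw [if_pos h3]
            by_contra! h10
            exact hi (State.mem_trig.2 (.inr ⟨ha, h9 h3, h7, h10⟩))
          · rw [if_neg h3] at h6
            split_ifs at h6
            omega

end IsPath

/-! ## Quantitative bounds for long horizons -/

/-- 47/20 bounds the number of negative-regret steps of a learner in units of (log T)², so 21/2 caps
the total effect of the multiplier on its step size. -/
lemma exp_le_of_log_two : Real.exp (47 / 20) ≤ 21 / 2 := by
  have h1 : Real.exp (47 / 20) ^ 20 ≤ (21 / 2 : ℝ) ^ 20 := by
    rw [← Real.exp_nat_mul]
    have : ((20 : ℕ) : ℝ) * (47 / 20) = (47 : ℕ) * 1 := by norm_num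
    rw [this, Real.exp_nat_mul]
    calc Real.exp 1 ^ 47 ≤ (2.7182818286 : ℝ) ^ 47 :=
          pow_le_pow_left₀ (Real.exp_pos 1).le Real.exp_one_lt_d9.le 47
      _ ≤ _ := by norm_num
  exact le_of_pow_le_pow_left₀ (by norm_num) (by norm_num) h1

/-- The case in which the horizon is large and the main phase is not empty. -/
structure Regime (K T : ℕ) : Prop where
  two_le : 2 ≤ K
  le_log : 2000000 ≤ Real.log T
  lt : K * initRounds T < T

namespace Regime

variable {K T : ℕ}

lemma log_pos (h : Regime K T) : 0 < Real.log T := by have := h.le_log; linarith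

lemma T_pos (h : Regime K T) : (0 : ℝ) < T := by
  have := h.lt
  exact_mod_cast (by omega : 0 < T)

lemma log_lt_initRounds (T : ℕ) : Real.log T < initRounds T := by
  unfold initRounds; push_cast; exact Nat.lt_floor_add_one _

lemma initRounds_le (h : Regime K T) : (initRounds T : ℝ) ≤ Real.log T + 1 := by
  unfold initRounds; push_cast; have := Nat.floor_le h.log_pos.le; linarith

lemma le_initRounds (h : Regime K T) : 2000000 ≤ initRounds T := by
  have h1 := h.le_log
  have h2 := log_lt_initRounds T
  have : (2000000 : ℝ) < initRounds T := by linarith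
  exact_mod_cast this.le

lemma le_init (h : Regime K T) : 4000000 ≤ K * initRounds T :=
  le_trans (by norm_num) (Nat.mul_le_mul h.two_le h.le_initRounds)

/-- Bound for the number of negative-regret steps of one learner. -/
lemma trig_bound (h : Regime K T) {e n : ℕ} (hn : n + K * initRounds T ≤ T)
    (he : 2 ^ e * (K * initRounds T) ≤ n + 2 * (K * initRounds T)) :
    ((numThresholds K T * (e + 1) : ℕ) : ℝ) ≤ 47 / 20 * Real.log T ^ 2 ∧
      ((e : ℝ) + 1) ≤ 2 * Real.log T := by
  have hK := h.two_le
  have hm : 4 ≤ initRounds T := le_trans (by norm_num) h.le_initRounds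
  have hT := h.lt
  have hT0 := h.T_pos
  have hK0 : (0 : ℝ) < K := by exact_mod_cast (by omega : 0 < K)
  have hl2 := Real.log_two_gt_d9
  have hlK : 0 ≤ Real.log K := Real.log_natCast_nonneg K
  have hKT : K ≤ T := by nlinarith
  -- epochs
  have h1 : 2 ^ (e + 1) * K ≤ T := by
    have : 4 * K ≤ K * initRounds T := by nlinarith
    have h2 : 2 ^ e * (4 * K) ≤ 2 * T := by
      calc 2 ^ e * (4 * K) ≤ 2 ^ e * (K * initRounds T) := Nat.mul_le_mul_left _ this
        _ ≤ _ := by omega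
    rw [pow_succ]; nlinarith
  have h2 : (e + 1 : ℝ) * Real.log 2 + Real.log K ≤ Real.log T := by
    have h3 : ((2 ^ (e + 1) * K : ℕ) : ℝ) ≤ T := by exact_mod_cast h1
    push_cast at h3
    have h4 := Real.log_le_log (by positivity) h3
    rw [Real.log_mul (by positivity) hK0.ne', Real.log_pow] at h4
    push_cast at h4
    exact h4
  -- thresholds
  have h3 : (numThresholds K T : ℝ) * Real.log 2 ≤ 2 * Real.log K + Real.log T := by
    have hq : K ^ 2 * T / 36 ≠ 0 := by
      have : 36 ≤ K ^ 2 * T := by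
        have h5 : 2 * 4 ≤ K * initRounds T := Nat.mul_le_mul hK hm
        have h6 : 2 ^ 2 * 9 ≤ K ^ 2 * T := Nat.mul_le_mul (Nat.pow_le_pow_left hK 2) (by omega)
        omega
      have := Nat.div_pos this (by norm_num)
      omega
    have h5 := Nat.pow_log_le_self 2 hq
    have h6 : 2 ^ (numThresholds K T) ≤ K ^ 2 * T := by
      unfold numThresholds
      rw [pow_succ]
      have := Nat.div_mul_le_self (K ^ 2 * T) 36
      omega
    have h7 : ((2 ^ numThresholds K T : ℕ) : ℝ) ≤ ((K ^ 2 * T : ℕ) : ℝ) := by exact_mod_cast h6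
    push_cast at h7
    have h8 := Real.log_le_log (by positivity) h7
    rw [Real.log_mul (by positivity) hT0.ne', Real.log_pow, Real.log_pow] at h8
    push_cast at h8
    exact h8
  set t := Real.log T
  set k := Real.log K
  have hlog := h.log_pos
  -- With t = log T and k = log K, the product (2k + t)(t - k) is largest at k = t/4, where it is
  -- 9t²/8; and 9/8 divided by (log 2)² is below 47/20.
  have hprod : ((numThresholds K T : ℝ) * Real.log 2) * ((e + 1 : ℝ) * Real.log 2) ≤
      9 / 8 * t ^ 2 := by
    calc _ ≤ (2 * k + t) * (t - k) :=
          mul_le_mul h3 (by linarith) (by positivity) (by positivity)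
      _ ≤ _ := by nlinarith [sq_nonneg (4 * k - t)]
  constructor
  · push_cast
    have h9 : (0.6931471803 : ℝ) ^ 2 ≤ Real.log 2 ^ 2 := pow_le_pow_left₀ (by norm_num) hl2.le 2
    have h10 : (0 : ℝ) ≤ numThresholds K T * (e + 1) := by positivity
    have h11 : (numThresholds K T : ℝ) * (e + 1) * Real.log 2 ^ 2 ≤ 9 / 8 * t ^ 2 := by
      calc _ = ((numThresholds K T : ℝ) * Real.log 2) * ((e + 1 : ℝ) * Real.log 2) := by ring
        _ ≤ _ := hprod
    have h12 : (numThresholds K T : ℝ) * (e + 1) * 0.6931471803 ^ 2 ≤ 9 / 8 * t ^ 2 :=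
      (mul_le_mul_of_nonneg_left h9 h10).trans h11
    have h13 : 0 ≤ t ^ 2 := sq_nonneg t
    norm_num at h12
    nlinarith
  · have : (0 : ℝ) ≤ e + 1 := by positivity
    nlinarith

end Regime

/-- The multiplier of the step sizes. -/
def mult (T : ℕ) : ℝ := Real.exp (1 / Real.log T ^ 2)

/-- `1 - 1 / β`. -/
def gain (T : ℕ) : ℝ := 1 - Real.exp (-(1 / Real.log T ^ 2))

lemma one_le_mult (T : ℕ) : 1 ≤ mult T := Real.one_le_exp (by positivity)

lemma one_sub_one_div_mult (T : ℕ) : 1 - 1 / mult T = gain T := by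
  unfold mult gain; rw [Real.exp_neg, one_div]

lemma gain_nonneg (T : ℕ) : 0 ≤ gain T := by
  unfold gain
  have : Real.exp (-(1 / Real.log T ^ 2)) ≤ 1 := by
    rw [Real.exp_le_one_iff]
    have : 0 ≤ 1 / Real.log T ^ 2 := by positivity
    linarith
  linarith

/-- From e^{-x} ≥ 1 - x. Error terms carry the factor `gain` and occur O((log T)²) times per
learner, so their total per learner stays bounded. -/
lemma gain_mul_le {T : ℕ} (h : 0 < Real.log T) : gain T * Real.log T ^ 2 ≤ 1 := by
  unfold gain
  have h1 := Real.add_one_le_exp (-(1 / Real.log T ^ 2))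
  have h2 : 1 - Real.exp (-(1 / Real.log T ^ 2)) ≤ 1 / Real.log T ^ 2 := by linarith
  calc _ ≤ 1 / Real.log T ^ 2 * Real.log T ^ 2 := mul_le_mul_of_nonneg_right h2 (sq_nonneg _)
    _ = 1 := by field_simp

lemma Regime.mult_le_two {K T : ℕ} (h : Regime K T) : mult T ≤ 2 := by
  have h1 := h.le_log
  have h2 : 1 / Real.log T ^ 2 ≤ Real.log 2 := by
    have h3 := Real.log_two_gt_d9
    have : 1 / Real.log T ^ 2 ≤ 1 / 2 := one_div_le_one_div_of_le (by norm_num) (by nlinarith)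
    linarith
  calc mult T ≤ Real.exp (Real.log 2) := Real.exp_le_exp.2 h2
    _ = 2 := Real.exp_log two_pos

namespace IsPath

variable {K : ℕ} {T : ℕ} {η₁ L₀ : Fin K → ℝ} {s : ℕ → State K} {ℓ : ℕ → Fin K → ℝ}

lemma nTrig_le_log (h : IsPath T (mult T) η₁ L₀ s ℓ) (hR : Regime K T) {n : ℕ}
    (hn : n + K * initRounds T ≤ T) (i : Fin K) :
    (nTrig T s i n : ℝ) ≤ 47 / 20 * Real.log T ^ 2 :=
  le_trans (by exact_mod_cast h.nTrig_le' n i) (hR.trig_bound hn (h.nEpoch_mul_le n)).1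

lemma nEpoch_le_log (h : IsPath T (mult T) η₁ L₀ s ℓ) (hR : Regime K T) {n : ℕ}
    (hn : n + K * initRounds T ≤ T) : (nEpoch T s n : ℝ) + 1 ≤ 2 * Real.log T :=
  (hR.trig_bound hn (h.nEpoch_mul_le n)).2

lemma nEpoch_mul_le' {β : ℝ} (h : IsPath T β η₁ L₀ s ℓ) (n : ℕ) :
    nEpoch T s n * (K * initRounds T) ≤ n + K * initRounds T := by
  have h1 := h.nEpoch_mul_le n
  have h2 : nEpoch T s n + 1 ≤ 2 ^ nEpoch T s n := Nat.lt_two_pow_self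
  have h3 := Nat.mul_le_mul_right (K * initRounds T) h2
  rw [add_mul, one_mul] at h3
  omega

/-- The number of FTRL steps is almost a quarter of the number of rounds. -/
lemma le_nFtrl' (h : IsPath T (mult T) η₁ L₀ s ℓ) (hR : Regime K T) (n : ℕ) :
    0.999 * (n : ℝ) + 2 ≤ 4 * ((nFtrl T s n + 2 : ℕ) : ℝ) := by
  have h1 := h.le_nFtrl n
  have h2 := (s n).tag_le_three
  have h3 := h.nEpoch_mul_le' n
  have h4 := hR.le_init
  have h5 : (n : ℝ) + 5 ≤ 4 * ((nFtrl T s n + 2 : ℕ) : ℝ) + 3 * nEpoch T s n := by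
    have : n + 5 ≤ 4 * (nFtrl T s n + 2) + 3 * nEpoch T s n := by omega
    exact_mod_cast this
  have h6 : (nEpoch T s n : ℝ) * ((K * initRounds T : ℕ) : ℝ) ≤ n + ((K * initRounds T : ℕ) : ℝ) := by
    exact_mod_cast h3
  have h7 : (4000000 : ℝ) ≤ ((K * initRounds T : ℕ) : ℝ) := by exact_mod_cast h4
  -- As M ≥ 4000000 there is, apart from one, at most one epoch per 4000000 rounds; the loss fits
  -- into the missing 0.001.
  have h8 : (nEpoch T s n : ℝ) ≤ 1 + n / 4000000 := by
    have h9 : (0 : ℝ) ≤ n := Nat.cast_nonneg n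
    by_contra! h10
    have h11 : (n : ℝ) / 4000000 * 4000000 = n := by field_simp
    nlinarith
  linarith

/-- The FTRL steps alone would give η₁ / √(number + 2); all multiplications by β together contribute
at most e^{47/20} ≤ 21/2. -/
lemma η_mul_sqrt_le (h : IsPath T (mult T) η₁ L₀ s ℓ) (hR : Regime K T) (hη₁ : ∀ i, 0 < η₁ i)
    {n : ℕ} (hn : n + K * initRounds T ≤ T) (i : Fin K) :
    (s n).η i * √((nFtrl T s n + 2 : ℕ) : ℝ) ≤ 21 / 2 * η₁ i := by
  have h1 := (h.η_sq_le hη₁ (one_le_mult T) n i).1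
  have h2 : mult T ^ nTrig T s i n ≤ 21 / 2 := by
    unfold mult
    rw [← Real.exp_nat_mul]
    refine le_trans (Real.exp_le_exp.2 ?_) exp_le_of_log_two
    have h3 := h.nTrig_le_log hR hn i
    have h4 := hR.log_pos
    rw [mul_one_div, div_le_iff₀ (by positivity)]
    exact h3
  have h3 : 0 ≤ mult T ^ nTrig T s i n := pow_nonneg (by linarith [one_le_mult T]) _
  have h4 := hη₁ i
  refine le_of_sq_le_sq ?_ (by positivity)
  rw [mul_pow, Real.sq_sqrt (by positivity), mul_comm]
  refine h1.trans ?_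
  rw [mul_pow, mul_comm 2, pow_mul]
  gcongr

/-- (21/2)(1/4)/√2 < 1.9. A bound below 2 is what stability needs: for losses shifted to be at least
-1, the quantity 1 + η(ℓ - x)√w/2 stays above 0.05, hence above 1/36. -/
lemma η_lt (h : IsPath T (mult T) η₁ L₀ s ℓ) (hR : Regime K T) (hη₁ : ∀ i, 0 < η₁ i)
    (hη₁' : ∀ i, η₁ i ≤ 1 / 4) {n : ℕ} (hn : n + K * initRounds T ≤ T) (i : Fin K) :
    (s n).η i ≤ 1.9 := by
  have h1 := h.η_mul_sqrt_le hR hη₁ hn i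
  have h2 : (1.41 : ℝ) ≤ √((nFtrl T s n + 2 : ℕ) : ℝ) := by
    apply Real.le_sqrt_of_sq_le
    push_cast
    have : (0 : ℝ) ≤ nFtrl T s n := Nat.cast_nonneg _
    nlinarith
  have h3 := h.η_pos hη₁ (one_le_mult T) n i
  have h4 := hη₁' i
  nlinarith

/-- Almost a quarter of the rounds are FTRL steps, so n + 1 ≤ 5 (number + 2), and √5 · 21/2 < 24. -/
lemma η_le_sqrt (h : IsPath T (mult T) η₁ L₀ s ℓ) (hR : Regime K T) (hη₁ : ∀ i, 0 < η₁ i)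
    {n : ℕ} (hn : n + K * initRounds T ≤ T) (i : Fin K) :
    (s n).η i ≤ 24 * η₁ i / √((n : ℝ) + 1) := by
  have h1 := h.η_mul_sqrt_le hR hη₁ hn i
  have h2 := h.le_nFtrl' hR n
  have h3 : √((n : ℝ) + 1) ≤ √(5 * ((nFtrl T s n + 2 : ℕ) : ℝ)) :=
    Real.sqrt_le_sqrt (by have : (0 : ℝ) ≤ n := Nat.cast_nonneg n; push_cast at h2 ⊢; linarith)
  rw [Real.sqrt_mul (by norm_num)] at h3
  have h4 : √(5 : ℝ) ≤ 2.24 := by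
    rw [Real.sqrt_le_left (by norm_num)]; norm_num
  have h5 := h.η_pos hη₁ (one_le_mult T) n i
  have h6 := hη₁ i
  rw [le_div_iff₀ (Real.sqrt_pos.2 (by positivity))]
  calc (s n).η i * √((n : ℝ) + 1)
      ≤ (s n).η i * (√5 * √((nFtrl T s n + 2 : ℕ) : ℝ)) := by gcongr
    _ = √5 * ((s n).η i * √((nFtrl T s n + 2 : ℕ) : ℝ)) := by ring
    _ ≤ 2.24 * (21 / 2 * η₁ i) := by gcongr
    _ ≤ 24 * η₁ i := by linarith

end IsPath

/-! ## One step of the algorithm -/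

/-- Bound for the shift of the multiplier in an update with unchanged step sizes. -/
def State.shift {K : ℕ} (s : State K) (ℓ : Fin K → ℝ) : ℝ :=
  (∑ i, s.η i * (s.w i * √(s.w i)) * ℓ i) / ∑ i, s.η i * (s.w i * √(s.w i))

/-- Negative regret of learner `j` due to an increase of its step size after the round. -/
def State.bonus {K : ℕ} (β : ℝ) (s : State K) (j : Fin K) : ℝ :=
  open Classical in
  if j ∈ s.nrs then (1 - 1 / β) * (2 / s.η j * ((1 - √(s.w j)) ^ 2 / √(s.w j))) else 0

lemma decrease_pos {K : ℕ} {η₁ η : Fin K → ℝ} (hη₁ : ∀ i, 0 < η₁ i) (hη : ∀ i, 0 < η i)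
    (i : Fin K) : 0 < decrease η₁ η i := by
  have := hη₁ i; have := hη i; unfold decrease; positivity

/-- √(a² + b²) ≤ a + b²/(2a) with a = 1/η and b = 1/η₁. -/
lemma one_div_decrease {K : ℕ} {η₁ η : Fin K → ℝ} (hη₁ : ∀ i, 0 < η₁ i) (hη : ∀ i, 0 < η i)
    (i : Fin K) : 1 / η i ≤ 1 / decrease η₁ η i ∧
      1 / decrease η₁ η i - 1 / η i ≤ η i / (2 * η₁ i ^ 2) := by
  have h1 := hη₁ i
  have h := hη i
  have e : 1 / decrease η₁ η i = √(1 / η i ^ 2 + 1 / η₁ i ^ 2) := by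
    unfold decrease; rw [one_div_one_div]
  rw [e]
  constructor
  · apply Real.le_sqrt_of_sq_le
    rw [div_pow, one_pow]
    have : 0 ≤ 1 / η₁ i ^ 2 := by positivity
    linarith
  · rw [sub_le_iff_le_add, Real.sqrt_le_left (by positivity)]
    have : (η i / (2 * η₁ i ^ 2) + 1 / η i) ^ 2 =
        (η i / (2 * η₁ i ^ 2)) ^ 2 + (1 / η i ^ 2 + 1 / η₁ i ^ 2) := by field_simp; ring
    rw [this]
    have : 0 ≤ (η i / (2 * η₁ i ^ 2)) ^ 2 := sq_nonneg _
    linarith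

namespace IsPath

variable {K : ℕ} {T : ℕ} {β : ℝ} {η₁ L₀ : Fin K → ℝ} {s : ℕ → State K} {ℓ : ℕ → Fin K → ℝ}

/-- Updates of negative-regret steps are updates with unchanged step sizes. -/
lemma omd_transition [NeZero K] (h : IsPath T β η₁ L₀ s ℓ) (hη₁ : ∀ i, 0 < η₁ i) (hβ : 1 ≤ β)
    (hℓ : ∀ n i, 0 ≤ ℓ n i) {n : ℕ} (ho : IsOmd T s n) :
    ∃ x, 0 ≤ x ∧
      x ≤ (∑ i, (s (n + 1)).η i * ((s n).w i * √((s n).w i)) * ℓ n i) /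
        ∑ i, (s (n + 1)).η i * ((s n).w i * √((s n).w i)) ∧
      ∀ i, 1 / √((s (n + 1)).w i) =
        1 / √((s n).w i) + (s (n + 1)).η i / 2 * (ℓ n i - x) := by
  obtain ⟨c, hc⟩ := h.kkt hη₁ hβ n
  obtain ⟨c', hc'⟩ := h.kkt hη₁ hβ (n + 1)
  have hp := h.η_pos hη₁ hβ n
  have hp' := h.η_pos hη₁ hβ (n + 1)
  rw [h.succ n] at hc' hp' ⊢
  rcases (s n).next_cases T β η₁ (K * initRounds T + n) (initRounds T + n + 1) (ℓ n) with
    ⟨-, -, h1, h2, h3, -⟩ | ⟨hf, h1, h2, h3, -⟩ | ⟨-, h1, h2, h3, -⟩ | ⟨-, h1, h2, h3, -⟩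
  · rw [h2] at hp' hc' ⊢
    rw [h1] at hc'
    exact hc.transition hc' hp (hℓ n)
  · exfalso
    rcases ho with ho | ho
    · rw [hf.2] at ho; simp at ho
    · rcases hf.1 with h4 | h4 <;> omega
  · rw [h1] at hc'
    exact (isKKT_neg_gradPsi hc.pos hc.sum).transition hc' hp' (hℓ n)
  · rw [h2] at hp' hc' ⊢
    rw [h1] at hc'
    exact hc.transition hc' hp (hℓ n)

/-- The shift of the multiplier is nonnegative and only helps. The new step size is at most β ≤ 2
times the old one, which uses up the factor 1/2. -/
lemma omd_le [NeZero K] (h : IsPath T β η₁ L₀ s ℓ) (hη₁ : ∀ i, 0 < η₁ i) (hβ : 1 ≤ β)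
    (hβ2 : β ≤ 2) (hℓ : ∀ n i, 0 ≤ ℓ n i) {n : ℕ} (ho : IsOmd T s n) (i : Fin K) :
    1 / √((s (n + 1)).w i) ≤ 1 / √((s n).w i) + (s n).η i * ℓ n i := by
  obtain ⟨x, hx, -, hY⟩ := h.omd_transition hη₁ hβ hℓ ho
  rw [hY i]
  have hp := h.η_pos hη₁ hβ n i
  have hl := hℓ n i
  have hη : (s (n + 1)).η i ≤ 2 * (s n).η i := by
    rw [h.η_succ]
    have : ¬ (s n).IsFtrl T (K * initRounds T + n) := by
      intro hf
      rcases ho with ho | ho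
      · rw [hf.2] at ho; simp at ho
      · rcases hf.1 with h4 | h4 <;> omega
    rw [if_neg this]
    split_ifs
    · gcongr
    · linarith
  have hp' := h.η_pos hη₁ hβ (n + 1) i
  have h1 : (s (n + 1)).η i / 2 * (ℓ n i - x) ≤ (s (n + 1)).η i / 2 * ℓ n i :=
    mul_le_mul_of_nonneg_left (by linarith) (by positivity)
  have h2 : (s (n + 1)).η i / 2 * ℓ n i ≤ (s n).η i * ℓ n i :=
    mul_le_mul_of_nonneg_right (by linarith) hl
  linarith

lemma not_isFtrl_of_trig {n : ℕ} (ht : ((s n).trig T (K * initRounds T + n)).Nonempty) :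
    ¬ (s n).IsFtrl T (K * initRounds T + n) := by
  intro hf; rw [hf.2] at ht; simp at ht

lemma nrs_of_trig {n : ℕ} (ht : ((s n).trig T (K * initRounds T + n)).Nonempty) :
    (s n).nrs = ∅ :=
  State.nrs_eq_empty (by rcases State.tag_of_trig ht with h | h <;> omega)

lemma η_of_trig (h : IsPath T β η₁ L₀ s ℓ) {n : ℕ}
    (ht : ((s n).trig T (K * initRounds T + n)).Nonempty) : (s (n + 1)).η = (s n).η := by
  funext i
  rw [h.η_succ, if_neg (not_isFtrl_of_trig ht), nrs_of_trig ht, if_neg (by simp)]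

/-- Here the loss only helps, and the shift is at most a weighted mean of the losses. The bonus is
collected one round after the trigger, and this limits how far 1/√w can have dropped by then. -/
lemma le_begin [NeZero K] (h : IsPath T β η₁ L₀ s ℓ) (hη₁ : ∀ i, 0 < η₁ i) (hβ : 1 ≤ β)
    (hℓ : ∀ n i, 0 ≤ ℓ n i) {n : ℕ} (ht : ((s n).trig T (K * initRounds T + n)).Nonempty)
    (i : Fin K) :
    1 / √((s n).w i) - (s n).η i / 2 * (s n).shift (ℓ n) ≤ 1 / √((s (n + 1)).w i) := by
  obtain ⟨x, hx, hx', hY⟩ := h.omd_transition hη₁ hβ hℓ (.inl ht)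
  rw [h.η_of_trig ht] at hx' hY
  rw [hY i]
  have hp := h.η_pos hη₁ hβ n i
  have h1 : (s n).η i / 2 * x ≤ (s n).η i / 2 * (s n).shift (ℓ n) :=
    mul_le_mul_of_nonneg_left hx' (by positivity)
  have h2 : 0 ≤ (s n).η i / 2 * ℓ n i := mul_nonneg (by positivity) (hℓ n i)
  linarith

/-- Regret of one step against the learner `j`. -/
lemma regret_step [NeZero K] (h : IsPath T (mult T) η₁ L₀ s ℓ) (hR : Regime K T)
    (hη₁ : ∀ i, 0 < η₁ i) (hη₁' : ∀ i, η₁ i ≤ 1 / 4) {n : ℕ} (hn : n + 1 + K * initRounds T ≤ T)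
    (j : Fin K) {x : ℝ} (hx : x ≤ 1) (hℓ : ∀ n i, 0 ≤ ℓ n i) :
    ∑ i, ℓ n i * ((s n).w i - (Pi.single j 1 : Fin K → ℝ) i) ≤
      divg (s n).η (Pi.single j 1) (s n).w - divg (s (n + 1)).η (Pi.single j 1) (s (n + 1)).w +
      108 / √((n : ℝ) + 1) * ∑ i, (ℓ n i - x) ^ 2 * ((s n).w i * √((s n).w i)) +
      ∑ i ∈ Finset.univ.erase j, 48 / (η₁ i * √((n : ℝ) + 1)) * √((s (n + 1)).w i) -
      (s n).bonus (mult T) j := by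
  have hβ := one_le_mult T
  have hu : (Pi.single j 1 : Fin K → ℝ) ∈ stdSimplex ℝ (Fin K) := single_mem_stdSimplex ℝ j
  obtain ⟨c, hc⟩ := h.kkt hη₁ hβ n
  obtain ⟨c', hc'⟩ := h.kkt hη₁ hβ (n + 1)
  have hp := h.η_pos hη₁ hβ n
  have hp' := h.η_pos hη₁ hβ (n + 1)
  have hsq : 0 < √((n : ℝ) + 1) := Real.sqrt_pos.2 (by positivity)
  have hη_le : ∀ i, (s n).η i ≤ 6 / √((n : ℝ) + 1) := fun i => by
    refine (h.η_le_sqrt hR hη₁ (by omega) i).trans ?_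
    have := hη₁' i; gcongr; linarith
  have hη_le' : ∀ i, (s (n + 1)).η i ≤ 6 / √((n : ℝ) + 1) := fun i => by
    refine (h.η_le_sqrt hR hη₁ hn i).trans ?_
    have := hη₁' i; have := hη₁ i
    gcongr
    · linarith
    · linarith
  -- The 18 of the stability lemma times the step-size bound 6/√(n + 1) gives 108. The step sizes
  -- are left open because the second OMD update uses the new ones.
  have hs : ∀ η : Fin K → ℝ, (∀ i, 0 < η i) → (∀ i, η i ≤ 6 / √((n : ℝ) + 1)) →
      (∀ i, η i ≤ 1.9) →
      ∑ i, ℓ n i * ((s n).w i - (s (n + 1)).w i) - divg η (s (n + 1)).w (s n).w ≤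
      108 / √((n : ℝ) + 1) * ∑ i, (ℓ n i - x) ^ 2 * ((s n).w i * √((s n).w i)) := by
    intro η h0 h1 h2
    refine (stability_le h0 hc.pos hc.sum hc'.mem x fun i => ?_).trans ?_
    · have h3 := hℓ n i
      have h4 : √((s n).w i) ≤ 1 := Real.sqrt_le_one.2 (hc.le_one i)
      have h5 := Real.sqrt_nonneg ((s n).w i)
      have h6 : η i * √((s n).w i) ≤ 1.9 * 1 := mul_le_mul (h2 i) h4 h5 (by norm_num)
      have h7 : 0 ≤ η i * √((s n).w i) := mul_nonneg (h0 i).le h5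
      nlinarith
    · rw [Finset.mul_sum]
      refine Finset.sum_le_sum fun i _ => ?_
      have h3 : 0 ≤ (ℓ n i - x) ^ 2 * ((s n).w i * √((s n).w i)) :=
        mul_nonneg (sq_nonneg _) (mul_nonneg (hc.pos i).le (Real.sqrt_nonneg _))
      have h4 := mul_le_mul_of_nonneg_right (h1 i) h3
      calc _ = 18 * (η i * ((ℓ n i - x) ^ 2 * ((s n).w i * √((s n).w i)))) := by ring
        _ ≤ 18 * (6 / √((n : ℝ) + 1) * ((ℓ n i - x) ^ 2 * ((s n).w i * √((s n).w i)))) := by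
            gcongr
        _ = _ := by ring
  have hpen : 0 ≤ ∑ i ∈ Finset.univ.erase j, 48 / (η₁ i * √((n : ℝ) + 1)) * √((s (n + 1)).w i) :=
    Finset.sum_nonneg fun i _ => by have := hη₁ i; positivity
  have hlt := h.η_lt hR hη₁ hη₁' (n := n) (by omega)
  have hlt' := h.η_lt hR hη₁ hη₁' hn
  have hnr : (s n).tag ≠ 1 → (s n).bonus (mult T) j = 0 := fun h1 => by
    unfold State.bonus; rw [State.nrs_eq_empty h1]; simp
  rcases (s n).next_cases T (mult T) η₁ (K * initRounds T + n) (initRounds T + n + 1) (ℓ n) with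
    ⟨-, h0, h1, h2, -⟩ | ⟨hf, h1, h2, -⟩ | ⟨h0, h1, h2, -⟩ | ⟨h0, h1, h2, -⟩
  · rw [← h.succ n] at h1 h2
    rw [hnr (by omega)]
    rw [h1, h2] at hc'
    have key := hc.regret_eq hc' hp hp hu
    have := hs _ hp hη_le hlt
    rw [h2]
    linarith
  · rw [← h.succ n] at h1 h2
    rw [hnr (by rcases hf.1 with h | h <;> omega)]
    rw [h1, h2] at hc'
    have key := hc.regret_eq hc' hp (decrease_pos hη₁ hp) hu
    have := hs _ hp hη_le hlt
    have h3 := penalty_le (fun i => (one_div_decrease hη₁ hp i).1) hc'.mem j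
    have h4 : ∑ i ∈ Finset.univ.erase j, 4 * ((1 / decrease η₁ (s n).η i - 1 / (s n).η i) *
        √((s (n + 1)).w i)) ≤
        ∑ i ∈ Finset.univ.erase j, 48 / (η₁ i * √((n : ℝ) + 1)) * √((s (n + 1)).w i) := by
      refine Finset.sum_le_sum fun i _ => ?_
      rw [← mul_assoc]
      refine mul_le_mul_of_nonneg_right ?_ (Real.sqrt_nonneg _)
      have h5 := (one_div_decrease hη₁ hp i).2
      have h6 := h.η_le_sqrt hR hη₁ (n := n) (by omega) i
      have h7 := hη₁ i
      calc 4 * (1 / decrease η₁ (s n).η i - 1 / (s n).η i)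
          ≤ 4 * (24 * η₁ i / √((n : ℝ) + 1) / (2 * η₁ i ^ 2)) := by
            gcongr; exact h5.trans (by gcongr)
        _ = _ := by field_simp; ring
    rw [h2]
    linarith
  · rw [← h.succ n] at h1 h2
    rw [h1] at hc'
    -- The step sizes change before this update: `w` is regarded as an FTRL iterate for the new
    -- ones, so no penalty arises, and exchanging the divergence at `w` produces the bonus.
    have key := (isKKT_neg_gradPsi hc.pos hc.sum).regret_eq hc' hp' hp' hu
    have := hs _ hp' hη_le' hlt'
    have h3 := divg_mul_le (u := (Pi.single j 1 : Fin K → ℝ)) (w := (s n).w) hp hβ (s n).nrs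
    rw [← h2] at h3
    unfold State.bonus
    split_ifs with h4
    · have h5 := h3.2 j h4
      rw [Pi.single_eq_same, Real.sqrt_one] at h5
      linarith
    · linarith [h3.1]
  · rw [← h.succ n] at h1 h2
    rw [hnr (by omega)]
    rw [h1, h2] at hc'
    have key := hc.regret_eq hc' hp hp hu
    have := hs _ hp hη_le hlt
    rw [h2]
    linarith

lemma bonus_nonneg [NeZero K] (h : IsPath T β η₁ L₀ s ℓ) (hη₁ : ∀ i, 0 < η₁ i)
    (hβ : 1 ≤ β) (n : ℕ) (j : Fin K) : 0 ≤ (s n).bonus β j := by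
  unfold State.bonus
  split_ifs
  · have h1 : 1 / β ≤ 1 := by rw [div_le_one (by linarith)]; exact hβ
    have h2 := h.η_pos hη₁ hβ n j
    exact mul_nonneg (by linarith) (by positivity)
  · exact le_rfl

/-- The learners of a negative-regret step have small probabilities. -/
lemma le_of_mem_trig (h : IsPath T β η₁ L₀ s ℓ) {n : ℕ} {j : Fin K}
    (hj : j ∈ (s n).trig T (K * initRounds T + n)) : (s n).w j ≤ 1 / 36 := by
  rcases State.mem_trig.1 hj with h1 | h1
  · rw [← threshold_one]; exact h1.2
  · exact h1.2.2.2.trans (one_div_le_one_div_of_le (by norm_num)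
      (le_threshold (h.θ_bounds n j).1))

lemma six_le_of_le {w : ℝ} (hw : 0 < w) (h : w ≤ 1 / 36) : 6 ≤ 1 / √w := by
  rw [le_div_iff₀ (Real.sqrt_pos.2 hw)]
  have : √w ≤ 1 / 6 := by
    rw [Real.sqrt_le_left (by norm_num)]; norm_num at h ⊢; exact h
  linarith

/-- The negative regret pays for the regret of the restarted learner. -/
lemma le_bonus [NeZero K] (h : IsPath T (mult T) η₁ L₀ s ℓ) (hR : Regime K T)
    (hη₁ : ∀ i, 0 < η₁ i) (hℓ : ∀ n i, 0 ≤ ℓ n i) {t : ℕ} (hn : t + 1 + K * initRounds T ≤ T)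
    (ht : 5 * (K * initRounds T) ≤ t) {j : Fin K}
    (hj : j ∈ (s t).trig T (K * initRounds T + t)) :
    2.48 * (gain T / (50 * η₁ j)) * √((t + 2 * (K * initRounds T) + 6 : ℕ) : ℝ) *
        (1 / √((s t).w j)) - gain T * (s t).shift (ℓ t) ≤
      (s (t + 1)).bonus (mult T) j := by
  have hβ := one_le_mult T
  have hne : ((s t).trig T (K * initRounds T + t)).Nonempty := ⟨j, hj⟩
  have hw := h.w_pos hη₁ hβ t j
  have hw' := h.w_pos hη₁ hβ (t + 1) j
  have hη := h.η_pos hη₁ hβ t j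
  have hη1 := hη₁ j
  have hg := gain_nonneg T
  unfold State.bonus
  rw [h.nrs_succ, if_pos hj, one_sub_one_div_mult, h.η_of_trig hne]
  have hY := h.le_begin hη₁ hβ hℓ hne j
  set x := (s t).shift (ℓ t) with hx
  have hx0 : 0 ≤ x := by
    rw [hx]; unfold State.shift
    refine div_nonneg (Finset.sum_nonneg fun i _ => ?_) (Finset.sum_nonneg fun i _ => ?_)
    · exact mul_nonneg (mul_nonneg (h.η_pos hη₁ hβ t i).le (mul_nonneg (h.w_pos hη₁ hβ t i).le
        (Real.sqrt_nonneg _))) (hℓ t i)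
    · exact mul_nonneg (h.η_pos hη₁ hβ t i).le (mul_nonneg (h.w_pos hη₁ hβ t i).le
        (Real.sqrt_nonneg _))
  have h6 : 6 ≤ 1 / √((s t).w j) := six_le_of_le hw (h.le_of_mem_trig hj)
  have hsq' : 0 < √((s (t + 1)).w j) := Real.sqrt_pos.2 hw'
  have hY1 : 1 ≤ 1 / √((s (t + 1)).w j) := by
    rw [le_div_iff₀ hsq', one_mul]; exact Real.sqrt_le_one.2 (h.w_le_one hη₁ hβ (t + 1) j)
  have e : (1 - √((s (t + 1)).w j)) ^ 2 / √((s (t + 1)).w j) =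
      1 / √((s (t + 1)).w j) - 2 + 1 / (1 / √((s (t + 1)).w j)) := by
    rw [one_div_one_div]; field_simp; ring
  rw [e]
  set Y := 1 / √((s t).w j)
  set Y' := 1 / √((s (t + 1)).w j)
  set η := (s t).η j
  -- Y - 2 + 1/Y = (1 - 1/Y)² Y ≥ (5/6)² Y for Y ≥ 6. The value is increasing on [1, ∞), so a rise
  -- of 1/√w since the trigger does no harm, and a drop is at most ηx/2.
  have hgY : 25 / 36 * Y - η / 2 * x ≤ Y' - 2 + 1 / Y' := by
    have h1 : 25 / 36 * Y ≤ Y - 2 + 1 / Y := by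
      have h2 : 0 ≤ (Y - 6) * (11 * Y - 6) / (36 * Y) :=
        div_nonneg (mul_nonneg (by linarith) (by linarith)) (by linarith)
      have h3 : (Y - 6) * (11 * Y - 6) / (36 * Y) = Y - 2 + 1 / Y - 25 / 36 * Y := by
        field_simp; ring
      linarith
    rcases le_total Y' Y with h2 | h2
    · have := one_div_le_one_div_of_le (by linarith) h2
      linarith
    · have h3 : 0 ≤ η / 2 * x := by positivity
      have h4 : Y + 1 / Y ≤ Y' + 1 / Y' := by
        have h5 : Y' + 1 / Y' - (Y + 1 / Y) = (Y' - Y) * (Y * Y' - 1) / (Y * Y') := by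
          field_simp; ring
        have h6 : 0 ≤ (Y' - Y) * (Y * Y' - 1) / (Y * Y') :=
          div_nonneg (mul_nonneg (by linarith) (by nlinarith)) (by positivity)
        linarith
      linarith
  have h7 : gain T * (2 / η * (25 / 36 * Y - η / 2 * x)) ≤
      gain T * (2 / η * (Y' - 2 + 1 / Y')) := by gcongr
  refine le_trans ?_ h7
  have e2 : gain T * (2 / η * (25 / 36 * Y - η / 2 * x)) =
      50 / 36 * gain T * (1 / η) * Y - gain T * x := by field_simp; ring
  rw [e2]
  have h8 : √((nFtrl T s t + 2 : ℕ) : ℝ) / (21 / 2 * η₁ j) ≤ 1 / η := by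
    rw [div_le_div_iff₀ (by positivity) hη]
    have := h.η_mul_sqrt_le hR hη₁ (n := t) (by omega) j
    linarith
  -- From t ≥ 5M one has t + 2M ≤ 7t/5, and almost a quarter of the t rounds are FTRL steps; 2.38²
  -- exceeds 4 · 7/5 with a little room.
  have h9 : 2.38 * √((nFtrl T s t + 2 : ℕ) : ℝ) ≥
      √((t + 2 * (K * initRounds T) + 6 : ℕ) : ℝ) := by
    rw [ge_iff_le, Real.sqrt_le_left (by positivity), mul_pow, Real.sq_sqrt (by positivity)]
    have h10 := h.le_nFtrl' hR t
    have h11 : (5 : ℝ) * ((K * initRounds T : ℕ) : ℝ) ≤ t := by exact_mod_cast ht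
    have h12 : (4000000 : ℝ) ≤ ((K * initRounds T : ℕ) : ℝ) := by exact_mod_cast hR.le_init
    have h13 : ((t + 2 * (K * initRounds T) + 6 : ℕ) : ℝ) =
      t + 2 * ((K * initRounds T : ℕ) : ℝ) + 6 := by push_cast; ring
    rw [h13]
    nlinarith
  -- 2.48 exceeds 1.43 + 1.04, the two rates at which a trigger is charged in `segmentCost`. The
  -- constant 50 in the condition on η₁ makes room for it: 2.48 · 2.38/50 < (50/36)(2/21).
  have h14 : 2.48 * (gain T / (50 * η₁ j)) * √((t + 2 * (K * initRounds T) + 6 : ℕ) : ℝ) * Y ≤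
      50 / 36 * gain T * (1 / η) * Y := by
    have hY0 : 0 ≤ Y := by linarith
    refine mul_le_mul_of_nonneg_right ?_ hY0
    calc 2.48 * (gain T / (50 * η₁ j)) * √((t + 2 * (K * initRounds T) + 6 : ℕ) : ℝ)
        ≤ 2.48 * (gain T / (50 * η₁ j)) * (2.38 * √((nFtrl T s t + 2 : ℕ) : ℝ)) := by gcongr
      _ ≤ 50 / 36 * gain T * (√((nFtrl T s t + 2 : ℕ) : ℝ) / (21 / 2 * η₁ j)) := by
          have h15 : 0 ≤ gain T * √((nFtrl T s t + 2 : ℕ) : ℝ) / η₁ j := by positivity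
          have e3 : 2.48 * (gain T / (50 * η₁ j)) * (2.38 * √((nFtrl T s t + 2 : ℕ) : ℝ)) =
            (2.48 * 2.38 / 50) * (gain T * √((nFtrl T s t + 2 : ℕ) : ℝ) / η₁ j) := by
              field_simp
          have e4 : 50 / 36 * gain T * (√((nFtrl T s t + 2 : ℕ) : ℝ) / (21 / 2 * η₁ j)) =
            (50 / 36 * 2 / 21) * (gain T * √((nFtrl T s t + 2 : ℕ) : ℝ) / η₁ j) := by
              field_simp
          rw [e3, e4]
          refine mul_le_mul_of_nonneg_right ?_ h15
          norm_num
      _ ≤ 50 / 36 * gain T * (1 / η) := by gcongr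
  linarith

/-- Divergence of the first distribution. -/
lemma divg_zero_le [NeZero K] (h : IsPath T β η₁ L₀ s ℓ) (hη₁ : ∀ i, 0 < η₁ i) (hβ : 1 ≤ β)
    (j : Fin K) (hL : ∀ i, 0 ≤ L₀ i) :
    divg (s 0).η (Pi.single j 1) (s 0).w ≤ L₀ j + ∑ i ∈ Finset.univ.erase j, 6 / η₁ i := by
  obtain ⟨c, hc⟩ := h.kkt hη₁ hβ 0
  have hp := h.η_pos hη₁ hβ 0
  have hu : (Pi.single j 1 : Fin K → ℝ) ∈ stdSimplex ℝ (Fin K) := single_mem_stdSimplex ℝ j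
  rw [hc.divg_eq hp hu]
  have hL0 : (s 0).L = L₀ := by rw [h.zero]; rfl
  have hη0 : ∀ i, 1 / (s 0).η i ≤ 1.5 / η₁ i := fun i => by
    rw [h.zero]
    have h1 := hη₁ i
    simp only [State.initial, decrease]
    rw [one_div_one_div, Real.sqrt_le_left (by positivity), div_pow, ← add_div]
    gcongr
    norm_num
  have h1 : ∑ i, (s 0).L i * (Pi.single j 1 : Fin K → ℝ) i = L₀ j := by
    rw [hL0]; simp [Pi.single_apply]
  have h2 : 0 ≤ ∑ i, (s 0).L i * (s 0).w i := by
    rw [hL0]; exact Finset.sum_nonneg fun i _ => mul_nonneg (hL i) (hc.pos i).le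
  have h3 : psi (s 0).η (Pi.single j 1) = -2 / (s 0).η j := by
    unfold psi
    rw [Finset.sum_eq_single j]
    · rw [Pi.single_eq_same, Real.sqrt_one]; ring
    · intro i _ hi; rw [Pi.single_eq_of_ne hi]; simp
    · simp
  -- Coordinate `j` gives at most the value at the vertex, which cancels below. The others use √w -
  -- w/2 ≤ 1 and 1/η ≤ 1.5/η₁, as √2 < 1.5.
  have h4 : -psi (s 0).η (s 0).w ≤ 2 / (s 0).η j + ∑ i ∈ Finset.univ.erase j, 6 / η₁ i := by
    unfold psi
    rw [← Finset.add_sum_erase _ _ (Finset.mem_univ j), neg_mul_eq_neg_mul, neg_neg, mul_add]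
    refine add_le_add ?_ ?_
    · have h5 : √((s 0).w j) - (s 0).w j / 2 ≤ 1 / 2 := by
        have := Real.sq_sqrt (hc.pos j).le
        nlinarith [sq_nonneg (√((s 0).w j) - 1)]
      have h6 := hp j
      calc 4 * ((√((s 0).w j) - (s 0).w j / 2) / (s 0).η j) ≤ 4 * (1 / 2 / (s 0).η j) := by gcongr
        _ = _ := by ring
    · rw [Finset.mul_sum]
      refine Finset.sum_le_sum fun i _ => ?_
      have h5 : √((s 0).w i) - (s 0).w i / 2 ≤ 1 := by
        have := Real.sqrt_le_one.2 (hc.le_one i)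
        have := (hc.pos i).le
        linarith
      have h6 := hp i
      calc 4 * ((√((s 0).w i) - (s 0).w i / 2) / (s 0).η i) ≤ 4 * (1 / (s 0).η i) := by gcongr
        _ ≤ 4 * (1.5 / η₁ i) := mul_le_mul_of_nonneg_left (hη0 i) (by norm_num)
        _ = _ := by ring
  rw [h1, h3]
  have h7 : -2 / (s 0).η j = -(2 / (s 0).η j) := by ring
  linarith

end IsPath

/-! ## Sampling probabilities between two restarts of a learner -/

/-- Mixing costs only the factor 1 - 1/(TK), close to 1 for long horizons, and guarantees the mass
1/(K²T) to which the last threshold is matched. -/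
lemma State.wbar_bounds {K T : ℕ} (hR : Regime K T) (s : State K) {i : Fin K} (h0 : 0 < s.w i) :
    0 < s.wbar T i ∧ 1 / √(s.wbar T i) ≤ 1.001 * (1 / √(s.w i)) ∧
      1 / s.wbar T i ≤ (K : ℝ) ^ 2 * T := by
  have hT := hR.T_pos
  have hK : (0 : ℝ) < K := by have := hR.two_le; exact_mod_cast (by omega : 0 < K)
  have hTK : (4000000 : ℝ) ≤ T * K := by
    have h1 := hR.le_init
    have h2 := hR.lt
    have h3 : 1 ≤ K := by have := hR.two_le; omega
    have h4 : 4000000 * 1 ≤ T * K := Nat.mul_le_mul (by omega) h3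
    exact_mod_cast h4
  have h1 : 1 / ((T : ℝ) * K) ≤ 1 / 4000000 := one_div_le_one_div_of_le (by norm_num) hTK
  have h2 : 0 < 1 / ((T : ℝ) * K) * (1 / K) := by positivity
  have h3 : 0.999 * s.w i ≤ s.wbar T i := by
    unfold State.wbar
    have : 0.999 ≤ 1 - 1 / ((T : ℝ) * K) := by linarith
    nlinarith
  have h4 : 1 / ((K : ℝ) ^ 2 * T) ≤ s.wbar T i := by
    unfold State.wbar
    have h5 : 1 / ((T : ℝ) * K) * (1 / K) = 1 / ((K : ℝ) ^ 2 * T) := by field_simp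
    rw [← h5]
    have : 0 ≤ (1 - 1 / ((T : ℝ) * K)) * s.w i := mul_nonneg (by linarith) h0.le
    linarith
  have h5 : 0 < s.wbar T i := by nlinarith
  refine ⟨h5, ?_, ?_⟩
  · have h6 : √(s.w i) ≤ 1.001 * √(s.wbar T i) := by
      rw [Real.sqrt_le_left (by positivity), mul_pow, Real.sq_sqrt h5.le]
      nlinarith
    rw [mul_one_div, div_le_div_iff₀ (Real.sqrt_pos.2 h5) (Real.sqrt_pos.2 h0)]
    linarith
  · rw [div_le_iff₀ h5]
    rw [div_le_iff₀ (by positivity)] at h4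
    linarith

section

variable {K : ℕ} (T : ℕ) (s : ℕ → State K) (ℓ : ℕ → Fin K → ℝ) (j : Fin K)

open Classical in
/-- Bound for the increase of `1 / √w` in a round of a negative-regret step. -/
def excess (n : ℕ) : ℝ := if IsOmd T s n then (s n).η j * ℓ n j else 0

/-- Bound for the increase of `1 / √w` in the rounds in which thresholds were not observed. -/
def accum (n : ℕ) : ℝ := ∑ k ∈ Finset.Ico (n - 3) n, excess T s ℓ j k

end

namespace IsPath

variable {K : ℕ} {T : ℕ} {β : ℝ} {η₁ L₀ : Fin K → ℝ} {s : ℕ → State K} {ℓ : ℕ → Fin K → ℝ}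

lemma tag_of_nrs {n : ℕ} {j : Fin K} (hj : j ∈ (s n).nrs) : (s n).tag = 1 := by
  by_contra h; rw [State.nrs_eq_empty h] at hj; simp at hj

/-- Nonzero tags are reached by one route only, from a triggering round through 1, 2 and 3. Going
back along it finds the round in which weights were last compared with thresholds. -/
lemma back_one (h : IsPath T β η₁ L₀ s ℓ) {n : ℕ} (ht : (s n).tag = 1) :
    ∃ k, n = k + 1 ∧ ((s k).trig T (K * initRounds T + k)).Nonempty ∧ (s n).begunAt = (s k).w := by
  cases n with
  | zero => rw [h.tag_zero] at ht; omega
  | succ k =>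
    have h2 : ((s k).trig T (K * initRounds T + k)).Nonempty := by
      rw [h.tag_succ] at ht
      by_contra h3
      rw [if_neg h3] at ht
      split_ifs at ht; omega
    exact ⟨k, rfl, h2, by rw [h.begunAt_succ, if_pos h2]⟩

lemma back_succ (h : IsPath T β η₁ L₀ s ℓ) {n t : ℕ} (ht : (s n).tag = t + 2) :
    ∃ k, n = k + 1 ∧ (s k).tag = t + 1 := by
  cases n with
  | zero => rw [h.tag_zero] at ht; omega
  | succ k =>
    refine ⟨k, rfl, ?_⟩
    rw [h.tag_succ] at ht
    split_ifs at ht <;> omega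

lemma not_atEpoch {n r : ℕ} (ht : (s n).tag = 1 ∨ (s n).tag = 2) : ¬ (s n).AtEpoch r :=
  fun h => by rcases h.1 with h | h <;> omega

lemma trig_eq_empty {n r : ℕ} (ht : (s n).tag = 1 ∨ (s n).tag = 2) : (s n).trig T r = ∅ :=
  Finset.not_nonempty_iff_eq_empty.1 fun h => by rcases State.tag_of_trig h with h | h <;> omega

lemma θ_succ_of_tag (h : IsPath T β η₁ L₀ s ℓ) {n : ℕ} (ht : (s n).tag = 1 ∨ (s n).tag = 2)
    (j : Fin K) : (s (n + 1)).θ j = (s n).θ j := by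
  rw [h.θ_succ, if_neg (not_atEpoch ht), trig_eq_empty ht, if_neg (by simp)]

lemma excess_nonneg (h : IsPath T β η₁ L₀ s ℓ) (hη₁ : ∀ i, 0 < η₁ i) (hβ : 1 ≤ β)
    (hℓ : ∀ n i, 0 ≤ ℓ n i) (j : Fin K) (n : ℕ) : 0 ≤ excess T s ℓ j n := by
  unfold excess
  split_ifs
  · exact mul_nonneg (h.η_pos hη₁ hβ n j).le (hℓ n j)
  · exact le_rfl

lemma accum_nonneg (h : IsPath T β η₁ L₀ s ℓ) (hη₁ : ∀ i, 0 < η₁ i) (hβ : 1 ≤ β)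
    (hℓ : ∀ n i, 0 ≤ ℓ n i) (j : Fin K) (n : ℕ) : 0 ≤ accum T s ℓ j n :=
  Finset.sum_nonneg fun k _ => h.excess_nonneg hη₁ hβ hℓ j k

/-- Where a learner that is neither being restarted nor below its threshold comes from: either its
probability was observed to be above the threshold at most three rounds ago, with only updates of a
negative-regret step since then, or it has just been restarted, or there are no more thresholds. -/
lemma observed [NeZero K] (h : IsPath T β η₁ L₀ s ℓ) (hη₁ : ∀ i, 0 < η₁ i) (hβ : 1 ≤ β)
    {n : ℕ} {j : Fin K} (h1 : j ∉ (s n).trig T (K * initRounds T + n)) (h2 : j ∉ (s n).nrs) :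
    (s n).θ j = numThresholds K T + 1 ∨
    ∃ k, k ≤ n ∧ n ≤ k + 3 ∧ (∀ q, k ≤ q → q < n → IsOmd T s q) ∧
      (1 / threshold ((s n).θ j) ≤ (s k).w j ∨
        2 ≤ (s n).θ j ∧ (s n).env j = 2 / (s k).w j) := by
  by_cases hθ : (s n).θ j ≤ numThresholds K T
  swap
  · left; have := (h.θ_bounds n j).2; omega
  right
  have hb := (h.θ_bounds n j).1
  by_cases ha : (s n).AtEpoch (K * initRounds T + n)
  · refine ⟨n, le_rfl, by omega, fun q h3 h4 => by omega, .inl ?_⟩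
    have h3 : 1 / threshold 1 < (s n).w j := by
      by_contra! h3; exact h1 (State.mem_trig.2 (.inl ⟨ha, h3⟩))
    refine le_trans (one_div_le_one_div_of_le (threshold_pos _) ?_) h3.le
    rw [threshold_one]; exact le_threshold hb
  · have htag := (s n).tag_le_three
    obtain ht | ht | ht | ht : (s n).tag = 0 ∨ (s n).tag = 1 ∨ (s n).tag = 2 ∨ (s n).tag = 3 := by
      omega
    · refine ⟨n, le_rfl, by omega, fun q h3 h4 => by omega, .inl ?_⟩
      by_contra! h3
      exact h1 (State.mem_trig.2 (.inr ⟨ha, ht, hθ, h3.le⟩))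
    · obtain ⟨k, rfl, hk, hv⟩ := h.back_one ht
      refine ⟨k, by omega, by omega, fun q h3 h4 => ?_, .inl ?_⟩
      · rw [show q = k by omega]; exact .inl hk
      · rw [← hv]; exact (((h.env_inv hη₁ hβ (k + 1) j).2.2 h2).2.2 ht hθ).le
    · obtain ⟨k1, rfl, hk1⟩ := h.back_succ ht
      obtain ⟨k, rfl, hk, hv⟩ := h.back_one hk1
      have e1 := h.θ_succ_of_tag (.inl hk1) j
      refine ⟨k, by omega, by omega, fun q h3 h4 => ?_, ?_⟩
      · obtain h5 | h5 : q = k ∨ q = k + 1 := by omega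
        · rw [h5]; exact .inl hk
        · rw [h5]; exact .inr (.inl hk1)
      · rw [e1] at hθ ⊢
        by_cases h3 : j ∈ (s (k + 1)).nrs
        · right
          refine ⟨((h.env_inv hη₁ hβ (k + 1) j).2.1 h3).1, ?_⟩
          rw [h.env_succ, if_neg (fun h => not_atEpoch (.inl hk1) h.1), if_pos h3, hv]
        · left; rw [← hv]; exact (((h.env_inv hη₁ hβ (k + 1) j).2.2 h3).2.2 hk1 hθ).le
    · obtain ⟨k2, rfl, hk2⟩ := h.back_succ ht
      obtain ⟨k1, rfl, hk1⟩ := h.back_succ hk2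
      obtain ⟨k, rfl, hk, hv⟩ := h.back_one hk1
      have e1 := h.θ_succ_of_tag (.inl hk1) j
      have e2 := h.θ_succ_of_tag (.inr hk2) j
      refine ⟨k, by omega, by omega, fun q h3 h4 => ?_, ?_⟩
      · obtain h5 | h5 | h5 : q = k ∨ q = k + 1 ∨ q = k + 2 := by omega
        · rw [h5]; exact .inl hk
        · rw [h5]; exact .inr (.inl hk1)
        · rw [h5]; exact .inr (.inr hk2)
      · rw [e2, e1] at hθ ⊢
        by_cases h3 : j ∈ (s (k + 1)).nrs
        · right
          refine ⟨((h.env_inv hη₁ hβ (k + 1) j).2.1 h3).1, ?_⟩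
          rw [h.env_succ, if_neg (fun h => not_atEpoch (.inr hk2) h.1),
            State.nrs_eq_empty (s := s (k + 1 + 1)) (by omega), if_neg (by simp),
            h.env_succ, if_neg (fun h => not_atEpoch (.inl hk1) h.1), if_pos h3, hv]
        · left; rw [← hv]; exact (((h.env_inv hη₁ hβ (k + 1) j).2.2 h3).2.2 hk1 hθ).le

lemma le_add_excess [NeZero K] (h : IsPath T β η₁ L₀ s ℓ) (hη₁ : ∀ i, 0 < η₁ i) (hβ : 1 ≤ β)
    (hβ2 : β ≤ 2) (hℓ : ∀ n i, 0 ≤ ℓ n i) (j : Fin K) {k n : ℕ} (hkn : k ≤ n)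
    (ho : ∀ q, k ≤ q → q < n → IsOmd T s q) :
    1 / √((s n).w j) ≤ 1 / √((s k).w j) + ∑ q ∈ Finset.Ico k n, excess T s ℓ j q := by
  induction n, hkn using Nat.le_induction with
  | base => simp
  | succ n hkn ih =>
    have h1 := ih fun q h2 h3 => ho q h2 (by omega)
    have h4 := ho n hkn (by omega)
    have h2 := h.omd_le hη₁ hβ hβ2 hℓ h4 j
    rw [Finset.sum_Ico_succ_top hkn]
    have h3 : excess T s ℓ j n = (s n).η j * ℓ n j := by unfold excess; rw [if_pos h4]
    linarith

lemma sum_excess_le_accum (h : IsPath T β η₁ L₀ s ℓ) (hη₁ : ∀ i, 0 < η₁ i) (hβ : 1 ≤ β)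
    (hℓ : ∀ n i, 0 ≤ ℓ n i) (j : Fin K) {k n : ℕ} (hkn : n ≤ k + 3) :
    ∑ q ∈ Finset.Ico k n, excess T s ℓ j q ≤ accum T s ℓ j n :=
  Finset.sum_le_sum_of_subset_of_nonneg (Finset.Ico_subset_Ico (by omega) le_rfl)
    fun q _ _ => h.excess_nonneg hη₁ hβ hℓ j q

lemma one_div_sqrt_le {w x : ℝ} (hx : 0 < x) (h : 1 / x ≤ w) : 1 / √w ≤ √x := by
  have h0 : 0 < w := lt_of_lt_of_le (by positivity) h
  rw [div_le_iff₀ (Real.sqrt_pos.2 h0), ← Real.sqrt_mul hx.le]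
  rw [div_le_iff₀ hx] at h
  rw [Real.one_le_sqrt]; linarith

/-- Sampling probability of a learner that is neither being restarted nor below its threshold. -/
lemma sampling_le [NeZero K] (h : IsPath T β η₁ L₀ s ℓ) (hR : Regime K T) (hη₁ : ∀ i, 0 < η₁ i)
    (hβ : 1 ≤ β) (hβ2 : β ≤ 2) (hℓ : ∀ n i, 0 ≤ ℓ n i) {n : ℕ} {j : Fin K}
    (h1 : j ∉ (s n).trig T (K * initRounds T + n)) (h2 : j ∉ (s n).nrs)
    (hθ : 2 ≤ (s n).θ j) :
    1 / √((s n).wbar T j) ≤ 1.001 * (√((s n).env j) + accum T s ℓ j n) := by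
  have hw := h.w_pos hη₁ hβ n j
  obtain ⟨hb0, hb1, hb2⟩ := State.wbar_bounds hR (s n) hw
  have henv := ((h.env_inv hη₁ hβ n j).2.2 h2).2.1 hθ
  have ha := h.accum_nonneg hη₁ hβ hℓ j n
  rcases h.observed hη₁ hβ h1 h2 with h3 | ⟨k, hk, hk3, ho, h4⟩
  -- No threshold is left: the index alone shows that the environment parameter is at least K²T, the
  -- largest rescaling possible.
  · have h5 : 1 / √((s n).wbar T j) ≤ √((s n).env j) := by
      rw [← Real.sqrt_one, ← Real.sqrt_div zero_le_one]
      apply Real.sqrt_le_sqrt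
      rw [h3] at henv
      exact hb2.trans ((le_threshold_numThresholds K T).trans henv)
    have := Real.sqrt_nonneg ((s n).env j)
    linarith
  · have h5 := h.le_add_excess hη₁ hβ hβ2 hℓ j hk ho
    have h6 := h.sum_excess_le_accum hη₁ hβ hℓ j hk3
    have h7 : 1 / √((s k).w j) ≤ √((s n).env j) := by
      rcases h4 with h4 | h4
      · exact (one_div_sqrt_le (threshold_pos _) h4).trans (Real.sqrt_le_sqrt henv)
      · rw [h4.2, ← Real.sqrt_one, ← Real.sqrt_div zero_le_one]
        apply Real.sqrt_le_sqrt
        have := h.w_pos hη₁ hβ k j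
        gcongr
        norm_num
    linarith

/-- Sampling probability of a learner whose negative-regret step was just begun. -/
lemma sampling_nrs_le [NeZero K] (h : IsPath T β η₁ L₀ s ℓ) (hR : Regime K T)
    (hη₁ : ∀ i, 0 < η₁ i) (hβ : 1 ≤ β) (hβ2 : β ≤ 2) (hℓ : ∀ n i, 0 ≤ ℓ n i) {n : ℕ} {j : Fin K}
    (h1 : j ∈ (s n).trig T (K * initRounds T + n)) :
    1 / √((s (n + 1)).wbar T j) ≤ 1.001 * (1 / √((s n).w j) + accum T s ℓ j (n + 1)) := by
  have hw := h.w_pos hη₁ hβ (n + 1) j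
  obtain ⟨-, hb1, -⟩ := State.wbar_bounds hR (s (n + 1)) hw
  have h5 := h.le_add_excess hη₁ hβ hβ2 hℓ j (Nat.le_succ n)
    (fun q h2 h3 => by rw [show q = n by omega]; exact .inl ⟨j, h1⟩)
  have h6 := h.sum_excess_le_accum hη₁ hβ hℓ j (show n + 1 ≤ n + 3 by omega)
  have : n.succ = n + 1 := rfl
  rw [this] at h5
  linarith

/-- Sampling probability of a learner with threshold index `1`. -/
lemma sampling_first_le [NeZero K] (h : IsPath T β η₁ L₀ s ℓ) (hR : Regime K T)
    (hη₁ : ∀ i, 0 < η₁ i) (hβ : 1 ≤ β) (hβ2 : β ≤ 2) (hℓ : ∀ n i, 0 ≤ ℓ n i)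
    {n : ℕ} {j : Fin K} (hℓ1 : ∀ n, ℓ n j ≤ 1 / (s n).wbar T j)
    (h1 : j ∉ (s n).trig T (K * initRounds T + n)) (hθ : (s n).θ j = 1)
    {c y₁ y₂ y₃ : ℝ} (hη : ∀ k < n, n ≤ k + 3 → (s k).η j ≤ c) (hc : 0 ≤ c)
    (hy₁ : 6 + 1.01 * c * 6 ^ 2 ≤ y₁) (hy₂ : y₁ + 1.01 * c * y₁ ^ 2 ≤ y₂)
    (hy₃ : y₂ + 1.01 * c * y₂ ^ 2 ≤ y₃) :
    1 / √((s n).wbar T j) ≤ 1.001 * y₃ := by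
  have hw := h.w_pos hη₁ hβ n j
  obtain ⟨hb0, hb1, hb2⟩ := State.wbar_bounds hR (s n) hw
  have h61 : (6 : ℝ) ≤ y₁ := le_trans (by nlinarith) hy₁
  have h12 : y₁ ≤ y₂ := le_trans (by nlinarith [mul_nonneg hc (sq_nonneg y₁)]) hy₂
  have h23 : y₂ ≤ y₃ := le_trans (by nlinarith [mul_nonneg hc (sq_nonneg y₂)]) hy₃
  have h2 : j ∉ (s n).nrs := fun h2 => by
    have := ((h.env_inv hη₁ hβ n j).2.1 h2).1; omega
  -- An unobserved update adds at most ηℓ ≤ c/wbar to y = 1/√w, and 1/wbar ≤ 1.01 y². At most three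
  -- of them follow the last observation, where y ≤ 6, the root of the first threshold.
  have hstep : ∀ k < n, n ≤ k + 3 → IsOmd T s k → ∀ y y', 1 / √((s k).w j) ≤ y →
      y + 1.01 * c * y ^ 2 ≤ y' → 1 / √((s (k + 1)).w j) ≤ y' := by
    intro k hk hk3 ho y y' hy hy'
    have h3 := h.omd_le hη₁ hβ hβ2 hℓ ho j
    have hwk := h.w_pos hη₁ hβ k j
    obtain ⟨hk0, hk1, -⟩ := State.wbar_bounds hR (s k) hwk
    have h4 : 1 / (s k).wbar T j ≤ 1.01 * y ^ 2 := by
      have h5 : 1 / (s k).wbar T j = (1 / √((s k).wbar T j)) ^ 2 := by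
        rw [div_pow, Real.sq_sqrt hk0.le, one_pow]
      rw [h5]
      have h6 : 0 ≤ 1 / √((s k).wbar T j) := by positivity
      have h7 : 0 ≤ 1 / √((s k).w j) := by positivity
      calc (1 / √((s k).wbar T j)) ^ 2 ≤ (1.001 * y) ^ 2 :=
            pow_le_pow_left₀ h6 (hk1.trans (by gcongr)) 2
        _ ≤ 1.01 * y ^ 2 := by nlinarith [sq_nonneg y]
    have h5 : (s k).η j * ℓ k j ≤ c * (1.01 * y ^ 2) :=
      mul_le_mul (hη k hk hk3) ((hℓ1 k).trans h4) (hℓ k j) hc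
    linarith
  have key : 1 / √((s n).w j) ≤ y₃ := by
    rcases h.observed hη₁ hβ h1 h2 with h3 | ⟨k, hk, hk3, ho, h4⟩
    · have := one_le_numThresholds K T; omega
    · have h5 : 1 / √((s k).w j) ≤ 6 := by
        rcases h4 with h4 | h4
        · rw [hθ] at h4
          have := one_div_sqrt_le (threshold_pos 1) h4
          rw [threshold_one] at this
          rwa [show (36 : ℝ) = 6 ^ 2 by norm_num, Real.sqrt_sq (by norm_num)] at this
        · omega
      obtain h6 | h6 | h6 | h6 : n = k ∨ n = k + 1 ∨ n = k + 2 ∨ n = k + 3 := by omega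
      · rw [h6]; linarith
      · have := hstep k (by omega) (by omega) (ho k le_rfl (by omega)) _ _ h5 hy₁
        rw [h6]; linarith
      · have := hstep k (by omega) (by omega) (ho k le_rfl (by omega)) _ _ h5 hy₁
        have := hstep (k + 1) (by omega) (by omega) (ho _ (by omega) (by omega)) _ _ this hy₂
        rw [h6]; linarith
      · have := hstep k (by omega) (by omega) (ho k le_rfl (by omega)) _ _ h5 hy₁
        have := hstep (k + 1) (by omega) (by omega) (ho _ (by omega) (by omega)) _ _ this hy₂
        have := hstep (k + 2) (by omega) (by omega) (ho _ (by omega) (by omega)) _ _ this hy₃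
        rw [h6]; linarith
  linarith

end IsPath

/-! ## The rounds between two restarts of a learner -/

section

variable {K : ℕ} (T : ℕ) (s : ℕ → State K) (ℓ : ℕ → Fin K → ℝ) (j : Fin K)

/-- Learner `j` has its first threshold and is above it. -/
def Active (n : ℕ) : Prop := (s n).θ j = 1 ∧ j ∉ (s n).trig T (K * initRounds T + n)

/-- The rounds of the segment of learner `j` that begins with round `p`, before round `N`. -/
def InSegment (N p n : ℕ) : Prop :=
  n < N ∧ (s n).start j = initRounds T + p ∧ (2 ≤ (s p).θ j ∨ Active T s j n)

open Classical in
/-- `1 / √w` in a round in which a negative-regret step is begun, and `0` otherwise. -/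
def trigCost (n : ℕ) : ℝ :=
  if j ∈ (s n).trig T (K * initRounds T + n) then 1 / √((s n).w j) else 0

/-- Bound for the length of a segment that contains round `n`. -/
def lengthBound (K T n : ℕ) : ℕ := n + 2 * (K * initRounds T) + 4

open Classical in
/-- Bound for the regret of learner `j` in the segment that begins with round `p`. -/
def segmentCost (κ r : ℝ) (N p : ℕ) : ℝ :=
  if (s p).start j = initRounds T + p then
    1.43 * κ * √(lengthBound K T p) * trigCost T s j (p - 2) +
    ∑ n ∈ Finset.Ico p N, if (s n).start j = initRounds T + p then
      κ * √(lengthBound K T n) * (1.04 * trigCost T s j n + 1.01 * accum T s ℓ j n) +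
        (if n + 1 = N then 6.2 * r else 0) else 0
  else 0

end

namespace IsPath

variable {K : ℕ} {T : ℕ} {β : ℝ} {η₁ L₀ : Fin K → ℝ} {s : ℕ → State K} {ℓ : ℕ → Fin K → ℝ}
  {j : Fin K}

lemma not_restart (h : IsPath T β η₁ L₀ s ℓ) {n : ℕ}
    (he : (s (n + 1)).start j = (s n).start j) :
    ¬ (s n).EpochRestart (K * initRounds T + n) j ∧ j ∉ (s n).nrs := by
  have h1 := (h.start_bounds n j).1
  rw [h.start_succ] at he
  by_contra h2
  rw [if_pos (by tauto)] at he
  omega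

/-- A restart sets the clock beyond all earlier values, so the old value of `start` shows that
nothing was restarted since the segment began; the environment parameter is then the same too. -/
lemma start_const (h : IsPath T β η₁ L₀ s ℓ) {a p n : ℕ} (ha : a ≤ initRounds T + p)
    (hn : (s n).start j = a) {k : ℕ} (hpk : p ≤ k) (hkn : k ≤ n) :
    (s k).start j = a ∧ (s k).env j = (s n).env j := by
  induction n, hkn using Nat.le_induction with
  | base => exact ⟨hn, rfl⟩
  | succ n hkn ih =>
    have h1 : ¬ ((s n).EpochRestart (K * initRounds T + n) j ∨ j ∈ (s n).nrs) := by
      intro h2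
      rw [h.start_succ, if_pos h2] at hn
      omega
    rw [h.start_succ, if_neg h1] at hn
    obtain ⟨h2, h3⟩ := ih hn
    refine ⟨h2, ?_⟩
    rw [h3, h.env_succ, if_neg (by tauto), if_neg (by tauto)]

/-- The index returns to 1 only when an epoch begins, and then the learner is restarted. Without a
restart it was 1 before, and no step was begun. -/
lemma active_of_succ (h : IsPath T β η₁ L₀ s ℓ) {n : ℕ}
    (he : (s (n + 1)).start j = (s n).start j) (ha : (s (n + 1)).θ j = 1) :
    Active T s j n := by
  obtain ⟨h1, h2⟩ := h.not_restart he
  have hb := (h.θ_bounds n j).1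
  have hθ := ha
  rw [h.θ_succ] at hθ
  split_ifs at hθ with h3 h4
  · have h5 : 1 / threshold 1 < (s n).w j := by
      by_contra! h5
      have := two_le_thresholdIndex (K := K) (T := T) h5
      omega
    refine ⟨?_, fun h6 => ?_⟩
    · by_contra h6
      exact h1 ⟨h3, h5, by omega⟩
    · rcases State.mem_trig.1 h6 with h7 | h7
      · exact absurd h7.2 (not_le.2 h5)
      · exact h7.1 h3
  · omega
  · exact ⟨hθ, h4⟩

lemma two_le_θ_succ (h : IsPath T β η₁ L₀ s ℓ) {n : ℕ}
    (he : (s (n + 1)).start j = (s n).start j) (hθ : 2 ≤ (s n).θ j) : 2 ≤ (s (n + 1)).θ j := by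
  by_contra h1
  have h2 := (h.θ_bounds (n + 1) j).1
  have h3 := (h.active_of_succ he (by omega)).1
  omega

lemma succ_of_active [NeZero K] (h : IsPath T β η₁ L₀ s ℓ) (hη₁ : ∀ i, 0 < η₁ i) (hβ : 1 ≤ β)
    {n : ℕ} (ha : Active T s j n) :
    (s (n + 1)).start j = (s n).start j ∧ (s (n + 1)).θ j = 1 := by
  have h1 : j ∉ (s n).nrs := fun h1 => by
    have := ((h.env_inv hη₁ hβ n j).2.1 h1).1
    have := ha.1
    omega
  have h2 : ¬ (s n).EpochRestart (K * initRounds T + n) j := fun h2 => by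
    have := h2.2.2
    have := ha.1
    omega
  refine ⟨by rw [h.start_succ, if_neg (by tauto)], ?_⟩
  rw [h.θ_succ]
  split_ifs with h3 h4
  · apply thresholdIndex_eq_one
    by_contra! h5
    exact ha.2 (State.mem_trig.2 (.inl ⟨h3, h5⟩))
  · exact absurd h4 ha.2
  · exact ha.1

lemma two_le_θ_of_start (h : IsPath T β η₁ L₀ s ℓ) {p n : ℕ} (hpn : p ≤ n)
    (hθ : 2 ≤ (s p).θ j) (hn : (s n).start j = initRounds T + p) : 2 ≤ (s n).θ j := by
  induction n, hpn using Nat.le_induction with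
  | base => exact hθ
  | succ n hpn ih =>
    have h1 := (h.start_const le_rfl hn hpn (Nat.le_succ n)).1
    exact h.two_le_θ_succ (hn.trans h1.symm) (ih h1)

/-- Segments which begin with a restart after a negative-regret step end soon after the end of
the epoch. -/
lemma segment_length_le (h : IsPath T β η₁ L₀ s ℓ) (hM : 2 ≤ K * initRounds T) {p n : ℕ}
    (hpn : p ≤ n) (hθ : 2 ≤ (s p).θ j) (hn : (s n).start j = initRounds T + p) :
    n ≤ 2 * p + 2 * (K * initRounds T) + 3 := by
  -- The segment belongs to one epoch: when the next begins, a learner with index at least 2 is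
  -- restarted at once or, being below the first threshold, enters a negative-regret step that
  -- restarts it after the following round. The second alternative is that delay.
  suffices (s n).epoch = (s p).epoch ∨
      (j ∈ (s n).nrs ∧ K * initRounds T + n ≤ (s p).epoch + 3) by
    have h1 := h.epoch_le p
    have h2 := h.round_le_epoch hM n
    have h3 := (s n).tag_le_three
    rcases this with h4 | h4 <;> omega
  induction n, hpn using Nat.le_induction with
  | base => exact .inl rfl
  | succ n hpn ih =>
    have h1 := (h.start_const le_rfl hn hpn (Nat.le_succ n)).1
    have h2 := h.not_restart (hn.trans h1.symm)
    have h3 := h.two_le_θ_of_start hpn hθ h1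
    have h4 : (s n).epoch = (s p).epoch := by
      rcases ih h1 with h4 | h4
      · exact h4
      · exact absurd h4.1 h2.2
    rw [h.epoch_succ, h.nrs_succ]
    split_ifs with h5
    · right
      refine ⟨State.mem_trig.2 (.inl ⟨h5, ?_⟩), ?_⟩
      · by_contra! h6
        exact h2.1 ⟨h5, h6, h3⟩
      · have := h.round_le_epoch hM n
        have := (s n).tag_le_three
        omega
    · exact .inl h4

/-- A restart by an epoch sets the index to 1, so a segment that starts with a larger one comes from
a negative-regret step, begun two rounds earlier. -/
lemma restart_of_two_le [NeZero K] (h : IsPath T β η₁ L₀ s ℓ) {p : ℕ} (hp : 1 ≤ p)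
    (hθ : 2 ≤ (s p).θ j) (hs : (s p).start j = initRounds T + p) :
    ∃ t, p = t + 2 ∧ j ∈ (s t).trig T (K * initRounds T + t) ∧ (s p).env j = 2 / (s t).w j ∧
      j ∉ (s p).nrs := by
  obtain ⟨q, rfl⟩ : ∃ q, p = q + 1 := ⟨p - 1, by omega⟩
  have h1 : ¬ (s q).EpochRestart (K * initRounds T + q) j := fun h1 => by
    rw [h.θ_succ, if_pos h1.1, thresholdIndex_eq_one h1.2.1] at hθ
    omega
  have h2 : j ∈ (s q).nrs := by
    by_contra h2
    rw [h.start_succ, if_neg (by tauto)] at hs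
    have := (h.start_bounds q j).1
    omega
  have h3 := tag_of_nrs h2
  obtain ⟨t, rfl, -, h4⟩ := h.back_one h3
  refine ⟨t, rfl, by rwa [h.nrs_succ] at h2, ?_, ?_⟩
  · rw [h.env_succ, if_neg h1, if_pos h2, h4]
  · rw [h.nrs_succ, trig_eq_empty (.inl h3)]
    simp

section sampling

variable [NeZero K] (h : IsPath T (mult T) η₁ L₀ s ℓ) (hR : Regime K T) (hη₁ : ∀ i, 0 < η₁ i)
  (hη₁' : ∀ i, η₁ i ≤ 1 / 4) (hℓ : ∀ n i, 0 ≤ ℓ n i) (hℓ1 : ∀ n, ℓ n j ≤ 1 / (s n).wbar T j)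
include h hR hη₁ hη₁' hℓ hℓ1

omit hR hη₁' hℓ hℓ1 in
lemma sqrt_env_le_of_active {n : ℕ} (ha : Active T s j n) : √((s n).env j) ≤ 6 := by
  have h1 : j ∉ (s n).nrs := fun h1 => by
    have := ((h.env_inv hη₁ (one_le_mult T) n j).2.1 h1).1
    have := ha.1
    omega
  have h2 := ((h.env_inv hη₁ (one_le_mult T) n j).2.2 h1).1 ha.1
  rw [Real.sqrt_le_left (by norm_num)]
  linarith

/-- Crude but valid in all rounds: y ↦ y + 1.01 · 1.9 y² leads from 6 to at most 76, 11200 and 2.5 ·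
10⁸. It is needed for a bounded number of early segments only. -/
lemma sampling_of_active {n : ℕ} (hn : n + K * initRounds T ≤ T) (ha : Active T s j n) :
    1 / √((s n).wbar T j) ≤ 300000000 :=
  (h.sampling_first_le hR hη₁ (one_le_mult T) hR.mult_le_two hℓ hℓ1 ha.2 ha.1 (c := 1.9)
    (y₁ := 76) (y₂ := 11200) (y₃ := 250000000)
    (fun k hk _ => h.η_lt hR hη₁ hη₁' (by omega) j) (by norm_num) (by norm_num) (by norm_num)
    (by norm_num)).trans (by norm_num)

/-- After 6M ≥ 24000000 rounds the step size is at most 6/4800, so three unobserved updates hardly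
move 1/√w away from 6. -/
lemma sampling_of_active_late {n : ℕ} (hn : n + K * initRounds T ≤ T)
    (hn' : 6 * (K * initRounds T) ≤ n) (ha : Active T s j n) :
    1 / √((s n).wbar T j) ≤ 6.2 := by
  refine (h.sampling_first_le hR hη₁ (one_le_mult T) hR.mult_le_two hℓ hℓ1 ha.2 ha.1 (c := 0.00125)
    (y₁ := 6.046) (y₂ := 6.093) (y₃ := 6.15)
    (fun k hk hk3 => ?_) (by norm_num) (by norm_num) (by norm_num)
    (by norm_num)).trans (by norm_num)
  refine (h.η_le_sqrt hR hη₁ (by omega) j).trans ?_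
  have h1 : (4800 : ℝ) ≤ √((k : ℝ) + 1) := by
    apply Real.le_sqrt_of_sq_le
    have h2 := hR.le_init
    have h3 : 4800 ^ 2 ≤ k + 1 := by omega
    exact_mod_cast h3
  rw [div_le_iff₀ (by linarith)]
  have := hη₁' j
  linarith

omit hη₁' hℓ1 in
-- A round either triggers, or follows a trigger, or is controlled by the threshold and hence by the
-- environment parameter. In the first two cases the weight of the triggering round, which lies in
-- the same segment, takes over.
lemma sampling_of_segment {p n : ℕ} (hp : 1 ≤ p) (hpn : p ≤ n) (hθ : 2 ≤ (s p).θ j)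
    (hn : (s n).start j = initRounds T + p) :
    ∃ k, p ≤ k ∧ k ≤ n ∧ (s k).start j = initRounds T + p ∧
      1 / √((s n).wbar T j) ≤ 1.001 * (√((s p).env j) + trigCost T s j k + accum T s ℓ j n) := by
  have h1 := h.start_const le_rfl hn le_rfl hpn
  have h2 := h.two_le_θ_of_start hpn hθ hn
  have h3 := h.accum_nonneg hη₁ (one_le_mult T) hℓ j n
  have h4 := Real.sqrt_nonneg ((s p).env j)
  by_cases ht : j ∈ (s n).trig T (K * initRounds T + n)
  · refine ⟨n, hpn, le_rfl, hn, ?_⟩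
    have := (State.wbar_bounds hR (s n) (h.w_pos hη₁ (one_le_mult T) n j)).2.1
    rw [trigCost, if_pos ht]
    linarith
  by_cases hnrs : j ∈ (s n).nrs
  · obtain ⟨k, rfl, -, -⟩ := h.back_one (tag_of_nrs hnrs)
    have hpk : p ≤ k := by
      by_contra hlt
      obtain ⟨t, -, -, -, h5⟩ := h.restart_of_two_le hp hθ h1.1
      obtain rfl : p = k + 1 := by omega
      exact h5 hnrs
    have hk := (h.start_const le_rfl hn hpk (Nat.le_succ k)).1
    rw [h.nrs_succ] at hnrs
    refine ⟨k, hpk, Nat.le_succ k, hk, ?_⟩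
    have := h.sampling_nrs_le hR hη₁ (one_le_mult T) hR.mult_le_two hℓ hnrs
    rw [trigCost, if_pos hnrs]
    linarith
  · refine ⟨n, hpn, le_rfl, hn, ?_⟩
    have := h.sampling_le hR hη₁ (one_le_mult T) hR.mult_le_two hℓ ht hnrs h2
    rw [trigCost, if_neg ht, h1.2]
    linarith

end sampling

lemma trigCost_nonneg (n : ℕ) : 0 ≤ trigCost T s j n := by
  unfold trigCost; split_ifs
  · positivity
  · exact le_rfl

section cost

variable [NeZero K] (h : IsPath T (mult T) η₁ L₀ s ℓ) (hR : Regime K T) (hη₁ : ∀ i, 0 < η₁ i)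
  (hη₁' : ∀ i, η₁ i ≤ 1 / 4) (hℓ : ∀ n i, 0 ≤ ℓ n i)
  {R : ℕ → ℝ} {κ : ℝ} (hR0 : ∀ t, 0 ≤ R t) (hRm : Monotone R) (hκ : 0 ≤ κ)
  (hRκ : ∀ t, 1 ≤ t → t ≤ T → R t ≤ κ * √(t : ℝ))
include h hR hη₁ hℓ hRκ hκ hR0

omit [NeZero K] hR hRκ in
lemma segmentCost_nonneg (N p : ℕ) : 0 ≤ segmentCost T s ℓ j κ (R T) N p := by
  unfold segmentCost
  have h1 := fun n => trigCost_nonneg (T := T) (s := s) (j := j) n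
  have h2 := h.accum_nonneg hη₁ (one_le_mult T) hℓ j
  split_ifs
  · refine add_nonneg (mul_nonneg (by positivity) (h1 _)) (Finset.sum_nonneg fun n _ => ?_)
    split_ifs
    · exact add_nonneg (mul_nonneg (by positivity) (add_nonneg (mul_nonneg (by norm_num) (h1 n))
        (mul_nonneg (by norm_num) (h2 n)))) (mul_nonneg (by norm_num) (hR0 T))
    · exact add_nonneg (mul_nonneg (by positivity) (add_nonneg (mul_nonneg (by norm_num) (h1 n))
        (mul_nonneg (by norm_num) (h2 n)))) le_rfl
    · exact le_rfl
  · exact le_rfl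

include hη₁' hRm in
/-- Regret bound for a segment: `Z` bounds the square roots of the rescaling factors. -/
lemma segment_bound (hℓ1 : ∀ n, ℓ n j ≤ 1 / (s n).wbar T j) {N p : ℕ}
    (hN : N + K * initRounds T ≤ T) (hp : 6 * (K * initRounds T) ≤ p)
    (hs : (s p).start j = initRounds T + p) :
    ∃ Z : ℝ, (InSegment T s j N p p → √((s p).env j) ≤ Z) ∧
      (∀ q, InSegment T s j N p (p + q) → 1 / √((s (p + q)).wbar T j) ≤ Z) ∧
      ∀ t, InSegment T s j N p (p + t) → ¬ InSegment T s j N p (p + (t + 1)) →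
        Z * R (t + 1) ≤ segmentCost T s ℓ j κ (R T) N p := by
  have hM := hR.le_init
  have hc1 := fun n => trigCost_nonneg (T := T) (s := s) (j := j) n
  have hc2 := h.accum_nonneg hη₁ (one_le_mult T) hℓ j
  have hterm : ∀ n, 0 ≤ κ * √(lengthBound K T n) *
      (1.04 * trigCost T s j n + 1.01 * accum T s ℓ j n) := fun n =>
    mul_nonneg (by positivity) (add_nonneg (mul_nonneg (by norm_num) (hc1 n))
      (mul_nonneg (by norm_num) (hc2 n)))
  have hlast : ∀ n, 0 ≤ (if n + 1 = N then 6.2 * R T else 0) := fun n => by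
    split_ifs
    · exact mul_nonneg (by norm_num) (hR0 T)
    · exact le_rfl
  by_cases hθ : 2 ≤ (s p).θ j
  · obtain ⟨u, hu, hut, henv, -⟩ := h.restart_of_two_le (by omega) hθ hs
    have hpu : p - 2 = u := by omega
    have hw := h.w_pos hη₁ (one_le_mult T) u j
    have hY : √((s p).env j) ≤ 1.415 * trigCost T s j (p - 2) := by
      rw [henv, hpu, trigCost, if_pos hut, Real.sqrt_div zero_le_two, mul_one_div]
      gcongr
      rw [Real.sqrt_le_left (by norm_num)]; norm_num
    have hY0 := hc1 (p - 2)
    set f : ℕ → ℝ := fun n => open Classical in if (s n).start j = initRounds T + p then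
      1.001 * trigCost T s j n + 1.001 * accum T s ℓ j n else 0 with hf
    have hf0 : ∀ n, 0 ≤ f n := fun n => by
      simp only [hf]
      split_ifs
      · have := hc1 n; have := hc2 n; positivity
      · exact le_rfl
    -- A maximum over rounds is replaced by a sum, so that it can be charged round by round after
    -- exchanging sums. 1.43 covers 1.001 · √2, with √2 from the parameter 2 / w.
    set Z : ℝ := 1.43 * trigCost T s j (p - 2) + ∑ n ∈ Finset.Ico p N, f n with hZ
    have hS0 : 0 ≤ ∑ n ∈ Finset.Ico p N, f n := Finset.sum_nonneg fun n _ => hf0 n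
    refine ⟨Z, fun _ => by linarith, fun q hq => ?_, fun t ht _ => ?_⟩
    · obtain ⟨k, hk1, hk2, hk3, hk4⟩ := h.sampling_of_segment hR hη₁ hℓ (by omega : 1 ≤ p)
        (Nat.le_add_right p q) hθ hq.2.1
      have hsum : 1.001 * trigCost T s j k + 1.001 * accum T s ℓ j (p + q) ≤
          ∑ n ∈ Finset.Ico p N, f n := by
        by_cases hkq : k = p + q
        · have h1 := Finset.single_le_sum (f := f) (fun n _ => hf0 n)
            (Finset.mem_Ico.2 ⟨Nat.le_add_right p q, hq.1⟩)
          simp only [hf, if_pos hq.2.1] at h1 ⊢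
          rw [hkq]; exact h1
        · have hsub : ({k, p + q} : Finset ℕ) ⊆ Finset.Ico p N := by
            intro x hx
            have := hq.1
            rw [Finset.mem_insert, Finset.mem_singleton] at hx
            rw [Finset.mem_Ico]
            omega
          have h1 := Finset.sum_le_sum_of_subset_of_nonneg (f := f) hsub fun n _ _ => hf0 n
          rw [Finset.sum_pair hkq] at h1
          simp only [hf, if_pos hq.2.1, if_pos hk3] at h1 ⊢
          have := hc1 (p + q); have := hc2 k
          linarith
      linarith
    -- The length is at most linear in the first round of the segment, so `R` of it is at most κ
    -- times the root attached to any round of the segment.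
    · have hlen := h.segment_length_le (by omega) (Nat.le_add_right p t) hθ ht.2.1
      have hbound : ∀ n, p ≤ n → R (t + 1) ≤ κ * √(lengthBound K T n) := fun n hn => by
        refine (hRκ _ (by omega) (by have := ht.1; omega)).trans ?_
        gcongr
        unfold lengthBound; omega
      have hR1 := hR0 (t + 1)
      unfold segmentCost
      rw [if_pos hs, hZ, add_mul, Finset.sum_mul]
      refine add_le_add ?_ (Finset.sum_le_sum fun n hn => ?_)
      · have := mul_le_mul_of_nonneg_left (hbound p le_rfl) (mul_nonneg (by norm_num : (0:ℝ) ≤ 1.43) hY0)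
        linarith
      · simp only [hf]
        split_ifs with h1 h2
        · have h3 := mul_le_mul_of_nonneg_left (hbound n (Finset.mem_Ico.1 hn).1)
            (by have := hc1 n; have := hc2 n; positivity :
              0 ≤ 1.001 * trigCost T s j n + 1.001 * accum T s ℓ j n)
          have h4 := mul_nonneg (mul_nonneg hκ (Real.sqrt_nonneg (lengthBound K T n))) (hc1 n)
          have h5 := mul_nonneg (mul_nonneg hκ (Real.sqrt_nonneg (lengthBound K T n))) (hc2 n)
          have h6 := hR0 T
          nlinarith
        · have h3 := mul_le_mul_of_nonneg_left (hbound n (Finset.mem_Ico.1 hn).1)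
            (by have := hc1 n; have := hc2 n; positivity :
              0 ≤ 1.001 * trigCost T s j n + 1.001 * accum T s ℓ j n)
          have h4 := mul_nonneg (mul_nonneg hκ (Real.sqrt_nonneg (lengthBound K T n))) (hc1 n)
          have h5 := mul_nonneg (mul_nonneg hκ (Real.sqrt_nonneg (lengthBound K T n))) (hc2 n)
          nlinarith
        · simp
  -- A segment with the first threshold may last for many epochs, so its length says nothing. It is
  -- followed only while the learner is active, and √ρ stays below 6.2 until then.
  · refine ⟨6.2, fun hq => ?_, fun q hq => ?_, fun t ht ht' => ?_⟩
    · have ha := hq.2.2.resolve_left hθ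
      have := h.sqrt_env_le_of_active hη₁ ha
      linarith
    · have ha := hq.2.2.resolve_left hθ
      exact h.sampling_of_active_late hR hη₁ hη₁' hℓ hℓ1 (by have := hq.1; omega) (by omega) ha
    · have ha := ht.2.2.resolve_left hθ
      obtain ⟨h1, h2⟩ := h.succ_of_active hη₁ (one_le_mult T) ha
      unfold segmentCost
      rw [if_pos hs]
      have hfirst : 0 ≤ 1.43 * κ * √(lengthBound K T p) * trigCost T s j (p - 2) :=
        mul_nonneg (by positivity) (hc1 _)
      refine le_trans ?_ (le_add_of_nonneg_left hfirst)
      have hnn : ∀ n ∈ Finset.Ico p N, 0 ≤ (open Classical in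
        if (s n).start j = initRounds T + p then
          κ * √(lengthBound K T n) * (1.04 * trigCost T s j n + 1.01 * accum T s ℓ j n) +
            (if n + 1 = N then 6.2 * R T else 0) else 0) := fun n _ => by
        split_ifs with h3 h4
        · have := hterm n; have := hR0 T; linarith
        · have := hterm n; linarith
        · exact le_rfl
      -- If a trigger cuts the segment, its 1/√w ≥ 6 takes the charge, as 1.04 · 6 > 6.2. If the
      -- segment lasts up to `N`, which happens to at most one, `R T` itself is paid.
      by_cases hlt : p + (t + 1) < N
      · have h3 : j ∈ (s (p + (t + 1))).trig T (K * initRounds T + (p + (t + 1))) := by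
          by_contra h3
          exact ht' ⟨hlt, h1.trans ht.2.1, .inr ⟨h2, h3⟩⟩
        refine le_trans ?_ (Finset.single_le_sum hnn
          (Finset.mem_Ico.2 ⟨by omega, hlt⟩ : p + (t + 1) ∈ Finset.Ico p N))
        rw [if_pos (show (s (p + (t + 1))).start j = _ from h1.trans ht.2.1)]
        refine le_trans ?_ (le_add_of_nonneg_right (hlast _))
        have h4 : R (t + 1) ≤ κ * √(lengthBound K T (p + (t + 1))) := by
          refine (hRκ _ (by omega) (by omega)).trans ?_
          gcongr
          unfold lengthBound; omega
        have h5 : 6 ≤ trigCost T s j (p + (t + 1)) := by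
          rw [trigCost, if_pos h3]
          exact six_le_of_le (h.w_pos hη₁ (one_le_mult T) _ j) (h.le_of_mem_trig h3)
        have h6 := hc2 (p + (t + 1))
        rw [mul_comm]
        refine mul_le_mul h4 (by linarith) (by norm_num) (by positivity)
      · have h3 : p + t + 1 = N := by have := ht.1; omega
        refine le_trans ?_ (Finset.single_le_sum hnn
          (Finset.mem_Ico.2 ⟨by omega, ht.1⟩ : p + t ∈ Finset.Ico p N))
        rw [if_pos ht.2.1, if_pos h3]
        have h4 : R (t + 1) ≤ R T := hRm (by omega)
        have := hterm (p + t)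
        linarith

omit [NeZero K] hR hRκ in
/-- The sum of the bounds for all segments that begin in a late round. -/
lemma sum_segmentCost_le (a N : ℕ) :
    ∑ p ∈ Finset.Ico a N, segmentCost T s ℓ j κ (R T) N p ≤
      ∑ n ∈ Finset.Ico a N, (1.43 * κ * √(lengthBound K T n) * trigCost T s j (n - 2) +
        κ * √(lengthBound K T n) * (1.04 * trigCost T s j n + 1.01 * accum T s ℓ j n)) +
      6.2 * R T := by
  classical
  have hc1 := fun n => trigCost_nonneg (T := T) (s := s) (j := j) n
  have hc2 := h.accum_nonneg hη₁ (one_le_mult T) hℓ j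
  set g : ℕ → ℝ := fun n => κ * √(lengthBound K T n) *
      (1.04 * trigCost T s j n + 1.01 * accum T s ℓ j n) + (if n + 1 = N then 6.2 * R T else 0)
    with hg
  have hg0 : ∀ n, 0 ≤ g n := fun n => by
    have h1 : 0 ≤ κ * √(lengthBound K T n) *
      (1.04 * trigCost T s j n + 1.01 * accum T s ℓ j n) :=
      mul_nonneg (by positivity) (add_nonneg (mul_nonneg (by norm_num) (hc1 n))
        (mul_nonneg (by norm_num) (hc2 n)))
    have := hR0 T
    simp only [hg]
    split_ifs <;> linarith
  calc _ ≤ ∑ p ∈ Finset.Ico a N, (1.43 * κ * √(lengthBound K T p) * trigCost T s j (p - 2) +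
        ∑ n ∈ Finset.Ico a N, if (s n).start j = initRounds T + p then g n else 0) := by
        refine Finset.sum_le_sum fun p hp => ?_
        have h1 : 0 ≤ ∑ n ∈ Finset.Ico a N, if (s n).start j = initRounds T + p then g n else 0 :=
          Finset.sum_nonneg fun n _ => by
            split_ifs
            · exact hg0 n
            · exact le_rfl
        unfold segmentCost
        split_ifs with h2
        · refine add_le_add le_rfl (Finset.sum_le_sum_of_subset_of_nonneg
            (Finset.Ico_subset_Ico (Finset.mem_Ico.1 hp).1 le_rfl) fun n _ _ => ?_)
          by_cases h3 : (s n).start j = initRounds T + p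
          · rw [if_pos h3]; exact hg0 n
          · rw [if_neg h3]
        · exact add_nonneg (mul_nonneg (by positivity) (hc1 _)) h1
    _ ≤ ∑ p ∈ Finset.Ico a N, 1.43 * κ * √(lengthBound K T p) * trigCost T s j (p - 2) +
        ∑ n ∈ Finset.Ico a N, g n := by
        -- A round belongs to at most one segment, so after exchanging the sums each round is
        -- charged once.
        rw [Finset.sum_add_distrib, Finset.sum_comm]
        refine add_le_add le_rfl (Finset.sum_le_sum fun n _ => ?_)
        by_cases h3 : ∃ p ∈ Finset.Ico a N, (s n).start j = initRounds T + p
        · obtain ⟨p, hp, h4⟩ := h3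
          rw [Finset.sum_eq_single p, if_pos h4]
          · intro q _ hqp
            rw [if_neg (by omega)]
          · exact fun h5 => absurd hp h5
        · push Not at h3
          rw [Finset.sum_eq_zero fun p hp => if_neg (h3 p hp)]
          exact hg0 n
    _ ≤ _ := by
        simp only [hg, Finset.sum_add_distrib]
        have : ∑ n ∈ Finset.Ico a N, (if n + 1 = N then 6.2 * R T else 0) ≤ 6.2 * R T := by
          have h5 : 0 ≤ 6.2 * R T := mul_nonneg (by norm_num) (hR0 T)
          by_cases h3 : N = 0
          · subst h3; simpa using h5
          · calc _ ≤ ∑ n ∈ Finset.Ico a N, (if n = N - 1 then 6.2 * R T else 0) :=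
                  Finset.sum_le_sum fun n _ => by
                    split_ifs
                    · exact le_rfl
                    · omega
                    · exact h5
                    · exact le_rfl
              _ ≤ _ := by
                rw [Finset.sum_ite_eq']
                split_ifs
                · exact le_rfl
                · exact h5
        linarith

end cost

end IsPath

/-! ## A priori bounds -/

/-- Some coordinate is at least 1/K, which bounds the multiplier from above and thereby every 1/√w.
Only finiteness matters: these bounds serve integrability. -/
lemma IsKKT.one_div_sqrt_le {K : ℕ} [NeZero K] {η L w : Fin K → ℝ} {c B : ℝ}
    (h : IsKKT η L w c) (hη : ∀ i, 0 < η i) (hB : ∀ i, η i ≤ B) (hB' : ∀ i, 1 / η i ≤ B)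
    (hL : ∀ i, |L i| ≤ B) (i : Fin K) : 1 / √(w i) ≤ 1 + B / 2 * (2 * B + 2 * √K * B) := by
  have hK : (0 : ℝ) < K := by exact_mod_cast NeZero.pos K
  have hB0 : 0 ≤ B := (hη i).le.trans (hB i)
  obtain ⟨q, hq⟩ : ∃ q, 1 / (K : ℝ) ≤ w q := by
    by_contra! hlt
    have h1 : ∑ i, w i < ∑ _i : Fin K, 1 / (K : ℝ) :=
      Finset.sum_lt_sum_of_nonempty ⟨i, Finset.mem_univ i⟩ fun j _ => hlt j
    rw [h.sum] at h1
    simp [hK.ne'] at h1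
  have h1 : 1 / √(w q) ≤ √K := IsPath.one_div_sqrt_le hK hq
  have h2 : c ≤ 2 * √K * B + B := by
    have h3 := h.eq q
    have h4 : 2 * (1 / √(w q) - 1) / η q ≤ 2 * √K * B := by
      rw [div_eq_mul_one_div]
      refine mul_le_mul (by linarith) (hB' q) (by have := hη q; positivity) (by positivity)
    have := neg_abs_le (L q)
    have := hL q
    linarith
  have h3 := h.eq i
  rw [div_eq_iff (hη i).ne'] at h3
  have h4 : L i + c ≤ 2 * B + 2 * √K * B := by
    have := le_abs_self (L i)
    have := hL i
    linarith
  have h5 : (L i + c) * η i ≤ (2 * B + 2 * √K * B) * B :=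
    mul_le_mul h4 (hB i) (hη i).le (by positivity)
  linarith

/-- All quantities that make up the state are bounded by `B`. -/
structure State.Bounded {K : ℕ} (B : ℝ) (s : State K) : Prop where
  η : ∀ i, s.η i ≤ B
  one_div_η : ∀ i, 1 / s.η i ≤ B
  L : ∀ i, |s.L i| ≤ B
  one_div_sqrt : ∀ i, 1 / √(s.w i) ≤ B
  env : ∀ i, s.env i ≤ B
  begunAt : ∀ i ∈ s.nrs, 2 / s.begunAt i ≤ B

/-- The state before round `n` is bounded if the estimated losses are. -/
lemma IsPath.exists_bounded {K : ℕ} [NeZero K] {T : ℕ} {β : ℝ} {η₁ : Fin K → ℝ}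
    (hη₁ : ∀ i, 0 < η₁ i) (hβ : 1 ≤ β) (b₀ b : ℝ) (n : ℕ) :
    ∃ B, ∀ (L₀ : Fin K → ℝ) (s : ℕ → State K) (ℓ : ℕ → Fin K → ℝ), IsPath T β η₁ L₀ s ℓ →
      (∀ i, |L₀ i| ≤ b₀) → (∀ n i, |ℓ n i| ≤ b) → (s n).Bounded B := by
  have hsum : ∀ {f : Fin K → ℝ}, (∀ i, 0 ≤ f i) → ∀ i, f i ≤ ∑ i, f i := fun hf i =>
    Finset.single_le_sum (fun j _ => hf j) (Finset.mem_univ i)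
  induction n with
  | zero =>
    have hp : ∀ i, 0 < decrease η₁ η₁ i := decrease_pos hη₁ hη₁
    set B₁ : ℝ := ∑ i, decrease η₁ η₁ i + ∑ i, 1 / decrease η₁ η₁ i + |b₀| with hB₁
    have h1 := hsum fun i => (hp i).le
    have h2 := hsum (f := fun i => 1 / decrease η₁ η₁ i) fun i => by have := hp i; positivity
    have h3 : 0 ≤ ∑ i, decrease η₁ η₁ i := Finset.sum_nonneg fun i _ => (hp i).le
    have h4 : 0 ≤ ∑ i, 1 / decrease η₁ η₁ i :=
      Finset.sum_nonneg fun i _ => by have := hp i; positivity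
    have h5 := abs_nonneg b₀
    have hB0 : 0 ≤ B₁ := by positivity
    set B₂ : ℝ := 1 + B₁ / 2 * (2 * B₁ + 2 * √K * B₁) with hB₂
    have hB2 : 0 ≤ B₂ := by positivity
    refine ⟨B₁ + B₂ + 1, fun L₀ s ℓ h hL hℓ => ?_⟩
    obtain ⟨c, hc⟩ := h.kkt hη₁ hβ 0
    rw [h.zero] at hc ⊢
    have hη : ∀ i, decrease η₁ η₁ i ≤ B₁ := fun i => by have := h1 i; linarith
    have hη' : ∀ i, 1 / decrease η₁ η₁ i ≤ B₁ := fun i => by have := h2 i; linarith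
    have hL' : ∀ i, |L₀ i| ≤ B₁ := fun i => by have := hL i; have := le_abs_self b₀; linarith
    refine ⟨fun i => ?_, fun i => ?_, fun i => ?_, fun i => ?_, fun i => ?_, fun i hi => ?_⟩
    · have := hη i; simp only [State.initial]; linarith
    · have := hη' i; simp only [State.initial]; linarith
    · have := hL' i; simp only [State.initial]; linarith
    · have := hc.one_div_sqrt_le hp hη hη' hL' i; linarith
    · simp only [State.initial]; linarith
    · simp [State.initial, State.nrs] at hi
  | succ n ih =>
    obtain ⟨B', hB'⟩ := ih
    set B : ℝ := |B'| with hB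
    have hB0 : 0 ≤ B := abs_nonneg _
    have hβ0 : 0 < β := by linarith
    set B₁ : ℝ := β * B + B + ∑ i, B / (2 * η₁ i ^ 2) with hB₁
    have h1 := hsum (f := fun i => B / (2 * η₁ i ^ 2)) fun i => by positivity
    have h2 : 0 ≤ ∑ i, B / (2 * η₁ i ^ 2) := Finset.sum_nonneg fun i _ => by positivity
    have hB1 : 0 ≤ B₁ := by positivity
    have hβB : B ≤ β * B := by nlinarith
    set B₂ : ℝ := B₁ + 2 * (B + 1) * B₁ + B + |b| with hB₂
    have hb := abs_nonneg b
    have hB2 : 0 ≤ B₂ := by positivity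
    set B₃ : ℝ := 1 + B₂ / 2 * (2 * B₂ + 2 * √K * B₂) with hB₃
    have hB3 : 0 ≤ B₃ := by positivity
    refine ⟨36 + 2 * B ^ 2 + B₂ + B₃, fun L₀ s ℓ h hL hℓ => ?_⟩
    have hx := hB' L₀ s ℓ h hL hℓ
    have hη0 := h.η_pos hη₁ hβ n
    have hη0' := h.η_pos hη₁ hβ (n + 1)
    have hle := le_abs_self B'
    have e1 : ∀ i, (s (n + 1)).η i ≤ B₁ := fun i => by
      have h3 := hx.η i
      have h4 := (one_div_decrease hη₁ hη0 i).1
      have h5 := (one_div_le_one_div (hη0 i) (decrease_pos hη₁ hη0 i)).1 h4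
      have h6 : β * (s n).η i ≤ β * B := by gcongr; linarith
      rw [h.η_succ]
      split_ifs <;> linarith
    have e2 : ∀ i, 1 / (s (n + 1)).η i ≤ B₁ := fun i => by
      have h3 := hx.one_div_η i
      have h4 := (one_div_decrease hη₁ hη0 i).2
      have h5 : (s n).η i / (2 * η₁ i ^ 2) ≤ B / (2 * η₁ i ^ 2) := by
        have := hx.η i
        gcongr; linarith
      have h6 := h1 i
      have h7 : 1 / (β * (s n).η i) ≤ 1 / (s n).η i :=
        one_div_le_one_div_of_le (hη0 i) (by nlinarith [hη0 i])
      have h8 : 0 ≤ β * B := by positivity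
      rw [h.η_succ]
      split_ifs <;> linarith
    have hw0 := h.w_pos hη₁ hβ n
    have hY1 : ∀ i, 1 ≤ 1 / √((s n).w i) := fun i => by
      rw [le_div_iff₀ (Real.sqrt_pos.2 (hw0 i)), one_mul]
      exact (Real.sqrt_le_sqrt (h.w_le_one hη₁ hβ n i)).trans_eq Real.sqrt_one
    have hℓ' : ∀ i, |ℓ n i| ≤ |b| := fun i => (hℓ n i).trans (le_abs_self b)
    have e3 : ∀ i, |(s (n + 1)).L i| ≤ B₂ := fun i => by
      have h3 := hx.L i
      have h4 := hℓ' i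
      have h5 := abs_add_le ((s n).L i) (ℓ n i)
      have h6 : 0 ≤ 2 * (B + 1) * B₁ := by positivity
      have hadd : |(s n).L i + ℓ n i| ≤ B₂ := by linarith
      have e2i := e2 i
      rw [h.succ n] at e2i ⊢
      rcases (s n).next_cases T β η₁ (K * initRounds T + n) (initRounds T + n + 1) (ℓ n) with
        ⟨-, -, h7, -⟩ | ⟨-, h7, -⟩ | ⟨-, h7, -⟩ | ⟨-, h7, -⟩
      · rw [h7]; exact hadd
      · rw [h7]; exact hadd
      · rw [h7]
        have hηi := hη0' i
        rw [h.succ n] at hηi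
        set e := ((s n).next T β η₁ (K * initRounds T + n) (initRounds T + n + 1) (ℓ n)).η i
          with he
        have h8 : |-gradPsi ((s n).next T β η₁ (K * initRounds T + n)
            (initRounds T + n + 1) (ℓ n)).η (s n).w i| ≤ 2 * (B + 1) * B₁ := by
          have h9 : -gradPsi ((s n).next T β η₁ (K * initRounds T + n)
            (initRounds T + n + 1) (ℓ n)).η (s n).w i = 2 * (1 / √((s n).w i) - 1) * (1 / e) := by
            unfold gradPsi; rw [← he]; ring
          have h10 := hx.one_div_sqrt i
          have h11 := hY1 i
          rw [h9, abs_of_nonneg (mul_nonneg (by linarith) (by positivity))]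
          exact mul_le_mul (by linarith) e2i (by positivity) (by positivity)
        refine (abs_add_le _ _).trans ?_
        linarith
      · rw [h7]; exact hadd
    obtain ⟨c, hc⟩ := h.kkt hη₁ hβ (n + 1)
    have hB12 : B₁ ≤ B₂ := by
      have : 0 ≤ 2 * (B + 1) * B₁ := by positivity
      linarith
    have e4 := hc.one_div_sqrt_le hη0' (fun i => (e1 i).trans hB12) (fun i => (e2 i).trans hB12) e3
    have hsq : 0 ≤ B ^ 2 := sq_nonneg B
    have hBB2 : B ≤ B₂ := by
      have : 0 ≤ 2 * (B + 1) * B₁ := by positivity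
      linarith
    refine ⟨fun i => ?_, fun i => ?_, fun i => ?_, fun i => ?_, fun i => ?_, fun i hi => ?_⟩
    · have := e1 i; linarith
    · have := e2 i; linarith
    · have := e3 i; linarith
    · have := e4 i; linarith
    · have h3 := hx.env i
      rw [h.env_succ]
      split_ifs with h4 h5
      · rw [threshold_one]; linarith
      · have := hx.begunAt i h5; linarith
      · linarith
    · rw [h.nrs_succ] at hi
      rw [h.begunAt_succ, if_pos ⟨i, hi⟩]
      have h3 := hx.one_div_sqrt i
      have h4 := hY1 i
      have h5 : 2 / (s n).w i = 2 * (1 / √((s n).w i)) ^ 2 := by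
        rw [div_pow, Real.sq_sqrt (hw0 i).le]; ring
      have h6 : (1 / √((s n).w i)) ^ 2 ≤ B ^ 2 := by
        apply pow_le_pow_left₀ (by positivity); linarith
      rw [h5]; linarith

/-! ## Measurability of the state -/

lemma measurable_thresholdIndex (K T : ℕ) : Measurable (thresholdIndex K T) := by
  have : Antitone (thresholdIndex K T) := fun x y hxy => by
    obtain ⟨h1, h2⟩ := thresholdIndex_spec K T x
    exact Nat.sInf_le ⟨h1, h2.imp_left fun h => h.trans_le hxy⟩
  exact this.measurable

/-- A random state whose fields are measurable. -/
structure MeasurableState {Ω : Type*} (m : MeasurableSpace Ω) {K : ℕ} (S : Ω → State K) :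
    Prop where
  w : ∀ i, Measurable[m] fun ω => (S ω).w i
  η : ∀ i, Measurable[m] fun ω => (S ω).η i
  θ : ∀ i, Measurable[m] fun ω => (S ω).θ i
  env : ∀ i, Measurable[m] fun ω => (S ω).env i
  start : ∀ i, Measurable[m] fun ω => (S ω).start i
  epoch : Measurable[m] fun ω => (S ω).epoch
  tag : Measurable[m] fun ω => (S ω).tag
  nrs : ∀ i, MeasurableSet[m] {ω | i ∈ (S ω).nrs}
  begunAt : ∀ i, Measurable[m] fun ω => (S ω).begunAt i

namespace MeasurableState

variable {Ω : Type*} {K : ℕ}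

lemma mono {m m' : MeasurableSpace Ω} {S : Ω → State K} (h : MeasurableState m S) (hm : m ≤ m') :
    MeasurableState m' S :=
  ⟨fun i => (h.w i).mono hm le_rfl, fun i => (h.η i).mono hm le_rfl,
    fun i => (h.θ i).mono hm le_rfl, fun i => (h.env i).mono hm le_rfl,
    fun i => (h.start i).mono hm le_rfl, h.epoch.mono hm le_rfl, h.tag.mono hm le_rfl,
    fun i => hm _ (h.nrs i), fun i => (h.begunAt i).mono hm le_rfl⟩

variable [m : MeasurableSpace Ω] {S : Ω → State K}

lemma measurableSet_tag (h : MeasurableState m S) (t : ℕ) : MeasurableSet {ω | (S ω).tag = t} :=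
  h.tag (measurableSet_singleton t)

lemma atEpoch (h : MeasurableState m S) (r : ℕ) : MeasurableSet {ω | (S ω).AtEpoch r} :=
  ((h.measurableSet_tag 0).union (h.measurableSet_tag 3)).inter
    (measurableSet_le h.epoch measurable_const)

lemma trig (h : MeasurableState m S) (T r : ℕ) (i : Fin K) :
    MeasurableSet {ω | i ∈ (S ω).trig T r} := by
  have h1 : {ω | i ∈ (S ω).trig T r} =
      ({ω | (S ω).AtEpoch r} ∩ {ω | (S ω).w i ≤ 1 / threshold 1}) ∪
      ({ω | (S ω).AtEpoch r}ᶜ ∩ ({ω | (S ω).tag = 0} ∩ ({ω | (S ω).θ i ≤ numThresholds K T} ∩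
        {ω | (S ω).w i ≤ 1 / threshold ((S ω).θ i)}))) := by
    ext ω; exact State.mem_trig
  rw [h1]
  have h2 : Measurable fun ω => 1 / threshold ((S ω).θ i) :=
    (measurable_of_countable fun n : ℕ => 1 / threshold n).comp (h.θ i)
  exact ((h.atEpoch r).inter (measurableSet_le (h.w i) measurable_const)).union
    ((h.atEpoch r).compl.inter ((h.measurableSet_tag 0).inter
      ((measurableSet_le (h.θ i) measurable_const).inter (measurableSet_le (h.w i) h2))))

lemma trig_nonempty (h : MeasurableState m S) (T r : ℕ) :
    MeasurableSet {ω | ((S ω).trig T r).Nonempty} := by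
  have : {ω | ((S ω).trig T r).Nonempty} = ⋃ i, {ω | i ∈ (S ω).trig T r} := by
    ext ω; simp [Finset.Nonempty]
  rw [this]
  exact MeasurableSet.iUnion fun i => h.trig T r i

lemma isFtrl (h : MeasurableState m S) (T r : ℕ) : MeasurableSet {ω | (S ω).IsFtrl T r} := by
  have : {ω | (S ω).IsFtrl T r} = ({ω | (S ω).tag = 0} ∪ {ω | (S ω).tag = 3}) ∩
      {ω | ((S ω).trig T r).Nonempty}ᶜ := by
    ext ω
    exact and_congr_right fun _ => Finset.not_nonempty_iff_eq_empty.symm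
  rw [this]
  exact ((h.measurableSet_tag 0).union (h.measurableSet_tag 3)).inter
    (h.trig_nonempty T r).compl

lemma epochRestart (h : MeasurableState m S) (r : ℕ) (i : Fin K) :
    MeasurableSet {ω | (S ω).EpochRestart r i} :=
  (h.atEpoch r).inter ((measurableSet_lt measurable_const (h.w i)).inter
    (measurableSet_le measurable_const (h.θ i)))

/-- The state after an update is measurable if the new distribution is. -/
lemma next (h : MeasurableState m S) {T : ℕ} {β : ℝ} {η₁ : Fin K → ℝ} {r clock : ℕ}
    {ℓ : Ω → Fin K → ℝ}
    (hw : ∀ i, Measurable fun ω => ((S ω).next T β η₁ r clock (ℓ ω)).w i) :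
    MeasurableState m fun ω => (S ω).next T β η₁ r clock (ℓ ω) where
  w := hw
  η i := by
    simp only [State.next_η]
    refine Measurable.ite (h.isFtrl T r) ?_ (Measurable.ite (h.nrs i) ((h.η i).const_mul β) (h.η i))
    unfold decrease
    have := h.η i
    fun_prop
  θ i := by
    simp only [State.next_θ]
    exact Measurable.ite (h.atEpoch r) ((measurable_thresholdIndex K T).comp (h.w i))
      (Measurable.ite (h.trig T r i) ((h.θ i).add_const 1) (h.θ i))
  env i := by
    simp only [State.next_env]
    exact Measurable.ite (h.epochRestart r i) measurable_const
      (Measurable.ite (h.nrs i) ((h.begunAt i).const_div 2) (h.env i))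
  start i := by
    simp only [State.next_start]
    exact Measurable.ite ((h.epochRestart r i).union (h.nrs i)) measurable_const (h.start i)
  epoch := by
    simp only [State.next_epoch]
    exact Measurable.ite (h.atEpoch r) ((h.epoch.const_mul 2).add_const _) h.epoch
  tag := by
    simp only [State.next_tag]
    exact Measurable.ite (h.trig_nonempty T r) measurable_const
      (Measurable.ite ((h.measurableSet_tag 0).union (h.measurableSet_tag 3)) measurable_const
        (h.tag.add_const 1))
  nrs i := by
    simp only [State.next_nrs]
    exact h.trig T r i
  begunAt i := by
    have : ∀ ω, ((S ω).next T β η₁ r clock (ℓ ω)).begunAt i = open Classical in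
        if ((S ω).trig T r).Nonempty then (S ω).w i else 0 := fun ω => by
      rw [State.next_begunAt]; split_ifs <;> rfl
    simp only [this]
    exact Measurable.ite (h.trig_nonempty T r) (h.w i) measurable_const

lemma wbar (h : MeasurableState m S) (T : ℕ) (i : Fin K) :
    Measurable fun ω => (S ω).wbar T i :=
  ((h.w i).const_mul _).add_const _

end MeasurableState

lemma MeasurableState.initial {Ω : Type*} {m : MeasurableSpace Ω} {K T : ℕ} {η₁ : Fin K → ℝ}
    {L : Ω → Fin K → ℝ} (hw : ∀ i, Measurable[m] fun ω => (State.initial T η₁ (L ω)).w i) :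
    MeasurableState m fun ω => State.initial T η₁ (L ω) :=
  ⟨hw, fun _ => measurable_const, fun _ => measurable_const, fun _ => measurable_const,
    fun _ => measurable_const, measurable_const, measurable_const,
    fun i => by simp [State.initial, State.nrs], fun _ => measurable_const⟩

/-- The state before round `n` of the main phase is determined by the past. -/
lemma IsRun.measurableState {K : ℕ} {k : Fin K → ℕ} {A : (i : Fin K) → Learner (k i)}
    {D : Measure ((i : Fin K) → Fin (k i) → ℝ)} {T : ℕ} {β : ℝ} {η₁ : Fin K → ℝ} {Ω : Type u}
    [m0 : MeasurableSpace Ω] {P : Measure Ω} {ℱ : Filtration ℕ m0} {X : Ω → Trajectory K k}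
    (h : IsRun A D T β η₁ P ℱ X) (n : ℕ) :
    MeasurableState (ℱ (K * initRounds T + n)) fun ω => (X ω).state T β η₁ n := by
  -- The weights are chosen minimizers, so their measurability is part of the notion of a run; that
  -- of the other fields is deduced from it.
  induction n with
  | zero => exact MeasurableState.initial fun i => h.measurable_weights 0 i
  | succ n ih =>
    exact MeasurableState.next (m := ℱ (K * initRounds T + (n + 1)))
      (ih.mono (ℱ.mono (by omega))) fun i => h.measurable_weights (n + 1) i

/-! ## Essentially bounded random variables -/

/-- Measurable and almost surely bounded. -/
def EssBounded {Ω : Type*} [MeasurableSpace Ω] (P : Measure Ω) (f : Ω → ℝ) : Prop :=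
  Measurable f ∧ ∃ B, ∀ᵐ ω ∂P, |f ω| ≤ B

namespace EssBounded

variable {Ω : Type*} [MeasurableSpace Ω] {P : Measure Ω} {f g : Ω → ℝ}

lemma const (c : ℝ) : EssBounded P fun _ => c :=
  ⟨measurable_const, |c|, Filter.Eventually.of_forall fun _ => le_rfl⟩

lemma add (hf : EssBounded P f) (hg : EssBounded P g) : EssBounded P fun ω => f ω + g ω := by
  obtain ⟨hf, B, hB⟩ := hf
  obtain ⟨hg, B', hB'⟩ := hg
  refine ⟨hf.add hg, B + B', ?_⟩
  filter_upwards [hB, hB'] with ω h1 h2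
  exact (abs_add_le _ _).trans (add_le_add h1 h2)

lemma mul (hf : EssBounded P f) (hg : EssBounded P g) : EssBounded P fun ω => f ω * g ω := by
  obtain ⟨hf, B, hB⟩ := hf
  obtain ⟨hg, B', hB'⟩ := hg
  refine ⟨hf.mul hg, B * B', ?_⟩
  filter_upwards [hB, hB'] with ω h1 h2
  rw [abs_mul]
  exact mul_le_mul h1 h2 (abs_nonneg _) ((abs_nonneg _).trans h1)

lemma const_mul (c : ℝ) (hf : EssBounded P f) : EssBounded P fun ω => c * f ω := (const c).mul hf

lemma sub (hf : EssBounded P f) (hg : EssBounded P g) : EssBounded P fun ω => f ω - g ω := by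
  have h := hf.add (hg.const_mul (-1))
  simpa only [neg_one_mul, ← sub_eq_add_neg] using h

lemma sum {ι : Type*} (s : Finset ι) {F : ι → Ω → ℝ} (h : ∀ i ∈ s, EssBounded P (F i)) :
    EssBounded P fun ω => ∑ i ∈ s, F i ω := by
  classical
  induction s using Finset.induction_on with
  | empty => simpa using const (P := P) 0
  | insert a s ha ih =>
    simp only [Finset.sum_insert ha]
    exact (h a (Finset.mem_insert_self a s)).add
      (ih fun i hi => h i (Finset.mem_insert_of_mem hi))

lemma ite {p : Ω → Prop} [DecidablePred p] (hp : MeasurableSet {ω | p ω}) (hf : EssBounded P f)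
    (hg : EssBounded P g) : EssBounded P fun ω => if p ω then f ω else g ω := by
  obtain ⟨hf, B, hB⟩ := hf
  obtain ⟨hg, B', hB'⟩ := hg
  refine ⟨Measurable.ite hp hf hg, max B B', ?_⟩
  filter_upwards [hB, hB'] with ω h1 h2
  split_ifs
  · exact h1.trans (le_max_left _ _)
  · exact h2.trans (le_max_right _ _)

lemma of_le (hf : Measurable f) {B : ℝ} (h : ∀ᵐ ω ∂P, 0 ≤ f ω ∧ f ω ≤ B) : EssBounded P f :=
  ⟨hf, B, h.mono fun _ hω => (abs_of_nonneg hω.1).trans_le hω.2⟩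

lemma integrable [IsFiniteMeasure P] (hf : EssBounded P f) : Integrable f P := by
  obtain ⟨hf, B, hB⟩ := hf
  exact Integrable.of_bound hf.aestronglyMeasurable B hB

end EssBounded

/-- Equal integrals over all past events mean equal conditional expectations, and a factor known
from the past can be pulled out. -/
lemma integral_mul_eq_of_setIntegral_eq {Ω : Type*} {m m0 : MeasurableSpace Ω} (hm : m ≤ m0)
    {P : Measure Ω} [IsFiniteMeasure P] {f g Z : Ω → ℝ} (hf : Integrable f P)
    (hg : Integrable g P) (h : ∀ S, MeasurableSet[m] S → ∫ ω in S, f ω ∂P = ∫ ω in S, g ω ∂P)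
    (hZ : Measurable[m] Z) (hZb : EssBounded P Z) :
    ∫ ω, Z ω * f ω ∂P = ∫ ω, Z ω * g ω ∂P := by
  have h1 : P[f | m] =ᵐ[P] P[g | m] := by
    refine ae_eq_condExp_of_forall_setIntegral_eq hm hg
      (fun s _ _ => integrable_condExp.integrableOn) (fun s hs _ => ?_)
      stronglyMeasurable_condExp.aestronglyMeasurable
    rw [setIntegral_condExp hm hf hs, h s hs]
  obtain ⟨-, B, hB⟩ := hZb
  have h2 := condExp_stronglyMeasurable_mul_of_bound hm hZ.stronglyMeasurable hf B hB
  have h3 := condExp_stronglyMeasurable_mul_of_bound hm hZ.stronglyMeasurable hg B hB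
  have h4 : P[Z * f | m] =ᵐ[P] P[Z * g | m] := by
    filter_upwards [h1, h2, h3] with ω h1 h2 h3
    rw [h2, h3, Pi.mul_apply, Pi.mul_apply, h1]
  have h5 := integral_congr_ae h4
  rw [integral_condExp hm, integral_condExp hm] at h5
  exact h5

/-- If a random vector has law `D` conditionally on an event, then so have its functions. -/
lemma setIntegral_comp_of_law {Ω E : Type*} [MeasurableSpace Ω] [MeasurableSpace E]
    {P : Measure Ω} [IsFiniteMeasure P] {D : Measure E} [IsProbabilityMeasure D] {Y : Ω → E}
    (hY : Measurable Y) {z : Set Ω}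
    (h : ∀ B, MeasurableSet B → P.real (z ∩ {ω | Y ω ∈ B}) = P.real z * D.real B) {f : E → ℝ}
    (hf : Measurable f) : ∫ ω in z, f (Y ω) ∂P = P.real z * ∫ x, f x ∂D := by
  have h1 : (P.restrict z).map Y = (P z) • D := by
    ext B hB
    rw [Measure.map_apply hY hB, Measure.restrict_apply (hY hB), Measure.smul_apply, smul_eq_mul,
      Set.inter_comm]
    have h2 := h B hB
    rw [measureReal_def, measureReal_def, measureReal_def, ← ENNReal.toReal_mul] at h2
    rwa [ENNReal.toReal_eq_toReal_iff' (measure_ne_top _ _)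
      (ENNReal.mul_ne_top (measure_ne_top _ _) (measure_ne_top _ _))] at h2
  rw [← integral_map hY.aemeasurable hf.aestronglyMeasurable, h1, integral_smul_measure,
    smul_eq_mul, measureReal_def]

lemma measurable_apply_of_countable {ι Ω β : Type*} [Countable ι] [MeasurableSpace ι]
    [MeasurableSingletonClass ι] [MeasurableSpace Ω] [MeasurableSpace β] {f : ι → Ω → β}
    (hf : ∀ i, Measurable (f i)) {g : Ω → ι} (hg : Measurable g) :
    Measurable fun ω => f (g ω) ω := by
  have h : Measurable fun p : Ω × ι => f p.2 p.1 := measurable_from_prod_countable_left hf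
  exact h.comp (measurable_id.prodMk hg)

/-- Marginal of a product law: the factors other than `i` sum to 1. Truncating the factor at `i` to
the single value `j` turns the filtered sum into an unrestricted one. -/
lemma sum_prod_eq_of_sum_eq_one {ι : Type*} [Fintype ι] [DecidableEq ι] {κ : ι → Type*}
    [∀ i, Fintype (κ i)] [∀ i, DecidableEq (κ i)] {p : ∀ i, κ i → ℝ} (hp : ∀ i, ∑ j, p i j = 1)
    (i : ι) (j : κ i) :
    ∑ x ∈ Finset.univ.filter (fun x : ∀ i, κ i => x i = j), ∏ i, p i (x i) = p i j := by
  set q : ∀ i, κ i → ℝ := Function.update p i (fun j' => if j' = j then p i j' else 0) with hq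
  have h1 : ∀ x : ∀ i, κ i, (if x i = j then ∏ i, p i (x i) else 0) = ∏ i, q i (x i) := by
    intro x
    have h2 : ∀ k ∈ Finset.univ.erase i, q k (x k) = p k (x k) := fun k hk => by
      rw [hq, Function.update_of_ne (Finset.ne_of_mem_erase hk)]
    rw [← Finset.mul_prod_erase _ _ (Finset.mem_univ i),
      ← Finset.mul_prod_erase _ (fun i => q i (x i)) (Finset.mem_univ i),
      Finset.prod_congr rfl h2, hq, Function.update_self]
    split_ifs <;> simp
  rw [Finset.sum_filter, Finset.sum_congr rfl fun x _ => h1 x]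
  have h3 := Finset.prod_univ_sum (fun i => (Finset.univ : Finset (κ i))) q
  rw [Fintype.piFinset_univ] at h3
  rw [← h3, ← Finset.mul_prod_erase _ _ (Finset.mem_univ i)]
  have h4 : ∏ k ∈ Finset.univ.erase i, ∑ j, q k j = 1 :=
    Finset.prod_eq_one fun k hk => by
      rw [hq, Function.update_of_ne (Finset.ne_of_mem_erase hk)]; exact hp k
  rw [h4, mul_one, hq, Function.update_self]
  simp

/-! ## One round of a run -/

namespace IsRun

variable {K : ℕ} {k : Fin K → ℕ} {A : (i : Fin K) → Learner (k i)}
  {D : Measure ((i : Fin K) → Fin (k i) → ℝ)} {T : ℕ} {β : ℝ} {η₁ : Fin K → ℝ} {Ω : Type u}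
  [m0 : MeasurableSpace Ω] {P : Measure Ω} {ℱ : Filtration ℕ m0} {X : Ω → Trajectory K k}

lemma measurable_chosen' (h : IsRun A D T β η₁ P ℱ X) (r : ℕ) :
    Measurable fun ω => (X ω).chosen r :=
  measurable_to_countable' fun i => ℱ.le _ _ (h.measurable_chosen r i)

lemma measurable_arm (h : IsRun A D T β η₁ P ℱ X) (i : Fin K) (q : ℕ) :
    Measurable fun ω => (X ω).arm i q := by
  refine measurable_to_countable' fun j => ?_
  by_cases hq : q < initRounds T
  · exact ℱ.le _ _ (h.measurable_arm_init q hq i j)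
  · obtain ⟨n, rfl⟩ : ∃ n, q = initRounds T + n := ⟨q - initRounds T, by omega⟩
    exact ℱ.le _ _ (h.measurable_arm_main n i j)

lemma measurable_loss' (h : IsRun A D T β η₁ P ℱ X) (r : ℕ) :
    Measurable fun ω => (X ω).loss r := (h.measurable_loss r).mono (ℱ.le _) le_rfl

lemma measurable_loss_apply (h : IsRun A D T β η₁ P ℱ X) (r : ℕ) (i : Fin K) (j : Fin (k i)) :
    Measurable fun ω => (X ω).loss r i j := by
  have := h.measurable_loss' r
  fun_prop

lemma measurable_loss_arm (h : IsRun A D T β η₁ P ℱ X) (r : ℕ) (i : Fin K) (q : ℕ) :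
    Measurable fun ω => (X ω).loss r i ((X ω).arm i q) :=
  measurable_apply_of_countable (f := fun j ω => (X ω).loss r i j)
    (fun j => h.measurable_loss_apply r i j) (h.measurable_arm i q)

lemma measurable_playedLoss (h : IsRun A D T β η₁ P ℱ X) (r : ℕ) :
    Measurable fun ω => (X ω).playedLoss T r :=
  measurable_apply_of_countable
    (f := fun i ω => (X ω).loss r i ((X ω).arm i (Trajectory.ownRound K T r)))
    (fun i => h.measurable_loss_arm r i _) (h.measurable_chosen' r)

lemma measurableState' (h : IsRun A D T β η₁ P ℱ X) (n : ℕ) :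
    MeasurableState m0 fun ω => (X ω).state T β η₁ n := (h.measurableState n).mono (ℱ.le _)

/-- The estimated losses in round `n` of the main phase. -/
def est (T : ℕ) (β : ℝ) (η₁ : Fin K → ℝ) (x : Trajectory K k) (n : ℕ) : Fin K → ℝ :=
  x.lossEstimate T (K * initRounds T + n) ((x.state T β η₁ n).wbar T)

lemma measurable_est (h : IsRun A D T β η₁ P ℱ X) (n : ℕ) (i : Fin K) :
    Measurable fun ω => est T β η₁ (X ω) n i := by
  unfold est Trajectory.lossEstimate iwLoss
  simp only [decide_eq_true_eq]
  exact Measurable.ite (h.measurable_chosen' _ (measurableSet_singleton i))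
    ((h.measurable_playedLoss _).div ((h.measurableState' n).wbar T i)) measurable_const

lemma measurable_history (h : IsRun A D T β η₁ P ℱ X) (i : Fin K) (q n : ℕ) :
    Measurable fun ω => (X ω).history T β η₁ i q n := by
  refine measurable_pi_lambda _ fun a => (h.measurable_arm i _).prodMk ?_
  unfold Trajectory.feedback
  split_ifs with hq
  · exact h.measurable_loss_arm _ i _
  · exact h.measurable_est _ i

/-- The probabilities with which learner `i` proposes its arms in round `n` of the main phase. -/
def armProb (A : (i : Fin K) → Learner (k i)) (T : ℕ) (β : ℝ) (η₁ : Fin K → ℝ)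
    (x : Trajectory K k) (n : ℕ) (i : Fin K) : Fin (k i) → ℝ :=
  (A i).policy ((x.state T β η₁ n).env i) (initRounds T + n - (x.state T β η₁ n).start i)
    (x.history T β η₁ i ((x.state T β η₁ n).start i)
      (initRounds T + n - (x.state T β η₁ n).start i))

lemma measurable_armProb (h : IsRun A D T β η₁ P ℱ X) (n : ℕ) (i : Fin K) (j : Fin (k i)) :
    Measurable fun ω => armProb A T β η₁ (X ω) n i j :=
  measurable_apply_of_countable
    (f := fun a ω => (A i).policy (((X ω).state T β η₁ n).env i) (initRounds T + n - a)
      ((X ω).history T β η₁ i a (initRounds T + n - a)) j)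
    (fun a => ((A i).measurable_policy _ j).comp
      (((h.measurableState' n).env i).prodMk (h.measurable_history i a _)))
    ((h.measurableState' n).start i)

lemma armProb_mem (x : Trajectory K k) (n : ℕ) (i : Fin K) :
    armProb A T β η₁ x n i ∈ stdSimplex ℝ (Fin (k i)) := (A i).policy_mem _ _ _

lemma armProb_le_one (x : Trajectory K k) (n : ℕ) (i : Fin K) (j : Fin (k i)) :
    armProb A T β η₁ x n i j ≤ 1 := by
  have h := armProb_mem (A := A) (T := T) (β := β) (η₁ := η₁) x n i
  rw [← h.2]; exact Finset.single_le_sum (fun j _ => h.1 j) (Finset.mem_univ j)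

section wbar

variable [NeZero K] (hT : 1 ≤ T) (hη₁ : ∀ i, 0 < η₁ i) (hβ : 1 ≤ β) (x : Trajectory K k) (n : ℕ)
include hT hη₁ hβ

lemma wbar_lower (i : Fin K) : 1 / ((K : ℝ) ^ 2 * T) ≤ (x.state T β η₁ n).wbar T i := by
  have hw := ((x.isPath T β η₁).w_pos hη₁ hβ n i).le
  have hK : (1 : ℝ) ≤ K := by exact_mod_cast NeZero.one_le
  have hT' : (1 : ℝ) ≤ T := by exact_mod_cast hT
  have h1 : 1 / ((T : ℝ) * K) ≤ 1 := by rw [div_le_one (by positivity)]; nlinarith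
  have h2 : 1 / ((T : ℝ) * K) * (1 / K) = 1 / ((K : ℝ) ^ 2 * T) := by field_simp
  unfold State.wbar
  rw [h2]
  have := mul_nonneg (sub_nonneg.2 h1) hw
  linarith

lemma wbar_pos (i : Fin K) : 0 < (x.state T β η₁ n).wbar T i := by
  have hK : (1 : ℝ) ≤ K := by exact_mod_cast NeZero.one_le
  have hT' : (1 : ℝ) ≤ T := by exact_mod_cast hT
  exact lt_of_lt_of_le (by positivity) (wbar_lower hT hη₁ hβ x n i)

lemma wbar_sum : ∑ i, (x.state T β η₁ n).wbar T i = 1 := by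
  have hw := (x.isPath T β η₁).w_sum hη₁ hβ n
  have hK : (K : ℝ) ≠ 0 := by exact_mod_cast NeZero.ne K
  unfold State.wbar
  rw [Finset.sum_add_distrib, ← Finset.mul_sum, hw, Finset.sum_const, Finset.card_univ,
    Fintype.card_fin, nsmul_eq_mul]
  field_simp
  ring

lemma wbar_le_one (i : Fin K) : (x.state T β η₁ n).wbar T i ≤ 1 := by
  rw [← wbar_sum hT hη₁ hβ x n]
  exact Finset.single_le_sum (fun j _ => (wbar_pos hT hη₁ hβ x n j).le) (Finset.mem_univ i)

end wbar

section law

variable [IsProbabilityMeasure D] [IsProbabilityMeasure P]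

omit [IsProbabilityMeasure D] [IsProbabilityMeasure P] in
lemma law_mul (h : IsRun A D T β η₁ P ℱ X) (n : ℕ) {S : Set Ω}
    (hS : MeasurableSet[ℱ (K * initRounds T + n)] S) (j : (i : Fin K) → Fin (k i)) (c : Fin K)
    {B : Set ((i : Fin K) → Fin (k i) → ℝ)} (hB : MeasurableSet B) :
    P.real (S ∩ {ω | (∀ i, (X ω).arm i (initRounds T + n) = j i) ∧
        (X ω).chosen (K * initRounds T + n) = c ∧ (X ω).loss (K * initRounds T + n) ∈ B}) =
      (∫ ω in S, (∏ i, armProb A T β η₁ (X ω) n i (j i)) *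
        ((X ω).state T β η₁ n).wbar T c ∂P) * D.real B := by
  rw [h.law_main n S hS j c B hB, ← integral_mul_const]
  rfl

omit [IsProbabilityMeasure D] [IsProbabilityMeasure P] in
lemma measurableSet_main (h : IsRun A D T β η₁ P ℱ X) (n : ℕ) (j : (i : Fin K) → Fin (k i))
    (c : Fin K) {B : Set ((i : Fin K) → Fin (k i) → ℝ)} (hB : MeasurableSet B) :
    MeasurableSet {ω | (∀ i, (X ω).arm i (initRounds T + n) = j i) ∧
      (X ω).chosen (K * initRounds T + n) = c ∧ (X ω).loss (K * initRounds T + n) ∈ B} := by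
  have h1 : {ω | ∀ i, (X ω).arm i (initRounds T + n) = j i} =
      ⋂ i, {ω | (X ω).arm i (initRounds T + n) = j i} := by ext; simp
  have h2 : MeasurableSet {ω | ∀ i, (X ω).arm i (initRounds T + n) = j i} := by
    rw [h1]
    exact MeasurableSet.iInter fun i => h.measurable_arm i _ (measurableSet_singleton (j i))
  exact h2.inter ((h.measurable_chosen' _ (measurableSet_singleton c)).inter
    (h.measurable_loss' _ hB))

variable [NeZero K]

omit [IsProbabilityMeasure D] in
/-- Joint law of the arm of one learner, the choice of the learner, and the losses. -/
lemma law_arm (h : IsRun A D T β η₁ P ℱ X) (hT : 1 ≤ T) (hη₁ : ∀ i, 0 < η₁ i) (hβ : 1 ≤ β)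
    (n : ℕ) {S : Set Ω} (hS : MeasurableSet[ℱ (K * initRounds T + n)] S) (i : Fin K)
    (j : Fin (k i)) (c : Fin K) {B : Set ((i : Fin K) → Fin (k i) → ℝ)} (hB : MeasurableSet B) :
    P.real (S ∩ {ω | (X ω).arm i (initRounds T + n) = j ∧
        (X ω).chosen (K * initRounds T + n) = c ∧ (X ω).loss (K * initRounds T + n) ∈ B}) =
      (∫ ω in S, armProb A T β η₁ (X ω) n i j * ((X ω).state T β η₁ n).wbar T c ∂P) *
        D.real B := by
  classical
  have hS' := ℱ.le _ _ hS
  have h1 : S ∩ {ω | (X ω).arm i (initRounds T + n) = j ∧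
        (X ω).chosen (K * initRounds T + n) = c ∧ (X ω).loss (K * initRounds T + n) ∈ B} =
      ⋃ x ∈ Finset.univ.filter (fun x : (i : Fin K) → Fin (k i) => x i = j),
        S ∩ {ω | (∀ i, (X ω).arm i (initRounds T + n) = x i) ∧
          (X ω).chosen (K * initRounds T + n) = c ∧ (X ω).loss (K * initRounds T + n) ∈ B} := by
    ext ω
    simp only [Set.mem_inter_iff, Set.mem_ofPred_eq, Set.mem_iUnion, Finset.mem_filter,
      Finset.mem_univ, true_and]
    constructor
    · rintro ⟨h1, h2, h3⟩
      exact ⟨fun i => (X ω).arm i (initRounds T + n), h2, h1, fun _ => rfl, h3⟩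
    · rintro ⟨x, hx, h1, h2, h3⟩
      exact ⟨h1, (h2 i).trans hx, h3⟩
  rw [h1, measureReal_biUnion_finset]
  · simp only [h.law_mul n hS _ c hB]
    rw [← Finset.sum_mul, ← integral_finsetSum]
    · congr 1
      refine integral_congr_ae (Filter.Eventually.of_forall fun ω => ?_)
      simp only
      rw [← Finset.sum_mul, sum_prod_eq_of_sum_eq_one (fun i => (armProb_mem (X ω) n i).2) i j]
    · intro x _
      refine Integrable.integrableOn (EssBounded.integrable (EssBounded.of_le (B := 1) ?_ ?_))
      · exact (Finset.measurable_prod _ fun i _ => h.measurable_armProb n i (x i)).mul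
          ((h.measurableState' n).wbar T c)
      · refine Filter.Eventually.of_forall fun ω => ?_
        have h2 : ∀ i, 0 ≤ armProb A T β η₁ (X ω) n i (x i) := fun i =>
          (armProb_mem (X ω) n i).1 _
        have h3 := (wbar_pos hT hη₁ hβ (X ω) n c).le
        exact ⟨mul_nonneg (Finset.prod_nonneg fun i _ => h2 i) h3,
          mul_le_one₀ (Finset.prod_le_one (fun i _ => h2 i) fun i _ => armProb_le_one _ _ _ _) h3
            (wbar_le_one hT hη₁ hβ (X ω) n c)⟩
  · intro x _ y _ hxy
    refine Set.disjoint_left.2 fun ω hx hy => hxy ?_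
    funext i
    rw [← hx.2.1 i, ← hy.2.1 i]
  · intro x _
    exact hS'.inter (h.measurableSet_main n x c hB)

omit [IsProbabilityMeasure D] in
/-- Law of the choice of the learner. -/
lemma prob_chosen (h : IsRun A D T β η₁ P ℱ X) (hT : 1 ≤ T) (hη₁ : ∀ i, 0 < η₁ i) (hβ : 1 ≤ β)
    (n : ℕ) {S : Set Ω} (hS : MeasurableSet[ℱ (K * initRounds T + n)] S) (c : Fin K)
    {B : Set ((i : Fin K) → Fin (k i) → ℝ)} (hB : MeasurableSet B) :
    P.real (S ∩ {ω | (X ω).chosen (K * initRounds T + n) = c ∧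
        (X ω).loss (K * initRounds T + n) ∈ B}) =
      (∫ ω in S, ((X ω).state T β η₁ n).wbar T c ∂P) * D.real B := by
  classical
  have hS' := ℱ.le _ _ hS
  have h1 : S ∩ {ω | (X ω).chosen (K * initRounds T + n) = c ∧
        (X ω).loss (K * initRounds T + n) ∈ B} =
      ⋃ j ∈ (Finset.univ : Finset (Fin (k c))),
        S ∩ {ω | (X ω).arm c (initRounds T + n) = j ∧
          (X ω).chosen (K * initRounds T + n) = c ∧ (X ω).loss (K * initRounds T + n) ∈ B} := by
    ext ω; simp
  rw [h1, measureReal_biUnion_finset]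
  · simp only [h.law_arm hT hη₁ hβ n hS c _ c hB]
    rw [← Finset.sum_mul, ← integral_finsetSum]
    · congr 1
      refine integral_congr_ae (Filter.Eventually.of_forall fun ω => ?_)
      simp only
      rw [← Finset.sum_mul, (armProb_mem (X ω) n c).2, one_mul]
    · intro j _
      refine Integrable.integrableOn (EssBounded.integrable (EssBounded.of_le (B := 1) ?_ ?_))
      · exact (h.measurable_armProb n c j).mul ((h.measurableState' n).wbar T c)
      · refine Filter.Eventually.of_forall fun ω => ?_
        have h3 := (wbar_pos hT hη₁ hβ (X ω) n c).le
        exact ⟨mul_nonneg ((armProb_mem (X ω) n c).1 _) h3,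
          mul_le_one₀ (armProb_le_one _ _ _ _) h3 (wbar_le_one hT hη₁ hβ (X ω) n c)⟩
  · intro x _ y _ hxy
    refine Set.disjoint_left.2 fun ω hx hy => hxy ?_
    rw [← hx.2.1, ← hy.2.1]
  · intro j _
    exact hS'.inter ((h.measurable_arm c _ (measurableSet_singleton j)).inter
      ((h.measurable_chosen' _ (measurableSet_singleton c)).inter (h.measurable_loss' _ hB)))

omit [IsProbabilityMeasure D] in
lemma law_loss_main (h : IsRun A D T β η₁ P ℱ X) (hT : 1 ≤ T) (hη₁ : ∀ i, 0 < η₁ i) (hβ : 1 ≤ β)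
    (n : ℕ) {B : Set ((i : Fin K) → Fin (k i) → ℝ)} (hB : MeasurableSet B) :
    P.real {ω | (X ω).loss (K * initRounds T + n) ∈ B} = D.real B := by
  classical
  have h1 : {ω | (X ω).loss (K * initRounds T + n) ∈ B} =
      ⋃ c ∈ (Finset.univ : Finset (Fin K)), Set.univ ∩
        {ω | (X ω).chosen (K * initRounds T + n) = c ∧
          (X ω).loss (K * initRounds T + n) ∈ B} := by
    ext ω; simp
  rw [h1, measureReal_biUnion_finset]
  · simp only [h.prob_chosen hT hη₁ hβ n MeasurableSet.univ _ hB]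
    rw [← Finset.sum_mul, ← integral_finsetSum]
    · have : ∀ ω, ∑ c, ((X ω).state T β η₁ n).wbar T c = 1 := fun ω =>
        wbar_sum hT hη₁ hβ (X ω) n
      simp [this]
    · intro c _
      refine Integrable.integrableOn (EssBounded.integrable (EssBounded.of_le (B := 1)
        ((h.measurableState' n).wbar T c) (Filter.Eventually.of_forall fun ω =>
          ⟨(wbar_pos hT hη₁ hβ (X ω) n c).le, wbar_le_one hT hη₁ hβ (X ω) n c⟩)))
  · intro x _ y _ hxy
    refine Set.disjoint_left.2 fun ω hx hy => hxy ?_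
    rw [← hx.2.1, ← hy.2.1]
  · intro c _
    exact MeasurableSet.univ.inter ((h.measurable_chosen' _ (measurableSet_singleton c)).inter
      (h.measurable_loss' _ hB))

omit [NeZero K] [IsProbabilityMeasure P] in
lemma law_loss_init (h : IsRun A D T β η₁ P ℱ X) {q : ℕ} (hq : q < initRounds T) (i : Fin K)
    {B : Set ((i : Fin K) → Fin (k i) → ℝ)} (hB : MeasurableSet B) (j : Fin (k i)) :
    P.real ({ω | (X ω).arm i q = j} ∩ {ω | (X ω).loss (q * K + i) ∈ B}) =
      P.real {ω | (X ω).arm i q = j} * D.real B := by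
  have h1 := h.law_init q hq i Set.univ MeasurableSet.univ j B hB
  have h2 := h.law_init q hq i Set.univ MeasurableSet.univ j Set.univ MeasurableSet.univ
  rw [integral_mul_const] at h1 h2
  simp only [Set.univ_inter, Set.mem_univ, and_true, probReal_univ, mul_one] at h1 h2
  rw [h2, ← h1]
  rfl

omit [NeZero K] in
lemma law_loss_init' (h : IsRun A D T β η₁ P ℱ X) {q : ℕ} (hq : q < initRounds T) (i : Fin K)
    {B : Set ((i : Fin K) → Fin (k i) → ℝ)} (hB : MeasurableSet B) :
    P.real {ω | (X ω).loss (q * K + i) ∈ B} = D.real B := by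
  classical
  have hun : ∀ B : Set ((i : Fin K) → Fin (k i) → ℝ), MeasurableSet B →
      P.real {ω | (X ω).loss (q * K + i) ∈ B} = ∑ j : Fin (k i),
        P.real ({ω | (X ω).arm i q = j} ∩ {ω | (X ω).loss (q * K + i) ∈ B}) := fun B hB => by
    have h1 : {ω | (X ω).loss (q * K + i) ∈ B} = ⋃ j ∈ (Finset.univ : Finset (Fin (k i))),
        ({ω | (X ω).arm i q = j} ∩ {ω | (X ω).loss (q * K + i) ∈ B}) := by
      ext ω; simp
    conv_lhs => rw [h1]
    rw [measureReal_biUnion_finset]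
    · intro x _ y _ hxy
      refine Set.disjoint_left.2 fun ω hx hy => hxy ?_
      exact hx.1.symm.trans hy.1
    · intro j _
      exact (h.measurable_arm i _ (measurableSet_singleton j)).inter (h.measurable_loss' _ hB)
  have h2 := hun Set.univ MeasurableSet.univ
  simp only [Set.mem_univ, Set.ofPred_true, Set.inter_univ, probReal_univ] at h2
  rw [hun B hB, Finset.sum_congr rfl fun j _ => h.law_loss_init hq i hB j, ← Finset.sum_mul, ← h2,
    one_mul]

/-- All losses are almost surely in the unit interval. -/
lemma ae_loss_mem (h : IsRun A D T β η₁ P ℱ X) (hT : 1 ≤ T) (hη₁ : ∀ i, 0 < η₁ i) (hβ : 1 ≤ β)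
    (hD : ∀ᵐ x ∂D, ∀ i j, x i j ∈ Set.Icc (0 : ℝ) 1) :
    ∀ᵐ ω ∂P, ∀ r i j, (X ω).loss r i j ∈ Set.Icc (0 : ℝ) 1 := by
  rw [ae_all_iff]
  intro r
  set B : Set ((i : Fin K) → Fin (k i) → ℝ) := {x | ∀ i j, x i j ∈ Set.Icc (0 : ℝ) 1}ᶜ with hB
  have hBm : MeasurableSet B := by
    have : {x : (i : Fin K) → Fin (k i) → ℝ | ∀ i j, x i j ∈ Set.Icc (0 : ℝ) 1} =
        ⋂ i, ⋂ j, {x | x i j ∈ Set.Icc (0 : ℝ) 1} := by ext; simp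
    rw [hB, this]
    exact (MeasurableSet.iInter fun i => MeasurableSet.iInter fun j =>
      (by fun_prop : Measurable fun x : (i : Fin K) → Fin (k i) → ℝ => x i j)
        measurableSet_Icc).compl
  have h0 : D.real B = 0 := by
    rw [measureReal_def, show D B = 0 from hD, ENNReal.toReal_zero]
  have h1 : P.real {ω | (X ω).loss r ∈ B} = 0 := by
    rw [← h0]
    by_cases hr : r < K * initRounds T
    · have hK := NeZero.pos K
      have h2 : r = r / K * K + ((⟨r % K, Nat.mod_lt r hK⟩ : Fin K) : ℕ) := by
        simp only; rw [mul_comm]; exact (Nat.div_add_mod r K).symm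
      rw [h2]
      exact h.law_loss_init' (Nat.div_lt_of_lt_mul hr) _ hBm
    · obtain ⟨n, rfl⟩ : ∃ n, r = K * initRounds T + n := ⟨r - K * initRounds T, by omega⟩
      exact h.law_loss_main hT hη₁ hβ n hBm
  rw [measureReal_eq_zero_iff] at h1
  rw [ae_iff]
  exact h1

end law

end IsRun

/-! ## Own rounds of a learner -/

/-- The round of the game that is the own round `q` of learner `i`. -/
def gameRound {K : ℕ} (T : ℕ) (i : Fin K) (q : ℕ) : ℕ :=
  if q < initRounds T then q * K + i else K * initRounds T + (q - initRounds T)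

lemma gameRound_of_lt {K T : ℕ} (i : Fin K) {q : ℕ} (hq : q < initRounds T) :
    gameRound T i q = q * K + i := if_pos hq

lemma gameRound_of_le {K T : ℕ} (i : Fin K) {q : ℕ} (hq : initRounds T ≤ q) :
    gameRound T i q = K * initRounds T + (q - initRounds T) := if_neg (not_lt.2 hq)

lemma gameRound_lt {K : ℕ} (T : ℕ) (i : Fin K) (q : ℕ) :
    gameRound T i q + 1 ≤ gameRound T i (q + 1) := by
  have hi := i.2
  unfold gameRound
  split_ifs with h1 h2 h2
  · rw [add_mul, one_mul]; omega
  · have : q + 1 = initRounds T := by omega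
    rw [← this, mul_add, mul_one, mul_comm]; omega
  · omega
  · omega

lemma gameRound_mono {K : ℕ} (T : ℕ) (i : Fin K) : Monotone (gameRound T i) :=
  monotone_nat_of_le_succ fun q => (Nat.le_succ _).trans (gameRound_lt T i q)

namespace Trajectory

variable {K : ℕ} {k : Fin K → ℕ}

/-- The probability with which learner `i` plays in its own round `q`. -/
def ownProb (T : ℕ) (β : ℝ) (η₁ : Fin K → ℝ) (x : Trajectory K k) (i : Fin K) (q : ℕ) : ℝ :=
  if q < initRounds T then 1 else (x.state T β η₁ (q - initRounds T)).wbar T i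

/-- Whether learner `i` plays in its own round `q`. -/
def ownPlays (T : ℕ) (x : Trajectory K k) (i : Fin K) (q : ℕ) : Bool :=
  if q < initRounds T then true else decide (x.chosen (gameRound T i q) = i)

/-- With sampling probability 1 the feedback is the plain loss, so the initial phase fits the
weighted environment and one play can extend over both phases. -/
lemma iwLoss_own (T : ℕ) (β : ℝ) (η₁ : Fin K → ℝ) (x : Trajectory K k) (i : Fin K) (q : ℕ) :
    iwLoss (x.ownPlays T i q) (x.loss (gameRound T i q) i (x.arm i q)) (x.ownProb T β η₁ i q) =
      x.feedback T β η₁ i q := by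
  unfold ownPlays ownProb feedback gameRound
  split_ifs with h1
  · simp [iwLoss]
  · unfold lossEstimate iwLoss
    simp only [decide_eq_true_eq]
    split_ifs with h2
    · unfold playedLoss
      have h3 : ownRound K T (K * initRounds T + (q - initRounds T)) = q := by
        unfold ownRound; rw [if_neg (by omega)]; omega
      rw [h3]
      congr 1
      rw [h2]
    · rfl

lemma history_eq (T : ℕ) (β : ℝ) (η₁ : Fin K → ℝ) (x : Trajectory K k) (i : Fin K) (a n : ℕ) :
    (fun s : Fin n => (x.arm i (a + s), iwLoss (x.ownPlays T i (a + s))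
      (x.loss (gameRound T i (a + s)) i (x.arm i (a + s))) (x.ownProb T β η₁ i (a + s)))) =
      x.history T β η₁ i a n := by
  funext s
  rw [iwLoss_own]; rfl

end Trajectory

namespace IsRun

variable {K : ℕ} {k : Fin K → ℕ} {A : (i : Fin K) → Learner (k i)}
  {D : Measure ((i : Fin K) → Fin (k i) → ℝ)} {T : ℕ} {β : ℝ} {η₁ : Fin K → ℝ} {Ω : Type u}
  [m0 : MeasurableSpace Ω] {P : Measure Ω} {ℱ : Filtration ℕ m0} {X : Ω → Trajectory K k}
  [IsProbabilityMeasure D] [IsProbabilityMeasure P] [NeZero K]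

omit [IsProbabilityMeasure D] [IsProbabilityMeasure P] [NeZero K] in
lemma measurable_ownProb (h : IsRun A D T β η₁ P ℱ X) (i : Fin K) (q : ℕ) :
    Measurable[ℱ (gameRound T i q)] fun ω => (X ω).ownProb T β η₁ i q := by
  unfold Trajectory.ownProb
  split_ifs with h1
  · exact measurable_const
  · rw [gameRound_of_le i (not_lt.1 h1)]
    exact (h.measurableState _).wbar (m := ℱ (K * initRounds T + (q - initRounds T))) T i

omit [IsProbabilityMeasure D] [IsProbabilityMeasure P] [NeZero K] in
lemma measurable_arm_own (h : IsRun A D T β η₁ P ℱ X) (i : Fin K) (q : ℕ) (j : Fin (k i)) :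
    MeasurableSet[ℱ (gameRound T i q + 1)] {ω | (X ω).arm i q = j} := by
  by_cases h1 : q < initRounds T
  · rw [gameRound_of_lt i h1]
    exact h.measurable_arm_init q h1 i j
  · rw [gameRound_of_le i (not_lt.1 h1)]
    have h2 := h.measurable_arm_main (q - initRounds T) i j
    simpa only [Nat.add_sub_cancel' (not_lt.1 h1)] using h2

omit [IsProbabilityMeasure D] [IsProbabilityMeasure P] [NeZero K] in
lemma measurable_ownPlays (h : IsRun A D T β η₁ P ℱ X) (i : Fin K) (q : ℕ) (b : Bool) :
    MeasurableSet[ℱ (gameRound T i q + 1)] {ω | (X ω).ownPlays T i q = b} := by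
  unfold Trajectory.ownPlays
  split_ifs with h1
  · exact MeasurableSet.const _
  · have h2 := h.measurable_chosen (gameRound T i q) i
    cases b
    · simp only [decide_eq_false_iff_not]; exact h2.compl
    · simp only [decide_eq_true_eq]; exact h2

lemma ownProb_bounds (hT : 1 ≤ T) (hη₁ : ∀ i, 0 < η₁ i) (hβ : 1 ≤ β) (x : Trajectory K k)
    (i : Fin K) (q : ℕ) :
    1 / ((K : ℝ) ^ 2 * T) ≤ x.ownProb T β η₁ i q ∧ x.ownProb T β η₁ i q ≤ 1 := by
  have hK : (1 : ℝ) ≤ K := by exact_mod_cast NeZero.one_le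
  have hT' : (1 : ℝ) ≤ T := by exact_mod_cast hT
  unfold Trajectory.ownProb
  split_ifs
  · exact ⟨by rw [div_le_one (by positivity)]; nlinarith, le_rfl⟩
  · exact ⟨wbar_lower hT hη₁ hβ x _ i, wbar_le_one hT hη₁ hβ x _ i⟩

omit [IsProbabilityMeasure D] in
/-- In the rounds since its last restart a learner plays against the importance-weighted
environment. -/
lemma law_own (h : IsRun A D T β η₁ P ℱ X) (hT : 1 ≤ T) (hη₁ : ∀ i, 0 < η₁ i) (hβ : 1 ≤ β)
    (i : Fin K) {a n : ℕ} (ha : a = 0 ∨ initRounds T ≤ a) {S : Set Ω}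
    (hS : MeasurableSet[ℱ (gameRound T i (a + n))] S)
    (hstart : initRounds T ≤ a + n →
      ∀ ω ∈ S, ((X ω).state T β η₁ (a + n - initRounds T)).start i = a)
    (j : Fin (k i)) (b : Bool) {B : Set (Fin (k i) → ℝ)} (hB : MeasurableSet B) :
    P.real (S ∩ {ω | (X ω).arm i (a + n) = j ∧ (X ω).ownPlays T i (a + n) = b ∧
        (X ω).loss (gameRound T i (a + n)) i ∈ B}) =
      ∫ ω in S, (A i).policy (((X ω).state T β η₁ (a - initRounds T)).env i) n
          ((X ω).history T β η₁ i a n) j *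
        (if b then (X ω).ownProb T β η₁ i (a + n) else 1 - (X ω).ownProb T β η₁ i (a + n)) *
        (D.map fun x => x i).real B ∂P := by
  classical
  have hmeas : Measurable fun x : (i : Fin K) → Fin (k i) → ℝ => x i := measurable_pi_apply i
  have hS' := ℱ.le _ _ hS
  rw [map_measureReal_apply hmeas hB]
  have hBm : MeasurableSet ((fun x : (i : Fin K) → Fin (k i) → ℝ => x i) ⁻¹' B) := hmeas hB
  by_cases hn : a + n < initRounds T
  · have ha0 : a = 0 := by omega
    subst ha0
    rw [zero_add] at *
    have henv : ∀ ω, ((X ω).state T β η₁ (0 - initRounds T)).env i = 1 := fun ω => by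
      rw [Nat.zero_sub]; rfl
    simp only [Trajectory.ownPlays, Trajectory.ownProb, if_pos hn, henv]
    have hgr : gameRound T i n = n * K + i := by unfold gameRound; rw [if_pos hn]
    rw [hgr] at hS ⊢
    cases b
    · simp
    · have h1 := h.law_init n hn i S hS j _ hBm
      simp only [true_and, if_true, mul_one]
      rw [← h1]; rfl
  · obtain ⟨p, hp⟩ : ∃ p, a + n = initRounds T + p := ⟨a + n - initRounds T, by omega⟩
    have hgr : gameRound T i (a + n) = K * initRounds T + p := by
      unfold gameRound; rw [if_neg hn, hp, Nat.add_sub_cancel_left]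
    have hst := hstart (by omega)
    rw [hp, Nat.add_sub_cancel_left] at hst
    simp only [Trajectory.ownPlays, Trajectory.ownProb, if_neg hn]
    rw [hgr] at hS ⊢
    rw [hp, Nat.add_sub_cancel_left]
    -- Nothing was restarted since clock `a`, so the parameter and history of this round are those
    -- of the segment.
    have hpol : ∀ ω ∈ S, (A i).policy (((X ω).state T β η₁ (a - initRounds T)).env i) n
          ((X ω).history T β η₁ i a n) j = armProb A T β η₁ (X ω) p i j := by
      intro ω hω
      have h1 := ((X ω).isPath T β η₁).start_const (p := a - initRounds T) (a := a) (by omega)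
        (hst ω hω) le_rfl (by omega)
      unfold armProb
      have h2 : n = initRounds T + p - a := by omega
      rw [hst ω hω, h1.2, ← h2]
    have hint : ∀ c, IntegrableOn (fun ω => armProb A T β η₁ (X ω) p i j *
        ((X ω).state T β η₁ p).wbar T c) S P := fun c => by
      refine Integrable.integrableOn (EssBounded.integrable (EssBounded.of_le (B := 1) ?_ ?_))
      · exact (h.measurable_armProb p i j).mul ((h.measurableState' p).wbar T c)
      · refine Filter.Eventually.of_forall fun ω => ?_
        have h3 := (wbar_pos hT hη₁ hβ (X ω) p c).le
        exact ⟨mul_nonneg ((armProb_mem (X ω) p i).1 _) h3,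
          mul_le_one₀ (armProb_le_one _ _ _ _) h3 (wbar_le_one hT hη₁ hβ (X ω) p c)⟩
    rw [integral_mul_const]
    cases b
    · simp only [decide_eq_false_iff_not, Bool.false_eq_true, if_false]
      -- Not being sampled means that another learner is chosen; those probabilities add up to 1
      -- minus that of `i`.
      have h1 : S ∩ {ω | (X ω).arm i (initRounds T + p) = j ∧
            ¬ (X ω).chosen (K * initRounds T + p) = i ∧
            (X ω).loss (K * initRounds T + p) i ∈ B} =
          ⋃ c ∈ Finset.univ.erase i, S ∩ {ω | (X ω).arm i (initRounds T + p) = j ∧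
            (X ω).chosen (K * initRounds T + p) = c ∧ (X ω).loss (K * initRounds T + p) ∈
              (fun x : (i : Fin K) → Fin (k i) → ℝ => x i) ⁻¹' B} := by
        ext ω
        simp only [Set.mem_inter_iff, Set.mem_ofPred_eq, Set.mem_iUnion, Finset.mem_erase,
          Finset.mem_univ, and_true, Set.mem_preimage]
        constructor
        · rintro ⟨h1, h2, h3, h4⟩
          exact ⟨_, h3, h1, h2, rfl, h4⟩
        · rintro ⟨c, hc, h1, h2, h3, h4⟩
          exact ⟨h1, h2, h3 ▸ hc, h4⟩
      rw [h1, measureReal_biUnion_finset]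
      · rw [Finset.sum_congr rfl fun c _ => h.law_arm hT hη₁ hβ p hS i j c hBm, ← Finset.sum_mul,
          ← integral_finsetSum _ fun c _ => hint c]
        congr 1
        refine setIntegral_congr_fun hS' fun ω hω => ?_
        rw [hpol ω hω, ← Finset.mul_sum]
        congr 1
        have := wbar_sum hT hη₁ hβ (X ω) p
        rw [← Finset.add_sum_erase _ _ (Finset.mem_univ i)] at this
        linarith
      · intro x _ y _ hxy
        refine Set.disjoint_left.2 fun ω hx hy => hxy ?_
        rw [← hx.2.2.1, ← hy.2.2.1]
      · intro c _
        exact hS'.inter ((h.measurable_arm i _ (measurableSet_singleton j)).inter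
          ((h.measurable_chosen' _ (measurableSet_singleton c)).inter (h.measurable_loss' _ hBm)))
    · simp only [decide_eq_true_eq, if_true]
      have h1 := h.law_arm hT hη₁ hβ p hS i j i hBm
      simp only [Set.mem_preimage] at h1
      rw [h1]
      congr 1
      refine setIntegral_congr_fun hS' fun ω hω => ?_
      rw [hpol ω hω]

end IsRun

/-- For decreasing events that are eventually empty, the time of the first failure exceeds `n`
exactly on the `n`-th event. This makes the length of a segment a stopping time. -/
lemma lt_sInf_iff {Ω : Type*} {G : ℕ → Set Ω} (hanti : Antitone G) {Q : ℕ} (hQ : G Q = ∅)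
    (ω : Ω) (n : ℕ) : n < sInf {q | ω ∉ G q} ↔ ω ∈ G n := by
  constructor
  · intro h
    by_contra h1
    exact absurd (Nat.sInf_le h1) (not_le.2 h)
  · intro h
    by_contra! h1
    have h2 : sInf {q | ω ∉ G q} ∈ {q | ω ∉ G q} := Nat.sInf_mem ⟨Q, by simp [hQ]⟩
    exact h2 (hanti h1 h)

open ProbabilityTheory in
lemma setIntegral_cond {Ω : Type*} [MeasurableSpace Ω] {P : Measure Ω} {G S : Set Ω}
    (hS : MeasurableSet S) (hSG : S ⊆ G) (f : Ω → ℝ) :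
    ∫ ω in S, f ω ∂(cond P G) = (P.real G)⁻¹ * ∫ ω in S, f ω ∂P := by
  rw [ProbabilityTheory.cond, Measure.restrict_smul, Measure.restrict_restrict hS,
    Set.inter_eq_left.2 hSG, integral_smul_measure, smul_eq_mul, ENNReal.toReal_inv,
    measureReal_def]

namespace IsRun

variable {K : ℕ} {k : Fin K → ℕ} {A : (i : Fin K) → Learner (k i)}
  {D : Measure ((i : Fin K) → Fin (k i) → ℝ)} {T : ℕ} {β : ℝ} {η₁ : Fin K → ℝ} {Ω : Type u}
  [m0 : MeasurableSpace Ω] {P : Measure Ω} {ℱ : Filtration ℕ m0} {X : Ω → Trajectory K k}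
  [IsProbabilityMeasure D] [IsProbabilityMeasure P] [NeZero K]

open ProbabilityTheory in
/-- The play of learner `i` from its own round `a`, while the events `G` hold. -/
def weightedPlay (h : IsRun A D T β η₁ P ℱ X) (hT : 1 ≤ T) (hη₁ : ∀ i, 0 < η₁ i) (hβ : 1 ≤ β)
    (i : Fin K) {a : ℕ} (ha : a = 0 ∨ initRounds T ≤ a) {G : ℕ → Set Ω} {Q : ℕ}
    (hG : ∀ q, MeasurableSet[ℱ (gameRound T i (a + q))] (G q)) (hanti : Antitone G)
    (hQ : G Q = ∅)
    (hstart : ∀ q, initRounds T ≤ a + q →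
      ∀ ω ∈ G q, ((X ω).state T β η₁ (a + q - initRounds T)).start i = a)
    {B : ℝ} (hB : ∀ᵐ ω ∂P, ((X ω).state T β η₁ (a - initRounds T)).env i ≤ B) :
    WeightedPlay (A i) (D.map fun x => x i) (cond P (G 0)) where
  ℱ := ⟨fun q => ℱ (gameRound T i (a + q)),
    fun _ _ hq => ℱ.mono (gameRound_mono T i (Nat.add_le_add_left hq a)), fun _ => ℱ.le _⟩
  τ ω := sInf {q | ω ∉ G q}
  -- A play asks for a sure bound, but the parameter is bounded only almost surely; the truncation
  -- alters it on a null set.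
  ρ₀ ω := min (((X ω).state T β η₁ (a - initRounds T)).env i) (max 1 B)
  w q ω := (X ω).ownProb T β η₁ i (a + q)
  arm q ω := (X ω).arm i (a + q)
  sampled q ω := (X ω).ownPlays T i (a + q)
  loss q ω := (X ω).loss (gameRound T i (a + q)) i
  measurable_τ n := by
    have : {ω | sInf {q | ω ∉ G q} ≤ n} = (G n)ᶜ := by
      ext ω
      rw [Set.mem_ofPred_eq, ← not_lt, lt_sInf_iff hanti hQ]; rfl
    rw [this]
    exact (hG n).compl
  τ_bdd := ⟨Q, fun ω => Nat.sInf_le (by simp [hQ])⟩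
  measurable_ρ₀ := by
    have h1 : Measurable[ℱ (gameRound T i (a + 0))]
        fun ω => ((X ω).state T β η₁ (a - initRounds T)).env i := by
      rcases ha with rfl | ha
      · have : (fun ω => ((X ω).state T β η₁ (0 - initRounds T)).env i) = fun _ => 1 := by
          funext ω; rw [Nat.zero_sub]; rfl
        rw [this]; exact measurable_const
      · have h2 : gameRound T i (a + 0) = K * initRounds T + (a - initRounds T) := by
          unfold gameRound; rw [if_neg (by omega), add_zero]
        rw [h2]; exact (h.measurableState _).env i
    exact h1.min measurable_const
  one_le_ρ₀ ω := le_min (((X ω).isPath T β η₁).env_inv hη₁ hβ _ i).1 (le_max_left _ _)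
  ρ₀_bdd := ⟨max 1 B, fun ω => min_le_right _ _⟩
  measurable_w n := h.measurable_ownProb i (a + n)
  w_pos := by
    have hK : (1 : ℝ) ≤ K := by exact_mod_cast NeZero.one_le
    have hT' : (1 : ℝ) ≤ T := by exact_mod_cast hT
    exact ⟨1 / ((K : ℝ) ^ 2 * T), by positivity, fun n ω =>
      (ownProb_bounds hT hη₁ hβ (X ω) i (a + n)).1⟩
  w_le_one n ω := (ownProb_bounds hT hη₁ hβ (X ω) i (a + n)).2
  measurable_arm n j :=
    ℱ.mono (gameRound_lt T i (a + n)) _ (h.measurable_arm_own i (a + n) j)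
  measurable_sampled n b :=
    ℱ.mono (gameRound_lt T i (a + n)) _ (h.measurable_ownPlays i (a + n) b)
  measurable_loss n := by
    have h1 : Measurable[ℱ (gameRound T i (a + n) + 1)]
        fun ω => (X ω).loss (gameRound T i (a + n)) i :=
      (measurable_pi_apply i).comp (h.measurable_loss _)
    exact h1.mono (ℱ.mono (gameRound_lt T i (a + n))) le_rfl
  law n S hS hSτ j b B' hB' := by
    have hSG : S ⊆ G n := fun ω hω => (lt_sInf_iff hanti hQ ω n).1 (hSτ hω)
    have hSG0 : S ⊆ G 0 := hSG.trans (hanti (Nat.zero_le n))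
    have hG0 := ℱ.le _ _ (hG 0)
    have hS' := ℱ.le _ _ hS
    rw [setIntegral_cond hS' hSG0, measureReal_def, cond_apply hG0, ENNReal.toReal_mul,
      ENNReal.toReal_inv, ← measureReal_def, ← measureReal_def, ← Set.inter_assoc,
      Set.inter_eq_right.2 hSG0,
      h.law_own hT hη₁ hβ i ha hS (fun hn ω hω => hstart n hn ω (hSG hω)) j b hB']
    congr 1
    refine setIntegral_congr_ae hS' ?_
    filter_upwards [hB] with ω hω _
    rw [Trajectory.history_eq, min_eq_left (hω.trans (le_max_right _ _))]

open ProbabilityTheory in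
omit [IsProbabilityMeasure D] in
/-- Regret of learner `i` from its own round `a`, while the events `G` hold. -/
lemma segment_regret (h : IsRun A D T β η₁ P ℱ X) (hT : 1 ≤ T) (hη₁ : ∀ i, 0 < η₁ i)
    (hβ : 1 ≤ β) {i : Fin K} {R : ℕ → ℝ}
    (hstab : IsStable.{u} (1 / 2) R (A i) (D.map fun x => x i)) (arm : Fin (k i)) {a : ℕ}
    (ha : a = 0 ∨ initRounds T ≤ a) {G : ℕ → Set Ω} {Q : ℕ}
    (hG : ∀ q, MeasurableSet[ℱ (gameRound T i (a + q))] (G q)) (hanti : Antitone G)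
    (hQ : G Q = ∅)
    (hstart : ∀ q, initRounds T ≤ a + q →
      ∀ ω ∈ G q, ((X ω).state T β η₁ (a + q - initRounds T)).start i = a)
    {B : ℝ} (hB : ∀ᵐ ω ∂P, ((X ω).state T β η₁ (a - initRounds T)).env i ≤ B) {c : Ω → ℝ}
    (hc : Integrable c P)
    (hint : ∀ q, Integrable (fun ω => (X ω).feedback T β η₁ i (a + q) -
      (X ω).loss (gameRound T i (a + q)) i arm) P)
    (hZ : ∀ᵐ ω ∂P, ω ∈ G 0 → ∃ Z : ℝ,
      √(((X ω).state T β η₁ (a - initRounds T)).env i) ≤ Z ∧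
      (∀ q, ω ∈ G q → 1 / √((X ω).ownProb T β η₁ i (a + q)) ≤ Z) ∧
      ∀ t, ω ∈ G t → ω ∉ G (t + 1) → Z * R (t + 1) ≤ c ω) :
    ∑ q ∈ Finset.range Q, ∫ ω in G q, ((X ω).feedback T β η₁ i (a + q) -
      (X ω).loss (gameRound T i (a + q)) i arm) ∂P ≤ ∫ ω in G 0, c ω ∂P := by
  have hGm : ∀ q, MeasurableSet (G q) := fun q => ℱ.le _ _ (hG q)
  obtain ⟨-, hR0, hst⟩ := hstab
  by_cases h0 : P (G 0) = 0
  · have h1 : ∀ q, P (G q) = 0 := fun q => measure_mono_null (hanti (Nat.zero_le q)) h0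
    have h2 : ∀ q, P.restrict (G q) = 0 := fun q => Measure.restrict_eq_zero.2 (h1 q)
    simp [h2]
  -- Whether the segment begins is known in its first round, so conditioning on `G 0` preserves the
  -- conditional laws. Stability is applied under the conditional measure, and the normalization
  -- cancels at the end.
  · have hprob : IsProbabilityMeasure (cond P (G 0)) := cond_isProbabilityMeasure h0
    have hpos : 0 < P.real (G 0) := ENNReal.toReal_pos h0 (measure_ne_top _ _)
    have h1 := hst Ω (cond P (G 0)) (h.weightedPlay hT hη₁ hβ i ha hG hanti hQ hstart hB) arm
    have hmem : ∀ᵐ ω ∂(cond P (G 0)), ω ∈ G 0 := ae_cond_mem (hGm 0)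
    have hac : ∀ {p : Ω → Prop}, (∀ᵐ ω ∂P, p ω) → ∀ᵐ ω ∂(cond P (G 0)), p ω := fun hp =>
      cond_absolutelyContinuous hp
    have e1 : ∀ f : Ω → ℝ, ∫ ω, f ω ∂(cond P (G 0)) = (P.real (G 0))⁻¹ * ∫ ω in G 0, f ω ∂P := by
      intro f
      rw [ProbabilityTheory.cond, integral_smul_measure, smul_eq_mul, ENNReal.toReal_inv,
        measureReal_def]
    have hle : ∀ ω, sInf {q | ω ∉ G q} ≤ Q := fun ω => Nat.sInf_le (by simp [hQ])
    -- the regret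
    have h2 : ∫ ω, ∑ n ∈ Finset.range (sInf {q | ω ∉ G q}),
        (iwLoss ((X ω).ownPlays T i (a + n))
          ((X ω).loss (gameRound T i (a + n)) i ((X ω).arm i (a + n)))
          ((X ω).ownProb T β η₁ i (a + n)) - (X ω).loss (gameRound T i (a + n)) i arm)
          ∂(cond P (G 0)) =
        (P.real (G 0))⁻¹ * ∑ q ∈ Finset.range Q, ∫ ω in G q, ((X ω).feedback T β η₁ i (a + q) -
          (X ω).loss (gameRound T i (a + q)) i arm) ∂P := by
      classical
      have h3 : ∀ ω, ∑ n ∈ Finset.range (sInf {q | ω ∉ G q}),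
          (iwLoss ((X ω).ownPlays T i (a + n))
            ((X ω).loss (gameRound T i (a + n)) i ((X ω).arm i (a + n)))
            ((X ω).ownProb T β η₁ i (a + n)) - (X ω).loss (gameRound T i (a + n)) i arm) =
          ∑ q ∈ Finset.range Q, (G q).indicator (fun ω => (X ω).feedback T β η₁ i (a + q) -
            (X ω).loss (gameRound T i (a + q)) i arm) ω := by
        intro ω
        simp only [Trajectory.iwLoss_own]
        have hsub : Finset.range (sInf {q | ω ∉ G q}) ⊆ Finset.range Q :=
          Finset.range_subset_range.2 (hle ω)
        rw [← Finset.sum_subset hsub fun q _ hq => Set.indicator_of_notMem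
          (fun h4 => hq (Finset.mem_range.2 ((lt_sInf_iff hanti hQ ω q).2 h4))) _]
        exact Finset.sum_congr rfl fun q hq => (Set.indicator_of_mem
          ((lt_sInf_iff hanti hQ ω q).1 (Finset.mem_range.1 hq)) (fun ω =>
            (X ω).feedback T β η₁ i (a + q) - (X ω).loss (gameRound T i (a + q)) i arm)).symm
      rw [e1]
      congr 1
      simp only [h3]
      rw [integral_finsetSum]
      · refine Finset.sum_congr rfl fun q _ => ?_
        rw [integral_indicator (hGm q), Measure.restrict_restrict (hGm q),
          Set.inter_eq_left.2 (hanti (Nat.zero_le q))]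
      · exact fun q _ => ((hint q).indicator (hGm q)).integrableOn
    -- the bound
    have h4 : ∫ ω, ((h.weightedPlay hT hη₁ hβ i ha hG hanti hQ hstart hB).rho ω) ^ (1 / 2 : ℝ) *
        R (sInf {q | ω ∉ G q}) ∂(cond P (G 0)) ≤ ∫ ω, c ω ∂(cond P (G 0)) := by
      have hcint : Integrable c (cond P (G 0)) := by
        rw [ProbabilityTheory.cond]
        exact hc.integrableOn.smul_measure (ENNReal.inv_ne_top.2 h0)
      refine integral_mono_of_nonneg (Filter.Eventually.of_forall fun ω => ?_) hcint ?_
      · refine mul_nonneg (Real.rpow_nonneg ?_ _) (hR0 _)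
        exact zero_le_one.trans (le_trans ((h.weightedPlay hT hη₁ hβ i ha hG hanti hQ hstart
          hB).one_le_ρ₀ ω) (le_max_left _ _))
      · filter_upwards [hmem, hac hZ, hac hB] with ω hω hZω hBω
        obtain ⟨Z, hZ1, hZ2, hZ3⟩ := hZω hω
        have hτ : 0 < sInf {q | ω ∉ G q} := (lt_sInf_iff hanti hQ ω 0).2 hω
        obtain ⟨t, ht⟩ : ∃ t, sInf {q | ω ∉ G q} = t + 1 := ⟨sInf {q | ω ∉ G q} - 1, by omega⟩
        have ht1 : ω ∈ G t := (lt_sInf_iff hanti hQ ω t).1 (by omega)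
        have ht2 : ω ∉ G (t + 1) := fun h5 => by
          have := (lt_sInf_iff hanti hQ ω (t + 1)).2 h5
          omega
        have hZ0 : 0 ≤ Z := (Real.sqrt_nonneg _).trans hZ1
        rw [ht]
        refine le_trans (mul_le_mul_of_nonneg_right ?_ (hR0 _)) (hZ3 t ht1 ht2)
        rw [← Real.sqrt_eq_rpow, Real.sqrt_le_left hZ0]
        refine max_le ?_ ?_
        · refine (min_le_left _ _).trans ?_
          exact (Real.sqrt_le_left hZ0).1 hZ1
        · have : Nonempty (Fin ((h.weightedPlay hT hη₁ hβ i ha hG hanti hQ hstart hB).τ ω)) :=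
            ⟨⟨0, hτ⟩⟩
          refine ciSup_le fun q => ?_
          have hq : ω ∈ G q := (lt_sInf_iff hanti hQ ω q).1 q.2
          have h5 := hZ2 q hq
          have h6 := (ownProb_bounds hT hη₁ hβ (X ω) i (a + q)).1
          have hK : (1 : ℝ) ≤ K := by exact_mod_cast NeZero.one_le
          have hT' : (1 : ℝ) ≤ T := by exact_mod_cast hT
          have h7 : 0 < (X ω).ownProb T β η₁ i (a + q) := lt_of_lt_of_le (by positivity) h6
          have h8 : 1 / (X ω).ownProb T β η₁ i (a + q) =
              (1 / √((X ω).ownProb T β η₁ i (a + q))) ^ 2 := by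
            rw [div_pow, Real.sq_sqrt h7.le, one_pow]
          change 1 / (X ω).ownProb T β η₁ i (a + q) ≤ Z ^ 2
          rw [h8]
          exact pow_le_pow_left₀ (by positivity) h5 2
    have h5 := (h2.symm.trans_le h1).trans h4
    rw [e1] at h5
    exact le_of_mul_le_mul_left h5 (inv_pos.2 hpos)

end IsRun

/-! ## Expectations in one round -/

/-- A run with admissible parameters and losses in the unit interval. -/
structure BoundedRun {K : ℕ} {k : Fin K → ℕ} (A : (i : Fin K) → Learner (k i))
    (D : Measure ((i : Fin K) → Fin (k i) → ℝ)) (T : ℕ) (β : ℝ) (η₁ : Fin K → ℝ)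
    {Ω : Type u} [m0 : MeasurableSpace Ω] (P : Measure Ω) (ℱ : Filtration ℕ m0)
    (X : Ω → Trajectory K k) : Prop extends IsRun A D T β η₁ P ℱ X where
  one_le_T : 1 ≤ T
  η₁_pos : ∀ i, 0 < η₁ i
  one_le_β : 1 ≤ β
  mem_Icc : ∀ᵐ x ∂D, ∀ i j, x i j ∈ Set.Icc (0 : ℝ) 1

namespace Trajectory

variable {K : ℕ} {k : Fin K → ℕ} {T : ℕ} {β : ℝ} {η₁ : Fin K → ℝ} {x : Trajectory K k}
  (hx : ∀ r i j, x.loss r i j ∈ Set.Icc (0 : ℝ) 1)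
include hx

lemma playedLoss_mem (r : ℕ) : x.playedLoss T r ∈ Set.Icc (0 : ℝ) 1 := hx _ _ _

lemma initLoss_mem (i : Fin K) : x.initLoss T i ∈ Set.Icc (0 : ℝ) (initRounds T) := by
  unfold initLoss
  refine ⟨Finset.sum_nonneg fun q _ => (hx _ _ _).1, ?_⟩
  refine (Finset.sum_le_sum fun q _ => (hx (q * K + i) i (x.arm i q)).2).trans ?_
  simp

lemma est_bounds [NeZero K] (hT : 1 ≤ T) (hη₁ : ∀ i, 0 < η₁ i) (hβ : 1 ≤ β) (n : ℕ) (i : Fin K) :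
    0 ≤ IsRun.est T β η₁ x n i ∧
      IsRun.est T β η₁ x n i ≤ 1 / (x.state T β η₁ n).wbar T i ∧
      IsRun.est T β η₁ x n i ≤ (K : ℝ) ^ 2 * T := by
  have h1 := IsRun.wbar_lower hT hη₁ hβ x n i
  have h2 := IsRun.wbar_pos hT hη₁ hβ x n i
  have hK : (1 : ℝ) ≤ K := by exact_mod_cast NeZero.one_le
  have hT' : (1 : ℝ) ≤ T := by exact_mod_cast hT
  have h3 : 1 / (x.state T β η₁ n).wbar T i ≤ (K : ℝ) ^ 2 * T := by
    rw [div_le_iff₀ (by positivity)] at h1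
    rw [div_le_iff₀ h2]; linarith
  obtain ⟨h4, h5⟩ := playedLoss_mem (T := T) hx (K * initRounds T + n)
  have h6 : IsRun.est T β η₁ x n i ≤ 1 / (x.state T β η₁ n).wbar T i := by
    unfold IsRun.est lossEstimate iwLoss
    split_ifs
    · gcongr
    · positivity
  refine ⟨?_, h6, h6.trans h3⟩
  unfold IsRun.est lossEstimate iwLoss
  split_ifs
  · positivity
  · exact le_rfl

end Trajectory

lemma measurable_loss_coord {K : ℕ} {k : Fin K → ℕ} (i : Fin K) (j : Fin (k i)) :
    Measurable fun x : (i : Fin K) → Fin (k i) → ℝ => x i j := by fun_prop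

lemma bestLoss_le {K : ℕ} {k : Fin K → ℕ} (D : Measure ((i : Fin K) → Fin (k i) → ℝ)) (i : Fin K)
    (j : Fin (k i)) : bestLoss D i ≤ meanLoss D i j :=
  ciInf_le (Set.finite_range _).bddBelow j

lemma meanLoss_mem {K : ℕ} {k : Fin K → ℕ} {D : Measure ((i : Fin K) → Fin (k i) → ℝ)}
    [IsProbabilityMeasure D] (hD : ∀ᵐ x ∂D, ∀ i j, x i j ∈ Set.Icc (0 : ℝ) 1) (i : Fin K)
    (j : Fin (k i)) : meanLoss D i j ∈ Set.Icc (0 : ℝ) 1 := by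
  have h1 : Integrable (fun x : (i : Fin K) → Fin (k i) → ℝ => x i j) D :=
    (EssBounded.of_le (measurable_loss_coord i j) (B := 1)
      (hD.mono fun x hx => hx i j)).integrable
  refine ⟨integral_nonneg_of_ae (hD.mono fun x hx => (hx i j).1), ?_⟩
  have h2 := integral_mono_ae h1 (integrable_const 1) (hD.mono fun x hx => (hx i j).2)
  simpa [meanLoss] using h2

lemma bestLoss_mem {K : ℕ} {k : Fin K → ℕ} {D : Measure ((i : Fin K) → Fin (k i) → ℝ)}
    [IsProbabilityMeasure D] (hD : ∀ᵐ x ∂D, ∀ i j, x i j ∈ Set.Icc (0 : ℝ) 1) {i : Fin K}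
    (hk : 0 < k i) : bestLoss D i ∈ Set.Icc (0 : ℝ) 1 := by
  have : Nonempty (Fin (k i)) := ⟨⟨0, hk⟩⟩
  exact ⟨le_ciInf fun j => (meanLoss_mem hD i j).1,
    (bestLoss_le D i ⟨0, hk⟩).trans (meanLoss_mem hD i _).2⟩

namespace BoundedRun

variable {K : ℕ} {k : Fin K → ℕ} {A : (i : Fin K) → Learner (k i)}
  {D : Measure ((i : Fin K) → Fin (k i) → ℝ)} {T : ℕ} {β : ℝ} {η₁ : Fin K → ℝ} {Ω : Type u}
  [m0 : MeasurableSpace Ω] {P : Measure Ω} {ℱ : Filtration ℕ m0} {X : Ω → Trajectory K k}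
  [IsProbabilityMeasure D] [IsProbabilityMeasure P] [NeZero K]
  (h : BoundedRun A D T β η₁ P ℱ X)
include h

lemma ae_mem : ∀ᵐ ω ∂P, ∀ r i j, (X ω).loss r i j ∈ Set.Icc (0 : ℝ) 1 :=
  h.ae_loss_mem h.one_le_T h.η₁_pos h.one_le_β h.mem_Icc

omit [IsProbabilityMeasure D] [IsProbabilityMeasure P] in
lemma est_bounds {x : Trajectory K k} (hx : ∀ r i j, x.loss r i j ∈ Set.Icc (0 : ℝ) 1) (n : ℕ)
    (i : Fin K) : 0 ≤ IsRun.est T β η₁ x n i ∧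
      IsRun.est T β η₁ x n i ≤ 1 / (x.state T β η₁ n).wbar T i ∧
      IsRun.est T β η₁ x n i ≤ (K : ℝ) ^ 2 * T :=
  Trajectory.est_bounds hx h.one_le_T h.η₁_pos h.one_le_β n i

lemma ae_bounded (n : ℕ) : ∃ B, ∀ᵐ ω ∂P, ((X ω).state T β η₁ n).Bounded B := by
  obtain ⟨B, hB⟩ := IsPath.exists_bounded (T := T) h.η₁_pos h.one_le_β (initRounds T : ℝ)
    ((K : ℝ) ^ 2 * T) n
  refine ⟨B, h.ae_mem.mono fun ω hω => hB _ _ _ ((X ω).isPath T β η₁) (fun i => ?_)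
    fun n i => ?_⟩
  · obtain ⟨h1, h2⟩ := Trajectory.initLoss_mem (T := T) hω i
    rwa [abs_of_nonneg h1]
  · obtain ⟨h1, -, h2⟩ := h.est_bounds hω n i
    exact (abs_of_nonneg h1).trans_le h2

omit [IsProbabilityMeasure D] [IsProbabilityMeasure P] in
lemma w_mem (x : Trajectory K k) (n : ℕ) (i : Fin K) :
    0 < (x.state T β η₁ n).w i ∧ (x.state T β η₁ n).w i ≤ 1 :=
  ⟨(x.isPath T β η₁).w_pos h.η₁_pos h.one_le_β n i,
    (x.isPath T β η₁).w_le_one h.η₁_pos h.one_le_β n i⟩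

omit [IsProbabilityMeasure D] [IsProbabilityMeasure P] in
lemma wbar_mem (x : Trajectory K k) (n : ℕ) (i : Fin K) :
    0 < (x.state T β η₁ n).wbar T i ∧ (x.state T β η₁ n).wbar T i ≤ 1 :=
  ⟨IsRun.wbar_pos h.one_le_T h.η₁_pos h.one_le_β x n i,
    IsRun.wbar_le_one h.one_le_T h.η₁_pos h.one_le_β x n i⟩

omit [NeZero K] [IsProbabilityMeasure D] [IsProbabilityMeasure P] in
lemma η_pos (x : Trajectory K k) (n : ℕ) (i : Fin K) : 0 < (x.state T β η₁ n).η i :=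
  (x.isPath T β η₁).η_pos h.η₁_pos h.one_le_β n i

section essBounded

omit [IsProbabilityMeasure D] [IsProbabilityMeasure P] in
lemma essBounded_w (n : ℕ) (i : Fin K) : EssBounded P fun ω => ((X ω).state T β η₁ n).w i :=
  .of_le ((h.measurableState' n).w i) (B := 1) (.of_forall fun _ =>
    ⟨(h.w_mem _ n i).1.le, (h.w_mem _ n i).2⟩)

omit [IsProbabilityMeasure D] [IsProbabilityMeasure P] in
lemma essBounded_sqrt_w (n : ℕ) (i : Fin K) :
    EssBounded P fun ω => √(((X ω).state T β η₁ n).w i) :=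
  .of_le ((h.measurableState' n).w i).sqrt (B := 1) (.of_forall fun _ =>
    ⟨Real.sqrt_nonneg _, (Real.sqrt_le_sqrt (h.w_mem _ n i).2).trans_eq Real.sqrt_one⟩)

omit [IsProbabilityMeasure D] [IsProbabilityMeasure P] in
lemma essBounded_wbar (n : ℕ) (i : Fin K) :
    EssBounded P fun ω => ((X ω).state T β η₁ n).wbar T i :=
  .of_le ((h.measurableState' n).wbar T i) (B := 1) (.of_forall fun _ =>
    ⟨(h.wbar_mem _ n i).1.le, (h.wbar_mem _ n i).2⟩)

omit [IsProbabilityMeasure D] [IsProbabilityMeasure P] in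
lemma essBounded_sqrt_wbar (n : ℕ) (i : Fin K) :
    EssBounded P fun ω => √(((X ω).state T β η₁ n).wbar T i) :=
  .of_le ((h.measurableState' n).wbar T i).sqrt (B := 1) (.of_forall fun _ =>
    ⟨Real.sqrt_nonneg _, (Real.sqrt_le_sqrt (h.wbar_mem _ n i).2).trans_eq Real.sqrt_one⟩)

omit [IsProbabilityMeasure D] [IsProbabilityMeasure P] in
lemma essBounded_one_div_wbar (n : ℕ) (i : Fin K) :
    EssBounded P fun ω => 1 / ((X ω).state T β η₁ n).wbar T i := by
  refine .of_le (((h.measurableState' n).wbar T i).const_div 1) (B := (K : ℝ) ^ 2 * T)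
    (.of_forall fun ω => ⟨by have := (h.wbar_mem (X ω) n i).1; positivity, ?_⟩)
  have h1 := IsRun.wbar_lower h.one_le_T h.η₁_pos h.one_le_β (X ω) n i
  have hK : (1 : ℝ) ≤ K := by exact_mod_cast NeZero.one_le
  have hT' : (1 : ℝ) ≤ T := by exact_mod_cast h.one_le_T
  rw [div_le_iff₀ (by positivity)] at h1
  rw [div_le_iff₀ (h.wbar_mem _ n i).1]; linarith

lemma essBounded_one_div_sqrt_w (n : ℕ) (i : Fin K) :
    EssBounded P fun ω => 1 / √(((X ω).state T β η₁ n).w i) := by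
  obtain ⟨B, hB⟩ := h.ae_bounded n
  exact .of_le (((h.measurableState' n).w i).sqrt.const_div 1)
    (hB.mono fun ω hω => ⟨by positivity, hω.one_div_sqrt i⟩)

lemma essBounded_η (n : ℕ) (i : Fin K) : EssBounded P fun ω => ((X ω).state T β η₁ n).η i := by
  obtain ⟨B, hB⟩ := h.ae_bounded n
  exact .of_le ((h.measurableState' n).η i)
    (hB.mono fun ω hω => ⟨(h.η_pos _ n i).le, hω.η i⟩)

lemma essBounded_one_div_η (n : ℕ) (i : Fin K) :
    EssBounded P fun ω => 1 / ((X ω).state T β η₁ n).η i := by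
  obtain ⟨B, hB⟩ := h.ae_bounded n
  exact .of_le (((h.measurableState' n).η i).const_div 1)
    (hB.mono fun ω hω => ⟨by have := h.η_pos (X ω) n i; positivity, hω.one_div_η i⟩)

lemma essBounded_est (n : ℕ) (i : Fin K) : EssBounded P fun ω => IsRun.est T β η₁ (X ω) n i :=
  .of_le (h.measurable_est n i) (h.ae_mem.mono fun _ hω =>
    ⟨(h.est_bounds hω n i).1, (h.est_bounds hω n i).2.2⟩)

lemma essBounded_playedLoss (r : ℕ) : EssBounded P fun ω => (X ω).playedLoss T r :=
  .of_le (h.measurable_playedLoss r) (h.ae_mem.mono fun _ hω => Trajectory.playedLoss_mem hω r)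

lemma essBounded_loss (r : ℕ) (i : Fin K) (j : Fin (k i)) :
    EssBounded P fun ω => (X ω).loss r i j :=
  .of_le (h.measurable_loss_apply r i j) (h.ae_mem.mono fun _ hω => hω r i j)

lemma essBounded_loss_arm (r : ℕ) (i : Fin K) (q : ℕ) :
    EssBounded P fun ω => (X ω).loss r i ((X ω).arm i q) :=
  .of_le (h.measurable_loss_arm r i q) (h.ae_mem.mono fun _ hω => hω r i _)

lemma essBounded_divg (n : ℕ) (j : Fin K) : EssBounded P fun ω =>
    divg ((X ω).state T β η₁ n).η (Pi.single j 1) ((X ω).state T β η₁ n).w := by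
  refine .sum _ fun i _ => ?_
  have h1 := (((h.essBounded_one_div_η n i).const_mul 2).mul
    (((EssBounded.const (√((Pi.single j 1 : Fin K → ℝ) i))).sub (h.essBounded_sqrt_w n i)).mul
      ((EssBounded.const (√((Pi.single j 1 : Fin K → ℝ) i))).sub (h.essBounded_sqrt_w n i)))).mul
    (h.essBounded_one_div_sqrt_w n i)
  refine ⟨?_, ?_⟩
  · have := (h.measurableState' n).η i
    have := (h.measurableState' n).w i
    fun_prop
  · obtain ⟨-, B, hB⟩ := h1
    refine ⟨B, hB.mono fun ω hω => le_trans (le_of_eq ?_) hω⟩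
    congr 1
    ring

lemma essBounded_bonus (n : ℕ) (j : Fin K) :
    EssBounded P fun ω => ((X ω).state T β η₁ n).bonus β j := by
  unfold State.bonus
  refine .ite ((h.measurableState' n).nrs j) ?_ (.const 0)
  have h1 := (((h.essBounded_one_div_η n j).const_mul 2).mul
    (((EssBounded.const 1).sub (h.essBounded_sqrt_w n j)).mul
      ((EssBounded.const 1).sub (h.essBounded_sqrt_w n j)))).mul (h.essBounded_one_div_sqrt_w n j)
  have h2 := h1.const_mul (1 - 1 / β)
  refine ⟨?_, ?_⟩
  · have := (h.measurableState' n).η j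
    have := (h.measurableState' n).w j
    fun_prop
  · obtain ⟨-, B, hB⟩ := h2
    refine ⟨B, hB.mono fun ω hω => le_trans (le_of_eq ?_) hω⟩
    congr 1
    ring

end essBounded

/-- Given the past, learner `i` plays with probability `wbar i`. -/
lemma integral_mul_chosen (n : ℕ) (i : Fin K) {Z : Ω → ℝ}
    (hZ : Measurable[ℱ (K * initRounds T + n)] Z) (hZb : EssBounded P Z) :
    ∫ ω, Z ω * ({ω | (X ω).chosen (K * initRounds T + n) = i}.indicator 1 ω) ∂P =
      ∫ ω, Z ω * ((X ω).state T β η₁ n).wbar T i ∂P := by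
  have hm : MeasurableSet {ω | (X ω).chosen (K * initRounds T + n) = i} :=
    h.measurable_chosen' _ (measurableSet_singleton i)
  refine integral_mul_eq_of_setIntegral_eq (ℱ.le _) ((integrable_const (1 : ℝ)).indicator hm)
    (h.essBounded_wbar n i).integrable (fun S hS => ?_) hZ hZb
  have h1 := h.prob_chosen h.one_le_T h.η₁_pos h.one_le_β n hS i MeasurableSet.univ
  simp only [Set.mem_univ, and_true, probReal_univ, mul_one] at h1
  rw [← h1]
  rw [setIntegral_indicator hm]
  simp

/-- Given the past, an estimated loss is on average at most one. -/
lemma integral_mul_est_le (n : ℕ) (i : Fin K) {Z : Ω → ℝ}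
    (hZ : Measurable[ℱ (K * initRounds T + n)] Z) (hZb : EssBounded P Z) (hZ0 : ∀ ω, 0 ≤ Z ω) :
    ∫ ω, Z ω * IsRun.est T β η₁ (X ω) n i ∂P ≤ ∫ ω, Z ω ∂P := by
  have h1 := h.integral_mul_chosen n i
    (Z := fun ω => Z ω * (1 / ((X ω).state T β η₁ n).wbar T i))
    (hZ.mul (((h.measurableState n).wbar (m := ℱ (K * initRounds T + n)) T i).const_div 1))
    (hZb.mul (h.essBounded_one_div_wbar n i))
  have h2 : ∫ ω, Z ω * (1 / ((X ω).state T β η₁ n).wbar T i) *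
      ((X ω).state T β η₁ n).wbar T i ∂P = ∫ ω, Z ω ∂P :=
    integral_congr_ae (.of_forall fun ω => by
      have := (h.wbar_mem (X ω) n i).1.ne'
      field_simp)
  rw [← h2, ← h1]
  have hm : MeasurableSet {ω | (X ω).chosen (K * initRounds T + n) = i} :=
    h.measurable_chosen' _ (measurableSet_singleton i)
  have hI : EssBounded P
      ({ω | (X ω).chosen (K * initRounds T + n) = i}.indicator (1 : Ω → ℝ)) :=
    .of_le (measurable_one.indicator hm) (B := 1) (.of_forall fun ω => by
      rw [Set.indicator_apply]; split_ifs <;> simp)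
  refine integral_mono_ae (hZb.mul (h.essBounded_est n i)).integrable
    ((hZb.mul (h.essBounded_one_div_wbar n i)).mul hI).integrable
    (h.ae_mem.mono fun ω hω => ?_)
  simp only
  rw [mul_assoc]
  refine mul_le_mul_of_nonneg_left ?_ (hZ0 ω)
  rw [Set.indicator_apply]
  split_ifs with hc
  · rw [Pi.one_apply, mul_one]; exact (h.est_bounds hω n i).2.1
  · have hc' : ¬ (X ω).chosen (K * initRounds T + n) = i := hc
    unfold IsRun.est Trajectory.lossEstimate iwLoss
    simp [hc']

lemma integral_loss_main (n : ℕ) (i : Fin K) (j : Fin (k i)) :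
    ∫ ω, (X ω).loss (K * initRounds T + n) i j ∂P = meanLoss D i j := by
  have h1 := setIntegral_comp_of_law (P := P) (D := D) (h.measurable_loss' (K * initRounds T + n))
    (z := Set.univ) (fun B hB => by
      rw [Set.univ_inter, h.law_loss_main h.one_le_T h.η₁_pos h.one_le_β n hB, probReal_univ,
        one_mul]) (measurable_loss_coord i j)
  simpa [meanLoss] using h1

omit [NeZero K] in
lemma integral_loss_init {q : ℕ} (hq : q < initRounds T) (i : Fin K) (j : Fin (k i)) :
    ∫ ω, (X ω).loss (q * K + i) i j ∂P = meanLoss D i j := by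
  have h1 := setIntegral_comp_of_law (P := P) (D := D) (h.measurable_loss' (q * K + i))
    (z := Set.univ) (fun B hB => by
      rw [Set.univ_inter, h.law_loss_init' hq i hB, probReal_univ,
        one_mul]) (measurable_loss_coord i j)
  simpa [meanLoss] using h1

/-- Expected loss of a learner in the initial phase. -/
lemma bestLoss_le_integral_init {q : ℕ} (hq : q < initRounds T) (i : Fin K) :
    bestLoss D i ≤ ∫ ω, (X ω).loss (q * K + i) i ((X ω).arm i q) ∂P := by
  have hm : ∀ j, MeasurableSet {ω | (X ω).arm i q = j} := fun j =>
    h.measurable_arm i q (measurableSet_singleton j)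
  have h1 : ∀ ω, (X ω).loss (q * K + i) i ((X ω).arm i q) =
      ∑ j, {ω | (X ω).arm i q = j}.indicator (fun ω => (X ω).loss (q * K + i) i j) ω := by
    intro ω
    simp [Set.indicator_apply]
  simp only [h1]
  rw [integral_finsetSum _ fun j _ => ((h.essBounded_loss _ i j).integrable.indicator (hm j))]
  have h2 : ∀ j, ∫ ω, {ω | (X ω).arm i q = j}.indicator (fun ω => (X ω).loss (q * K + i) i j) ω ∂P
      = P.real {ω | (X ω).arm i q = j} * meanLoss D i j := fun j => by
    rw [integral_indicator (hm j)]
    exact setIntegral_comp_of_law (h.measurable_loss' _)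
      (fun B hB => h.law_loss_init hq i hB j) (measurable_loss_coord i j)
  simp only [h2]
  have h3 : ∑ j, P.real {ω | (X ω).arm i q = j} = 1 := by
    rw [← measureReal_biUnion_finset]
    · have : (⋃ j ∈ (Finset.univ : Finset (Fin (k i))), {ω | (X ω).arm i q = j}) = Set.univ := by
        ext ω; simp
      rw [this, probReal_univ]
    · intro x _ y _ hxy
      exact Set.disjoint_left.2 fun ω hx hy => hxy (hx.symm.trans hy)
    · exact fun j _ => hm j
  calc bestLoss D i = ∑ j, P.real {ω | (X ω).arm i q = j} * bestLoss D i := by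
        rw [← Finset.sum_mul, h3, one_mul]
    _ ≤ _ := Finset.sum_le_sum fun j _ =>
        mul_le_mul_of_nonneg_left (bestLoss_le D i j) measureReal_nonneg

/-- Expected loss of the corralling algorithm in a round of the main phase. -/
lemma le_integral_playedLoss (n : ℕ) :
    ∑ c, (∫ ω, ((X ω).state T β η₁ n).wbar T c ∂P) * bestLoss D c ≤
      ∫ ω, (X ω).playedLoss T (K * initRounds T + n) ∂P := by
  set z : (c : Fin K) → Fin (k c) → Set Ω := fun c j => {ω | (X ω).arm c (initRounds T + n) = j ∧
    (X ω).chosen (K * initRounds T + n) = c} with hz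
  have hm : ∀ c j, MeasurableSet (z c j) := fun c j =>
    (h.measurable_arm c _ (measurableSet_singleton j)).inter
      (h.measurable_chosen' _ (measurableSet_singleton c))
  have hown : Trajectory.ownRound K T (K * initRounds T + n) = initRounds T + n := by
    unfold Trajectory.ownRound; rw [if_neg (by omega)]; omega
  have h1 : ∀ ω, (X ω).playedLoss T (K * initRounds T + n) =
      ∑ c, ∑ j, (z c j).indicator (fun ω => (X ω).loss (K * initRounds T + n) c j) ω := by
    intro ω
    unfold Trajectory.playedLoss
    rw [hown, Finset.sum_eq_single ((X ω).chosen (K * initRounds T + n)),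
      Finset.sum_eq_single ((X ω).arm ((X ω).chosen (K * initRounds T + n)) (initRounds T + n))]
    · rw [Set.indicator_of_mem]
      exact ⟨rfl, rfl⟩
    · exact fun j _ hj => Set.indicator_of_notMem (fun h2 => hj h2.1.symm) _
    · simp
    · exact fun c _ hc => Finset.sum_eq_zero fun j _ =>
        Set.indicator_of_notMem (fun h2 => hc h2.2.symm) _
    · simp
  simp only [h1]
  have hi : ∀ c j, Integrable ((z c j).indicator
      (fun ω => (X ω).loss (K * initRounds T + n) c j)) P := fun c j =>
    (h.essBounded_loss _ c j).integrable.indicator (hm c j)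
  rw [integral_finsetSum _ fun c _ => integrable_finsetSum _ fun j _ => hi c j]
  refine Finset.sum_le_sum fun c _ => ?_
  rw [integral_finsetSum _ fun j _ => hi c j]
  have hlaw : ∀ j, ∀ B, MeasurableSet B →
      P.real (z c j ∩ {ω | (X ω).loss (K * initRounds T + n) ∈ B}) =
        P.real (z c j) * D.real B := fun j B hB => by
    have h2 := h.law_arm h.one_le_T h.η₁_pos h.one_le_β n MeasurableSet.univ c j c hB
    have h3 := h.law_arm h.one_le_T h.η₁_pos h.one_le_β n MeasurableSet.univ c j c
      MeasurableSet.univ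
    simp only [Set.univ_inter, Set.mem_univ, and_true, probReal_univ, mul_one] at h2 h3
    rw [← h3] at h2
    rw [hz, ← h2]
    congr 1
    ext ω
    simp [and_assoc]
  have h2 : ∀ j, ∫ ω, (z c j).indicator (fun ω => (X ω).loss (K * initRounds T + n) c j) ω ∂P
      = P.real (z c j) * meanLoss D c j := fun j => by
    rw [integral_indicator (hm c j)]
    exact setIntegral_comp_of_law (h.measurable_loss' _) (hlaw j) (measurable_loss_coord c j)
  simp only [h2]
  have h3 : ∑ j, P.real (z c j) = ∫ ω, ((X ω).state T β η₁ n).wbar T c ∂P := by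
    rw [← measureReal_biUnion_finset]
    · have h4 := h.prob_chosen h.one_le_T h.η₁_pos h.one_le_β n MeasurableSet.univ c
        MeasurableSet.univ
      simp only [Set.univ_inter, Set.mem_univ, and_true, probReal_univ, mul_one,
        Measure.restrict_univ] at h4
      rw [← h4]
      congr 1
      ext ω
      simp [hz]
    · intro x _ y _ hxy
      exact Set.disjoint_left.2 fun ω hx hy => hxy (hx.1.symm.trans hy.1)
    · exact fun j _ => hm c j
  rw [← h3, Finset.sum_mul]
  exact Finset.sum_le_sum fun j _ =>
    mul_le_mul_of_nonneg_left (bestLoss_le D c j) measureReal_nonneg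

/-- Expected squared deviations of the estimated losses. -/
lemma integral_stability_le (hR : Regime K T) (n : ℕ) (j : Fin K) :
    ∫ ω, ∑ i, (IsRun.est T β η₁ (X ω) n i - (X ω).playedLoss T (K * initRounds T + n)) ^ 2 *
        (((X ω).state T β η₁ n).w i * √(((X ω).state T β η₁ n).w i)) ∂P ≤
      ∫ ω, ∑ i ∈ Finset.univ.erase j, 2.1 * √(((X ω).state T β η₁ n).wbar T i) ∂P := by
  set v : Fin K → Ω → ℝ := fun i ω =>
    ((X ω).state T β η₁ n).w i * √(((X ω).state T β η₁ n).w i) with hv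
  set b : Fin K → Ω → ℝ := fun i ω => ((X ω).state T β η₁ n).wbar T i with hb
  have hvb : ∀ i, EssBounded P (v i) := fun i =>
    (h.essBounded_w n i).mul (h.essBounded_sqrt_w n i)
  have hbb : ∀ i, EssBounded P (b i) := h.essBounded_wbar n
  have hb1 : ∀ i, EssBounded P fun ω => 1 / b i ω := h.essBounded_one_div_wbar n
  have hv0 : ∀ i ω, 0 ≤ v i ω := fun i ω =>
    mul_nonneg (h.w_mem _ n i).1.le (Real.sqrt_nonneg _)
  have hb0 : ∀ i ω, 0 < b i ω := fun i ω => (h.wbar_mem _ n i).1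
  have hsum : ∀ ω, ∑ i, b i ω = 1 := fun ω =>
    IsRun.wbar_sum h.one_le_T h.η₁_pos h.one_le_β (X ω) n
  have hm : ∀ i, MeasurableSet {ω | (X ω).chosen (K * initRounds T + n) = i} := fun i =>
    h.measurable_chosen' _ (measurableSet_singleton i)
  set I : Fin K → Ω → ℝ := fun i =>
    {ω | (X ω).chosen (K * initRounds T + n) = i}.indicator (1 : Ω → ℝ) with hI
  have hIb : ∀ i, EssBounded P (I i) := fun i =>
    .of_le (measurable_one.indicator (hm i)) (B := 1) (.of_forall fun ω => by
      simp only [hI, Set.indicator_apply]; split_ifs <;> simp)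
  -- In absolute value the deviation is at most 1/b - 1 if `i` is chosen and at most 1 otherwise.
  -- Its square is thus at most 1 + ((1/b - 1)² - 1) times the indicator of the choice.
  set Z : Fin K → Ω → ℝ := fun i ω => v i ω * ((1 / b i ω - 1) * (1 / b i ω - 1) - 1) with hZ
  have hZb : ∀ i, EssBounded P (Z i) := fun i =>
    (hvb i).mul (((((hb1 i).sub (.const 1)).mul ((hb1 i).sub (.const 1)))).sub (.const 1))
  have hdev : ∀ i, EssBounded P fun ω =>
      (IsRun.est T β η₁ (X ω) n i - (X ω).playedLoss T (K * initRounds T + n)) ^ 2 * v i ω :=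
    fun i => by
      have h1 := (h.essBounded_est n i).sub (h.essBounded_playedLoss (K * initRounds T + n))
      have h2 := (h1.mul h1).mul (hvb i)
      simpa only [pow_two] using h2
  -- deviations, coordinate by coordinate
  have h1 : ∀ i, ∫ ω, (IsRun.est T β η₁ (X ω) n i -
      (X ω).playedLoss T (K * initRounds T + n)) ^ 2 * v i ω ∂P ≤
      ∫ ω, v i ω * (1 / b i ω - 1) ∂P := by
    intro i
    -- In expectation, b(1/b - 1)² + (1 - b) = 1/b - 1.
    have h2 : ∫ ω, v i ω * (1 / b i ω - 1) ∂P = ∫ ω, (Z i ω * I i ω + v i ω) ∂P := by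
      rw [integral_add ((hZb i).mul (hIb i)).integrable (hvb i).integrable,
        h.integral_mul_chosen n i (Z := Z i) ?_ (hZb i),
        ← integral_add ((hZb i).mul (hbb i)).integrable (hvb i).integrable]
      · refine integral_congr_ae (.of_forall fun ω => ?_)
        have := (hb0 i ω).ne'
        simp only [hZ]
        change v i ω * (1 / b i ω - 1) =
          v i ω * ((1 / b i ω - 1) * (1 / b i ω - 1) - 1) * b i ω + v i ω
        field_simp
        ring
      · have h3 := (h.measurableState n).w i
        have h4 := (h.measurableState n).wbar (m := ℱ (K * initRounds T + n)) T i
        have h5 : Measurable[ℱ (K * initRounds T + n)] (v i) := h3.mul h3.sqrt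
        have h6 : Measurable[ℱ (K * initRounds T + n)] fun ω => 1 / b i ω - 1 :=
          (h4.const_div 1).sub_const 1
        exact h5.mul ((h6.mul h6).sub_const 1)
    rw [h2]
    refine integral_mono_ae (hdev i).integrable
      (((hZb i).mul (hIb i)).add (hvb i)).integrable (h.ae_mem.mono fun ω hω => ?_)
    obtain ⟨h3, h4⟩ := Trajectory.playedLoss_mem (T := T) hω (K * initRounds T + n)
    have h5 := hv0 i ω
    simp only [hI, Set.indicator_apply, Set.mem_ofPred_eq]
    unfold IsRun.est Trajectory.lossEstimate iwLoss
    simp only [decide_eq_true_eq]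
    split_ifs with hc
    · change ((X ω).playedLoss T (K * initRounds T + n) / b i ω - _) ^ 2 * v i ω ≤ _
      have h6 : (X ω).playedLoss T (K * initRounds T + n) / b i ω -
          (X ω).playedLoss T (K * initRounds T + n) =
          (X ω).playedLoss T (K * initRounds T + n) * (1 / b i ω - 1) := by ring
      rw [h6, mul_pow, Pi.one_apply, mul_one]
      have h7 : (X ω).playedLoss T (K * initRounds T + n) ^ 2 ≤ 1 := pow_le_one₀ h3 h4
      have h8 := mul_le_mul_of_nonneg_right h7
        (mul_nonneg (sq_nonneg (1 / b i ω - 1)) h5)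
      simp only [hZ]
      linarith
    · rw [zero_sub, neg_sq, mul_zero, zero_add]
      have h7 : (X ω).playedLoss T (K * initRounds T + n) ^ 2 ≤ 1 := pow_le_one₀ h3 h4
      exact mul_le_of_le_one_left h5 h7
  have h2 : ∀ i, EssBounded P fun ω => v i ω * (1 / b i ω - 1) := fun i =>
    (hvb i).mul ((hb1 i).sub (.const 1))
  calc _ = ∑ i, ∫ ω, (IsRun.est T β η₁ (X ω) n i -
        (X ω).playedLoss T (K * initRounds T + n)) ^ 2 * v i ω ∂P :=
        integral_finsetSum _ fun i _ => (hdev i).integrable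
    _ ≤ ∑ i, ∫ ω, v i ω * (1 / b i ω - 1) ∂P := Finset.sum_le_sum fun i _ => h1 i
    _ = ∫ ω, ∑ i, v i ω * (1 / b i ω - 1) ∂P :=
        (integral_finsetSum _ fun i _ => (h2 i).integrable).symm
    _ ≤ _ := by
      refine integral_mono_ae (EssBounded.sum _ fun i _ => h2 i).integrable
        (EssBounded.sum _ fun i _ => (h.essBounded_sqrt_wbar n i).const_mul 2.1).integrable
        (.of_forall fun ω => ?_)
      simp only
      have hcoord : ∀ i, v i ω * (1 / b i ω - 1) ≤
          1.003 * √(((X ω).state T β η₁ n).w i) * (1 - b i ω) ∧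
          √(((X ω).state T β η₁ n).w i) ≤ 1.001 * √(b i ω) := by
        intro i
        obtain ⟨hw0, hw1⟩ := h.w_mem (X ω) n i
        obtain ⟨hb0', hb2, -⟩ := State.wbar_bounds hR ((X ω).state T β η₁ n) hw0
        have hsw := Real.sqrt_pos.2 hw0
        have hsb := Real.sqrt_pos.2 hb0'
        rw [mul_one_div, div_le_div_iff₀ hsb hsw, one_mul] at hb2
        refine ⟨?_, hb2⟩
        have h3 : ((X ω).state T β η₁ n).w i ≤ 1.003 * b i ω := by
          have h4 : √(((X ω).state T β η₁ n).w i) ^ 2 ≤ (1.001 * √(b i ω)) ^ 2 :=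
            pow_le_pow_left₀ hsw.le hb2 2
          rw [mul_pow, Real.sq_sqrt hw0.le, Real.sq_sqrt hb0'.le] at h4
          have := hb0 i ω
          norm_num at h4 ⊢
          linarith
        have h5 : v i ω * (1 / b i ω - 1) = (((X ω).state T β η₁ n).w i / b i ω) *
            (√(((X ω).state T β η₁ n).w i) * (1 - b i ω)) := by
          have := (hb0 i ω).ne'
          simp only [hv]; field_simp
        have h6 : ((X ω).state T β η₁ n).w i / b i ω ≤ 1.003 := by
          rw [div_le_iff₀ (hb0 i ω)]; exact h3
        have h7 : 0 ≤ 1 - b i ω := sub_nonneg.2 (h.wbar_mem (X ω) n i).2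
        rw [h5, mul_assoc]
        exact mul_le_mul_of_nonneg_right h6 (mul_nonneg hsw.le h7)
      rw [← Finset.add_sum_erase _ _ (Finset.mem_univ j)]
      -- Shifting by the played loss has left a factor 1 - b. For `j` itself this is the sum of the
      -- other b_i, each at most its root, so `j` disappears from the bound.
      have h3 : v j ω * (1 / b j ω - 1) ≤ ∑ i ∈ Finset.univ.erase j, 1.003 * √(b i ω) := by
        obtain ⟨h4, -⟩ := hcoord j
        have h5 := hsum ω
        rw [← Finset.add_sum_erase _ _ (Finset.mem_univ j)] at h5
        have h6 : √(((X ω).state T β η₁ n).w j) ≤ 1 :=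
          (Real.sqrt_le_sqrt (h.w_mem (X ω) n j).2).trans_eq Real.sqrt_one
        have h7 : ∑ i ∈ Finset.univ.erase j, b i ω ≤ ∑ i ∈ Finset.univ.erase j, √(b i ω) :=
          Finset.sum_le_sum fun i _ => by
            have h8 := (hb0 i ω).le
            have h9 : √(b i ω) ≤ 1 :=
              (Real.sqrt_le_sqrt (h.wbar_mem (X ω) n i).2).trans_eq Real.sqrt_one
            calc b i ω = √(b i ω) * √(b i ω) := (Real.mul_self_sqrt h8).symm
              _ ≤ 1 * √(b i ω) := mul_le_mul_of_nonneg_right h9 (Real.sqrt_nonneg _)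
              _ = _ := one_mul _
        have h8 : 0 ≤ 1 - b j ω := sub_nonneg.2 (h.wbar_mem (X ω) n j).2
        rw [← Finset.mul_sum]
        have h9 : 1.003 * √(((X ω).state T β η₁ n).w j) * (1 - b j ω) ≤ 1.003 * (1 - b j ω) := by
          rw [mul_assoc]
          exact mul_le_mul_of_nonneg_left (mul_le_of_le_one_left h8 h6) (by norm_num)
        linarith
      have h4 : ∑ i ∈ Finset.univ.erase j, v i ω * (1 / b i ω - 1) ≤
          ∑ i ∈ Finset.univ.erase j, 1.01 * √(b i ω) := Finset.sum_le_sum fun i _ => by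
        obtain ⟨h5, h6⟩ := hcoord i
        have h7 := (hb0 i ω).le
        have h8 := Real.sqrt_nonneg (b i ω)
        have h9 : √(((X ω).state T β η₁ n).w i) * (1 - b i ω) ≤ √(((X ω).state T β η₁ n).w i) :=
          mul_le_of_le_one_right (Real.sqrt_nonneg _) (by linarith)
        nlinarith
      refine (add_le_add h3 h4).trans ?_
      rw [← Finset.sum_add_distrib]
      refine Finset.sum_le_sum fun i _ => ?_
      have := Real.sqrt_nonneg (b i ω)
      simp only [hb] at this ⊢
      linarith

/-- The expected shift of the multiplier. -/
lemma integral_mul_shift_le (n : ℕ) {S : Set Ω} (hS : MeasurableSet[ℱ (K * initRounds T + n)] S) :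
    EssBounded P (fun ω => S.indicator 1 ω *
      ((X ω).state T β η₁ n).shift (IsRun.est T β η₁ (X ω) n)) ∧
    ∫ ω, S.indicator 1 ω * ((X ω).state T β η₁ n).shift (IsRun.est T β η₁ (X ω) n) ∂P ≤
      P.real S := by
  set f : Fin K → Ω → ℝ := fun i ω => ((X ω).state T β η₁ n).η i *
    (((X ω).state T β η₁ n).w i * √(((X ω).state T β η₁ n).w i)) with hf
  have hf0 : ∀ i ω, 0 < f i ω := fun i ω => by
    have h1 := h.η_pos (X ω) n i
    have h2 := (h.w_mem (X ω) n i).1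
    simp only [hf]; positivity
  -- The shift is a convex combination of the estimated losses with coefficients known before the
  -- round, and each of these losses has conditional mean at most 1.
  set Z : Fin K → Ω → ℝ := fun i ω => S.indicator 1 ω * (f i ω / ∑ i, f i ω) with hZ
  have hfm : ∀ i, Measurable[ℱ (K * initRounds T + n)] (f i) := fun i => by
    have h1 := (h.measurableState n).η i
    have h2 := (h.measurableState n).w i
    exact h1.mul (h2.mul h2.sqrt)
  have hZm : ∀ i, Measurable[ℱ (K * initRounds T + n)] (Z i) := fun i =>
    ((measurable_const (a := (1 : ℝ))).indicator hS).mul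
      ((hfm i).div (Finset.measurable_sum _ fun i _ => hfm i))
  have hS0 : ∀ ω, 0 ≤ S.indicator (1 : Ω → ℝ) ω ∧ S.indicator (1 : Ω → ℝ) ω ≤ 1 := fun ω => by
    by_cases hω : ω ∈ S <;> simp [hω]
  have hr : ∀ i ω, 0 ≤ f i ω / ∑ i, f i ω ∧ f i ω / ∑ i, f i ω ≤ 1 := fun i ω => by
    have h1 : f i ω ≤ ∑ i, f i ω :=
      Finset.single_le_sum (f := fun i => f i ω) (fun i _ => (hf0 i ω).le) (Finset.mem_univ i)
    have h2 := hf0 i ω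
    exact ⟨div_nonneg h2.le (by linarith), by rw [div_le_one (by linarith)]; exact h1⟩
  have hZ0 : ∀ i ω, 0 ≤ Z i ω := fun i ω => mul_nonneg (hS0 ω).1 (hr i ω).1
  have hZb : ∀ i, EssBounded P (Z i) := fun i =>
    .of_le ((hZm i).mono (ℱ.le _) le_rfl) (B := 1) (.of_forall fun ω =>
      ⟨hZ0 i ω, mul_le_one₀ (hS0 ω).2 (hr i ω).1 (hr i ω).2⟩)
  have he : ∀ ω, S.indicator 1 ω * ((X ω).state T β η₁ n).shift (IsRun.est T β η₁ (X ω) n) =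
      ∑ i, Z i ω * IsRun.est T β η₁ (X ω) n i := fun ω => by
    unfold State.shift
    simp only [hZ, hf]
    rw [Finset.sum_div, Finset.mul_sum]
    exact Finset.sum_congr rfl fun i _ => by ring
  simp only [he]
  refine ⟨.sum _ fun i _ => (hZb i).mul (h.essBounded_est n i), ?_⟩
  rw [integral_finsetSum _ fun i _ => ((hZb i).mul (h.essBounded_est n i)).integrable]
  refine (Finset.sum_le_sum fun i _ => h.integral_mul_est_le n i (hZm i) (hZb i) (hZ0 i)).trans ?_
  rw [← integral_finsetSum _ fun i _ => (hZb i).integrable]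
  have h1 : ∀ ω, ∑ i, Z i ω = S.indicator 1 ω := fun ω => by
    simp only [hZ]
    rw [← Finset.mul_sum, ← Finset.sum_div, div_self, mul_one]
    exact (Finset.sum_pos (fun i _ => hf0 i ω) Finset.univ_nonempty).ne'
  simp only [h1]
  rw [integral_indicator_one (ℱ.le _ _ hS)]

end BoundedRun

/-! ## Regret of one learner in the main phase -/

/-- The clock of a learner that was last started before round `p` of the main phase. -/
def startClock (T p : ℕ) : ℕ := if p = 0 then 0 else initRounds T + p

/-- The rounds to which the stability of learner `j` is applied: those of the segment that begins
with round `p`, except that the early segments are cut when the first threshold is passed. -/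
def Covered {K : ℕ} (T : ℕ) (s : ℕ → State K) (j : Fin K) (N p n : ℕ) : Prop :=
  n < N ∧ (s n).start j = startClock T p ∧
    ((6 * (K * initRounds T) ≤ p ∧ 2 ≤ (s p).θ j) ∨ Active T s j n)

lemma one_le_initRounds (T : ℕ) : 1 ≤ initRounds T := Nat.le_add_left 1 _

lemma startClock_injective (T : ℕ) : Function.Injective (startClock T) := fun p q h => by
  have := one_le_initRounds T
  unfold startClock at h
  split_ifs at h <;> omega

namespace IsPath

variable {K : ℕ} {T : ℕ} {β : ℝ} {η₁ L₀ : Fin K → ℝ} {s : ℕ → State K} {ℓ : ℕ → Fin K → ℝ}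
  {j : Fin K}

lemma covered_iff {N p n : ℕ} (hp : 6 * (K * initRounds T) ≤ p) (hp0 : p ≠ 0) :
    Covered T s j N p n ↔ InSegment T s j N p n := by
  unfold Covered InSegment startClock
  rw [if_neg hp0]
  tauto

lemma le_of_covered (h : IsPath T β η₁ L₀ s ℓ) {N p n : ℕ} (hc : Covered T s j N p n) : p ≤ n := by
  have h1 := (h.start_bounds n j).1
  rw [hc.2.1] at h1
  unfold startClock at h1
  split_ifs at h1 <;> omega

lemma covered_of_succ (h : IsPath T β η₁ L₀ s ℓ) {N p n : ℕ} (hpn : p ≤ n)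
    (hc : Covered T s j N p (n + 1)) : Covered T s j N p n := by
  have h1 : startClock T p ≤ initRounds T + p := by unfold startClock; split_ifs <;> omega
  have h2 := (h.start_const h1 hc.2.1 hpn (Nat.le_succ n)).1
  refine ⟨by have := hc.1; omega, h2, ?_⟩
  rcases hc.2.2 with h3 | h3
  · exact .inl h3
  · exact .inr (h.active_of_succ (hc.2.1.trans h2.symm) h3.1)

/-- Number of early segments. -/
lemma sum_covered_le [NeZero K] (h : IsPath T β η₁ L₀ s ℓ)
    (hM : 1 ≤ K * initRounds T) (N : ℕ) (g : ℕ → ℝ)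
    (hg : ∀ p, g p = open Classical in if Covered T s j N p p then 1 else 0) :
    ∑ p ∈ Finset.Ico 1 (6 * (K * initRounds T)), g p ≤ 3 := by
  classical
  set M := K * initRounds T with hM'
  have h1 : ∑ p ∈ Finset.Ico 1 (6 * M), g p ≤
      ∑ p ∈ Finset.range (6 * M), if (s p).EpochRestart (M + p) j then (1 : ℝ) else 0 := by
    rw [Finset.sum_Ico_eq_sum_range]
    refine (Finset.sum_le_sum fun q hq => ?_).trans (Finset.sum_le_sum_of_subset_of_nonneg
      (Finset.range_subset_range.2 (Nat.sub_le (6 * M) 1)) fun _ _ _ => by split_ifs <;> simp)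
    rw [hg]
    -- A covered early segment begins with index 1, whereas a negative-regret step leaves an index
    -- of at least 2; so the restart is due to an epoch.
    have h2 : Covered T s j N (1 + q) (1 + q) → (s q).EpochRestart (M + q) j := by
      intro hc
      have hθ : (s (1 + q)).θ j = 1 := by
        rcases hc.2.2 with h3 | h3
        · have := Finset.mem_range.1 hq
          have := h3.1
          omega
        · exact h3.1
      have hst := hc.2.1
      unfold startClock at hst
      rw [if_neg (by omega), add_comm 1 q] at hst
      rw [add_comm 1 q] at hθ
      by_contra h4
      have h5 : j ∈ (s q).nrs := by
        by_contra h5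
        rw [h.start_succ, if_neg (by tauto)] at hst
        have := (h.start_bounds q j).1
        omega
      have h6 := tag_of_nrs h5
      have h7 := h.θ_succ_of_tag (.inl h6) j
      have hk := h.nrs_succ
      obtain ⟨t, rfl, -, -⟩ := h.back_one h6
      rw [hk] at h5
      have h8 : 2 ≤ (s (t + 1)).θ j := by
        rw [h.θ_succ]
        have := (h.θ_bounds t j).1
        split_ifs with h9
        · rcases State.mem_trig.1 h5 with h10 | h10
          · exact two_le_thresholdIndex h10.2
          · exact absurd h9 h10.1
        · omega
      omega
    by_cases hc : Covered T s j N (1 + q) (1 + q)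
    · rw [if_pos hc, if_pos (h2 hc)]
    · rw [if_neg hc]; split_ifs <;> simp
  refine h1.trans ?_
  have h2 : ∑ p ∈ Finset.range (6 * M), (if (s p).EpochRestart (M + p) j then (1 : ℝ) else 0) =
      nRestart T s j (6 * M) := by
    rw [Finset.sum_boole, nRestart, Nat.count_eq_card_filter_range]
  rw [h2]
  have h3 := nRestart_le (T := T) (s := s) (6 * M) j
  have h4 := h.nEpoch_mul_le (6 * M)
  rw [← hM'] at h4
  -- Four epochs would require 16M ≤ 8M.
  have h5 : nEpoch T s (6 * M) ≤ 3 := by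
    by_contra! h5
    have h6 : 2 ^ 4 ≤ 2 ^ nEpoch T s (6 * M) := Nat.pow_le_pow_right (by norm_num) h5
    have h7 : 2 ^ 4 * M ≤ 2 ^ nEpoch T s (6 * M) * M := Nat.mul_le_mul_right M h6
    omega
  exact_mod_cast h3.trans h5

/-- The rounds that are not covered. -/
lemma not_covered [NeZero K] (h : IsPath T β η₁ L₀ s ℓ) (hη₁ : ∀ i, 0 < η₁ i) (hβ : 1 ≤ β)
    (hM : 2 ≤ K * initRounds T) {N n : ℕ} (hn : n < N)
    (hc : ∀ p < N, ¬ Covered T s j N p n) :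
    n < 14 * (K * initRounds T) + 4 ∨
      (j ∈ (s n).trig T (K * initRounds T + n) ∧ (s n).θ j = 1) ∨
      ∃ q, n = q + 1 ∧ j ∈ (s q).trig T (K * initRounds T + q) ∧ (s q).θ j = 1 := by
  obtain ⟨p, hpn, hp⟩ : ∃ p ≤ n, (s n).start j = startClock T p := by
    obtain ⟨h1, h2⟩ := h.start_bounds n j
    rcases h2 with h2 | h2
    · exact ⟨0, Nat.zero_le n, h2⟩
    · refine ⟨(s n).start j - initRounds T, by omega, ?_⟩
      unfold startClock
      rw [if_neg (by omega)]; omega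
  have hcp := hc p (by omega)
  have hact : ¬ Active T s j n := fun h1 => hcp ⟨hn, hp, .inr h1⟩
  have hle : startClock T p ≤ initRounds T + p := by unfold startClock; split_ifs <;> omega
  by_cases hθ : 2 ≤ (s p).θ j
  -- A segment begun by a negative-regret step before round 6M; by the bound for its length it is
  -- over before round 14M + 4.
  · left
    have hp0 : p ≠ 0 := fun h0 => by
      rw [h0, h.zero] at hθ; simp [State.initial] at hθ
    have h1 : ¬ 6 * (K * initRounds T) ≤ p := fun h1 => hcp ⟨hn, hp, .inl ⟨h1, hθ⟩⟩
    unfold startClock at hp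
    rw [if_neg hp0] at hp
    have := h.segment_length_le hM hpn hθ hp
    omega
  · right
    have hθ1 : (s p).θ j = 1 := by have := (h.θ_bounds p j).1; omega
    -- Once the index leaves 1, only the round after the trigger still belongs to the segment; then
    -- the learner is restarted.
    have key : (s n).θ j = 1 ∨
        ∃ q, n = q + 1 ∧ j ∈ (s q).trig T (K * initRounds T + q) ∧ (s q).θ j = 1 := by
      clear hact hcp hc hn
      induction n, hpn using Nat.le_induction with
      | base => exact .inl hθ1
      | succ n hpn ih =>
        have h2 := (h.start_const hle hp hpn (Nat.le_succ n)).1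
        have h3 := h.not_restart (hp.trans h2.symm)
        rcases ih h2 with h4 | ⟨q, rfl, h4, h5⟩
        · by_cases h5 : j ∈ (s n).trig T (K * initRounds T + n)
          · exact .inr ⟨n, rfl, h5, h4⟩
          · exact .inl (h.succ_of_active hη₁ hβ ⟨h4, h5⟩).2
        · rw [h.nrs_succ] at h3
          exact absurd h4 h3.2
    rcases key with h1 | h1
    · left
      refine ⟨?_, h1⟩
      by_contra h2
      exact hact ⟨h1, h2⟩
    · exact .inr h1

/-- Number of rounds that are not covered. -/
lemma sum_not_covered_le [NeZero K] (h : IsPath T β η₁ L₀ s ℓ) (hη₁ : ∀ i, 0 < η₁ i)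
    (hβ : 1 ≤ β) (hM : 2 ≤ K * initRounds T) (N : ℕ) (g : ℕ → ℝ)
    (hg : ∀ n, g n = open Classical in if ∀ p < N, ¬ Covered T s j N p n then 1 else 0) :
    ∑ n ∈ Finset.range N, g n ≤ 14 * (K * initRounds T : ℕ) + 4 + 2 * nFirst T s j N := by
  classical
  set M := K * initRounds T with hM'
  set f : ℕ → ℝ := fun n => if j ∈ (s n).trig T (M + n) ∧ (s n).θ j = 1 then 1 else 0 with hf
  have hf0 : ∀ n, 0 ≤ f n := fun n => by simp only [hf]; split_ifs <;> simp
  have hfs : ∑ n ∈ Finset.range N, f n = nFirst T s j N := by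
    simp only [hf]
    rw [Finset.sum_boole, nFirst, Nat.count_eq_card_filter_range]
  have h1 : ∀ n ∈ Finset.range N, g n ≤ (if n < 14 * M + 4 then 1 else 0) + f n +
      (if n = 0 then 0 else f (n - 1)) := by
    intro n hn
    have hf1 := hf0 n
    have hf2 := hf0 (n - 1)
    have h0 : (0 : ℝ) ≤ if n < 14 * M + 4 then 1 else 0 := by split_ifs <;> simp
    have h0' : (0 : ℝ) ≤ if n = 0 then 0 else f (n - 1) := by split_ifs <;> simp [hf2]
    rw [hg]
    by_cases hc : ∀ p < N, ¬ Covered T s j N p n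
    · rw [if_pos hc]
      rcases h.not_covered hη₁ hβ hM (Finset.mem_range.1 hn) hc with h2 | h2 | ⟨q, rfl, h2⟩
      · rw [if_pos (show n < 14 * M + 4 from h2)]; linarith
      · have : f n = 1 := if_pos h2
        linarith
      · have : f q = 1 := if_pos h2
        rw [if_neg (Nat.succ_ne_zero q), Nat.add_sub_cancel, this]
        linarith
    · rw [if_neg hc]; linarith
  refine (Finset.sum_le_sum h1).trans ?_
  rw [Finset.sum_add_distrib, Finset.sum_add_distrib, hfs]
  have h2 : ∑ n ∈ Finset.range N, (if n < 14 * M + 4 then (1 : ℝ) else 0) ≤ 14 * (M : ℕ) + 4 := by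
    rw [Finset.sum_boole]
    have : (Finset.filter (fun n => n < 14 * M + 4) (Finset.range N)).card ≤ 14 * M + 4 := by
      refine (Finset.card_le_card (t := Finset.range (14 * M + 4)) fun n hn => ?_).trans_eq
        (Finset.card_range _)
      exact Finset.mem_range.2 (Finset.mem_filter.1 hn).2
    exact_mod_cast this
  have h3 : ∑ n ∈ Finset.range N, (if n = 0 then 0 else f (n - 1)) ≤ nFirst T s j N := by
    rw [← hfs]
    cases N with
    | zero => simp
    | succ N =>
      rw [Finset.sum_range_succ', Finset.sum_range_succ]
      simp only [if_true, add_zero, Nat.succ_ne_zero, if_false, Nat.add_sub_cancel]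
      have := hf0 N
      linarith
  linarith

end IsPath

namespace BoundedRun

variable {K : ℕ} {k : Fin K → ℕ} {A : (i : Fin K) → Learner (k i)}
  {D : Measure ((i : Fin K) → Fin (k i) → ℝ)} {T : ℕ} {β : ℝ} {η₁ : Fin K → ℝ} {Ω : Type u}
  [m0 : MeasurableSpace Ω] {P : Measure Ω} {ℱ : Filtration ℕ m0} {X : Ω → Trajectory K k}

lemma isPath (x : Trajectory K k) : IsPath T β η₁ (x.initLoss T) (x.state T β η₁)
    (IsRun.est T β η₁ x) := x.isPath T β η₁

variable [IsProbabilityMeasure D] [IsProbabilityMeasure P] [NeZero K]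
  (h : BoundedRun A D T β η₁ P ℱ X)
include h

omit [IsProbabilityMeasure D] [IsProbabilityMeasure P] [NeZero K] in
lemma measurableSet_covered (j : Fin K) (N p n : ℕ) :
    MeasurableSet[ℱ (K * initRounds T + n)]
      {ω | Covered T ((X ω).state T β η₁) j N p n} := by
  by_cases hpn : p ≤ n
  · have hs := h.measurableState n
    have hp := (h.measurableState p).mono (ℱ.mono (Nat.add_le_add_left hpn (K * initRounds T)))
    have h1 : MeasurableSet[ℱ (K * initRounds T + n)]
        {ω | ((X ω).state T β η₁ n).start j = startClock T p} :=
      hs.start j (measurableSet_singleton _)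
    have h2 : MeasurableSet[ℱ (K * initRounds T + n)]
        {ω | 2 ≤ ((X ω).state T β η₁ p).θ j} := hp.θ j measurableSet_Ici
    have h3 : MeasurableSet[ℱ (K * initRounds T + n)]
        {ω | ((X ω).state T β η₁ n).θ j = 1} := hs.θ j (measurableSet_singleton _)
    have h4 := hs.trig (m := ℱ (K * initRounds T + n)) T (K * initRounds T + n) j
    exact @MeasurableSet.inter _ (ℱ _) _ _ (@MeasurableSet.const _ (ℱ _) _)
      (h1.inter ((@MeasurableSet.inter _ (ℱ _) _ _ (@MeasurableSet.const _ (ℱ _) _) h2).union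
        (h3.inter h4.compl)))
  · have : {ω | Covered T ((X ω).state T β η₁) j N p n} = ∅ := by
      ext ω
      simp only [Set.mem_ofPred_eq, Set.mem_empty_iff_false, iff_false]
      exact fun hc => hpn ((isPath (X ω)).le_of_covered hc)
    rw [this]
    exact @MeasurableSet.empty _ (ℱ _)

lemma essBounded_trigCost (j : Fin K) (n : ℕ) :
    EssBounded P fun ω => trigCost T ((X ω).state T β η₁) j n :=
  .ite ((h.measurableState' n).trig T _ j) (h.essBounded_one_div_sqrt_w n j) (.const 0)

omit [IsProbabilityMeasure D] [IsProbabilityMeasure P] [NeZero K] in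
lemma measurableSet_isOmd (n : ℕ) :
    MeasurableSet[ℱ (K * initRounds T + n)] {ω | IsOmd T ((X ω).state T β η₁) n} := by
  have hs := h.measurableState n
  exact (hs.trig_nonempty (m := ℱ (K * initRounds T + n)) T _).union
    ((hs.tag (measurableSet_singleton 1)).union (hs.tag (measurableSet_singleton 2)))

lemma essBounded_excess (j : Fin K) (n : ℕ) :
    EssBounded P fun ω => excess T ((X ω).state T β η₁) (IsRun.est T β η₁ (X ω)) j n := by
  classical
  exact .ite (ℱ.le _ _ (h.measurableSet_isOmd n)) ((h.essBounded_η n j).mul (h.essBounded_est n j))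
    (.const 0)

lemma essBounded_accum (j : Fin K) (n : ℕ) :
    EssBounded P fun ω => accum T ((X ω).state T β η₁) (IsRun.est T β η₁ (X ω)) j n :=
  .sum _ fun k _ => h.essBounded_excess j k

lemma essBounded_segmentCost (j : Fin K) (κ r : ℝ) (N p : ℕ) : EssBounded P fun ω =>
    segmentCost T ((X ω).state T β η₁) (IsRun.est T β η₁ (X ω)) j κ r N p := by
  have hst : ∀ n, MeasurableSet
      {ω | ((X ω).state T β η₁ n).start j = initRounds T + p} := fun n =>
    (h.measurableState' n).start j (measurableSet_singleton _)
  refine .ite (hst p) (.add ((h.essBounded_trigCost j _).const_mul _) (.sum _ fun n _ =>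
    .ite (hst n) (.add (.const_mul _ (.add ((h.essBounded_trigCost j n).const_mul _)
      ((h.essBounded_accum j n).const_mul _))) ?_) (.const 0))) (.const 0)
  split_ifs
  · exact .const _
  · exact .const _

/-- Regret of a learner in a round, on an event of the past. -/
lemma setIntegral_regret_le (j : Fin K) (a : Fin (k j)) (n : ℕ) {S : Set Ω}
    (hS : MeasurableSet[ℱ (K * initRounds T + n)] S) :
    ∫ ω in S, (IsRun.est T β η₁ (X ω) n j - (X ω).loss (K * initRounds T + n) j a) ∂P ≤
      P.real S := by
  have hS' := ℱ.le _ _ hS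
  have hI : EssBounded P (S.indicator (1 : Ω → ℝ)) :=
    .of_le (measurable_one.indicator hS') (B := 1) (.of_forall fun ω => by
      by_cases hω : ω ∈ S <;> simp [hω])
  have h1 := h.integral_mul_est_le n j (Z := S.indicator 1)
    ((measurable_const (a := (1 : ℝ))).indicator hS) hI
    (fun ω => by by_cases hω : ω ∈ S <;> simp [hω])
  rw [integral_indicator_one hS'] at h1
  refine le_trans ?_ h1
  rw [← integral_indicator hS']
  refine integral_mono_ae (((h.essBounded_est n j).sub
    (h.essBounded_loss _ j a)).integrable.indicator hS') (hI.mul (h.essBounded_est n j)).integrable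
    (h.ae_mem.mono fun ω hω => ?_)
  have := (hω (K * initRounds T + n) j a).1
  by_cases hωS : ω ∈ S
  · simp only [Set.indicator_of_mem hωS, Pi.one_apply, one_mul]; linarith
  · simp [Set.indicator_of_notMem hωS]

end BoundedRun

lemma sum_range_add_eq {f : ℕ → ℝ} {p N : ℕ} (h1 : ∀ n < p, f n = 0) (h2 : ∀ n, N ≤ n → f n = 0) :
    ∑ q ∈ Finset.range N, f (p + q) = ∑ n ∈ Finset.range N, f n := by
  have h3 : ∑ n ∈ Finset.range (p + N), f n = ∑ q ∈ Finset.range N, f (p + q) := by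
    rw [Finset.sum_range_add, Finset.sum_eq_zero fun n hn => h1 n (Finset.mem_range.1 hn), zero_add]
  rw [← h3]
  refine (Finset.sum_subset (Finset.range_subset_range.2 (Nat.le_add_left N p)) fun n _ hn =>
    h2 n ?_).symm
  simpa using hn

namespace BoundedRun

variable {K : ℕ} {k : Fin K → ℕ} {A : (i : Fin K) → Learner (k i)}
  {D : Measure ((i : Fin K) → Fin (k i) → ℝ)} {T : ℕ} {η₁ : Fin K → ℝ} {Ω : Type u}
  [m0 : MeasurableSpace Ω] {P : Measure Ω} {ℱ : Filtration ℕ m0} {X : Ω → Trajectory K k}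
  [IsProbabilityMeasure D] [IsProbabilityMeasure P] [NeZero K]
  {j : Fin K}

/-- Estimated loss of a learner minus the loss of one of its arms. -/
def regretTerm (T : ℕ) (β : ℝ) (η₁ : Fin K → ℝ) (X : Ω → Trajectory K k) (j : Fin K)
    (a : Fin (k j)) (n : ℕ) (ω : Ω) : ℝ :=
  IsRun.est T β η₁ (X ω) n j - (X ω).loss (K * initRounds T + n) j a

section general

variable {β : ℝ} (h : BoundedRun A D T β η₁ P ℱ X)
include h

lemma essBounded_regretTerm (a : Fin (k j)) (n : ℕ) :
    EssBounded P (regretTerm T β η₁ X j a n) :=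
  (h.essBounded_est n j).sub (h.essBounded_loss _ j a)

omit m0 [IsProbabilityMeasure D] [IsProbabilityMeasure P] [NeZero K] h in
lemma ownRound_main (a : Fin (k j)) (n : ℕ) (ω : Ω) :
    (X ω).feedback T β η₁ j (initRounds T + n) -
      (X ω).loss (gameRound T j (initRounds T + n)) j a = regretTerm T β η₁ X j a n ω := by
  rw [gameRound_of_le j (Nat.le_add_right _ _), Nat.add_sub_cancel_left]
  unfold Trajectory.feedback regretTerm
  rw [if_neg (by omega), Nat.add_sub_cancel_left]
  rfl

lemma integrable_ownRound (a : Fin (k j)) (q : ℕ) : Integrable (fun ω =>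
    (X ω).feedback T β η₁ j q - (X ω).loss (gameRound T j q) j a) P := by
  by_cases hq : q < initRounds T
  · simp only [gameRound_of_lt j hq, Trajectory.feedback, if_pos hq]
    exact ((h.essBounded_loss_arm _ j q).sub (h.essBounded_loss _ j a)).integrable
  · obtain ⟨n, rfl⟩ := Nat.exists_eq_add_of_le (not_lt.1 hq)
    simp only [ownRound_main a n]
    exact (h.essBounded_regretTerm a n).integrable

omit [IsProbabilityMeasure D] [IsProbabilityMeasure P] [NeZero K] in
lemma measurableSet_covered' (j : Fin K) (N p n : ℕ) :
    MeasurableSet {ω | Covered T ((X ω).state T β η₁) j N p n} :=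
  ℱ.le _ _ (h.measurableSet_covered j N p n)

/-- Regret in the rounds of a segment that begins in the main phase. -/
lemma sum_covered_regret_le {R : ℕ → ℝ}
    (hstab : IsStable.{u} (1 / 2) R (A j) (D.map fun x => x j)) (a : Fin (k j)) {N p : ℕ}
    (hp : 1 ≤ p) {c : Ω → ℝ} (hc : EssBounded P c)
    (hZ : ∀ᵐ ω ∂P, Covered T ((X ω).state T β η₁) j N p p → ∃ Z : ℝ,
      √(((X ω).state T β η₁ p).env j) ≤ Z ∧
      (∀ q, Covered T ((X ω).state T β η₁) j N p (p + q) →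
        1 / √(((X ω).state T β η₁ (p + q)).wbar T j) ≤ Z) ∧
      ∀ t, Covered T ((X ω).state T β η₁) j N p (p + t) →
        ¬ Covered T ((X ω).state T β η₁) j N p (p + (t + 1)) → Z * R (t + 1) ≤ c ω) :
    ∑ n ∈ Finset.range N, ∫ ω in {ω | Covered T ((X ω).state T β η₁) j N p n},
      regretTerm T β η₁ X j a n ω ∂P ≤
    ∫ ω in {ω | Covered T ((X ω).state T β η₁) j N p p}, c ω ∂P := by
  have hsub : ∀ q, initRounds T + p + q - initRounds T = p + q := fun q => by omega
  obtain ⟨B, hB⟩ := h.ae_bounded p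
  have h1 := h.segment_regret h.one_le_T h.η₁_pos h.one_le_β hstab a (a := initRounds T + p)
    (.inr (Nat.le_add_right _ _))
    (G := fun q => {ω | Covered T ((X ω).state T β η₁) j N p (p + q)}) (Q := N)
    (fun q => by
      rw [gameRound_of_le j (by omega), hsub]
      exact h.measurableSet_covered j N p (p + q))
    (antitone_nat_of_succ_le fun q ω hω =>
      (isPath (X ω)).covered_of_succ (Nat.le_add_right p q) hω)
    (by
      ext ω
      simp only [Set.mem_ofPred_eq, Set.mem_empty_iff_false, iff_false]
      exact fun hω => by have := hω.1; omega)
    (fun q _ ω hω => by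
      rw [hsub]
      refine hω.2.1.trans ?_
      unfold startClock
      rw [if_neg (by omega)])
    (B := B)
    (by
      rw [Nat.add_sub_cancel_left]
      exact hB.mono fun ω hω => hω.env j)
    hc.integrable (fun q => h.integrable_ownRound a _)
    (by
      filter_upwards [hZ] with ω hω hω0
      obtain ⟨Z, h2, h3, h4⟩ := hω hω0
      refine ⟨Z, by rwa [Nat.add_sub_cancel_left], fun q hq => ?_, h4⟩
      have h5 := h3 q hq
      unfold Trajectory.ownProb
      rwa [if_neg (by omega), hsub])
  refine le_trans (le_of_eq ?_) h1
  have h2 : ∀ q ω, (X ω).feedback T β η₁ j (initRounds T + p + q) -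
      (X ω).loss (gameRound T j (initRounds T + p + q)) j a =
        regretTerm T β η₁ X j a (p + q) ω := fun q ω => by
    rw [add_assoc]; exact ownRound_main a (p + q) ω
  simp only [h2]
  refine (sum_range_add_eq (f := fun n => ∫ ω in {ω | Covered T ((X ω).state T β η₁) j N p n},
      regretTerm T β η₁ X j a n ω ∂P) (fun n hn => ?_) (fun n hn => ?_)).symm
  · have : {ω | Covered T ((X ω).state T β η₁) j N p n} = ∅ := by
      ext ω
      simp only [Set.mem_ofPred_eq, Set.mem_empty_iff_false, iff_false]
      exact fun hc => by have := (isPath (X ω)).le_of_covered hc; omega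
    simp [this]
  · have : {ω | Covered T ((X ω).state T β η₁) j N p n} = ∅ := by
      ext ω
      simp only [Set.mem_ofPred_eq, Set.mem_empty_iff_false, iff_false]
      exact fun hc => by have := hc.1; omega
    simp [this]

/-- Regret in the rounds of the segment that begins in the initial phase. -/
lemma sum_covered_zero_regret_le {R : ℕ → ℝ}
    (hstab : IsStable.{u} (1 / 2) R (A j) (D.map fun x => x j)) {a : Fin (k j)}
    (ha : meanLoss D j a = bestLoss D j) {N : ℕ} {Z c : ℝ} (hZ1 : 1 ≤ Z)
    (hc : ∀ t < initRounds T + N, Z * R (t + 1) ≤ c)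
    (hZ : ∀ᵐ ω ∂P, ∀ n, Covered T ((X ω).state T β η₁) j N 0 n →
        1 / √(((X ω).state T β η₁ n).wbar T j) ≤ Z) :
    ∑ n ∈ Finset.range N, ∫ ω in {ω | Covered T ((X ω).state T β η₁) j N 0 n},
      regretTerm T β η₁ X j a n ω ∂P ≤ c := by
  set G : ℕ → Set Ω := fun q =>
    if q < initRounds T then Set.univ
    else {ω | Covered T ((X ω).state T β η₁) j N 0 (q - initRounds T)} with hG
  have hG1 : ∀ q, q < initRounds T → G q = Set.univ := fun q hq => if_pos hq
  have hG2 : ∀ n, G (initRounds T + n) = {ω | Covered T ((X ω).state T β η₁) j N 0 n} := by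
    intro n
    simp only [hG]
    rw [if_neg (by omega), Nat.add_sub_cancel_left]
  have hm := one_le_initRounds T
  have hlt : ∀ q, ∀ ω ∈ G q, q < initRounds T + N := by
    intro q ω hω
    by_cases hq : q < initRounds T
    · omega
    · obtain ⟨n, rfl⟩ := Nat.exists_eq_add_of_le (not_lt.1 hq)
      rw [hG2] at hω
      have := hω.1
      omega
  have h1 := h.segment_regret h.one_le_T h.η₁_pos h.one_le_β hstab a (a := 0) (.inl rfl)
    (G := G) (Q := initRounds T + N)
    (fun q => by
      rw [zero_add]
      by_cases hq : q < initRounds T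
      · rw [hG1 q hq]; exact @MeasurableSet.univ _ (ℱ _)
      · obtain ⟨n, rfl⟩ := Nat.exists_eq_add_of_le (not_lt.1 hq)
        rw [hG2, gameRound_of_le j (by omega), Nat.add_sub_cancel_left]
        exact h.measurableSet_covered j N 0 n)
    (antitone_nat_of_succ_le fun q => by
      by_cases hq : q < initRounds T
      · rw [hG1 q hq]; exact Set.subset_univ _
      · obtain ⟨n, rfl⟩ := Nat.exists_eq_add_of_le (not_lt.1 hq)
        rw [add_assoc, hG2, hG2]
        exact fun ω hω => (isPath (X ω)).covered_of_succ (Nat.zero_le n) hω)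
    (by
      ext ω
      simp only [Set.mem_empty_iff_false, iff_false]
      exact fun hω => (hlt _ ω hω).false)
    (fun q hq ω hω => by
      rw [zero_add] at hq ⊢
      obtain ⟨n, rfl⟩ := Nat.exists_eq_add_of_le hq
      rw [hG2] at hω
      rw [Nat.add_sub_cancel_left]
      exact hω.2.1)
    (B := 1)
    (.of_forall fun ω => by rw [Nat.zero_sub]; exact le_rfl)
    (integrable_const c) (fun q => h.integrable_ownRound a _)
    (by
      filter_upwards [hZ] with ω hω _
      refine ⟨Z, ?_, fun q hq => ?_, fun t ht _ => hc t (hlt t ω ht)⟩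
      · rw [Nat.zero_sub]
        change √1 ≤ Z
        rwa [Real.sqrt_one]
      · rw [zero_add]
        unfold Trajectory.ownProb
        split_ifs with h5
        · simpa using hZ1
        · obtain ⟨n, rfl⟩ := Nat.exists_eq_add_of_le (not_lt.1 h5)
          rw [hG2] at hq
          rw [Nat.add_sub_cancel_left]
          exact hω n hq)
  simp only [zero_add] at h1
  rw [Finset.sum_range_add, hG1 0 hm, Measure.restrict_univ, integral_const, probReal_univ,
    one_smul] at h1
  -- In the initial phase the expected loss of the learner is at least that of its best arm, so
  -- these rounds may be dropped.
  have h2 : 0 ≤ ∑ q ∈ Finset.range (initRounds T), ∫ ω in G q, ((X ω).feedback T β η₁ j q -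
      (X ω).loss (gameRound T j q) j a) ∂P := by
    refine Finset.sum_nonneg fun q hq => ?_
    have hq := Finset.mem_range.1 hq
    rw [hG1 q hq, Measure.restrict_univ]
    simp only [gameRound_of_lt j hq, Trajectory.feedback, if_pos hq]
    rw [integral_sub (h.essBounded_loss_arm _ j q).integrable (h.essBounded_loss _ j a).integrable,
      h.integral_loss_init hq, ha]
    exact sub_nonneg.2 (h.bestLoss_le_integral_init hq j)
  have h3 : ∀ n, ∫ ω in G (initRounds T + n), ((X ω).feedback T β η₁ j (initRounds T + n) -
      (X ω).loss (gameRound T j (initRounds T + n)) j a) ∂P =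
      ∫ ω in {ω | Covered T ((X ω).state T β η₁) j N 0 n}, regretTerm T β η₁ X j a n ω ∂P := by
    intro n
    rw [hG2]
    simp only [ownRound_main a n]
  simp only [h3] at h1
  linarith

/-- Decomposition of the regret into segments. -/
lemma sum_regret_eq (a : Fin (k j)) (N : ℕ) :
    ∑ n ∈ Finset.range N, ∫ ω, regretTerm T β η₁ X j a n ω ∂P =
      ∑ n ∈ Finset.range N, ∫ ω in {ω | ∀ p < N, ¬ Covered T ((X ω).state T β η₁) j N p n},
        regretTerm T β η₁ X j a n ω ∂P +
      ∑ p ∈ Finset.range N, ∑ n ∈ Finset.range N,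
        ∫ ω in {ω | Covered T ((X ω).state T β η₁) j N p n}, regretTerm T β η₁ X j a n ω ∂P := by
  rw [Finset.sum_comm, ← Finset.sum_add_distrib]
  refine Finset.sum_congr rfl fun n _ => ?_
  have hI := (h.essBounded_regretTerm a n).integrable
  have hm : ∀ p, MeasurableSet {ω | Covered T ((X ω).state T β η₁) j N p n} := fun p =>
    h.measurableSet_covered' j N p n
  rw [← integral_biUnion_finset (Finset.range N) (fun p _ => hm p) (fun p _ q _ hpq =>
      Set.disjoint_left.2 fun ω h1 h2 => hpq (startClock_injective T (h1.2.1.symm.trans h2.2.1)))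
      fun p _ => hI.integrableOn,
    ← integral_add_compl (Finset.measurableSet_biUnion (Finset.range N) fun p _ => hm p) hI,
    add_comm]
  congr 2
  congr 1
  ext ω
  simp

end general

variable (h : BoundedRun A D T (mult T) η₁ P ℱ X) (hR : Regime K T)
include h hR

/-- Regret of a learner in the main phase. -/
lemma sum_regret_le (hη₁' : ∀ i, η₁ i ≤ 1 / 4) {R : ℕ → ℝ}
    (hstab : IsStable.{u} (1 / 2) R (A j) (D.map fun x => x j)) {a : Fin (k j)}
    (ha : meanLoss D j a = bestLoss D j) {κ : ℝ} (hκ : 0 ≤ κ)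
    (hRκ : ∀ t, 1 ≤ t → t ≤ T → R t ≤ κ * √(t : ℝ)) {N : ℕ} (hN : N + K * initRounds T ≤ T) :
    ∑ n ∈ Finset.range N, ∫ ω, regretTerm T (mult T) η₁ X j a n ω ∂P ≤
      ∑ p ∈ Finset.Ico (6 * (K * initRounds T)) N,
        ∫ ω, segmentCost T ((X ω).state T (mult T) η₁) (IsRun.est T (mult T) η₁ (X ω)) j κ (R T)
          N p ∂P +
      1200000000 * R T + (14 * (K * initRounds T : ℕ) + 4 + 4 * Real.log T) := by
  classical
  obtain ⟨hRm, hR0, -⟩ := id hstab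
  set M := K * initRounds T with hM
  have hM1 : 4000000 ≤ M := hR.le_init
  have hmM : initRounds T ≤ M := Nat.le_mul_of_pos_left _ (by have := hR.two_le; omega)
  have hact : ∀ p < 6 * M, ∀ n ω, Covered T ((X ω).state T (mult T) η₁) j N p n →
      Active T ((X ω).state T (mult T) η₁) j n := fun p hp n ω hc => by
    rcases hc.2.2 with h1 | h1
    · have := h1.1; omega
    · exact h1
  have hsamp : ∀ᵐ ω ∂P, ∀ p < 6 * M, ∀ n, Covered T ((X ω).state T (mult T) η₁) j N p n →
      1 / √(((X ω).state T (mult T) η₁ n).wbar T j) ≤ 300000000 := by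
    filter_upwards [h.ae_mem] with ω hω p hp n hc
    refine (isPath (X ω)).sampling_of_active hR h.η₁_pos hη₁' (fun n i => (h.est_bounds hω n i).1)
      (fun n => (h.est_bounds hω n j).2.1) ?_ (hact p hp n ω hc)
    have := hc.1
    omega
  rw [h.sum_regret_eq a N]
  -- Each uncovered round costs at most 1 in expectation. Besides the early ones there are two for
  -- each step begun at index 1, and at most one such step per epoch plus one more.
  have hU : ∑ n ∈ Finset.range N,
      ∫ ω in {ω | ∀ p < N, ¬ Covered T ((X ω).state T (mult T) η₁) j N p n},
        regretTerm T (mult T) η₁ X j a n ω ∂P ≤ 14 * (M : ℕ) + 4 + 4 * Real.log T := by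
    have hUm : ∀ n, MeasurableSet[ℱ (M + n)]
        {ω | ∀ p < N, ¬ Covered T ((X ω).state T (mult T) η₁) j N p n} := by
      intro n
      have : {ω | ∀ p < N, ¬ Covered T ((X ω).state T (mult T) η₁) j N p n} =
          ⋂ p ∈ Finset.range N, {ω | Covered T ((X ω).state T (mult T) η₁) j N p n}ᶜ := by
        ext ω; simp
      rw [this]
      exact Finset.measurableSet_biInter (m := ℱ (M + n)) _ fun p _ =>
        @MeasurableSet.compl _ _ (ℱ (M + n)) (h.measurableSet_covered j N p n)
    refine (Finset.sum_le_sum fun n _ => h.setIntegral_regret_le j a n (hUm n)).trans ?_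
    have h1 : ∀ n, P.real {ω | ∀ p < N, ¬ Covered T ((X ω).state T (mult T) η₁) j N p n} =
        ∫ ω, {ω | ∀ p < N, ¬ Covered T ((X ω).state T (mult T) η₁) j N p n}.indicator 1 ω ∂P :=
      fun n => (integral_indicator_one (ℱ.le _ _ (hUm n))).symm
    have hint : ∀ n, Integrable
        ({ω | ∀ p < N, ¬ Covered T ((X ω).state T (mult T) η₁) j N p n}.indicator (1 : Ω → ℝ)) P :=
      fun n => (integrable_const (1 : ℝ)).indicator (ℱ.le _ _ (hUm n))
    simp only [h1]
    rw [← integral_finsetSum _ fun n _ => hint n]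
    refine (integral_mono (integrable_finsetSum _ fun n _ => hint n)
      (integrable_const (14 * (M : ℕ) + 4 + 4 * Real.log T)) fun ω => ?_).trans_eq (by simp)
    have hp := isPath (T := T) (β := mult T) (η₁ := η₁) (X ω)
    have h2 := hp.sum_not_covered_le (j := j) h.η₁_pos h.one_le_β (by omega) N
      (fun n => {ω | ∀ p < N, ¬ Covered T ((X ω).state T (mult T) η₁) j N p n}.indicator 1 ω)
      (fun n => by simp [Set.indicator_apply])
    have h3 := hp.nEpoch_le_log hR hN
    have h4 : (nFirst T ((X ω).state T (mult T) η₁) j N : ℝ) ≤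
        nEpoch T ((X ω).state T (mult T) η₁) N + 1 := by
      exact_mod_cast (Nat.le_add_right _ _).trans (hp.nFirst_le N j)
    dsimp only
    linarith
  -- Early segments with the first threshold, for which no bonus is used. There are at most three
  -- besides the one from the initial phase, whence the total 4 · 3 · 10⁸ `R T`.
  have hE : ∀ p, 1 ≤ p → p < 6 * M → ∑ n ∈ Finset.range N,
      ∫ ω in {ω | Covered T ((X ω).state T (mult T) η₁) j N p n},
        regretTerm T (mult T) η₁ X j a n ω ∂P ≤
      P.real {ω | Covered T ((X ω).state T (mult T) η₁) j N p p} * (300000000 * R T) := by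
    intro p hp1 hp2
    refine (h.sum_covered_regret_le hstab a hp1 (c := fun _ => 300000000 * R T) (.const _)
      (hsamp.mono fun ω hω hc => ⟨300000000, ?_, fun q hq => hω p hp2 _ hq,
        fun t ht _ => ?_⟩)).trans_eq ?_
    · exact ((isPath (X ω)).sqrt_env_le_of_active h.η₁_pos (hact p hp2 p ω hc)).trans
        (by norm_num)
    · have := ht.1
      exact mul_le_mul_of_nonneg_left (hRm (by omega)) (by norm_num)
    · rw [setIntegral_const, smul_eq_mul]
  have hZ0 : ∑ n ∈ Finset.range N,
      ∫ ω in {ω | Covered T ((X ω).state T (mult T) η₁) j N 0 n},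
        regretTerm T (mult T) η₁ X j a n ω ∂P ≤ 300000000 * R T :=
    h.sum_covered_zero_regret_le hstab ha (by norm_num)
      (fun t ht => mul_le_mul_of_nonneg_left (hRm (by omega)) (by norm_num))
      (hsamp.mono fun ω hω n hc => hω 0 (by omega) n hc)
  have hL : ∀ p, 6 * M ≤ p → ∑ n ∈ Finset.range N,
      ∫ ω in {ω | Covered T ((X ω).state T (mult T) η₁) j N p n},
        regretTerm T (mult T) η₁ X j a n ω ∂P ≤
      ∫ ω, segmentCost T ((X ω).state T (mult T) η₁) (IsRun.est T (mult T) η₁ (X ω)) j κ (R T)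
          N p ∂P := by
    intro p hp
    have hcov : ∀ n ω, Covered T ((X ω).state T (mult T) η₁) j N p n ↔
        InSegment T ((X ω).state T (mult T) η₁) j N p n := fun n ω =>
      IsPath.covered_iff hp (by omega)
    refine (h.sum_covered_regret_le hstab a (by omega) (h.essBounded_segmentCost j κ (R T) N p)
      (h.ae_mem.mono fun ω hω hc => ?_)).trans
      (setIntegral_le_integral (h.essBounded_segmentCost j κ (R T) N p).integrable
        (h.ae_mem.mono fun ω hω => ?_))
    · rw [hcov] at hc
      obtain ⟨Z, h1, h2, h3⟩ := (isPath (X ω)).segment_bound hR h.η₁_pos hη₁'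
        (fun n i => (h.est_bounds hω n i).1) hR0 hRm hκ hRκ
        (fun n => (h.est_bounds hω n j).2.1) hN hp hc.2.1
      simp only [hcov]
      exact ⟨Z, h1 hc, h2, h3⟩
    · exact (isPath (X ω)).segmentCost_nonneg h.η₁_pos (fun n i => (h.est_bounds hω n i).1) hR0
        hκ N p
  have hE3 : ∑ p ∈ Finset.Ico 1 (6 * M),
      P.real {ω | Covered T ((X ω).state T (mult T) η₁) j N p p} ≤ 3 := by
    have hm : ∀ p, MeasurableSet {ω | Covered T ((X ω).state T (mult T) η₁) j N p p} := fun p =>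
      h.measurableSet_covered' j N p p
    have hint : ∀ p, Integrable
        ({ω | Covered T ((X ω).state T (mult T) η₁) j N p p}.indicator (1 : Ω → ℝ)) P :=
      fun p => (integrable_const (1 : ℝ)).indicator (hm p)
    have h1 : ∀ p, P.real {ω | Covered T ((X ω).state T (mult T) η₁) j N p p} =
        ∫ ω, {ω | Covered T ((X ω).state T (mult T) η₁) j N p p}.indicator 1 ω ∂P :=
      fun p => (integral_indicator_one (hm p)).symm
    simp only [h1]
    rw [← integral_finsetSum _ fun n _ => hint n]
    refine (integral_mono (integrable_finsetSum _ fun n _ => hint n)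
      (integrable_const (3 : ℝ)) fun ω => ?_).trans_eq (by simp)
    exact (isPath (T := T) (β := mult T) (η₁ := η₁) (X ω)).sum_covered_le (j := j) (by omega) N
      (fun p => {ω | Covered T ((X ω).state T (mult T) η₁) j N p p}.indicator 1 ω)
      (fun n => by simp [Set.indicator_apply])
  have hseg : ∑ p ∈ Finset.range N, ∑ n ∈ Finset.range N,
      ∫ ω in {ω | Covered T ((X ω).state T (mult T) η₁) j N p n},
        regretTerm T (mult T) η₁ X j a n ω ∂P ≤
      300000000 * R T + 3 * (300000000 * R T) + ∑ p ∈ Finset.Ico (6 * M) N,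
        ∫ ω, segmentCost T ((X ω).state T (mult T) η₁) (IsRun.est T (mult T) η₁ (X ω)) j κ (R T)
          N p ∂P := by
    have hRT := hR0 T
    set F : ℕ → ℝ := fun p => ∑ n ∈ Finset.range N,
      ∫ ω in {ω | Covered T ((X ω).state T (mult T) η₁) j N p n},
        regretTerm T (mult T) η₁ X j a n ω ∂P with hF
    set e : ℕ → ℝ := fun p => P.real {ω | Covered T ((X ω).state T (mult T) η₁) j N p p} *
      (300000000 * R T) with he
    have he0 : ∀ p, 0 ≤ e p := fun p => by positivity
    have h1 : ∑ p ∈ Finset.Ico 1 (6 * M), e p ≤ 3 * (300000000 * R T) := by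
      rw [← Finset.sum_mul]
      exact mul_le_mul_of_nonneg_right hE3 (by positivity)
    rcases Nat.eq_zero_or_pos N with h0 | h0
    · rw [h0]
      simp only [Finset.range_zero, Finset.sum_empty]
      rw [Finset.Ico_eq_empty_of_le (Nat.zero_le _), Finset.sum_empty]
      positivity
    rw [Finset.range_eq_Ico, Finset.sum_eq_sum_Ico_succ_bot h0, add_assoc]
    refine add_le_add hZ0 ?_
    rcases le_total (6 * M) N with h2 | h2
    · rw [← Finset.sum_Ico_consecutive F (show 0 + 1 ≤ 6 * M by omega) h2]
      refine add_le_add ((Finset.sum_le_sum fun p hp => ?_).trans h1)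
        (Finset.sum_le_sum fun p hp => hL p (Finset.mem_Ico.1 hp).1)
      have := Finset.mem_Ico.1 hp
      exact hE p (by omega) (by omega)
    · rw [Finset.Ico_eq_empty_of_le h2, Finset.sum_empty, add_zero]
      refine le_trans ((Finset.sum_le_sum fun p hp => ?_).trans
        (Finset.sum_le_sum_of_subset_of_nonneg
          (Finset.Ico_subset_Ico (le_refl (0 + 1)) h2) fun p _ _ => he0 p)) h1
      have := Finset.mem_Ico.1 hp
      exact hE p (by omega) (by omega)
  linarith

end BoundedRun

/-! ### Restarts are paid for by the negative regret -/

lemma sum_comp_le {f : ℕ → ℝ} (hf : ∀ n, 0 ≤ f n) {s : Finset ℕ} {N : ℕ} {g : ℕ → ℕ}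
    (hg : Set.InjOn g s) (hN : ∀ n ∈ s, g n < N) :
    ∑ n ∈ s, f (g n) ≤ ∑ n ∈ Finset.range N, f n := by
  rw [← Finset.sum_image (f := f) hg]
  refine Finset.sum_le_sum_of_subset_of_nonneg (fun x hx => ?_) fun n _ _ => hf n
  obtain ⟨n, hn, rfl⟩ := Finset.mem_image.1 hx
  exact Finset.mem_range.2 (hN n hn)

namespace IsPath

variable {K : ℕ} {T : ℕ} {β : ℝ} {η₁ L₀ : Fin K → ℝ} {s : ℕ → State K} {ℓ : ℕ → Fin K → ℝ}
  {j : Fin K}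

lemma shift_nonneg [NeZero K] (h : IsPath T β η₁ L₀ s ℓ) (hη₁ : ∀ i, 0 < η₁ i) (hβ : 1 ≤ β)
    (hℓ : ∀ n i, 0 ≤ ℓ n i) (n : ℕ) : 0 ≤ (s n).shift (ℓ n) := by
  have h1 : ∀ i, 0 ≤ (s n).η i * ((s n).w i * √((s n).w i)) := fun i =>
    mul_nonneg (h.η_pos hη₁ hβ n i).le
      (mul_nonneg (h.w_pos hη₁ hβ n i).le (Real.sqrt_nonneg _))
  exact div_nonneg (Finset.sum_nonneg fun i _ => mul_nonneg (h1 i) (hℓ n i))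
    (Finset.sum_nonneg fun i _ => h1 i)

open Classical in
/-- The regret of the learner after its restarts is paid for by the negative regret. -/
lemma sum_segmentCost_le_bonus [NeZero K] (h : IsPath T (mult T) η₁ L₀ s ℓ) (hR : Regime K T)
    (hη₁ : ∀ i, 0 < η₁ i) (hℓ : ∀ n i, 0 ≤ ℓ n i) {R : ℕ → ℝ} (hR0 : ∀ t, 0 ≤ R t) {N : ℕ}
    (hN : N + 1 + K * initRounds T ≤ T) :
    ∑ p ∈ Finset.Ico (6 * (K * initRounds T)) N,
        segmentCost T s ℓ j (gain T / (50 * η₁ j)) (R T) N p ≤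
      ∑ n ∈ Finset.range (N + 1), (s n).bonus (mult T) j +
      (gain T * ∑ n ∈ Finset.range (N + 1),
        (if j ∈ (s n).trig T (K * initRounds T + n) then (s n).shift (ℓ n) else 0) +
      3 * gain T * ∑ n ∈ Finset.range (N + 1), (if IsOmd T s n then ℓ n j else 0)) +
      6.2 * R T := by
  set M := K * initRounds T with hM
  have hM1 : 4000000 ≤ M := hR.le_init
  have hβ := one_le_mult T
  have hg := gain_nonneg T
  have hη := hη₁ j
  set κ := gain T / (50 * η₁ j) with hκ
  have hκ0 : 0 ≤ κ := by positivity
  set b : ℕ → ℝ := fun n => (s n).bonus (mult T) j with hb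
  set Y : ℕ → ℝ := fun n => if j ∈ (s n).trig T (M + n) then (s n).shift (ℓ n) else 0 with hY
  set E : ℕ → ℝ := fun n => if IsOmd T s n then ℓ n j else 0 with hE
  have hb0 : ∀ n, 0 ≤ b n := fun n => h.bonus_nonneg hη₁ hβ n j
  have hY0 : ∀ n, 0 ≤ Y n := fun n => by
    simp only [hY]; split_ifs
    · exact h.shift_nonneg hη₁ hβ hℓ n
    · exact le_rfl
  have hE0 : ∀ n, 0 ≤ E n := fun n => by
    simp only [hE]; split_ifs
    · exact hℓ n j
    · exact le_rfl
  -- A trigger in round t is compensated by the bonus of round t + 1, after which the step size is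
  -- increased.
  have hcost : ∀ t, 5 * M ≤ t → t + 1 ≤ N + 1 →
      2.48 * (κ * √((t + 2 * M + 6 : ℕ) : ℝ) * trigCost T s j t) ≤ b (t + 1) + gain T * Y t := by
    intro t ht htN
    by_cases hj : j ∈ (s t).trig T (M + t)
    · have h1 := h.le_bonus hR hη₁ hℓ (by omega) ht hj
      have h2 : trigCost T s j t = 1 / √((s t).w j) := if_pos hj
      have h3 : Y t = (s t).shift (ℓ t) := if_pos hj
      rw [h2, h3]
      simp only [hb]
      linarith
    · have h2 : trigCost T s j t = 0 := if_neg hj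
      have h3 : Y t = 0 := if_neg hj
      rw [h2, h3]
      have := hb0 (t + 1)
      linarith
  -- The growth of κ√n is offset by η ≤ 24η₁/√n; with κ = gain/(50η₁) there remains 2 · 24/50 = 0.96
  -- of the gain.
  have hexc : ∀ n, 6 * M ≤ n → n ≤ N → ∀ k, n - 3 ≤ k → k < n →
      κ * √(lengthBound K T n) * excess T s ℓ j k ≤ 0.96 * gain T * E k := by
    intro n hn hnN k hk hkn
    by_cases ho : IsOmd T s k
    · have h1 : excess T s ℓ j k = (s k).η j * ℓ k j := if_pos ho
      have h2 : E k = ℓ k j := if_pos ho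
      rw [h1, h2, ← mul_assoc]
      refine mul_le_mul_of_nonneg_right ?_ (hℓ k j)
      have h3 := h.η_le_sqrt hR hη₁ (show k + K * initRounds T ≤ T by omega) j
      have h4 : √(lengthBound K T n : ℝ) ≤ 2 * √((k : ℝ) + 1) := by
        rw [show (2 : ℝ) = √(2 ^ 2) by rw [Real.sqrt_sq (by norm_num)],
          ← Real.sqrt_mul (by norm_num)]
        refine Real.sqrt_le_sqrt ?_
        have h5 : lengthBound K T n ≤ 4 * (k + 1) := by
          unfold lengthBound; rw [← hM]; omega
        have h6 : (lengthBound K T n : ℝ) ≤ 4 * ((k : ℝ) + 1) := by exact_mod_cast h5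
        linarith
      have h5 : 0 < √((k : ℝ) + 1) := Real.sqrt_pos.2 (by positivity)
      calc κ * √(lengthBound K T n : ℝ) * (s k).η j
          ≤ κ * (2 * √((k : ℝ) + 1)) * (24 * η₁ j / √((k : ℝ) + 1)) :=
            mul_le_mul (mul_le_mul_of_nonneg_left h4 hκ0) h3 (h.η_pos hη₁ hβ k j).le (by positivity)
        _ = 0.96 * gain T := by rw [hκ]; field_simp; norm_num; ring
    · have h1 : excess T s ℓ j k = 0 := if_neg ho
      have h2 : E k = 0 := if_neg ho
      rw [h1, h2]; simp
  -- A trigger is charged by the segment that it ends and by the one that begins two rounds later;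
  -- 1.43 + 1.04 < 2.48 lets one bonus pay for both.
  have hterm : ∀ n ∈ Finset.Ico (6 * M) N,
      1.43 * κ * √(lengthBound K T n) * trigCost T s j (n - 2) +
        κ * √(lengthBound K T n) * (1.04 * trigCost T s j n + 1.01 * accum T s ℓ j n) ≤
      1.43 / 2.48 * (b (n - 1) + gain T * Y (n - 2)) + 1.04 / 2.48 * (b (n + 1) + gain T * Y n) +
        (gain T * E (n - 1) + gain T * E (n - 2) + gain T * E (n - 3)) := by
    intro n hn
    obtain ⟨hn1, hn2⟩ := Finset.mem_Ico.1 hn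
    have h1 := hcost (n - 2) (by omega) (by omega)
    have h2 := hcost n (by omega) (by omega)
    have h3 : n - 2 + 2 * M + 6 = lengthBound K T n := by
      unfold lengthBound; rw [← hM]; omega
    have h4 : √(lengthBound K T n : ℝ) ≤ √((n + 2 * M + 6 : ℕ) : ℝ) := by
      refine Real.sqrt_le_sqrt ?_
      have : lengthBound K T n ≤ n + 2 * M + 6 := by unfold lengthBound; rw [← hM]; omega
      exact_mod_cast this
    have h5 : κ * √(lengthBound K T n) * trigCost T s j n ≤
        κ * √((n + 2 * M + 6 : ℕ) : ℝ) * trigCost T s j n :=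
      mul_le_mul_of_nonneg_right (mul_le_mul_of_nonneg_left h4 hκ0) (trigCost_nonneg n)
    rw [h3, show n - 2 + 1 = n - 1 by omega] at h1
    have h6 : κ * √(lengthBound K T n) * accum T s ℓ j n =
        κ * √(lengthBound K T n) * excess T s ℓ j (n - 1) +
        κ * √(lengthBound K T n) * excess T s ℓ j (n - 2) +
        κ * √(lengthBound K T n) * excess T s ℓ j (n - 3) := by
      obtain ⟨q, rfl⟩ : ∃ q, n = q + 3 := ⟨n - 3, by omega⟩
      unfold accum
      rw [Nat.add_sub_cancel, Finset.sum_Ico_succ_top (by omega), Finset.sum_Ico_succ_top (by omega),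
        Finset.sum_Ico_succ_top (by omega), Finset.Ico_self, Finset.sum_empty]
      rw [show q + 3 - 1 = q + 2 by omega, show q + 3 - 2 = q + 1 by omega]
      ring
    have e1 := hexc n hn1 (by omega) (n - 1) (by omega) (by omega)
    have e2 := hexc n hn1 (by omega) (n - 2) (by omega) (by omega)
    have e3 := hexc n hn1 (by omega) (n - 3) (by omega) (by omega)
    have g1 := mul_nonneg hg (hE0 (n - 1))
    have g2 := mul_nonneg hg (hE0 (n - 2))
    have g3 := mul_nonneg hg (hE0 (n - 3))
    have e : κ * √(lengthBound K T n) * (1.04 * trigCost T s j n + 1.01 * accum T s ℓ j n) =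
        1.04 * (κ * √(lengthBound K T n) * trigCost T s j n) +
        1.01 * (κ * √(lengthBound K T n) * accum T s ℓ j n) := by ring
    have e' : 1.43 * κ * √(lengthBound K T n) * trigCost T s j (n - 2) =
        1.43 * (κ * √(lengthBound K T n) * trigCost T s j (n - 2)) := by ring
    rw [e, e', h6]
    linarith
  refine (h.sum_segmentCost_le hη₁ hℓ hR0 hκ0 _ N).trans ?_
  refine add_le_add (le_trans (Finset.sum_le_sum hterm) ?_) le_rfl
  simp only [Finset.sum_add_distrib, ← Finset.mul_sum]
  have inj : ∀ c ≤ 3, Set.InjOn (fun n => n - c) (Finset.Ico (6 * M) N : Set ℕ) :=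
    fun c hc x hx y hy hxy => by
      have h1 := (Finset.mem_Ico.1 hx).1
      have h2 := (Finset.mem_Ico.1 hy).1
      have h3 : x - c = y - c := hxy
      omega
  have rng : ∀ c, ∀ n ∈ Finset.Ico (6 * M) N, n - c < N + 1 := fun c n hn => by
    have := (Finset.mem_Ico.1 hn).2
    omega
  have b1 := sum_comp_le hb0 (inj 1 (by omega)) (rng 1)
  have b2 : ∑ n ∈ Finset.Ico (6 * M) N, b (n + 1) ≤ ∑ n ∈ Finset.range (N + 1), b n :=
    sum_comp_le hb0 (fun x _ y _ hxy => Nat.succ_injective hxy) fun n hn => by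
      have := (Finset.mem_Ico.1 hn).2
      omega
  have y1 := sum_comp_le hY0 (inj 2 (by omega)) (rng 2)
  have y2 := sum_comp_le hY0 (inj 0 (by omega)) (rng 0)
  have e1 := sum_comp_le hE0 (inj 1 (by omega)) (rng 1)
  have e2 := sum_comp_le hE0 (inj 2 (by omega)) (rng 2)
  have e3 := sum_comp_le hE0 (inj 3 (by omega)) (rng 3)
  simp only [Nat.sub_zero] at y2
  have bs : 0 ≤ ∑ n ∈ Finset.range (N + 1), b n := Finset.sum_nonneg fun n _ => hb0 n
  have ys : 0 ≤ ∑ n ∈ Finset.range (N + 1), Y n := Finset.sum_nonneg fun n _ => hY0 n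
  have y1' := mul_le_mul_of_nonneg_left y1 hg
  have y2' := mul_le_mul_of_nonneg_left y2 hg
  have e1' := mul_le_mul_of_nonneg_left e1 hg
  have e2' := mul_le_mul_of_nonneg_left e2 hg
  have e3' := mul_le_mul_of_nonneg_left e3 hg
  have ys' := mul_nonneg hg ys
  linarith

end IsPath

namespace BoundedRun

variable {K : ℕ} {k : Fin K → ℕ} {A : (i : Fin K) → Learner (k i)}
  {D : Measure ((i : Fin K) → Fin (k i) → ℝ)} {T : ℕ} {η₁ : Fin K → ℝ} {Ω : Type u}
  [m0 : MeasurableSpace Ω] {P : Measure Ω} {ℱ : Filtration ℕ m0} {X : Ω → Trajectory K k}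
  [IsProbabilityMeasure D] [IsProbabilityMeasure P] [NeZero K]
  (h : BoundedRun A D T (mult T) η₁ P ℱ X) (hR : Regime K T) {j : Fin K}
include h hR

-- The errors from the shift and from unobserved updates have conditional mean at most 1 per round
-- and occur in O(K (log T)²) rounds altogether; `gain` ≤ 1/(log T)² reduces them to O(K).
open Classical in
lemma sum_integral_segmentCost_le {R : ℕ → ℝ} (hR0 : ∀ t, 0 ≤ R t) {N : ℕ}
    (hN : N + 1 + K * initRounds T ≤ T) :
    ∑ p ∈ Finset.Ico (6 * (K * initRounds T)) N,
        ∫ ω, segmentCost T ((X ω).state T (mult T) η₁) (IsRun.est T (mult T) η₁ (X ω)) j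
          (gain T / (50 * η₁ j)) (R T) N p ∂P ≤
      ∑ n ∈ Finset.range (N + 1), ∫ ω, ((X ω).state T (mult T) η₁ n).bonus (mult T) j ∂P +
        (24 * K + 6.2 * R T) := by
  have hg := gain_nonneg T
  have hgl := gain_mul_le hR.log_pos
  have hN' : N + 1 + K * initRounds T ≤ T := hN
  set M := K * initRounds T with hM
  set S : ℕ → Set Ω := fun n => {ω | j ∈ ((X ω).state T (mult T) η₁ n).trig T (M + n)} with hS
  set O : ℕ → Set Ω := fun n => {ω | IsOmd T ((X ω).state T (mult T) η₁) n} with hO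
  have hSm : ∀ n, MeasurableSet[ℱ (M + n)] (S n) := fun n =>
    (h.measurableState n).trig (m := ℱ (M + n)) T (M + n) j
  have hOm : ∀ n, MeasurableSet[ℱ (M + n)] (O n) := fun n => h.measurableSet_isOmd n
  have hsh := fun n => h.integral_mul_shift_le n (hSm n)
  have hI : ∀ n, EssBounded P ((O n).indicator (1 : Ω → ℝ)) := fun n =>
    .of_le (measurable_one.indicator (ℱ.le _ _ (hOm n))) (B := 1) (.of_forall fun ω => by
      by_cases hω : ω ∈ O n <;> simp [hω])
  have hO1 : ∀ n, ∫ ω, (O n).indicator 1 ω * IsRun.est T (mult T) η₁ (X ω) n j ∂P ≤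
      P.real (O n) := fun n => by
    refine (h.integral_mul_est_le n j (Z := (O n).indicator 1)
      ((measurable_const (a := (1 : ℝ))).indicator (hOm n)) (hI n)
      (fun ω => by by_cases hω : ω ∈ O n <;> simp [hω])).trans_eq ?_
    rw [integral_indicator_one (ℱ.le _ _ (hOm n))]
  have iB : ∀ n, Integrable (fun ω => ((X ω).state T (mult T) η₁ n).bonus (mult T) j) P := fun n =>
    (h.essBounded_bonus n j).integrable
  have iY : ∀ n, Integrable (fun ω => (S n).indicator 1 ω *
      ((X ω).state T (mult T) η₁ n).shift (IsRun.est T (mult T) η₁ (X ω) n)) P := fun n =>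
    (hsh n).1.integrable
  have iE : ∀ n, Integrable (fun ω => (O n).indicator 1 ω *
      IsRun.est T (mult T) η₁ (X ω) n j) P := fun n => ((hI n).mul (h.essBounded_est n j)).integrable
  have iSB := integrable_finsetSum (Finset.range (N + 1)) fun n _ => iB n
  have iSY := (integrable_finsetSum (Finset.range (N + 1)) fun n _ => iY n).const_mul (gain T)
  have iSE := (integrable_finsetSum (Finset.range (N + 1)) fun n _ => iE n).const_mul (3 * gain T)
  have key : ∑ p ∈ Finset.Ico (6 * M) N,
        ∫ ω, segmentCost T ((X ω).state T (mult T) η₁) (IsRun.est T (mult T) η₁ (X ω)) j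
          (gain T / (50 * η₁ j)) (R T) N p ∂P ≤
      ∑ n ∈ Finset.range (N + 1), ∫ ω, ((X ω).state T (mult T) η₁ n).bonus (mult T) j ∂P +
      (gain T * ∑ n ∈ Finset.range (N + 1), P.real (S n) +
        3 * gain T * ∑ n ∈ Finset.range (N + 1), P.real (O n)) + 6.2 * R T := by
    rw [← integral_finsetSum _ fun p _ => (h.essBounded_segmentCost j _ (R T) N p).integrable]
    refine (integral_mono_ae (integrable_finsetSum _ fun p _ =>
      (h.essBounded_segmentCost j _ (R T) N p).integrable)
      ((iSB.add (iSY.add iSE)).add (integrable_const (6.2 * R T)))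
      (h.ae_mem.mono fun ω hω => ?_)).trans ?_
    · have h1 := (isPath (X ω)).sum_segmentCost_le_bonus (j := j) hR h.η₁_pos
        (fun n i => (h.est_bounds hω n i).1) hR0 hN
      simpa [Set.indicator_apply, hS, hO] using h1
    · rw [integral_add' (iSB.add (iSY.add iSE)) (integrable_const _),
        integral_add' iSB (iSY.add iSE), integral_add' iSY iSE, integral_const_mul,
        integral_const_mul, integral_finsetSum _ fun n _ => iB n,
        integral_finsetSum _ fun n _ => iY n, integral_finsetSum _ fun n _ => iE n, integral_const,
        probReal_univ, one_smul]
      refine add_le_add (add_le_add le_rfl (add_le_add (mul_le_mul_of_nonneg_left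
        (Finset.sum_le_sum fun n _ => (hsh n).2) hg) (mul_le_mul_of_nonneg_left
        (Finset.sum_le_sum fun n _ => hO1 n) (by positivity)))) le_rfl
  have count : ∀ (U : ℕ → Set Ω) (c : ℝ), (∀ n, MeasurableSet (U n)) →
      (∀ ω, ∑ n ∈ Finset.range (N + 1), (U n).indicator (1 : Ω → ℝ) ω ≤ c) →
      ∑ n ∈ Finset.range (N + 1), P.real (U n) ≤ c := by
    intro U c hU hc
    have hint : ∀ n, Integrable ((U n).indicator (1 : Ω → ℝ)) P := fun n =>
      (integrable_const (1 : ℝ)).indicator (hU n)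
    have h1 : ∀ n, P.real (U n) = ∫ ω, (U n).indicator 1 ω ∂P := fun n =>
      (integral_indicator_one (hU n)).symm
    simp only [h1]
    rw [← integral_finsetSum _ fun n _ => hint n]
    exact (integral_mono (integrable_finsetSum _ fun n _ => hint n)
      (integrable_const c) hc).trans_eq (by simp)
  have hcS := count S (47 / 20 * Real.log T ^ 2) (fun n => ℱ.le _ _ (hSm n)) fun ω => by
    have h1 := (isPath (T := T) (β := mult T) (η₁ := η₁) (X ω)).nTrig_le_log hR hN j
    rw [nTrig, Nat.count_eq_card_filter_range, ← Finset.sum_boole] at h1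
    simpa [Set.indicator_apply, hS] using h1
  have hcO := count O (3 * (K * (47 / 20 * Real.log T ^ 2))) (fun n => ℱ.le _ _ (hOm n)) fun ω => by
    have hp := isPath (T := T) (β := mult T) (η₁ := η₁) (X ω)
    have h1 : (nOmd T ((X ω).state T (mult T) η₁) (N + 1) : ℝ) ≤
        3 * ∑ i, (nTrig T ((X ω).state T (mult T) η₁) i (N + 1) : ℝ) := by
      exact_mod_cast hp.nOmd_le (N + 1)
    have h2 : ∑ i, (nTrig T ((X ω).state T (mult T) η₁) i (N + 1) : ℝ) ≤
        K * (47 / 20 * Real.log T ^ 2) := by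
      refine (Finset.sum_le_sum fun i _ => hp.nTrig_le_log hR hN i).trans_eq ?_
      simp
    rw [nOmd, Nat.count_eq_card_filter_range, ← Finset.sum_boole] at h1
    have h3 : ∑ n ∈ Finset.range (N + 1), (O n).indicator (1 : Ω → ℝ) ω =
        ∑ n ∈ Finset.range (N + 1), if IsOmd T ((X ω).state T (mult T) η₁) n then (1 : ℝ) else 0 := by
      simp [Set.indicator_apply, hO]
    rw [h3]
    linarith
  have f1 := mul_le_mul_of_nonneg_left hcS hg
  have f2 := mul_le_mul_of_nonneg_left hcO (show 0 ≤ 3 * gain T by positivity)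
  have hK : (2 : ℝ) ≤ K := by exact_mod_cast hR.two_le
  have f3 : (K : ℝ) * (gain T * Real.log T ^ 2) ≤ K * 1 := mul_le_mul_of_nonneg_left hgl (by positivity)
  -- 47/20 + 9 · (47/20) K ≤ 24 K for K ≥ 2.
  nlinarith

end BoundedRun

/-! ### Self-bounding of the regret in the main phase -/

lemma sum_one_div_le (N : ℕ) :
    ∑ n ∈ Finset.range N, 1 / ((n : ℝ) + 1) ≤ 1 + Real.log N := by
  have h1 := harmonic_le_one_add_log N
  have h2 : ((harmonic N : ℚ) : ℝ) = ∑ n ∈ Finset.range N, 1 / ((n : ℝ) + 1) := by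
    unfold harmonic
    push_cast
    simp only [one_div]
  rwa [h2] at h1

/-- Young's inequality for the bounds of the stability and penalty terms. -/
lemma mul_sqrt_le {c d x y : ℝ} (hd : 0 < d) (hy : 0 < y) (hx : 0 ≤ x) :
    c / √y * √x ≤ d / 4 * x + c ^ 2 / d * (1 / y) := by
  have h1 := Real.sq_sqrt hx
  have h2 := Real.sq_sqrt hy.le
  have h3 := Real.sqrt_pos.2 hy
  have h4 : d / 4 * x + c ^ 2 / d * (1 / y) - c / √y * √x = (d / 2 * √x - c / √y) ^ 2 / d := by
    rw [sub_sq, div_pow, h2, mul_pow, h1]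
    field_simp
    ring
  have h5 : 0 ≤ (d / 2 * √x - c / √y) ^ 2 / d := by positivity
  linarith

/-- The penalty involves the weights, but the lower bound for the regret involves the sampling
probabilities; this is the exchange rate. -/
lemma le_two_mul_wbar {K T : ℕ} {s : State K} {i : Fin K} (hK : 2 ≤ K) (hT : 1 ≤ T)
    (hw : 0 ≤ s.w i) : s.w i ≤ 2 * s.wbar T i := by
  have hK' : (2 : ℝ) ≤ K := by exact_mod_cast hK
  have hT' : (1 : ℝ) ≤ T := by exact_mod_cast hT
  have h1 : 1 / ((T : ℝ) * K) ≤ 1 / 2 := one_div_le_one_div_of_le (by norm_num) (by nlinarith)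
  have h2 : 0 ≤ 1 / ((T : ℝ) * K) * (1 / K) := by positivity
  unfold State.wbar
  nlinarith

namespace BoundedRun

variable {K : ℕ} {k : Fin K → ℕ} {A : (i : Fin K) → Learner (k i)}
  {D : Measure ((i : Fin K) → Fin (k i) → ℝ)} {T : ℕ} {η₁ : Fin K → ℝ} {Ω : Type u}
  [m0 : MeasurableSpace Ω] {P : Measure Ω} {ℱ : Filtration ℕ m0} {X : Ω → Trajectory K k}
  [IsProbabilityMeasure D] [IsProbabilityMeasure P] [NeZero K]
  {j : Fin K}

section general

variable {β : ℝ} (h : BoundedRun A D T β η₁ P ℱ X)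
include h

omit [IsProbabilityMeasure D] [IsProbabilityMeasure P] in
lemma playedLoss_eq (x : Trajectory K k) (n : ℕ) : x.playedLoss T (K * initRounds T + n) =
    ∑ i, IsRun.est T β η₁ x n i * (x.state T β η₁ n).wbar T i := by
  have h1 : ∀ i, IsRun.est T β η₁ x n i * (x.state T β η₁ n).wbar T i =
      if x.chosen (K * initRounds T + n) = i then x.playedLoss T (K * initRounds T + n) else 0 := by
    intro i
    have h2 := (h.wbar_mem x n i).1.ne'
    change iwLoss _ _ _ * _ = _
    unfold iwLoss
    simp only [decide_eq_true_eq]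
    split_ifs
    · exact div_mul_cancel₀ _ h2
    · exact zero_mul _
  simp only [h1, Finset.sum_ite_eq, Finset.mem_univ, if_true]

lemma essBounded_sum_est (n : ℕ) : EssBounded P fun ω => ∑ i, IsRun.est T β η₁ (X ω) n i *
    (((X ω).state T β η₁ n).w i - (Pi.single j 1 : Fin K → ℝ) i) :=
  .sum _ fun i _ => (h.essBounded_est n i).mul ((h.essBounded_w n i).sub (.const _))

/-- The regret in a round is the regret against learner `j` and the regret of learner `j`. -/
lemma integral_playedLoss_sub_le {a : Fin (k j)} (ha : meanLoss D j a = bestLoss D j) (n : ℕ) :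
    ∫ ω, (X ω).playedLoss T (K * initRounds T + n) ∂P - bestLoss D j ≤
      1 / T + ∫ ω, ∑ i, IsRun.est T β η₁ (X ω) n i *
        (((X ω).state T β η₁ n).w i - (Pi.single j 1 : Fin K → ℝ) i) ∂P +
      ∫ ω, regretTerm T β η₁ X j a n ω ∂P := by
  have hK : (1 : ℝ) ≤ K := by exact_mod_cast NeZero.one_le
  have hT : (1 : ℝ) ≤ T := by exact_mod_cast h.one_le_T
  have i1 := (EssBounded.sum Finset.univ fun i _ => (h.essBounded_est n i).const_mul
    (1 / ((T : ℝ) * K) * (1 / K))).integrable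
  have i2 := (h.essBounded_sum_est (j := j) n).integrable
  have i3 := (h.essBounded_regretTerm a n).integrable
  have i4 := (h.essBounded_loss (K * initRounds T + n) j a).integrable
  have h1 := integral_mono_ae (h.essBounded_playedLoss (K * initRounds T + n)).integrable
      (((i1.add i2).add i3).add i4) (h.ae_mem.mono fun ω hω => by
    simp only [Pi.add_apply]
    rw [h.playedLoss_eq]
    have h2 : ∑ i, IsRun.est T β η₁ (X ω) n i * (Pi.single j 1 : Fin K → ℝ) i =
        IsRun.est T β η₁ (X ω) n j := by simp [Pi.single_apply]
    unfold regretTerm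
    simp only [mul_sub, Finset.sum_sub_distrib]
    rw [h2]
    have h3 : ∑ i, IsRun.est T β η₁ (X ω) n i * ((X ω).state T β η₁ n).wbar T i ≤
        ∑ i, (1 / ((T : ℝ) * K) * (1 / K) * IsRun.est T β η₁ (X ω) n i +
          IsRun.est T β η₁ (X ω) n i * ((X ω).state T β η₁ n).w i) := by
      refine Finset.sum_le_sum fun i _ => ?_
      have h4 := (h.est_bounds hω n i).1
      have h5 : ((X ω).state T β η₁ n).wbar T i ≤
          1 / ((T : ℝ) * K) * (1 / K) + ((X ω).state T β η₁ n).w i := by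
        have h6 : 0 ≤ 1 / ((T : ℝ) * K) * ((X ω).state T β η₁ n).w i :=
          mul_nonneg (by positivity) (h.w_mem _ n i).1.le
        unfold State.wbar
        linarith
      have h7 := mul_le_mul_of_nonneg_left h5 h4
      linarith
    rw [Finset.sum_add_distrib] at h3
    linarith)
  rw [integral_add' ((i1.add i2).add i3) i4, integral_add' (i1.add i2) i3, integral_add' i1 i2,
    h.integral_loss_main, ha] at h1
  -- The uniform part of the sampling distribution: K losses of mean at most 1, each with
  -- probability 1/(TK²).
  have h2 : ∫ ω, ∑ i, 1 / ((T : ℝ) * K) * (1 / K) * IsRun.est T β η₁ (X ω) n i ∂P ≤ 1 / T := by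
    rw [integral_finsetSum _ fun i _ =>
      ((h.essBounded_est n i).const_mul (1 / ((T : ℝ) * K) * (1 / K))).integrable]
    have h3 : ∀ i, ∫ ω, 1 / ((T : ℝ) * K) * (1 / K) * IsRun.est T β η₁ (X ω) n i ∂P ≤
        1 / ((T : ℝ) * K) * (1 / K) := fun i => by
      refine (h.integral_mul_est_le n i (Z := fun _ => 1 / ((T : ℝ) * K) * (1 / K))
        measurable_const (.const _) fun _ => by positivity).trans_eq (by simp)
    refine (Finset.sum_le_sum fun i _ => h3 i).trans ?_
    rw [Finset.sum_const, Finset.card_univ, Fintype.card_fin, nsmul_eq_mul]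
    calc (K : ℝ) * (1 / (T * K) * (1 / K)) = 1 / T * (1 / K) := by field_simp
      _ ≤ 1 / T * 1 := mul_le_mul_of_nonneg_left (by rw [div_le_one (by linarith)]; exact hK)
          (by positivity)
      _ = 1 / T := mul_one _
  linarith

/-- Lower bound for the regret in a round. -/
lemma sum_gap_mul_le (n : ℕ) :
    ∑ i ∈ Finset.univ.erase j, gap D j i * ∫ ω, ((X ω).state T β η₁ n).wbar T i ∂P ≤
      ∫ ω, (X ω).playedLoss T (K * initRounds T + n) ∂P - bestLoss D j := by
  have h1 := h.le_integral_playedLoss n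
  have h2 : ∑ i, ∫ ω, ((X ω).state T β η₁ n).wbar T i ∂P = 1 := by
    rw [← integral_finsetSum _ fun i _ => (h.essBounded_wbar n i).integrable]
    simp only [IsRun.wbar_sum h.one_le_T h.η₁_pos h.one_le_β]
    simp
  have h3 : ∑ i ∈ Finset.univ.erase j, gap D j i * ∫ ω, ((X ω).state T β η₁ n).wbar T i ∂P =
      ∑ i, gap D j i * ∫ ω, ((X ω).state T β η₁ n).wbar T i ∂P := by
    rw [← Finset.add_sum_erase Finset.univ _ (Finset.mem_univ j)]
    simp [gap]
  have h4 : ∑ i, gap D j i * ∫ ω, ((X ω).state T β η₁ n).wbar T i ∂P =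
      ∑ i, (∫ ω, ((X ω).state T β η₁ n).wbar T i ∂P) * bestLoss D i - bestLoss D j := by
    unfold gap
    simp only [sub_mul, Finset.sum_sub_distrib]
    rw [← Finset.mul_sum, h2, mul_one]
    simp only [mul_comm]
  rw [h3, h4]
  linarith

end general

variable (h : BoundedRun A D T (mult T) η₁ P ℱ X) (hR : Regime K T)
include h hR

/-- Regret of the distributions over the learners. -/
lemma sum_integral_ftrl_le (hη₁' : ∀ i, η₁ i ≤ 1 / 4) {N : ℕ} (hN : N + K * initRounds T ≤ T) :
    ∑ n ∈ Finset.range N, ∫ ω, ∑ i, IsRun.est T (mult T) η₁ (X ω) n i *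
        (((X ω).state T (mult T) η₁ n).w i - (Pi.single j 1 : Fin K → ℝ) i) ∂P ≤
      initRounds T + ∑ i ∈ Finset.univ.erase j, 6 / η₁ i +
      ∑ n ∈ Finset.range N, ∑ i ∈ Finset.univ.erase j,
        (226.8 / √((n : ℝ) + 1) * ∫ ω, √(((X ω).state T (mult T) η₁ n).wbar T i) ∂P +
          48 / η₁ i / √((n : ℝ) + 1) * ∫ ω, √(((X ω).state T (mult T) η₁ (n + 1)).w i) ∂P) -
      ∑ n ∈ Finset.range N, ∫ ω, ((X ω).state T (mult T) η₁ n).bonus (mult T) j ∂P := by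
  set d : ℕ → ℝ := fun n => ∫ ω, divg ((X ω).state T (mult T) η₁ n).η (Pi.single j 1)
    ((X ω).state T (mult T) η₁ n).w ∂P with hd
  have hstep : ∀ n ∈ Finset.range N, ∫ ω, ∑ i, IsRun.est T (mult T) η₁ (X ω) n i *
        (((X ω).state T (mult T) η₁ n).w i - (Pi.single j 1 : Fin K → ℝ) i) ∂P ≤
      (d n - d (n + 1)) + ∑ i ∈ Finset.univ.erase j,
        (226.8 / √((n : ℝ) + 1) * ∫ ω, √(((X ω).state T (mult T) η₁ n).wbar T i) ∂P +
          48 / η₁ i / √((n : ℝ) + 1) * ∫ ω, √(((X ω).state T (mult T) η₁ (n + 1)).w i) ∂P) -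
      ∫ ω, ((X ω).state T (mult T) η₁ n).bonus (mult T) j ∂P := by
    intro n hn
    have hn := Finset.mem_range.1 hn
    have i1 := (h.essBounded_divg n j).integrable
    have i2 := (h.essBounded_divg (n + 1) j).integrable
    have b3 : EssBounded P fun ω => ∑ i, (IsRun.est T (mult T) η₁ (X ω) n i -
        (X ω).playedLoss T (K * initRounds T + n)) ^ 2 *
        (((X ω).state T (mult T) η₁ n).w i * √(((X ω).state T (mult T) η₁ n).w i)) := by
      simp only [pow_two]
      exact .sum _ fun i _ => (((h.essBounded_est n i).sub (h.essBounded_playedLoss _)).mul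
        ((h.essBounded_est n i).sub (h.essBounded_playedLoss _))).mul
        ((h.essBounded_w n i).mul (h.essBounded_sqrt_w n i))
    have i3 := (b3.const_mul (108 / √((n : ℝ) + 1))).integrable
    have i4' : ∀ i, Integrable (fun ω => 48 / (η₁ i * √((n : ℝ) + 1)) *
        √(((X ω).state T (mult T) η₁ (n + 1)).w i)) P := fun i =>
      ((h.essBounded_sqrt_w (n + 1) i).const_mul _).integrable
    have i4 := integrable_finsetSum (Finset.univ.erase j) fun i _ => i4' i
    have i5 := (h.essBounded_bonus n j).integrable
    -- The pathwise inequality is used with the played loss as shift, to match the estimate of the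
    -- stability term; 226.8 = 108 · 2.1.
    have h1 := integral_mono_ae (h.essBounded_sum_est (j := j) n).integrable
      ((((i1.sub i2).add i3).add i4).sub i5) (h.ae_mem.mono fun ω hω =>
        (isPath (X ω)).regret_step hR h.η₁_pos hη₁' (n := n) (by omega) j
          (Trajectory.playedLoss_mem hω (K * initRounds T + n)).2
          (fun n i => (h.est_bounds hω n i).1))
    rw [integral_sub' (((i1.sub i2).add i3).add i4) i5, integral_add' ((i1.sub i2).add i3) i4,
      integral_add' (i1.sub i2) i3, integral_sub' i1 i2, integral_const_mul,
      integral_finsetSum _ fun i _ => i4' i] at h1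
    refine h1.trans ?_
    have h2 := mul_le_mul_of_nonneg_left (h.integral_stability_le hR n j)
      (show 0 ≤ 108 / √((n : ℝ) + 1) by positivity)
    rw [integral_finsetSum _ fun i _ => ((h.essBounded_sqrt_wbar n i).const_mul 2.1).integrable,
      Finset.mul_sum] at h2
    have h3 : ∀ i, 108 / √((n : ℝ) + 1) * ∫ ω, 2.1 * √(((X ω).state T (mult T) η₁ n).wbar T i) ∂P =
        226.8 / √((n : ℝ) + 1) * ∫ ω, √(((X ω).state T (mult T) η₁ n).wbar T i) ∂P := fun i => by
      rw [integral_const_mul]; ring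
    have h4 : ∀ i, ∫ ω, 48 / (η₁ i * √((n : ℝ) + 1)) *
        √(((X ω).state T (mult T) η₁ (n + 1)).w i) ∂P =
        48 / η₁ i / √((n : ℝ) + 1) * ∫ ω, √(((X ω).state T (mult T) η₁ (n + 1)).w i) ∂P := fun i => by
      rw [integral_const_mul, div_div]
    simp only [h3] at h2
    simp only [h4]
    rw [Finset.sum_add_distrib]
    linarith
  refine (Finset.sum_le_sum hstep).trans ?_
  rw [Finset.sum_sub_distrib, Finset.sum_add_distrib, Finset.sum_range_sub']
  have h1 : 0 ≤ d N := integral_nonneg fun ω => divg_nonneg fun i => h.η_pos (X ω) N i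
  have h2 : d 0 ≤ initRounds T + ∑ i ∈ Finset.univ.erase j, 6 / η₁ i := by
    refine (integral_mono_ae (h.essBounded_divg 0 j).integrable (integrable_const
      ((initRounds T : ℝ) + ∑ i ∈ Finset.univ.erase j, 6 / η₁ i))
      (h.ae_mem.mono fun ω hω => ?_)).trans_eq (by simp)
    have h3 := (isPath (X ω)).divg_zero_le h.η₁_pos h.one_le_β j
      fun i => (Trajectory.initLoss_mem (T := T) hω i).1
    have h4 := (Trajectory.initLoss_mem (T := T) hω j).2
    dsimp only at h3 ⊢
    linarith
  linarith

/-- Regret in the main phase, in terms of itself. -/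
lemma sum_regret_main_le (hη₁' : ∀ i, η₁ i ≤ 1 / 4) (hgap : ∀ i, i ≠ j → 0 < gap D j i)
    {R : ℕ → ℝ} (hstab : IsStable.{u} (1 / 2) R (A j) (D.map fun x => x j)) {a : Fin (k j)}
    (ha : meanLoss D j a = bestLoss D j)
    (hRκ : ∀ t, 1 ≤ t → t ≤ T → R t ≤ gain T / (50 * η₁ j) * √(t : ℝ)) {N : ℕ}
    (hN : N + 1 + K * initRounds T ≤ T) :
    ∑ n ∈ Finset.range (N + 1), (∫ ω, (X ω).playedLoss T (K * initRounds T + n) ∂P -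
      bestLoss D j) ≤
    2 * (∑ i ∈ Finset.univ.erase j, (6 / η₁ i + gap D j i / 4 +
        (226.8 ^ 2 + 2 * (48 / η₁ i) ^ 2) / gap D j i * (1 + Real.log T)) +
      1300000000 * R T + 15 * (K * initRounds T : ℕ) + 24 * K + 6 + 4 * Real.log T) := by
  obtain ⟨-, hR0, -⟩ := id hstab
  have hη := h.η₁_pos
  have hT0 := hR.T_pos
  set M := K * initRounds T with hM
  have hmM : initRounds T ≤ M := Nat.le_mul_of_pos_left _ (by have := hR.two_le; omega)
  set reg : ℕ → ℝ := fun n => ∫ ω, (X ω).playedLoss T (M + n) ∂P - bestLoss D j with hreg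
  set b : ℕ → Fin K → ℝ := fun n i => ∫ ω, ((X ω).state T (mult T) η₁ n).wbar T i ∂P with hb
  have hb0 : ∀ n i, 0 ≤ b n i := fun n i => integral_nonneg fun ω => (h.wbar_mem (X ω) n i).1.le
  have hb1 : ∀ n i, b n i ≤ 1 := fun n i =>
    (integral_mono (h.essBounded_wbar n i).integrable (integrable_const (1 : ℝ))
      fun ω => (h.wbar_mem (X ω) n i).2).trans_eq (by simp)
  -- The regret of the learner in round `N` is bounded separately by 1, so that the bonus of every
  -- trigger before round `N` falls within the N + 1 rounds.
  have hsum1 : ∑ n ∈ Finset.range (N + 1), reg n ≤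
      1 + ∑ n ∈ Finset.range (N + 1), ∫ ω, ∑ i, IsRun.est T (mult T) η₁ (X ω) n i *
        (((X ω).state T (mult T) η₁ n).w i - (Pi.single j 1 : Fin K → ℝ) i) ∂P +
      (∑ n ∈ Finset.range N, ∫ ω, regretTerm T (mult T) η₁ X j a n ω ∂P + 1) := by
    refine (Finset.sum_le_sum fun n _ => h.integral_playedLoss_sub_le ha n).trans ?_
    rw [Finset.sum_add_distrib, Finset.sum_add_distrib,
      Finset.sum_range_succ (fun n => ∫ ω, regretTerm T (mult T) η₁ X j a n ω ∂P)]
    have h1 : ∑ _n ∈ Finset.range (N + 1), 1 / (T : ℝ) ≤ 1 := by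
      rw [Finset.sum_const, Finset.card_range, nsmul_eq_mul, mul_one_div, div_le_one hT0]
      exact_mod_cast (by omega : N + 1 ≤ T)
    have h2 := h.setIntegral_regret_le j a N (@MeasurableSet.univ _ (ℱ (M + N)))
    rw [Measure.restrict_univ, probReal_univ] at h2
    have h3 : ∫ ω, regretTerm T (mult T) η₁ X j a N ω ∂P ≤ 1 := h2
    linarith
  have hsum2 := h.sum_integral_ftrl_le (j := j) hR hη₁' (N := N + 1) hN
  have hsum3 := h.sum_regret_le hR hη₁' hstab ha
    (by have := gain_nonneg T; have := hη j; positivity) hRκ (N := N) (by omega)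
  have hsum4 := h.sum_integral_segmentCost_le (j := j) hR hR0 hN
  have hΓ : ∑ n ∈ Finset.range (N + 1), ∑ i ∈ Finset.univ.erase j, gap D j i * b n i ≤
      ∑ n ∈ Finset.range (N + 1), reg n := Finset.sum_le_sum fun n _ => h.sum_gap_mul_le n
  -- Young's inequality, weighted by the gap: stability and penalty each use Δ/4 of the expected
  -- probability, together half of the lower bound for the regret. The harmonic sum supplies the
  -- logarithm.
  have hyoung : ∑ n ∈ Finset.range (N + 1), ∑ i ∈ Finset.univ.erase j,
        (226.8 / √((n : ℝ) + 1) * ∫ ω, √(((X ω).state T (mult T) η₁ n).wbar T i) ∂P +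
          48 / η₁ i / √((n : ℝ) + 1) * ∫ ω, √(((X ω).state T (mult T) η₁ (n + 1)).w i) ∂P) ≤
      1 / 2 * ∑ n ∈ Finset.range (N + 1), ∑ i ∈ Finset.univ.erase j, gap D j i * b n i +
      ∑ i ∈ Finset.univ.erase j, (gap D j i / 4 +
        (226.8 ^ 2 + 2 * (48 / η₁ i) ^ 2) / gap D j i * (1 + Real.log T)) := by
    rw [Finset.sum_comm, Finset.sum_comm (s := Finset.range (N + 1)), Finset.mul_sum,
      ← Finset.sum_add_distrib]
    refine Finset.sum_le_sum fun i hi => ?_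
    have hΔ := hgap i (Finset.ne_of_mem_erase hi)
    set Δ := gap D j i with hΔdef
    have hηi := hη i
    have h1 : ∀ n : ℕ, 226.8 / √((n : ℝ) + 1) * ∫ ω, √(((X ω).state T (mult T) η₁ n).wbar T i) ∂P ≤
        Δ / 4 * b n i + 226.8 ^ 2 / Δ * (1 / ((n : ℝ) + 1)) := by
      intro n
      rw [← integral_const_mul]
      refine (integral_mono ((h.essBounded_sqrt_wbar n i).const_mul _).integrable
        (((h.essBounded_wbar n i).const_mul (Δ / 4)).add
          (.const (226.8 ^ 2 / Δ * (1 / ((n : ℝ) + 1))))).integrable fun ω =>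
        mul_sqrt_le hΔ (by positivity) (h.wbar_mem (X ω) n i).1.le).trans_eq ?_
      rw [integral_add ((h.essBounded_wbar n i).const_mul (Δ / 4)).integrable (integrable_const _),
        integral_const_mul, integral_const, probReal_univ, one_smul]
    have h2 : ∀ n : ℕ, 48 / η₁ i / √((n : ℝ) + 1) *
        ∫ ω, √(((X ω).state T (mult T) η₁ (n + 1)).w i) ∂P ≤
        Δ / 4 * b (n + 1) i + 2 * (48 / η₁ i) ^ 2 / Δ * (1 / ((n : ℝ) + 1)) := by
      intro n
      rw [← integral_const_mul]
      refine (integral_mono ((h.essBounded_sqrt_w (n + 1) i).const_mul _).integrable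
        (((h.essBounded_wbar (n + 1) i).const_mul (Δ / 4)).add
          (.const (2 * (48 / η₁ i) ^ 2 / Δ * (1 / ((n : ℝ) + 1))))).integrable
          fun ω => ?_).trans_eq ?_
      · have h3 := (h.wbar_mem (X ω) (n + 1) i).1
        have h4 := le_two_mul_wbar (T := T) hR.two_le h.one_le_T (h.w_mem (X ω) (n + 1) i).1.le
        have h5 := mul_sqrt_le (c := √2 * (48 / η₁ i)) hΔ
          (show 0 < (n : ℝ) + 1 by positivity) h3.le
        rw [mul_pow, Real.sq_sqrt (by norm_num : (0 : ℝ) ≤ 2)] at h5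
        refine le_trans ?_ h5
        calc 48 / η₁ i / √((n : ℝ) + 1) * √(((X ω).state T (mult T) η₁ (n + 1)).w i)
            ≤ 48 / η₁ i / √((n : ℝ) + 1) *
              (√2 * √(((X ω).state T (mult T) η₁ (n + 1)).wbar T i)) := by
              rw [← Real.sqrt_mul (by norm_num)]
              exact mul_le_mul_of_nonneg_left (Real.sqrt_le_sqrt h4) (by positivity)
          _ = _ := by ring
      · rw [integral_add ((h.essBounded_wbar (n + 1) i).const_mul (Δ / 4)).integrable
          (integrable_const _), integral_const_mul, integral_const, probReal_univ, one_smul]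
    have h3 : ∑ n ∈ Finset.range (N + 1), 1 / ((n : ℝ) + 1) ≤ 1 + Real.log T := by
      refine (sum_one_div_le (N + 1)).trans (add_le_add le_rfl (Real.log_le_log ?_ ?_))
      · positivity
      · exact_mod_cast (by omega : N + 1 ≤ T)
    -- The penalty is taken at the weights after the update; moving the index costs at most one
    -- term.
    have h4 : ∑ n ∈ Finset.range (N + 1), b (n + 1) i ≤
        ∑ n ∈ Finset.range (N + 1), b n i + 1 := by
      have h5 := Finset.sum_range_succ (fun n => b n i) (N + 1)
      rw [Finset.sum_range_succ'] at h5
      have h6 := hb1 (N + 1) i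
      have h7 := hb0 0 i
      linarith
    refine (Finset.sum_le_sum fun n _ => add_le_add (h1 n) (h2 n)).trans ?_
    simp only [Finset.sum_add_distrib, ← Finset.mul_sum]
    have h5 := mul_le_mul_of_nonneg_left h3
      (show 0 ≤ (226.8 ^ 2 + 2 * (48 / η₁ i) ^ 2) / Δ by positivity)
    have h6 := mul_le_mul_of_nonneg_left h4 (show 0 ≤ Δ / 4 by positivity)
    have h7 : (226.8 ^ 2 + 2 * (48 / η₁ i) ^ 2) / Δ *
        ∑ n ∈ Finset.range (N + 1), 1 / ((n : ℝ) + 1) =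
        226.8 ^ 2 / Δ * ∑ n ∈ Finset.range (N + 1), 1 / ((n : ℝ) + 1) +
        2 * (48 / η₁ i) ^ 2 / Δ * ∑ n ∈ Finset.range (N + 1), 1 / ((n : ℝ) + 1) := by
      rw [add_div, add_mul]
    linarith
  have hmM' : (initRounds T : ℝ) ≤ (M : ℕ) := by exact_mod_cast hmM
  have hRT := hR0 T
  rw [← hM] at hsum3 hsum4
  have hsplit : ∑ i ∈ Finset.univ.erase j, (6 / η₁ i + gap D j i / 4 +
        (226.8 ^ 2 + 2 * (48 / η₁ i) ^ 2) / gap D j i * (1 + Real.log T)) =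
      ∑ i ∈ Finset.univ.erase j, 6 / η₁ i + ∑ i ∈ Finset.univ.erase j, (gap D j i / 4 +
        (226.8 ^ 2 + 2 * (48 / η₁ i) ^ 2) / gap D j i * (1 + Real.log T)) := by
    rw [← Finset.sum_add_distrib]
    simp only [add_assoc]
  -- The bonuses in `hsum2` and `hsum4` cancel. By `hΓ` half of the left-hand side is moved over,
  -- whence the factor 2.
  rw [hsplit]
  linarith

end BoundedRun

/-! ### A single learner, short horizons, and the final constants -/

lemma exists_meanLoss_eq {K : ℕ} {k : Fin K → ℕ} (D : Measure ((i : Fin K) → Fin (k i) → ℝ))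
    {i : Fin K} (hk : 0 < k i) : ∃ a, meanLoss D i a = bestLoss D i := by
  have : Nonempty (Fin (k i)) := ⟨⟨0, hk⟩⟩
  exact exists_eq_ciInf_of_finite

/-- The only weight is 1, above all thresholds, so nothing is triggered or restarted. -/
lemma IsPath.start_eq_zero_of_one {K : ℕ} {T : ℕ} {β : ℝ} {η₁ L₀ : Fin K → ℝ} {s : ℕ → State K}
    {ℓ : ℕ → Fin K → ℝ} [NeZero K] (h : IsPath T β η₁ L₀ s ℓ) (hη₁ : ∀ i, 0 < η₁ i) (hβ : 1 ≤ β)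
    (hK : K = 1) (n : ℕ) (i : Fin K) : (s n).start i = 0 ∧ (s n).θ i = 1 := by
  induction n with
  | zero => rw [h.zero]; exact ⟨rfl, rfl⟩
  | succ n ih =>
    have hw : (s n).w i = 1 := by
      rw [← h.w_sum hη₁ hβ n]
      subst hK
      rw [Fin.sum_univ_one, Subsingleton.elim i 0]
    have h1 : Active T s i n := ⟨ih.2, fun h2 => by
      have h3 := h.le_of_mem_trig h2
      rw [hw] at h3
      norm_num at h3⟩
    obtain ⟨h2, h3⟩ := h.succ_of_active hη₁ hβ h1
    exact ⟨h2.trans ih.1, h3⟩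

namespace BoundedRun

variable {K : ℕ} {k : Fin K → ℕ} {A : (i : Fin K) → Learner (k i)}
  {D : Measure ((i : Fin K) → Fin (k i) → ℝ)} {T : ℕ} {η₁ : Fin K → ℝ} {Ω : Type u}
  [m0 : MeasurableSpace Ω] {P : Measure Ω} {ℱ : Filtration ℕ m0} {X : Ω → Trajectory K k}
  [IsProbabilityMeasure D] [IsProbabilityMeasure P] [NeZero K]
  {j : Fin K}

section general

variable {β : ℝ} (h : BoundedRun A D T β η₁ P ℱ X)
include h

lemma expectedRegret_eq : expectedRegret D j T P X =
    ∑ r ∈ Finset.range T, (∫ ω, (X ω).playedLoss T r ∂P - bestLoss D j) := by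
  unfold expectedRegret
  rw [integral_finsetSum _ fun r _ => (h.essBounded_playedLoss r).integrable,
    Finset.sum_sub_distrib]
  simp

lemma integral_playedLoss_sub_bestLoss_le (hk : 0 < k j) (r : ℕ) :
    ∫ ω, (X ω).playedLoss T r ∂P - bestLoss D j ≤ 1 := by
  have h1 : ∫ ω, (X ω).playedLoss T r ∂P ≤ 1 :=
    (integral_mono_ae (h.essBounded_playedLoss r).integrable (integrable_const (1 : ℝ))
      (h.ae_mem.mono fun ω hω => (Trajectory.playedLoss_mem hω r).2)).trans_eq (by simp)
  have h2 := (bestLoss_mem h.mem_Icc hk).1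
  linarith

lemma expectedRegret_le_horizon (hk : 0 < k j) : expectedRegret D j T P X ≤ T := by
  rw [h.expectedRegret_eq]
  refine (Finset.sum_le_sum fun r _ => h.integral_playedLoss_sub_bestLoss_le hk r).trans_eq ?_
  simp

/-- A single learner plays in the original environment. -/
lemma expectedRegret_le_of_one (hK : K = 1) (hk : 0 < k j) {R : ℕ → ℝ}
    (hstab : IsStable.{u} (1 / 2) R (A j) (D.map fun x => x j)) :
    expectedRegret D j T P X ≤ R T := by
  obtain ⟨hRm, -, -⟩ := id hstab
  obtain ⟨a, ha⟩ := exists_meanLoss_eq D hk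
  have hj : (j : ℕ) = 0 := by have := j.2; omega
  have hsub : ∀ i : Fin K, i = j := fun i => by
    have h1 := i.2
    exact Fin.ext (by omega)
  have hinit : ∀ q, q * K + (j : ℕ) = q := fun q => by rw [hj, add_zero, hK, mul_one]
  have hround : ∀ q, gameRound T j q = q := fun q => by
    by_cases hq : q < initRounds T
    · rw [gameRound_of_lt j hq, hinit]
    · have h1 : K * initRounds T + (q - initRounds T) = q := by rw [hK]; omega
      rw [gameRound_of_le j (not_lt.1 hq), h1]
  have hown : ∀ q, Trajectory.ownRound K T q = q := fun q => by
    unfold Trajectory.ownRound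
    rw [hK]
    split_ifs
    · exact Nat.div_one q
    · omega
  have hwbar : ∀ (x : Trajectory K k) n, (x.state T β η₁ n).wbar T j = 1 := fun x n => by
    rw [← IsRun.wbar_sum h.one_le_T h.η₁_pos h.one_le_β x n]
    exact (Fintype.sum_eq_single j fun i hi => absurd (hsub i) hi).symm
  have hplayed : ∀ (x : Trajectory K k) r, x.playedLoss T r = x.loss r j (x.arm j r) := fun x r => by
    unfold Trajectory.playedLoss
    rw [hown, hsub (x.chosen r)]
  have hfeed : ∀ (x : Trajectory K k) q, x.feedback T β η₁ j q = x.playedLoss T q := fun x q => by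
    unfold Trajectory.feedback
    split_ifs with h1
    · rw [hplayed, hinit]
    · unfold Trajectory.lossEstimate
      rw [hwbar, hsub (x.chosen _)]
      have h2 : K * initRounds T + (q - initRounds T) = q := by rw [hK]; omega
      rw [h2]
      simp [iwLoss]
  have hmean : ∀ q, ∫ ω, (X ω).loss q j a ∂P = bestLoss D j := fun q => by
    rw [← ha]
    by_cases hq : q < initRounds T
    · have h1 := h.integral_loss_init hq j a
      rwa [hinit] at h1
    · have h1 := h.integral_loss_main (q - initRounds T) j a
      rwa [show K * initRounds T + (q - initRounds T) = q by rw [hK]; omega] at h1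
  have hstart := fun ω => (isPath (T := T) (β := β) (η₁ := η₁) (X ω)).start_eq_zero_of_one
    h.η₁_pos h.one_le_β hK
  have h1 := h.segment_regret h.one_le_T h.η₁_pos h.one_le_β hstab a (a := 0) (.inl rfl)
    (G := fun q => if q < T then Set.univ else ∅) (Q := T)
    (fun q => by
      split_ifs
      · exact @MeasurableSet.univ _ (ℱ _)
      · exact @MeasurableSet.empty _ (ℱ _))
    (antitone_nat_of_succ_le fun q => by
      split_ifs
      · exact le_rfl
      · omega
      · exact Set.empty_subset _
      · exact le_rfl)
    (if_neg (lt_irrefl T))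
    (fun q _ ω _ => (hstart ω _ j).1)
    (B := 1) (.of_forall fun ω => by rw [Nat.zero_sub]; exact le_rfl)
    (integrable_const (R T)) (fun q => h.integrable_ownRound a _)
    (.of_forall fun ω _ => by
      refine ⟨1, ?_, fun q _ => ?_, fun t ht _ => ?_⟩
      · rw [Nat.zero_sub]
        change √1 ≤ 1
        rw [Real.sqrt_one]
      · unfold Trajectory.ownProb
        rw [hwbar]
        simp
      · have h2 : t < T := by
          by_contra h2
          rw [if_neg h2] at ht
          exact ht
        rw [one_mul]
        exact hRm (by omega))
  have hT := h.one_le_T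
  simp only [zero_add, hround, hfeed] at h1
  rw [if_pos (by omega), Measure.restrict_univ, integral_const, probReal_univ, one_smul] at h1
  rw [h.expectedRegret_eq]
  refine le_trans (le_of_eq (Finset.sum_congr rfl fun q hq => ?_)) h1
  rw [if_pos (Finset.mem_range.1 hq), Measure.restrict_univ,
    integral_sub (h.essBounded_playedLoss q).integrable (h.essBounded_loss q j a).integrable, hmean]

end general

variable (h : BoundedRun A D T (mult T) η₁ P ℱ X)
include h

omit [IsProbabilityMeasure P] [NeZero K] in
lemma gap_le_one (hk : ∀ i, 0 < k i) (i : Fin K) : gap D j i ≤ 1 := by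
  have h1 := (bestLoss_mem h.mem_Icc (hk i)).2
  have h2 := (bestLoss_mem h.mem_Icc (hk j)).1
  unfold gap
  linarith

omit [IsProbabilityMeasure P] [NeZero K] in
lemma le_bound (hT : 2 ≤ T) (hk : ∀ i, 0 < k i) (hη₁' : ∀ i, η₁ i ≤ 1 / 4)
    (hgap : ∀ i, i ≠ j → 0 < gap D j i) {i : Fin K} (hi : i ≠ j) :
    16 * Real.log T ≤ Real.log T / (η₁ i ^ 2 * gap D j i) := by
  have hη := h.η₁_pos i
  have hη' := hη₁' i
  have hΔ := hgap i hi
  have hΔ' := h.gap_le_one (j := j) hk i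
  have hlog : 0 ≤ Real.log T := Real.log_nonneg (by exact_mod_cast (by omega : 1 ≤ T))
  have h1 : η₁ i ^ 2 ≤ 1 / 16 := by nlinarith
  have h2 : η₁ i ^ 2 * gap D j i ≤ 1 / 16 := by
    have := mul_le_mul h1 hΔ' hΔ.le (by norm_num)
    linarith
  rw [le_div_iff₀ (by positivity)]
  nlinarith

-- Each summand is at least 16 log T because η₁ ≤ 1/4 and Δ ≤ 1, and K - 1 ≥ K/2. Terms of order K
-- log T, such as the length of the initial phase, are thereby covered by the claimed bound.
omit [IsProbabilityMeasure P] [NeZero K] in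
lemma le_sum_bound (hT : 2 ≤ T) (hK : 2 ≤ K) (hk : ∀ i, 0 < k i) (hη₁' : ∀ i, η₁ i ≤ 1 / 4)
    (hgap : ∀ i, i ≠ j → 0 < gap D j i) :
    8 * (K * Real.log T) ≤ ∑ i ∈ Finset.univ.erase j, Real.log T / (η₁ i ^ 2 * gap D j i) := by
  have h1 := Finset.sum_le_sum fun i (hi : i ∈ Finset.univ.erase j) =>
    h.le_bound hT hk hη₁' hgap (Finset.ne_of_mem_erase hi)
  rw [Finset.sum_const, Finset.card_erase_of_mem (Finset.mem_univ j), Finset.card_univ,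
    Fintype.card_fin, nsmul_eq_mul, Nat.cast_sub (by omega)] at h1
  have hK' : (2 : ℝ) ≤ K := by exact_mod_cast hK
  have hlog : 0 ≤ Real.log T := Real.log_nonneg (by exact_mod_cast (by omega : 1 ≤ T))
  refine le_trans ?_ h1
  push_cast
  nlinarith [mul_nonneg (sub_nonneg.2 hK') hlog]

/-- The regret bound for long horizons. -/
lemma expectedRegret_le_of_regime (hR : Regime K T) (hk : ∀ i, 0 < k i) (hη₁' : ∀ i, η₁ i ≤ 1 / 4)
    (hgap : ∀ i, i ≠ j → 0 < gap D j i) {R : ℕ → ℝ}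
    (hstab : IsStable.{u} (1 / 2) R (A j) (D.map fun x => x j))
    (hRκ : ∀ t, 1 ≤ t → t ≤ T → R t ≤ gain T / (50 * η₁ j) * √(t : ℝ)) :
    expectedRegret D j T P X ≤ 4000000000 *
      (∑ i ∈ Finset.univ.erase j, Real.log T / (η₁ i ^ 2 * gap D j i) + R T) := by
  obtain ⟨-, hR0, -⟩ := id hstab
  obtain ⟨a, ha⟩ := exists_meanLoss_eq D (hk j)
  have hRT := hR0 T
  have hlog := hR.le_log
  have hlt := hR.lt
  have hM := hR.le_init
  have hB := h.le_sum_bound (j := j) (by omega) hR.two_le hk hη₁' hgap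
  have hMle : ((K * initRounds T : ℕ) : ℝ) ≤ 2 * (K * Real.log T) := by
    push_cast
    have h1 := mul_le_mul_of_nonneg_left hR.initRounds_le (show (0 : ℝ) ≤ K by positivity)
    have h2 : (K : ℝ) * 1 ≤ K * Real.log T :=
      mul_le_mul_of_nonneg_left (by linarith) (by positivity)
    linarith
  obtain ⟨N, hN⟩ : ∃ N, T = K * initRounds T + (N + 1) := ⟨T - K * initRounds T - 1, by omega⟩
  have hmain := h.sum_regret_main_le (j := j) hR hη₁' hgap hstab ha hRκ (N := N) (by omega)
  have hsplit : expectedRegret D j T P X ≤ (K * initRounds T : ℕ) +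
      ∑ n ∈ Finset.range (N + 1), (∫ ω, (X ω).playedLoss T (K * initRounds T + n) ∂P -
        bestLoss D j) := by
    rw [h.expectedRegret_eq]
    have h1 : Finset.range T = Finset.range (K * initRounds T + (N + 1)) := by rw [← hN]
    rw [h1, Finset.sum_range_add]
    refine add_le_add ((Finset.sum_le_sum fun r _ =>
      h.integral_playedLoss_sub_bestLoss_le (hk j) r).trans_eq ?_) le_rfl
    simp
  have hterm : ∑ i ∈ Finset.univ.erase j, (6 / η₁ i + gap D j i / 4 +
        (226.8 ^ 2 + 2 * (48 / η₁ i) ^ 2) / gap D j i * (1 + Real.log T)) ≤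
      20000 * ∑ i ∈ Finset.univ.erase j, Real.log T / (η₁ i ^ 2 * gap D j i) := by
    rw [Finset.mul_sum]
    refine Finset.sum_le_sum fun i hi => ?_
    have hne := Finset.ne_of_mem_erase hi
    have hη := h.η₁_pos i
    have hη' := hη₁' i
    have hΔ := hgap i hne
    have hΔ' := h.gap_le_one (j := j) hk i
    set Δ := gap D j i
    set e := 1 / η₁ i with he
    set y := 1 / Δ with hy
    have he4 : 4 ≤ e := by rw [he, le_div_iff₀ hη]; linarith
    have hy1 : 1 ≤ y := by rw [hy, le_div_iff₀ hΔ]; linarith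
    have e1 : 6 / η₁ i = 6 * e := by rw [he]; ring
    have e2 : (226.8 ^ 2 + 2 * (48 / η₁ i) ^ 2) / Δ * (1 + Real.log T) =
        (226.8 ^ 2 + 4608 * e ^ 2) * y * (1 + Real.log T) := by rw [he, hy]; ring
    have e3 : Real.log T / (η₁ i ^ 2 * Δ) = e ^ 2 * y * Real.log T := by
      rw [he, hy]; field_simp
    rw [e1, e2, e3]
    have h1 : 16 ≤ e ^ 2 := by nlinarith
    -- 16 · 3216 is just above 226.8², and 3216 + 4608 = 7824.
    have h2 : 226.8 ^ 2 ≤ 3216 * e ^ 2 := by nlinarith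
    have h3 : (226.8 ^ 2 + 4608 * e ^ 2) * y * (1 + Real.log T) ≤
        (7824 * e ^ 2) * y * (2 * Real.log T) := by
      gcongr <;> linarith
    have h4 : e ^ 2 ≤ e ^ 2 * y := le_mul_of_one_le_right (by positivity) hy1
    have h5 : e ^ 2 * y ≤ e ^ 2 * y * Real.log T :=
      le_mul_of_one_le_right (by positivity) (by linarith)
    nlinarith
  have hK : (2 : ℝ) ≤ K := by exact_mod_cast hR.two_le
  have h1 : (K : ℝ) * 1 ≤ K * Real.log T :=
    mul_le_mul_of_nonneg_left (by linarith) (by positivity)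
  have h2 : 2 * Real.log T ≤ K * Real.log T := mul_le_mul_of_nonneg_right hK (by linarith)
  linarith

/-- The regret bound for short horizons. -/
lemma expectedRegret_le_of_not_regime (hR : ¬ Regime K T) (hT : 2 ≤ T) (hK : 2 ≤ K)
    (hk : ∀ i, 0 < k i) (hη₁' : ∀ i, η₁ i ≤ 1 / 4) (hgap : ∀ i, i ≠ j → 0 < gap D j i) :
    expectedRegret D j T P X ≤ Real.exp 2000000 *
      ∑ i ∈ Finset.univ.erase j, Real.log T / (η₁ i ^ 2 * gap D j i) := by
  have hB := h.le_sum_bound (j := j) hT hK hk hη₁' hgap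
  have hK' : (2 : ℝ) ≤ K := by exact_mod_cast hK
  have hT' : (2 : ℝ) ≤ T := by exact_mod_cast hT
  have hlog : 1 / 2 ≤ Real.log T := by
    have h1 := Real.log_le_log (by norm_num) hT'
    have h2 := Real.log_two_gt_d9
    linarith
  have h1 : 8 ≤ ∑ i ∈ Finset.univ.erase j, Real.log T / (η₁ i ^ 2 * gap D j i) := by nlinarith
  refine (h.expectedRegret_le_horizon (hk j)).trans ?_
  by_cases h2 : 2000000 ≤ Real.log T
  -- A long horizon without a main phase: then T itself is of order K log T.
  · have h3 : T ≤ K * initRounds T := by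
      by_contra! h3
      exact hR ⟨hK, h2, h3⟩
    have h4 : (T : ℝ) ≤ K * initRounds T := by exact_mod_cast h3
    have h5 : (initRounds T : ℝ) ≤ Real.log T + 1 := by
      unfold initRounds; push_cast; have := Nat.floor_le (show 0 ≤ Real.log T by linarith); linarith
    have h6 : (K : ℝ) * initRounds T ≤ K * (8 * Real.log T) :=
      mul_le_mul_of_nonneg_left (by linarith) (by linarith)
    have h7 : 1 ≤ Real.exp 2000000 := Real.one_le_exp (by norm_num)
    nlinarith
  · have h3 : (T : ℝ) ≤ Real.exp 2000000 := by
      rw [← Real.log_le_iff_le_exp (by linarith)]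
      linarith
    have h4 := Real.exp_pos 2000000
    nlinarith

end BoundedRun

end

end Corral

theorem theorem4 :
    ∃ C : ℝ, 0 < C ∧
      ∀ (K : ℕ) (k : Fin K → ℕ) (_ : ∀ i, 0 < k i)
        (D : Measure ((i : Fin K) → Fin (k i) → ℝ)) (_ : IsProbabilityMeasure D)
        (_ : ∀ᵐ x ∂D, ∀ i j, x i j ∈ Set.Icc (0 : ℝ) 1)
        (istar : Fin K) (_ : ∀ i, i ≠ istar → 0 < Corral.gap D istar i)
        (A : (i : Fin K) → Corral.Learner (k i))
        (R Rbar : Fin K → ℕ → ℝ)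
        (_ : ∀ i, Corral.IsStable.{u} (1 / 2) (R i) (A i) (D.map fun x => x i))
        (T : ℕ) (_ : 2 ≤ T)
        (_ : ∀ i, ∀ t ∈ Finset.Icc 1 T, R i t ≤ Rbar i t)
        (η₁ : Fin K → ℝ) (_ : ∀ i, 0 < η₁ i) (_ : ∀ i, η₁ i ≤ 1 / 4)
        (_ : ∀ i, ∀ t ∈ Finset.Icc 1 T,
          50 * Rbar i t * η₁ i ≤ (1 - Real.exp (-(1 / Real.log T ^ 2))) * √(t : ℝ))
        (Ω : Type u) (m0 : MeasurableSpace Ω) (P : Measure Ω) (_ : IsProbabilityMeasure P)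
        (ℱ : Filtration ℕ m0) (X : Ω → Corral.Trajectory K k)
        (_ : Corral.IsRun A D T (Real.exp (1 / Real.log T ^ 2)) η₁ P ℱ X),
        Corral.expectedRegret D istar T P X ≤
          C * (∑ i ∈ Finset.univ.erase istar,
                Real.log T / (η₁ i ^ 2 * Corral.gap D istar i) + R istar T) := by
  -- The first summand serves long horizons with a main phase; the second covers those with log T
  -- below 2000000, where the regret is at most T.
  refine ⟨4000000000 + Real.exp 2000000, by positivity, ?_⟩
  intro K k hk D hD hmem istar hgap A R Rbar hstab T hT hRbar η₁ hη₁ hη₁' hη₁R Ω m0 P hP ℱ X hX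
  have : NeZero K := ⟨by have := istar.2; omega⟩
  have h : Corral.BoundedRun A D T (Corral.mult T) η₁ P ℱ X :=
    { toIsRun := hX
      one_le_T := by omega
      η₁_pos := hη₁
      one_le_β := Corral.one_le_mult T
      mem_Icc := hmem }
  have hR0 := (hstab istar).2.1 T
  have hexp := Real.exp_pos 2000000
  have hsum : 0 ≤ ∑ i ∈ Finset.univ.erase istar,
      Real.log T / (η₁ i ^ 2 * Corral.gap D istar i) := Finset.sum_nonneg fun i hi => by
    have h1 := hgap i (Finset.ne_of_mem_erase hi)
    have h2 : 0 ≤ Real.log T := Real.log_nonneg (by exact_mod_cast (by omega : 1 ≤ T))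
    positivity
  by_cases hK : K = 1
  · have h1 := h.expectedRegret_le_of_one hK (hk istar) (hstab istar)
    nlinarith
  have hK2 : 2 ≤ K := by have := istar.2; omega
  by_cases hreg : Corral.Regime K T
  · refine (h.expectedRegret_le_of_regime hreg hk hη₁' hgap (hstab istar) fun t ht htT => ?_).trans
      (mul_le_mul_of_nonneg_right (by linarith) (by positivity))
    have h1 := hη₁R istar t (Finset.mem_Icc.2 ⟨ht, htT⟩)
    have h2 := hRbar istar t (Finset.mem_Icc.2 ⟨ht, htT⟩)
    have h3 := hη₁ istar
    rw [div_mul_eq_mul_div, le_div_iff₀ (by positivity)]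
    refine le_trans ?_ h1
    have h4 := mul_le_mul_of_nonneg_right h2 h3.le
    linarith
  · refine (h.expectedRegret_le_of_not_regime hreg hT hK2 hk hη₁' hgap).trans
      (mul_le_mul (by linarith) (by linarith) hsum (by positivity))
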